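/- Call a program on a random access machine with logarithmic cost (numbers are natural numbers, the operations are $+,-,\cdot,\div$, indirect loads and stores, tests and loops; every step costs one plus the binary lengths of the numbers handled) an algorithm. Let SETH be the statement: for every $\varepsilon>0$ there is $k\ge 3$ such that no algorithm decides, in time $O(2^{(1-\varepsilon)n})$, satisfiability of $k$-CNF formulas on $n$ variables (without repeated clauses). Theorem. Assume SETH. There are functions $f,g:\mathbb N\to\mathbb R$ with $f(N)\to0$ and $g(N)\to 0$ as $N\to\infty$ such that, for every $\varepsilon>0$, both of the following hold; write $c(N)=2^{(\log_2 N)^{1-g(N)}}$. (1) No algorithm does the following in time $O(N^{2-\varepsilon})$: given $N\ge 2$ and two collections $A,B$ (repetitions allowed), each of $N$ subsets of $[m]$ (as characteristic vectors), where $m\le N^{f(N)}$ and all $b\in B$ have the same size $k\ge1$, distinguish between the cases - (Completeness) there exist $a\in A$, $b\in B$ with $b\subseteq a$; - (Soundness) $|a\cap b|\le k/c(N)$ for all $a\in A$, $b\in B$. (The algorithm need not halt on inputs for which neither case holds.) (2) No algorithm does the following in time $O(N^{2-\varepsilon})$: given $N\ge2$ and two collections $A,B$, each of $N$ vectors in $\{0,1\}^m$,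 where $m\le N^{f(N)}$, return $(a,b)\in A\times B$ with $\max_{a'\in A,\,b'\in B}a'\cdot b'\le c(N)\,(a\cdot b)$. -/

import Mathlib

open Filter Topology

/-! ### Random access machines with logarithmic cost -/

/-- The memory of a random access machine: registers `reg x` and random access arrays `arr a`
(array number `a`, then address), all holding natural numbers. A program mentions only finitely
many registers and arrays. -/
structure RAMState where
  reg : ℕ → ℕ
  arr : ℕ → ℕ → ℕ

/-- `reg x := v`. -/
def RAMState.setReg (s : RAMState) (x v : ℕ) : RAMState :=
  { s with reg := Function.update s.reg x v }

/-- `arr a [i] := v`. -/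
def RAMState.setArr (s : RAMState) (a i v : ℕ) : RAMState :=
  { s with arr := Function.update s.arr a (Function.update (s.arr a) i v) }

/-- The arithmetic operations; subtraction is truncated at `0`, and `x / 0 = 0`. -/
inductive RAMOp where
  | add | sub | mul | div

def RAMOp.eval : RAMOp → ℕ → ℕ → ℕ
  | .add, u, v => u + v
  | .sub, u, v => u - v
  | .mul, u, v => u * v
  | .div, u, v => u / v

/-- Programs of a random access machine, in structured form. -/
inductive RAMProg where
  /-- do nothing -/
  | skip
  /-- `reg x := c` -/
  | const (x c : ℕ)
  /-- `reg x := op (reg y) (reg z)` -/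
  | arith (op : RAMOp) (x y z : ℕ)
  /-- `reg x := arr a [reg y]` -/
  | load (x a y : ℕ)
  /-- `arr a [reg y] := reg x` -/
  | store (a y x : ℕ)
  /-- first `p`, then `q` -/
  | seq (p q : RAMProg)
  /-- if `reg x ≠ 0` then `p` else `q` -/
  | ite (x : ℕ) (p q : RAMProg)
  /-- while `reg x ≠ 0` do `p` -/
  | loop (x : ℕ) (p : RAMProg)

/-- `RAMRun p s t s'`: started in the state `s`, the program `p` halts in the state `s'` after time
exactly `t`. Every elementary instruction and every test costs `1` plus the binary lengths of the
numbers (constants, operands, results and addresses) that it handles. -/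
inductive RAMRun : RAMProg → RAMState → ℕ → RAMState → Prop where
  | skip (s : RAMState) : RAMRun .skip s 1 s
  | const (s : RAMState) (x c : ℕ) :
      RAMRun (.const x c) s (1 + c.size) (s.setReg x c)
  | arith (s : RAMState) (op : RAMOp) (x y z : ℕ) :
      RAMRun (.arith op x y z) s
        (1 + (s.reg y).size + (s.reg z).size + (op.eval (s.reg y) (s.reg z)).size)
        (s.setReg x (op.eval (s.reg y) (s.reg z)))
  | load (s : RAMState) (x a y : ℕ) :
      RAMRun (.load x a y) s (1 + (s.reg y).size + (s.arr a (s.reg y)).size)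
        (s.setReg x (s.arr a (s.reg y)))
  | store (s : RAMState) (a y x : ℕ) :
      RAMRun (.store a y x) s (1 + (s.reg y).size + (s.reg x).size)
        (s.setArr a (s.reg y) (s.reg x))
  | seq {p q : RAMProg} {s s' s'' : RAMState} {t t' : ℕ}
      (hp : RAMRun p s t s') (hq : RAMRun q s' t' s'') :
      RAMRun (.seq p q) s (t + t') s''
  | iteTrue {x : ℕ} {p q : RAMProg} {s s' : RAMState} {t : ℕ}
      (hx : s.reg x ≠ 0) (hp : RAMRun p s t s') :
      RAMRun (.ite x p q) s (1 + (s.reg x).size + t) s'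
  | iteFalse {x : ℕ} {p q : RAMProg} {s s' : RAMState} {t : ℕ}
      (hx : s.reg x = 0) (hq : RAMRun q s t s') :
      RAMRun (.ite x p q) s (1 + (s.reg x).size + t) s'
  | loopStop {x : ℕ} {p : RAMProg} {s : RAMState} (hx : s.reg x = 0) :
      RAMRun (.loop x p) s (1 + (s.reg x).size) s
  | loopStep {x : ℕ} {p : RAMProg} {s s' s'' : RAMState} {t t' : ℕ}
      (hx : s.reg x ≠ 0) (hp : RAMRun p s t s') (hl : RAMRun (.loop x p) s' t' s'') :
      RAMRun (.loop x p) s (1 + (s.reg x).size + t + t') s''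

/-- The initial state on the input `l`: array `0` holds `l`, register `0` holds the length of `l`,
and everything else is `0`. -/
def RAMState.start (l : List ℕ) : RAMState where
  reg x := if x = 0 then l.length else 0
  arr a i := if a = 0 then l.getD i 0 else 0

/-! ### `k`-SAT and the Strong Exponential Time Hypothesis -/

/-- A clause with `k` literals over `n` variables. A literal is a variable together with the truth
value that makes the literal true. Repeating a literal gives the clauses with fewer literals. -/
abbrev KClause (k n : ℕ) : Type := Fin k → Fin n × Bool

/-- Some assignment makes at least one literal true in each clause. -/
def KSatisfiable {k n : ℕ} (φ : List (KClause k n)) : Prop :=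
  ∃ x : Fin n → Bool, ∀ c ∈ φ, ∃ i : Fin k, x (c i).1 = (c i).2

/-- The number of variables, the number of clauses, and the clauses, each as its `k` literals. -/
def encodeKCNF {k n : ℕ} (φ : List (KClause k n)) : List ℕ :=
  n :: φ.length :: φ.flatMap fun c => List.ofFn fun i => 2 * ((c i).1 : ℕ) + (c i).2.toNat

/-- Some program solves `k`-SAT on `n` variables in time `O(T n)`. As usual a formula has no
repeated clause, so its length is polynomial in `n` for fixed `k`. -/
def KSatSolvableInTime (k : ℕ) (T : ℕ → ℝ) : Prop :=
  ∃ (p : RAMProg) (C : ℝ), ∀ (n : ℕ) (φ : List (KClause k n)), φ.Nodup →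
    ∃ (t : ℕ) (s : RAMState), RAMRun p (.start (encodeKCNF φ)) t s ∧
      (t : ℝ) ≤ C * T n ∧
      (KSatisfiable φ → s.reg 0 = 1) ∧ (¬ KSatisfiable φ → s.reg 0 = 0)

/-- The Strong Exponential Time Hypothesis. -/
def SETH : Prop :=
  ∀ ε : ℝ, 0 < ε → ∃ k : ℕ, 3 ≤ k ∧
    ¬ KSatSolvableInTime k fun n => (2 : ℝ) ^ ((1 - ε) * (n : ℝ))

/-! ### Approximate Subset Query and Bichromatic Max-IP -/

/-- The inner product of two vectors in `{0,1}^m`. -/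
def bitInner {m : ℕ} (a b : Fin m → Bool) : ℕ :=
  ∑ u : Fin m, (a u).toNat * (b u).toNat

/-- A collection of `N` vectors in `{0,1}^m`, written out one vector after the other. -/
def encodeVectors {N m : ℕ} (A : Fin N → Fin m → Bool) : List ℕ :=
  (List.ofFn fun i => List.ofFn fun u => (A i u).toNat).flatten

/-- The input consisting of two collections, each of `N` vectors in `{0,1}^m`. -/
def encodeVectorPair {N m : ℕ} (A B : Fin N → Fin m → Bool) : List ℕ :=
  N :: m :: (encodeVectors A ++ encodeVectors B)

/-- The characteristic vectors of a collection of subsets. -/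
def charVectors {N m : ℕ} (A : Fin N → Finset (Fin m)) : Fin N → Fin m → Bool :=
  fun i u => decide (u ∈ A i)

/-- The factor `2 ^ ((log N) ^ (1 - g(N)))`, with the logarithm to base `2`. -/
noncomputable def gapFactor (g : ℕ → ℝ) (N : ℕ) : ℝ :=
  (2 : ℝ) ^ (Real.logb 2 N ^ (1 - g N))

/-- Completeness: some `b` is contained in some `a`. -/
def SubsetYes {N m : ℕ} (A B : Fin N → Finset (Fin m)) : Prop :=
  ∃ i j, B j ⊆ A i

/-- Soundness: every `|a ∩ b|` is at most `k / c`. -/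
def SubsetNo {N m : ℕ} (k : ℕ) (c : ℝ) (A B : Fin N → Finset (Fin m)) : Prop :=
  ∀ i j, ((A i ∩ B j).card : ℝ) ≤ k / c

/-- The program `p` distinguishes `SubsetYes` from `SubsetNo`, with gap factor
`2 ^ ((log N) ^ (1 - g(N)))`, in time at most `C * T N`, on all inputs that consist of two
collections of `N` subsets of `[m]`, where `m ≤ N ^ f(N)` and all sets in `B` have the same
size `k ≥ 1`. -/
def DistinguishesSubset (p : RAMProg) (f g : ℕ → ℝ) (C : ℝ) (T : ℕ → ℝ) : Prop :=
  ∀ (N m k : ℕ), 2 ≤ N → (m : ℝ) ≤ (N : ℝ) ^ f N → 1 ≤ k →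
    ∀ A B : Fin N → Finset (Fin m), (∀ j, (B j).card = k) →
      SubsetYes A B ∨ SubsetNo k (gapFactor g N) A B →
      ∃ (t : ℕ) (s : RAMState),
        RAMRun p (.start (encodeVectorPair (charVectors A) (charVectors B))) t s ∧
        (t : ℝ) ≤ C * T N ∧
        (SubsetYes A B → s.reg 0 = 1) ∧
        (SubsetNo k (gapFactor g N) A B → s.reg 0 = 0)

/-- Given two collections of `N` vectors in `{0,1}^m`, where `m ≤ N ^ f(N)`, the program `p`
returns, in time at most `C * T N`, a pair of indices `i`, `j` (in the registers `0` and `1`)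
whose inner product is within the factor `2 ^ ((log N) ^ (1 - g(N)))` of the maximum. -/
def ApproximatesMaxIP (p : RAMProg) (f g : ℕ → ℝ) (C : ℝ) (T : ℕ → ℝ) : Prop :=
  ∀ (N m : ℕ), 2 ≤ N → (m : ℝ) ≤ (N : ℝ) ^ f N →
    ∀ A B : Fin N → Fin m → Bool,
      ∃ (t : ℕ) (s : RAMState) (i j : Fin N),
        RAMRun p (.start (encodeVectorPair A B)) t s ∧
        (t : ℝ) ≤ C * T N ∧
        s.reg 0 = i ∧ s.reg 1 = j ∧
        ∀ i' j' : Fin N,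
          (bitInner (A i') (B j') : ℝ) ≤ gapFactor g N * bitInner (A i) (B j)

/-! ### Polynomially bounded cost functions -/

/-- `T V` is at most a fixed power of `V`. -/
def PolyBd (T : ℕ → ℕ) : Prop := ∃ c : ℕ, ∀ V, 2 ≤ V → T V ≤ V ^ c

namespace PolyBd

/-- The restriction to `2 ≤ V` pays off here: a constant `a` is at most `2 ^ a`, so no leading
factor is needed in polynomial bounds. -/
theorem const (a : ℕ) : PolyBd fun _ => a :=
  ⟨a, fun _ hV => (Nat.lt_two_pow_self).le.trans (Nat.pow_le_pow_left hV a)⟩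

theorem id : PolyBd fun V => V := ⟨1, fun V _ => by simp⟩

theorem mul {S T : ℕ → ℕ} (hS : PolyBd S) (hT : PolyBd T) : PolyBd fun V => S V * T V := by
  obtain ⟨a, ha⟩ := hS
  obtain ⟨b, hb⟩ := hT
  exact ⟨a + b, fun V hV => by rw [pow_add]; exact Nat.mul_le_mul (ha V hV) (hb V hV)⟩

theorem add {S T : ℕ → ℕ} (hS : PolyBd S) (hT : PolyBd T) : PolyBd fun V => S V + T V := by
  obtain ⟨a, ha⟩ := hS
  obtain ⟨b, hb⟩ := hT
  refine ⟨a + b + 1, fun V hV => ?_⟩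
  have h1 := (ha V hV).trans (Nat.pow_le_pow_right (by omega : 0 < V) (by omega : a ≤ a + b))
  have h2 := (hb V hV).trans (Nat.pow_le_pow_right (by omega : 0 < V) (by omega : b ≤ a + b))
  rw [pow_succ]
  nlinarith [Nat.zero_le (V ^ (a + b))]

theorem comp {S T : ℕ → ℕ} (hS : PolyBd S) (hT : PolyBd T) (h2 : ∀ V, 2 ≤ V → 2 ≤ T V) :
    PolyBd fun V => S (T V) := by
  obtain ⟨a, ha⟩ := hS
  obtain ⟨b, hb⟩ := hT
  exact ⟨b * a, fun V hV => (ha _ (h2 V hV)).trans <| by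
    rw [pow_mul]; exact Nat.pow_le_pow_left (hb V hV) a⟩

end PolyBd

/-! ### Binary lengths -/

theorem Nat.size_le_self (x : ℕ) : x.size ≤ x := Nat.size_le.2 Nat.lt_two_pow_self

theorem Nat.size_mono {x y : ℕ} (h : x ≤ y) : x.size ≤ y.size := Nat.size_le_size h

theorem Nat.size_le_of_le {x y : ℕ} (h : x ≤ y) : x.size ≤ y := (Nat.size_le_self x).trans h

/-! ### Runs with a bound on the time -/

/-- Started in `s`, the program `p` halts in `s'` after time at most `B`. -/
def RunsLE (p : RAMProg) (s : RAMState) (B : ℕ) (s' : RAMState) : Prop :=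
  ∃ t, t ≤ B ∧ RAMRun p s t s'

namespace RAMState

@[simp] theorem setReg_reg (s : RAMState) (x v y : ℕ) :
    (s.setReg x v).reg y = if y = x then v else s.reg y := by
  simp [setReg, Function.update_apply]

@[simp] theorem setReg_arr (s : RAMState) (x v : ℕ) : (s.setReg x v).arr = s.arr := rfl

@[simp] theorem setArr_reg (s : RAMState) (a i v : ℕ) : (s.setArr a i v).reg = s.reg := rfl

theorem setArr_arr (s : RAMState) (a i v b j : ℕ) :
    (s.setArr a i v).arr b j = if b = a ∧ j = i then v else s.arr b j := by
  by_cases hb : b = a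
  · subst hb; simp [setArr, Function.update_apply]
  · simp [setArr, hb]

end RAMState

namespace RunsLE

theorem mono {p s B B' s'} (h : RunsLE p s B s') (hB : B ≤ B') : RunsLE p s B' s' := by
  obtain ⟨t, ht, hr⟩ := h
  exact ⟨t, ht.trans hB, hr⟩

theorem seq {p q s s' s'' B B'} (hp : RunsLE p s B s') (hq : RunsLE q s' B' s'') :
    RunsLE (.seq p q) s (B + B') s'' := by
  obtain ⟨t, ht, hr⟩ := hp
  obtain ⟨t', ht', hr'⟩ := hq
  exact ⟨t + t', by omega, .seq hr hr'⟩

/-- An elementary instruction handles at most three numbers. One common bound `1 + 3 * A` for all of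
them makes the costs of sequences easy to add. -/
theorem const {s : RAMState} {x c A : ℕ} (h : c.size ≤ A) :
    RunsLE (.const x c) s (1 + 3 * A) (s.setReg x c) := ⟨_, by omega, .const s x c⟩

theorem arith {s : RAMState} {op : RAMOp} {x y z A : ℕ} (hy : (s.reg y).size ≤ A)
    (hz : (s.reg z).size ≤ A) (hr : (op.eval (s.reg y) (s.reg z)).size ≤ A) :
    RunsLE (.arith op x y z) s (1 + 3 * A) (s.setReg x (op.eval (s.reg y) (s.reg z))) :=
  ⟨_, by omega, .arith s op x y z⟩

theorem load {s : RAMState} {x a y A : ℕ} (hy : (s.reg y).size ≤ A)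
    (hr : (s.arr a (s.reg y)).size ≤ A) :
    RunsLE (.load x a y) s (1 + 3 * A) (s.setReg x (s.arr a (s.reg y))) :=
  ⟨_, by omega, .load s x a y⟩

theorem store {s : RAMState} {a y x A : ℕ} (hy : (s.reg y).size ≤ A)
    (hr : (s.reg x).size ≤ A) :
    RunsLE (.store a y x) s (1 + 3 * A) (s.setArr a (s.reg y) (s.reg x)) :=
  ⟨_, by omega, .store s a y x⟩

/-- A loop whose control register counts down to `0`. -/
theorem loop {x : ℕ} {body : RAMProg} {n B A : ℕ} (I : ℕ → RAMState → Prop) (hA : n.size ≤ A)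
    (hstep : ∀ j s, j < n → I j s → s.reg x = n - j →
      ∃ s', RunsLE body s B s' ∧ I (j + 1) s' ∧ s'.reg x = n - (j + 1))
    (s : RAMState) (h0 : I 0 s) (hx : s.reg x = n) :
    ∃ s', RunsLE (.loop x body) s ((n + 1) * (B + A + 1)) s' ∧ I n s' ∧ s'.reg x = 0 := by
  -- Induction on the number `r` of remaining rounds; the factor `r + 1` contains the last test,
  -- which ends the loop.
  have key : ∀ r j s, j + r = n → I j s → s.reg x = n - j →
      ∃ s', RunsLE (.loop x body) s ((r + 1) * (B + A + 1)) s' ∧ I n s' ∧ s'.reg x = 0 := by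
    intro r
    induction r with
    | zero =>
      intro j s hj hI hs
      obtain rfl : j = n := by omega
      have hs0 : s.reg x = 0 := by simpa using hs
      exact ⟨s, ⟨_, by simp [hs0], .loopStop hs0⟩, hI, hs0⟩
    | succ r ih =>
      intro j s hj hI hs
      obtain ⟨s₁, ⟨t₁, ht₁, hr₁⟩, hI₁, hs₁⟩ := hstep j s (by omega) hI hs
      obtain ⟨s₂, ⟨t₂, ht₂, hr₂⟩, hI₂, hs₂⟩ := ih (j + 1) s₁ (by omega) hI₁ hs₁
      refine ⟨s₂, ⟨_, ?_, .loopStep (by omega) hr₁ hr₂⟩, hI₂, hs₂⟩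
      have : (s.reg x).size ≤ A := (Nat.size_mono (by omega)).trans hA
      rw [add_mul (r + 1) 1]
      omega
  exact key n 0 s (by omega) h0 (by simpa using hx)

end RunsLE

/-! ### Programs depend only on the registers and arrays that they mention -/

/-- All registers and arrays mentioned by the program have numbers less than `K`. -/
def RAMProg.Below (K : ℕ) : RAMProg → Prop
  | .skip => True
  | .const x _ => x < K
  | .arith _ x y z => x < K ∧ y < K ∧ z < K
  | .load x a y => x < K ∧ a < K ∧ y < K
  | .store a y x => a < K ∧ y < K ∧ x < K
  | .seq p q => p.Below K ∧ q.Below K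
  | .ite x p q => x < K ∧ p.Below K ∧ q.Below K
  | .loop x p => x < K ∧ p.Below K

theorem RAMProg.Below.mono {K L : ℕ} (h : K ≤ L) {p : RAMProg} (hp : p.Below K) : p.Below L := by
  induction p <;> simp only [RAMProg.Below] at hp ⊢ <;> grind

theorem RAMProg.exists_below (p : RAMProg) : ∃ K, p.Below K := by
  induction p with
  | skip => exact ⟨0, trivial⟩
  | const x c => exact ⟨x + 1, by simp [Below]⟩
  | arith op x y z => exact ⟨x + y + z + 1, by simp [Below]; omega⟩
  | load x a y => exact ⟨x + a + y + 1, by simp [Below]; omega⟩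
  | store a y x => exact ⟨a + y + x + 1, by simp [Below]; omega⟩
  | seq p q hp hq =>
    obtain ⟨K, hK⟩ := hp
    obtain ⟨L, hL⟩ := hq
    exact ⟨K + L, hK.mono (by omega), hL.mono (by omega)⟩
  | ite x p q hp hq =>
    obtain ⟨K, hK⟩ := hp
    obtain ⟨L, hL⟩ := hq
    exact ⟨K + L + x + 1, by omega, hK.mono (by omega), hL.mono (by omega)⟩
  | loop x p hp =>
    obtain ⟨K, hK⟩ := hp
    exact ⟨K + x + 1, by omega, hK.mono (by omega)⟩

/-- Two states agree on the registers and arrays with numbers less than `K`. -/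
def AgreeBelow (K : ℕ) (s u : RAMState) : Prop :=
  (∀ x < K, s.reg x = u.reg x) ∧ ∀ a < K, ∀ i, s.arr a i = u.arr a i

/-- Two states agree on the registers and arrays with numbers at least `K`. -/
def AgreeAbove (K : ℕ) (s u : RAMState) : Prop :=
  (∀ x, K ≤ x → s.reg x = u.reg x) ∧ ∀ a, K ≤ a → ∀ i, s.arr a i = u.arr a i

theorem AgreeAbove.trans {K : ℕ} {s u v : RAMState} (h : AgreeAbove K s u) (h' : AgreeAbove K u v) :
    AgreeAbove K s v :=
  ⟨fun x hx => (h.1 x hx).trans (h'.1 x hx), fun a ha i => (h.2 a ha i).trans (h'.2 a ha i)⟩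

theorem AgreeBelow.setReg {K x v : ℕ} {s u : RAMState} (h : AgreeBelow K s u) :
    AgreeBelow K (s.setReg x v) (u.setReg x v) :=
  ⟨fun y hy => by simp [h.1 y hy], fun a ha i => by simp [h.2 a ha i]⟩

theorem AgreeAbove.setReg_self {K x v : ℕ} {u : RAMState} (hx : x < K) :
    AgreeAbove K u (u.setReg x v) :=
  ⟨fun y hy => by simp [show y ≠ x by omega], fun a ha i => by simp⟩

/-- This is what allows an arbitrary program to be called as a subroutine. Data at numbers from `K`
on are invisible to it and untouched by it, and the time is exactly the same. -/
theorem RAMRun.transfer {K : ℕ} {p : RAMProg} {s s' : RAMState} {t : ℕ} (h : RAMRun p s t s') :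
    p.Below K → ∀ u, AgreeBelow K s u →
      ∃ u', RAMRun p u t u' ∧ AgreeBelow K s' u' ∧ AgreeAbove K u u' := by
  induction h with
  | skip s => exact fun _ u hu => ⟨u, .skip u, hu, ⟨fun _ _ => rfl, fun _ _ _ => rfl⟩⟩
  | const s x c => exact fun hp u hu => ⟨_, .const u x c, hu.setReg, .setReg_self hp⟩
  | arith s op x y z =>
    intro ⟨hx, hy, hz⟩ u hu
    rw [hu.1 y hy, hu.1 z hz]
    exact ⟨_, .arith u op x y z, hu.setReg, .setReg_self hx⟩
  | load s x a y =>
    intro ⟨hx, ha, hy⟩ u hu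
    rw [hu.1 y hy, hu.2 a ha]
    exact ⟨_, .load u x a y, hu.setReg, .setReg_self hx⟩
  | store s a y x =>
    intro ⟨ha, hy, hx⟩ u hu
    rw [hu.1 y hy, hu.1 x hx]
    refine ⟨_, .store u a y x, ⟨fun z hz => hu.1 z hz, fun b hb i => ?_⟩,
      ⟨fun z hz => rfl, fun b hb i => ?_⟩⟩
    · simp only [RAMState.setArr_arr, hu.2 b hb i]
    · rw [RAMState.setArr_arr, if_neg (by omega)]
  | seq _ _ ihp ihq =>
    intro ⟨hp, hq⟩ u hu
    obtain ⟨u₁, h₁, h₂, h₃⟩ := ihp hp u hu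
    obtain ⟨u₂, h₄, h₅, h₆⟩ := ihq hq u₁ h₂
    exact ⟨u₂, .seq h₁ h₄, h₅, h₃.trans h₆⟩
  | iteTrue hx _ ih =>
    intro ⟨hxK, hp, hq⟩ u hu
    obtain ⟨u₁, h₁, h₂, h₃⟩ := ih hp u hu
    rw [hu.1 _ hxK] at hx ⊢
    exact ⟨u₁, .iteTrue hx h₁, h₂, h₃⟩
  | iteFalse hx _ ih =>
    intro ⟨hxK, hp, hq⟩ u hu
    obtain ⟨u₁, h₁, h₂, h₃⟩ := ih hq u hu
    rw [hu.1 _ hxK] at hx ⊢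
    exact ⟨u₁, .iteFalse hx h₁, h₂, h₃⟩
  | loopStop hx =>
    intro ⟨hxK, hp⟩ u hu
    rw [hu.1 _ hxK] at hx ⊢
    exact ⟨u, .loopStop hx, hu, ⟨fun _ _ => rfl, fun _ _ _ => rfl⟩⟩
  | loopStep hx _ _ ih₁ ih₂ =>
    intro ⟨hxK, hp⟩ u hu
    obtain ⟨u₁, h₁, h₂, h₃⟩ := ih₁ hp u hu
    obtain ⟨u₂, h₄, h₅, h₆⟩ := ih₂ ⟨hxK, hp⟩ u₁ h₂
    rw [hu.1 _ hxK] at hx ⊢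
    exact ⟨u₂, .loopStep hx h₁ h₄, h₅, h₃.trans h₆⟩

/-! ### Expressions -/

/-- Arithmetical expressions over variables and arrays. -/
inductive Ex where
  | const (c : ℕ)
  | var (x : ℕ)
  /-- an entry of an array -/
  | read (a : ℕ) (e : Ex)
  | bin (op : RAMOp) (e f : Ex)
  /-- the sum of `e` over all values of the variable `x` below `n` -/
  | sum (x : ℕ) (n e : Ex)
  /-- the power `b ^ e`, where every intermediate result is reduced modulo `m + 1` -/
  | pow (b e m : Ex)

def Ex.eval : Ex → (ℕ → ℕ) → (ℕ → ℕ → ℕ) → ℕ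
  | .const c, _, _ => c
  | .var x, v, _ => v x
  | .read a e, v, r => r a (e.eval v r)
  | .bin op e f, v, r => op.eval (e.eval v r) (f.eval v r)
  | .sum x n e, v, r => ∑ i ∈ Finset.range (n.eval v r), e.eval (Function.update v x i) r
  | .pow b e m, v, r => (fun y => y * b.eval v r % (m.eval v r + 1))^[e.eval v r] 1

/-- The arrays that an expression reads. -/
def Ex.arrays : Ex → List ℕ
  | .const _ => []
  | .var _ => []
  | .read a e => a :: e.arrays
  | .bin _ e f => e.arrays ++ f.arrays
  | .sum _ n e => n.arrays ++ e.arrays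
  | .pow b e m => b.arrays ++ e.arrays ++ m.arrays

/-- Needed when a table is filled in: an expression that does not read the target array is not
affected by the entries already written. -/
theorem Ex.eval_congr_arrays {r r' : ℕ → ℕ → ℕ} (e : Ex) :
    ∀ v, (∀ a ∈ e.arrays, r a = r' a) → e.eval v r = e.eval v r' := by
  induction e with
  | const c => intros; rfl
  | var x => intros; rfl
  | read a e ih =>
    intro v h
    simp only [arrays, List.mem_cons, forall_eq_or_imp] at h
    simp only [eval, h.1, ih v h.2]
  | bin op e f ihe ihf =>
    intro v h
    simp only [arrays, List.mem_append] at h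
    simp only [eval, ihe v fun a ha => h a (.inl ha), ihf v fun a ha => h a (.inr ha)]
  | sum x n e ihn ihe =>
    intro v h
    simp only [arrays, List.mem_append] at h
    simp only [eval, ihn v fun a ha => h a (.inl ha), ihe _ fun a ha => h a (.inr ha)]
  | pow b e m ihb ihe ihm =>
    intro v h
    simp only [arrays, List.mem_append] at h
    simp only [eval, ihb v fun a ha => h a (.inl (.inl ha)),
      ihe v fun a ha => h a (.inl (.inr ha)), ihm v fun a ha => h a (.inr ha)]

theorem powMod_le (b m e : ℕ) : (fun y => y * b % (m + 1))^[e] 1 ≤ m + 1 := by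
  cases e with
  | zero => simp
  | succ e => rw [Function.iterate_succ_apply']; exact (Nat.mod_lt _ (by omega)).le

/-- The iteration starts from `1` without reduction, and for `m = 0` and exponent `0` this is not
the residue; hence `1 ≤ m`. -/
theorem powMod_eq {m : ℕ} (hm : 1 ≤ m) (b e : ℕ) :
    (fun y => y * b % (m + 1))^[e] 1 = b ^ e % (m + 1) := by
  induction e with
  | zero => simp [Nat.mod_eq_of_lt (show 1 < m + 1 by omega)]
  | succ e ih => rw [Function.iterate_succ_apply', ih, pow_succ, Nat.mod_mul_mod]

/-- All variables and array entries are at most `V`. -/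
def EnvBd (V : ℕ) (v : ℕ → ℕ) (r : ℕ → ℕ → ℕ) : Prop := (∀ x, v x ≤ V) ∧ ∀ a i, r a i ≤ V

theorem EnvBd.update {V n : ℕ} {v : ℕ → ℕ} {r : ℕ → ℕ → ℕ} (h : EnvBd V v r) {x i : ℕ}
    (hi : i ≤ n) : EnvBd (V + n) (Function.update v x i) r :=
  ⟨fun y => by rw [Function.update_apply]; split_ifs; omega; have := h.1 y; omega,
    fun a j => by have := h.2 a j; omega⟩

theorem RAMOp.eval_le (op : RAMOp) (u v : ℕ) : op.eval u v ≤ u + v + u * v := by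
  cases op
  · exact Nat.le_add_right _ _
  · exact (Nat.sub_le u v).trans (by rw [add_assoc]; exact Nat.le_add_right _ _)
  · exact Nat.le_add_left _ _
  · exact (Nat.div_le_self u v).trans (by rw [add_assoc]; exact Nat.le_add_right _ _)

/-- Values stay polynomial because the only dangerous operation, the power, is reduced modulo an
expression. In a sum the summation variable may exceed `V`, so the summand is estimated for the
enlarged bound `V + W V`. -/
theorem Ex.eval_bd (e : Ex) : ∃ W : ℕ → ℕ, PolyBd W ∧
    ∀ V v r, 2 ≤ V → EnvBd V v r → e.eval v r ≤ W V := by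
  induction e with
  | const c => exact ⟨_, .const c, fun V v r _ _ => le_rfl⟩
  | var x => exact ⟨_, .id, fun V v r _ h => h.1 x⟩
  | read a e ih => exact ⟨_, .id, fun V v r _ h => h.2 a _⟩
  | bin op e f ihe ihf =>
    obtain ⟨W, hW, h⟩ := ihe
    obtain ⟨W', hW', h'⟩ := ihf
    refine ⟨_, (hW.add hW').add (hW.mul hW'), fun V v r hV hE => (op.eval_le _ _).trans ?_⟩
    have h1 := h V v r hV hE
    have h2 := h' V v r hV hE
    have := Nat.mul_le_mul h1 h2
    omega
  | sum x n e ihn ihe =>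
    obtain ⟨W, hW, h⟩ := ihn
    obtain ⟨W', hW', h'⟩ := ihe
    refine ⟨_, hW.mul (hW'.comp (PolyBd.id.add hW) (fun V hV => by omega)),
      fun V v r hV hE => ?_⟩
    have h1 := h V v r hV hE
    calc _ ≤ ∑ i ∈ Finset.range (n.eval v r), W' (V + W V) := Finset.sum_le_sum fun i hi =>
          h' _ _ _ (by omega) (hE.update (by have := Finset.mem_range.1 hi; omega))
      _ = n.eval v r * W' (V + W V) := by simp
      _ ≤ _ := Nat.mul_le_mul_right _ h1
  | pow b e m ihb ihe ihm =>
    obtain ⟨W, hW, h⟩ := ihm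
    exact ⟨_, hW.add (.const 1), fun V v r hV hE =>
      (powMod_le _ _ _).trans (Nat.add_le_add_right (h V v r hV hE) 1)⟩

/-! ### Compilation of expressions -/

/-- The register of a variable. -/
def uv (K x : ℕ) : ℕ := K + 3 * x

/-- A scratch register. -/
def sc (K y : ℕ) : ℕ := K + 3 * y + 1

/-- The register of a big number. -/
def bg (K z : ℕ) : ℕ := K + 3 * z + 2

section
variable {K x y : ℕ}
@[simp] theorem uv_inj : uv K x = uv K y ↔ x = y := by unfold uv; omega
@[simp] theorem sc_inj : sc K x = sc K y ↔ x = y := by unfold sc; omega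
@[simp] theorem bg_inj : bg K x = bg K y ↔ x = y := by unfold bg; omega
@[simp] theorem uv_ne_sc : uv K x ≠ sc K y := by unfold uv sc; omega
@[simp] theorem uv_ne_bg : uv K x ≠ bg K y := by unfold uv bg; omega
@[simp] theorem sc_ne_uv : sc K x ≠ uv K y := by unfold uv sc; omega
@[simp] theorem bg_ne_uv : bg K x ≠ uv K y := by unfold uv bg; omega
@[simp] theorem bg_ne_sc : bg K x ≠ sc K y := by unfold sc bg; omega
theorem ne_uv_of_lt (h : x < K) : x ≠ uv K y := by unfold uv; omega
theorem ne_sc_of_lt (h : x < K) : x ≠ sc K y := by unfold sc; omega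
theorem ne_bg_of_lt (h : x < K) : x ≠ bg K y := by unfold bg; omega
end

/-- A program that puts the value of an expression into the scratch register `d`, and leaves
everything unchanged except for the scratch registers from `d` on. -/
def Ex.comp (K : ℕ) : Ex → ℕ → RAMProg
  | .const c, d => .const (sc K d) c
  -- There is no copy instruction; a register is copied by adding `0`.
  | .var x, d => .seq (.const (sc K (d + 1)) 0) (.arith .add (sc K d) (uv K x) (sc K (d + 1)))
  | .read a e, d => .seq (e.comp K d) (.load (sc K d) (K + a) (sc K d))
  | .bin op e f, d =>
    .seq (e.comp K d) (.seq (f.comp K (d + 1)) (.arith op (sc K d) (sc K d) (sc K (d + 1))))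
  | .sum x n e, d =>
    .seq (n.comp K d) <| .seq (.const (sc K (d + 1)) 0) <|
    -- The summation variable is a real register and is overwritten by the loop. Its old value waits
    -- in the scratch register `d + 2` and is restored afterwards.
    .seq (.arith .add (sc K (d + 2)) (uv K x) (sc K (d + 1))) <| .seq (.const (uv K x) 0) <|
    .seq (.loop (sc K d) <|
      .seq (e.comp K (d + 3)) <|
      .seq (.arith .add (sc K (d + 1)) (sc K (d + 1)) (sc K (d + 3))) <|
      .seq (.const (sc K (d + 3)) 1) <|
      .seq (.arith .add (uv K x) (uv K x) (sc K (d + 3))) <|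
      .arith .sub (sc K d) (sc K d) (sc K (d + 3))) <|
    .seq (.const (sc K (d + 3)) 0) <|
    .seq (.arith .add (uv K x) (sc K (d + 2)) (sc K (d + 3))) <|
    .arith .add (sc K d) (sc K (d + 1)) (sc K (d + 3))
  | .pow b e m, d =>
    .seq (e.comp K d) <| .seq (b.comp K (d + 1)) <| .seq (m.comp K (d + 2)) <|
    .seq (.const (sc K (d + 3)) 1) <|
    .seq (.arith .add (sc K (d + 2)) (sc K (d + 2)) (sc K (d + 3))) <|
    .seq (.loop (sc K d) <|
      .seq (.arith .mul (sc K (d + 3)) (sc K (d + 3)) (sc K (d + 1))) <|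
      -- There is no remainder instruction: the quotient times the modulus is formed in the register
      -- `d + 4` and subtracted.
      .seq (.arith .div (sc K (d + 4)) (sc K (d + 3)) (sc K (d + 2))) <|
      .seq (.arith .mul (sc K (d + 4)) (sc K (d + 4)) (sc K (d + 2))) <|
      .seq (.arith .sub (sc K (d + 3)) (sc K (d + 3)) (sc K (d + 4))) <|
      .seq (.const (sc K (d + 4)) 1) <|
      .arith .sub (sc K d) (sc K d) (sc K (d + 4))) <|
    .seq (.const (sc K (d + 4)) 0) <|
    .arith .add (sc K d) (sc K (d + 3)) (sc K (d + 4))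

/-- `s'` differs from `s` at most in the scratch registers from `d` on. -/
def SameBut (K d : ℕ) (s s' : RAMState) : Prop :=
  (∀ r, (∀ y, d ≤ y → r ≠ sc K y) → s'.reg r = s.reg r) ∧ s'.arr = s.arr

namespace SameBut
variable {K d d' : ℕ} {s s' s'' : RAMState}

theorem trans (h : SameBut K d s s') (h' : SameBut K d s' s'') : SameBut K d s s'' :=
  ⟨fun r hr => (h'.1 r hr).trans (h.1 r hr), h'.2.trans h.2⟩

theorem mono (h : SameBut K d s s') (hd : d' ≤ d) : SameBut K d' s s' :=
  ⟨fun r hr => h.1 r fun y hy => hr y (hd.trans hy), h.2⟩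

theorem setReg {y v : ℕ} (hy : d ≤ y) : SameBut K d s (s.setReg (sc K y) v) :=
  ⟨fun r hr => by simp [hr y hy], rfl⟩

theorem sc_eq (h : SameBut K d s s') {y : ℕ} (hy : y < d) : s'.reg (sc K y) = s.reg (sc K y) :=
  h.1 _ fun z hz => by simp; omega

theorem uv_eq (h : SameBut K d s s') (x : ℕ) : s'.reg (uv K x) = s.reg (uv K x) :=
  h.1 _ fun z hz => by simp

theorem bg_eq (h : SameBut K d s s') (x : ℕ) : s'.reg (bg K x) = s.reg (bg K x) :=
  h.1 _ fun z hz => by simp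

end SameBut

/-- The program `p` computes `f` into the scratch register `d`, in time `T V` on environments
bounded by `V`. -/
def Computes (K : ℕ) (p : RAMProg) (d : ℕ) (e : Ex) (T : ℕ → ℕ) : Prop :=
  ∀ V s v r, 2 ≤ V → EnvBd V v r → (∀ x, s.reg (uv K x) = v x) → (∀ a, s.arr (K + a) = r a) →
    ∃ s', RunsLE p s (T V) s' ∧ s'.reg (sc K d) = e.eval v r ∧ SameBut K d s s'

theorem sub_mul_div_eq_mod (a b : ℕ) : a - a / b * b = a % b := by
  have := Nat.div_add_mod a b
  rw [mul_comm] at this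
  omega

/-- By induction on the expression. Each subexpression is compiled to a higher scratch register, so
that results already obtained survive, and the polynomial `T` depends on the expression but not on
the environment. -/
theorem Ex.comp_computes (K : ℕ) (e : Ex) :
    ∀ d, ∃ T, PolyBd T ∧ Computes K (e.comp K d) d e T := by
  induction e with
  | const c =>
    intro d
    exact ⟨_, .const (1 + 3 * c), fun V s v r _ _ _ _ =>
      ⟨_, .const (Nat.size_le_self c), by simp [eval], .setReg le_rfl⟩⟩
  | var x =>
    intro d
    refine ⟨fun V => (1 + 3 * V) + (1 + 3 * V), ((PolyBd.const 1).add ((PolyBd.const 3).mul .id)).add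
      ((PolyBd.const 1).add ((PolyBd.const 3).mul .id)), fun V s v r _ hE hv hr =>
      ⟨_, .seq (.const (by simp)) (.arith (A := V) ?_ ?_ ?_), ?_, ?_⟩⟩
    · simpa [hv] using Nat.size_le_of_le (hE.1 x)
    · simp
    · simpa [hv, RAMOp.eval] using Nat.size_le_of_le (hE.1 x)
    · simp [hv, RAMOp.eval, eval]
    · exact (SameBut.setReg (by omega)).trans (.setReg le_rfl)
  | read a e ih =>
    intro d
    obtain ⟨T, hT, h⟩ := ih d
    obtain ⟨W, hW, h'⟩ := e.eval_bd
    refine ⟨fun V => T V + (1 + 3 * (W V + V)),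
      hT.add ((PolyBd.const 1).add ((PolyBd.const 3).mul (hW.add .id))),
      fun V s v r hV hE hv hr => ?_⟩
    obtain ⟨s', h1, h2, h3⟩ := h V s v r hV hE hv hr
    have h4 := h' V v r hV hE
    refine ⟨_, h1.seq (.load ?_ ?_), ?_, h3.trans (.setReg le_rfl)⟩
    · rw [h2]; exact Nat.size_le_of_le (by omega)
    · rw [h2, h3.2, hr]; exact Nat.size_le_of_le (by have := hE.2 a (e.eval v r); omega)
    · simp [h2, h3.2, hr, eval]
  | bin op e f ihe ihf =>
    intro d
    obtain ⟨T, hT, h⟩ := ihe d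
    obtain ⟨T', hT', h'⟩ := ihf (d + 1)
    obtain ⟨W, hW, hw⟩ := e.eval_bd
    obtain ⟨W', hW', hw'⟩ := f.eval_bd
    refine ⟨fun V => T V + (T' V + (1 + 3 * (W V + W' V + W V * W' V))),
      hT.add (hT'.add ((PolyBd.const 1).add ((PolyBd.const 3).mul ((hW.add hW').add (hW.mul hW'))))),
      fun V s v r hV hE hv hr => ?_⟩
    obtain ⟨s', h1, h2, h3⟩ := h V s v r hV hE hv hr
    obtain ⟨s'', h4, h5, h6⟩ := h' V s' v r hV hE (fun x => (h3.uv_eq x).trans (hv x))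
      (fun a => by rw [h3.2]; exact hr a)
    have h7 := hw V v r hV hE
    have h8 := hw' V v r hV hE
    have h9 : s''.reg (sc K d) = e.eval v r := (h6.sc_eq (by omega)).trans h2
    have h10 := Nat.mul_le_mul h7 h8
    refine ⟨_, h1.seq (h4.seq (.arith ?_ ?_ ?_)), ?_, h3.trans ((h6.mono (by omega)).trans
      (.setReg le_rfl))⟩
    · rw [h9]; exact Nat.size_le_of_le (by omega)
    · rw [h5]; exact Nat.size_le_of_le (by omega)
    · rw [h5, h9]; exact Nat.size_le_of_le ((op.eval_le _ _).trans (by omega))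
    · simp [h5, h9, eval]
  | sum x n e ihn ihe =>
    intro d
    obtain ⟨T, hT, h⟩ := ihn d
    obtain ⟨T', hT', h'⟩ := ihe (d + 3)
    obtain ⟨W, hW, hw⟩ := n.eval_bd
    obtain ⟨W', hW', hw'⟩ := e.eval_bd
    have hVW : ∀ V, 2 ≤ V → 2 ≤ V + W V := fun V hV => by omega
    -- A common bound for all numbers that occur in the loop: the counter, the summation variable,
    -- the partial sums and the summands. Every instruction then costs at most `1 + 3 * A V`.
    let A : ℕ → ℕ := fun V => 1 + V + W V + W V * W' (V + W V) + W' (V + W V)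
    have hA : PolyBd A := ((((PolyBd.const 1).add .id).add hW).add
      (hW.mul (hW'.comp (PolyBd.id.add hW) hVW))).add (hW'.comp (PolyBd.id.add hW) hVW)
    have hI : PolyBd fun V => 1 + 3 * A V := (PolyBd.const 1).add ((PolyBd.const 3).mul hA)
    refine ⟨fun V => T V + ((1 + 3 * A V) + ((1 + 3 * A V) + ((1 + 3 * A V) +
      ((W V + 1) * ((T' (V + W V) + ((1 + 3 * A V) + ((1 + 3 * A V) + ((1 + 3 * A V) +
        (1 + 3 * A V))))) + A V + 1) + ((1 + 3 * A V) + ((1 + 3 * A V) + (1 + 3 * A V))))))),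
      hT.add (hI.add (hI.add (hI.add (((hW.add (.const 1)).mul
        (((((hT'.comp (PolyBd.id.add hW) hVW)).add (hI.add (hI.add (hI.add hI)))).add hA).add
          (.const 1))).add (hI.add (hI.add hI)))))), fun V s v r hV hE hv hr => ?_⟩
    obtain ⟨s₁, h1, h2, h3⟩ := h V s v r hV hE hv hr
    have hn := hw V v r hV hE
    set N := n.eval v r with hN
    let g : ℕ → ℕ := fun i => e.eval (Function.update v x i) r
    have hg : ∀ i ≤ N, g i ≤ W' (V + W V) := fun i hi =>
      hw' _ _ _ (by omega) (hE.update (by omega))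
    have hG : ∀ j ≤ N, ∑ i ∈ Finset.range j, g i ≤ W V * W' (V + W V) := fun j hj =>
      calc _ ≤ ∑ i ∈ Finset.range j, W' (V + W V) :=
            Finset.sum_le_sum fun i hi => hg i (by have := Finset.mem_range.1 hi; omega)
        _ = j * W' (V + W V) := by simp
        _ ≤ _ := Nat.mul_le_mul_right _ (by omega)
    have hvx := hE.1 x
    let I : ℕ → RAMState → Prop := fun j u =>
      u.reg (sc K (d + 1)) = ∑ i ∈ Finset.range j, g i ∧ u.reg (sc K (d + 2)) = v x ∧
      u.reg (uv K x) = j ∧ u.arr = s.arr ∧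
      ∀ ρ, ρ ≠ uv K x → (∀ y, d ≤ y → ρ ≠ sc K y) → u.reg ρ = s.reg ρ
    have hloop := RunsLE.loop (x := sc K d) (body := .seq (e.comp K (d + 3)) <|
      .seq (.arith .add (sc K (d + 1)) (sc K (d + 1)) (sc K (d + 3))) <|
      .seq (.const (sc K (d + 3)) 1) <|
      .seq (.arith .add (uv K x) (uv K x) (sc K (d + 3))) <|
      .arith .sub (sc K d) (sc K d) (sc K (d + 3))) (n := N) (A := A V)
      (B := T' (V + W V) + ((1 + 3 * A V) + ((1 + 3 * A V) + ((1 + 3 * A V) + (1 + 3 * A V)))))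
      I (Nat.size_le_of_le (by simp only [A]; omega)) (by
        intro j u hj ⟨hu1, hu2, hu3, hu4, hu5⟩ hu
        obtain ⟨u₁, k1, k2, k3⟩ := h' (V + W V) u (Function.update v x j) r (by omega)
          (hE.update (by omega)) (fun y => by
            by_cases hy : y = x
            · subst hy; simpa using hu3
            · rw [hu5 _ (by simpa using hy) (by simp), hv, Function.update_of_ne hy])
          (fun a => by rw [hu4]; exact hr a)
        have k4 := k3.sc_eq (y := d) (by omega)
        have k5 := k3.sc_eq (y := d + 1) (by omega)
        have k6 := k3.sc_eq (y := d + 2) (by omega)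
        have k7 := k3.uv_eq x
        rw [hu] at k4
        rw [hu1] at k5
        rw [hu2] at k6
        rw [hu3] at k7
        have g1 := hG j hj.le
        have g2 := hg j hj.le
        have g3 := hG (j + 1) hj
        have k2' : u₁.reg (sc K (d + 3)) = g j := k2
        rw [Finset.sum_range_succ] at g3
        refine ⟨_, k1.seq (.seq (.arith ?_ ?_ ?_) (.seq (.const (A := A V) ?_) (.seq (.arith ?_ ?_ ?_)
          (.arith ?_ ?_ ?_)))), ⟨?_, ?_, ?_, ?_, ?_⟩, ?_⟩
        · rw [k5]; exact Nat.size_le_of_le (by simp only [A]; omega)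
        · rw [k2']; exact Nat.size_le_of_le (by simp only [A]; omega)
        · rw [k5, k2']; exact Nat.size_le_of_le (by simp only [A, RAMOp.eval]; omega)
        · exact Nat.size_le_of_le (by simp only [A]; omega)
        · simp only [RAMState.setReg_reg, uv_ne_sc, if_false, k7]
          exact Nat.size_le_of_le (by simp only [A]; omega)
        · simp only [RAMState.setReg_reg, if_true]
          exact Nat.size_le_of_le (by simp only [A]; omega)
        · simp only [RAMState.setReg_reg, uv_ne_sc, if_false, if_true, k7]
          exact Nat.size_le_of_le (by simp only [A, RAMOp.eval]; omega)
        · simp [k4]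
          exact Nat.size_le_of_le (by simp only [A]; omega)
        · simp
          simp only [A]; omega
        · simp [k4, RAMOp.eval]
          exact Nat.size_le_of_le (by simp only [A]; omega)
        · simp [k5, k2', RAMOp.eval, Finset.sum_range_succ]
        · simp [k6]
        · simp [k7, RAMOp.eval]
        · simp [k3.2, hu4]
        · intro ρ hρ1 hρ2
          simp only [RAMState.setReg_reg, hρ1, hρ2 _ (show d ≤ d + 1 by omega),
            hρ2 _ (show d ≤ d + 3 by omega), hρ2 _ le_rfl, if_false]
          rw [k3.1 ρ fun y hy => hρ2 y (by omega), hu5 ρ hρ1 hρ2]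
        · simp [k4, RAMOp.eval]; omega)
    have hs1v : s₁.reg (uv K x) = v x := (h3.uv_eq x).trans (hv x)
    obtain ⟨s₂, l1, ⟨l2, l3, l4, l5, l6⟩, l7⟩ := hloop
      ((((s₁.setReg (sc K (d + 1)) 0).setReg (sc K (d + 2)) (v x)).setReg (uv K x) 0))
      ⟨by simp, by simp, by simp, by simp [h3.2], fun ρ hρ1 hρ2 => by
        simp only [RAMState.setReg_reg, hρ1, hρ2 _ (show d ≤ d + 1 by omega),
          hρ2 _ (show d ≤ d + 2 by omega), if_false]
        exact h3.1 ρ hρ2⟩ (by simp [h2])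
    have hGN := hG N le_rfl
    refine ⟨_, h1.seq (.seq (.const (A := A V) ?_) (.seq (s' := (s₁.setReg (sc K (d + 1)) 0).setReg
      (sc K (d + 2)) (v x)) ?_ (.seq (.const (A := A V) ?_) (.seq (l1.mono ?_)
      (.seq (.const (A := A V) ?_) (.seq (.arith ?_ ?_ ?_) (.arith ?_ ?_ ?_))))))), ?_, ?_, ?_⟩
    · simp
    · convert RunsLE.arith (s := s₁.setReg (sc K (d + 1)) 0) (op := .add) (x := sc K (d + 2))
        (y := uv K x) (z := sc K (d + 1)) (A := A V) ?_ ?_ ?_ using 2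
      · simp [RAMOp.eval, hs1v]
      · simp [hs1v]
        exact Nat.size_le_of_le (by simp only [A]; omega)
      · simp
      · simp [RAMOp.eval, hs1v]
        exact Nat.size_le_of_le (by simp only [A]; omega)
    · simp
    · exact Nat.mul_le_mul_right _ (by omega)
    · simp
    · simp [l3]
      exact Nat.size_le_of_le (by simp only [A]; omega)
    · simp
    · simp [l3, RAMOp.eval]
      exact Nat.size_le_of_le (by simp only [A]; omega)
    · simp [l2]
      exact Nat.size_le_of_le (by simp only [A]; omega)
    · simp
    · simp [l2, RAMOp.eval]
      exact Nat.size_le_of_le (by simp only [A]; omega)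
    · simp [RAMOp.eval, eval, l2, g, hN]
    · intro ρ hρ
      by_cases hρx : ρ = uv K x
      · subst hρx
        simp [RAMOp.eval, l3, hv]
      · simp only [RAMState.setReg_reg, hρx, hρ _ (show d ≤ d + 3 by omega), hρ _ le_rfl, if_false]
        exact l6 ρ hρx hρ
    · simp [l5]
  | pow b e m ihb ihe ihm =>
    intro d
    obtain ⟨T₁, hT₁, h₁⟩ := ihe d
    obtain ⟨T₂, hT₂, h₂⟩ := ihb (d + 1)
    obtain ⟨T₃, hT₃, h₃⟩ := ihm (d + 2)
    obtain ⟨W₁, hW₁, hw₁⟩ := e.eval_bd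
    obtain ⟨W₂, hW₂, hw₂⟩ := b.eval_bd
    obtain ⟨W₃, hW₃, hw₃⟩ := m.eval_bd
    let A : ℕ → ℕ := fun V => 1 + W₁ V + W₂ V + W₃ V + (W₃ V + 1) * W₂ V
    have hA : PolyBd A := ((((PolyBd.const 1).add hW₁).add hW₂).add hW₃).add
      ((hW₃.add (.const 1)).mul hW₂)
    have hI : PolyBd fun V => 1 + 3 * A V := (PolyBd.const 1).add ((PolyBd.const 3).mul hA)
    refine ⟨fun V => T₁ V + (T₂ V + (T₃ V + ((1 + 3 * A V) + ((1 + 3 * A V) +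
      ((W₁ V + 1) * (((1 + 3 * A V) + ((1 + 3 * A V) + ((1 + 3 * A V) + ((1 + 3 * A V) +
        ((1 + 3 * A V) + (1 + 3 * A V)))))) + A V + 1) + ((1 + 3 * A V) + (1 + 3 * A V))))))),
      hT₁.add (hT₂.add (hT₃.add (hI.add (hI.add (((hW₁.add (.const 1)).mul
        (((hI.add (hI.add (hI.add (hI.add (hI.add hI))))).add hA).add (.const 1))).add
        (hI.add hI)))))), fun V s v r hV hE hv hr => ?_⟩
    obtain ⟨s₁, a1, a2, a3⟩ := h₁ V s v r hV hE hv hr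
    obtain ⟨s₂, b1, b2, b3⟩ := h₂ V s₁ v r hV hE (fun x => (a3.uv_eq x).trans (hv x))
      (fun a => by rw [a3.2]; exact hr a)
    obtain ⟨s₃, c1, c2, c3⟩ := h₃ V s₂ v r hV hE
      (fun x => ((b3.uv_eq x).trans (a3.uv_eq x)).trans (hv x))
      (fun a => by rw [b3.2, a3.2]; exact hr a)
    have e1 := hw₁ V v r hV hE
    have e2 := hw₂ V v r hV hE
    have e3 := hw₃ V v r hV hE
    set N := e.eval v r with hN
    set Q := b.eval v r with hQ
    set P := m.eval v r with hP
    have f1 : s₃.reg (sc K d) = N := by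
      rw [c3.sc_eq (by omega), b3.sc_eq (by omega), a2]
    have f2 : s₃.reg (sc K (d + 1)) = Q := by
      rw [c3.sc_eq (by omega), b2]
    have hsame : SameBut K d s s₃ := a3.trans ((b3.mono (by omega)).trans (c3.mono (by omega)))
    let y : ℕ → ℕ := fun j => (fun y => y * Q % (P + 1))^[j] 1
    have hy : ∀ j, y j ≤ P + 1 := powMod_le Q P
    have hyQ : ∀ j, y j * Q ≤ (W₃ V + 1) * W₂ V := fun j =>
      Nat.mul_le_mul ((hy j).trans (by omega)) e2
    have hyS : ∀ j, y (j + 1) = y j * Q % (P + 1) := fun j => Function.iterate_succ_apply' _ _ _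
    let I : ℕ → RAMState → Prop := fun j u =>
      u.reg (sc K (d + 3)) = y j ∧ u.reg (sc K (d + 1)) = Q ∧ u.reg (sc K (d + 2)) = P + 1 ∧
      SameBut K d s u
    have hloop := RunsLE.loop (x := sc K d) (body :=
      .seq (.arith .mul (sc K (d + 3)) (sc K (d + 3)) (sc K (d + 1))) <|
      .seq (.arith .div (sc K (d + 4)) (sc K (d + 3)) (sc K (d + 2))) <|
      .seq (.arith .mul (sc K (d + 4)) (sc K (d + 4)) (sc K (d + 2))) <|
      .seq (.arith .sub (sc K (d + 3)) (sc K (d + 3)) (sc K (d + 4))) <|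
      .seq (.const (sc K (d + 4)) 1) <|
      .arith .sub (sc K d) (sc K d) (sc K (d + 4))) (n := N) (A := A V)
      (B := (1 + 3 * A V) + ((1 + 3 * A V) + ((1 + 3 * A V) + ((1 + 3 * A V) +
        ((1 + 3 * A V) + (1 + 3 * A V))))))
      I (Nat.size_le_of_le (by simp only [A]; omega)) (by
        intro j u hj ⟨hu1, hu2, hu3, hu4⟩ hu
        have k1 := hy j
        have k2 := hyQ j
        have k3 : y j * Q / (P + 1) ≤ y j * Q := Nat.div_le_self _ _
        have k4 : y j * Q / (P + 1) * (P + 1) ≤ y j * Q := Nat.div_mul_le_self _ _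
        refine ⟨_, .seq (.arith ?_ ?_ ?_) (.seq (.arith ?_ ?_ ?_) (.seq (.arith ?_ ?_ ?_)
          (.seq (.arith ?_ ?_ ?_) (.seq (.const (A := A V) ?_) (.arith ?_ ?_ ?_))))), ⟨?_, ?_, ?_, ?_⟩, ?_⟩
        all_goals try (simp [RAMOp.eval, hu1, hu2, hu3, hu]; done)
        · simp [hu1]; exact Nat.size_le_of_le (by simp only [A]; omega)
        · simp [hu2]; exact Nat.size_le_of_le (by simp only [A]; omega)
        · simp [RAMOp.eval, hu1, hu2]; exact Nat.size_le_of_le (by simp only [A]; omega)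
        · simp [RAMOp.eval, hu1, hu2]; exact Nat.size_le_of_le (by simp only [A]; omega)
        · simp [RAMOp.eval, hu3]; exact Nat.size_le_of_le (by simp only [A]; omega)
        · simp [RAMOp.eval, hu1, hu2, hu3]; exact Nat.size_le_of_le (by simp only [A]; omega)
        · simp [RAMOp.eval, hu1, hu2, hu3]; exact Nat.size_le_of_le (by simp only [A]; omega)
        · simp [RAMOp.eval, hu3]; exact Nat.size_le_of_le (by simp only [A]; omega)
        · simp [RAMOp.eval, hu1, hu2, hu3]; exact Nat.size_le_of_le (by simp only [A]; omega)
        · simp [RAMOp.eval, hu1, hu2]; exact Nat.size_le_of_le (by simp only [A]; omega)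
        · simp [RAMOp.eval, hu1, hu2, hu3]; exact Nat.size_le_of_le (by simp only [A]; omega)
        · simp [RAMOp.eval, hu1, hu2, hu3]; exact Nat.size_le_of_le (by simp only [A]; omega)
        · exact Nat.size_le_of_le (by simp only [A]; omega)
        · simp [RAMOp.eval, hu]; exact Nat.size_le_of_le (by simp only [A]; omega)
        · simp; simp only [A]; omega
        · simp [RAMOp.eval, hu]; exact Nat.size_le_of_le (by simp only [A]; omega)
        · simp [RAMOp.eval, hu1, hu2, hu3, hyS, sub_mul_div_eq_mod]
        · exact hu4.trans <| (SameBut.setReg (by omega)).trans <|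
            (SameBut.setReg (by omega)).trans <| (SameBut.setReg (by omega)).trans <|
            (SameBut.setReg (by omega)).trans <| (SameBut.setReg (by omega)).trans
            (SameBut.setReg (by omega))
        · simp [RAMOp.eval, hu]; omega)
    obtain ⟨s₄, l1, ⟨l2, l3, l4, l5⟩, l7⟩ := hloop
      ((s₃.setReg (sc K (d + 3)) 1).setReg (sc K (d + 2)) (P + 1))
      ⟨by simp [y], by simp [f2], by simp,
        hsame.trans <| (SameBut.setReg (by omega)).trans (SameBut.setReg (by omega))⟩
      (by simp [f1])
    have k1 := hy N
    have hmul : 0 ≤ (W₃ V + 1) * W₂ V := Nat.zero_le _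
    refine ⟨_, a1.seq (b1.seq (c1.seq (.seq (.const (A := A V) ?_) (.seq (s' := (s₃.setReg
      (sc K (d + 3)) 1).setReg (sc K (d + 2)) (P + 1)) ?_ (.seq (l1.mono ?_)
      (.seq (.const (A := A V) ?_) (.arith ?_ ?_ ?_))))))), ?_,
      l5.trans ((SameBut.setReg (by omega)).trans (.setReg le_rfl))⟩
    · exact Nat.size_le_of_le (by simp only [A]; omega)
    · convert RunsLE.arith (s := s₃.setReg (sc K (d + 3)) 1) (op := .add) (x := sc K (d + 2))
        (y := sc K (d + 2)) (z := sc K (d + 3)) (A := A V) ?_ ?_ ?_ using 2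
      · simp [RAMOp.eval, c2]
      · simp [c2]
        exact Nat.size_le_of_le (by simp only [A]; omega)
      · simp
        simp only [A]; omega
      · simp [RAMOp.eval, c2]
        exact Nat.size_le_of_le (by simp only [A]; omega)
    · exact Nat.mul_le_mul_right _ (by omega)
    · simp
    · simp [l2]
      exact Nat.size_le_of_le (by simp only [A]; omega)
    · simp
    · simp [l2, RAMOp.eval]
      exact Nat.size_le_of_le (by simp only [A]; omega)
    · simp [RAMOp.eval, eval, l2, y, hN, hQ, hP]

/-! ### Programs acting on an abstract memory -/

/-- The memory as seen by a program that uses an unknown program as a subroutine: variables `v`,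
big numbers `b`, arrays `a`, and the registers `o` and arrays `oa` of the subroutine. -/
@[ext] structure Mem where
  v : ℕ → ℕ
  b : ℕ → ℕ
  a : ℕ → ℕ → ℕ
  o : ℕ → ℕ
  oa : ℕ → ℕ → ℕ

namespace Mem

def setV (μ : Mem) (x c : ℕ) : Mem := { μ with v := Function.update μ.v x c }
def setB (μ : Mem) (x c : ℕ) : Mem := { μ with b := Function.update μ.b x c }
def setA (μ : Mem) (x : ℕ) (f : ℕ → ℕ) : Mem := { μ with a := Function.update μ.a x f }
def setO (μ : Mem) (x c : ℕ) : Mem := { μ with o := Function.update μ.o x c }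
def setOA (μ : Mem) (f : ℕ → ℕ) : Mem := { μ with oa := Function.update μ.oa 0 f }

variable (μ : Mem) (x c : ℕ) (f : ℕ → ℕ)
@[simp] theorem setV_v : (μ.setV x c).v = Function.update μ.v x c := rfl
@[simp] theorem setV_b : (μ.setV x c).b = μ.b := rfl
@[simp] theorem setV_a : (μ.setV x c).a = μ.a := rfl
@[simp] theorem setV_o : (μ.setV x c).o = μ.o := rfl
@[simp] theorem setV_oa : (μ.setV x c).oa = μ.oa := rfl
@[simp] theorem setB_v : (μ.setB x c).v = μ.v := rfl
@[simp] theorem setB_b : (μ.setB x c).b = Function.update μ.b x c := rfl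
@[simp] theorem setB_a : (μ.setB x c).a = μ.a := rfl
@[simp] theorem setB_o : (μ.setB x c).o = μ.o := rfl
@[simp] theorem setB_oa : (μ.setB x c).oa = μ.oa := rfl
@[simp] theorem setA_v : (μ.setA x f).v = μ.v := rfl
@[simp] theorem setA_b : (μ.setA x f).b = μ.b := rfl
@[simp] theorem setA_a : (μ.setA x f).a = Function.update μ.a x f := rfl
@[simp] theorem setA_o : (μ.setA x f).o = μ.o := rfl
@[simp] theorem setA_oa : (μ.setA x f).oa = μ.oa := rfl
@[simp] theorem setO_v : (μ.setO x c).v = μ.v := rfl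
@[simp] theorem setO_b : (μ.setO x c).b = μ.b := rfl
@[simp] theorem setO_a : (μ.setO x c).a = μ.a := rfl
@[simp] theorem setO_o : (μ.setO x c).o = Function.update μ.o x c := rfl
@[simp] theorem setO_oa : (μ.setO x c).oa = μ.oa := rfl
@[simp] theorem setOA_v : (μ.setOA f).v = μ.v := rfl
@[simp] theorem setOA_b : (μ.setOA f).b = μ.b := rfl
@[simp] theorem setOA_a : (μ.setOA f).a = μ.a := rfl
@[simp] theorem setOA_o : (μ.setOA f).o = μ.o := rfl
@[simp] theorem setOA_oa : (μ.setOA f).oa = Function.update μ.oa 0 f := rfl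

end Mem

/-- The state `s` of the machine represents the memory `μ`. -/
structure Shows (K : ℕ) (s : RAMState) (μ : Mem) : Prop where
  v : ∀ x, s.reg (uv K x) = μ.v x
  b : ∀ x, s.reg (bg K x) = μ.b x
  a : ∀ i, s.arr (K + i) = μ.a i
  o : ∀ x < K, s.reg x = μ.o x
  oa : ∀ i < K, s.arr i = μ.oa i

theorem Shows.sameBut {K d : ℕ} {s s' : RAMState} {μ : Mem} (h : Shows K s μ) (h' : SameBut K d s s') :
    Shows K s' μ :=
  ⟨fun x => (h'.uv_eq x).trans (h.v x), fun x => (h'.bg_eq x).trans (h.b x),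
    fun i => by rw [h'.2, h.a], fun x hx => (h'.1 x fun y _ => ne_sc_of_lt hx).trans (h.o x hx),
    fun i hi => by rw [h'.2, h.oa i hi]⟩

namespace Shows
variable {K : ℕ} {s : RAMState} {μ : Mem} {c i : ℕ}

theorem setSc (h : Shows K s μ) (d : ℕ) : Shows K (s.setReg (sc K d) c) μ :=
  h.sameBut (SameBut.setReg (Nat.zero_le d))

theorem setUv (h : Shows K s μ) (x : ℕ) : Shows K (s.setReg (uv K x) c) (μ.setV x c) :=
  ⟨fun y => by simp [h.v, Function.update_apply], fun y => by simp [h.b], fun i => by simp [h.a],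
    fun y hy => by simp [h.o y hy, ne_uv_of_lt hy], fun i hi => by simp [h.oa i hi]⟩

theorem setBg (h : Shows K s μ) (x : ℕ) : Shows K (s.setReg (bg K x) c) (μ.setB x c) :=
  ⟨fun y => by simp [h.v], fun y => by simp [h.b, Function.update_apply], fun i => by simp [h.a],
    fun y hy => by simp [h.o y hy, ne_bg_of_lt hy], fun i hi => by simp [h.oa i hi]⟩

theorem setOr (h : Shows K s μ) {x : ℕ} (hx : x < K) : Shows K (s.setReg x c) (μ.setO x c) :=
  ⟨fun y => by simp [h.v, (ne_uv_of_lt hx).symm], fun y => by simp [h.b, (ne_bg_of_lt hx).symm],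
    fun i => by simp [h.a], fun y hy => by simp [h.o y hy, Function.update_apply],
    fun i hi => by simp [h.oa i hi]⟩

theorem setArr (h : Shows K s μ) (x : ℕ) :
    Shows K (s.setArr (K + x) i c) (μ.setA x (Function.update (μ.a x) i c)) :=
  ⟨fun y => by simp [h.v], fun y => by simp [h.b], fun y => by
      funext j
      by_cases hy : y = x
      · subst hy; simp [RAMState.setArr_arr, h.a, Function.update_apply]
      · simp [RAMState.setArr_arr, h.a, hy], fun y hy => by simp [h.o y hy],
    fun y hy => by
      funext j
      simp [RAMState.setArr_arr, h.oa y hy, show y ≠ K + x by omega]⟩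

theorem setOArr (h : Shows K s μ) (hK : 0 < K) :
    Shows K (s.setArr 0 i c) (μ.setOA (Function.update (μ.oa 0) i c)) :=
  ⟨fun y => by simp [h.v], fun y => by simp [h.b], fun y => by
      funext j
      simp [RAMState.setArr_arr, h.a]; omega, fun y hy => by simp [h.o y hy],
    fun y hy => by
      funext j
      by_cases hy0 : y = 0
      · subst hy0; simp [RAMState.setArr_arr, h.oa 0 hK, Function.update_apply]
      · simp [RAMState.setArr_arr, h.oa y hy, hy0]⟩

end Shows

/-- On the memory `μ` the program `p` produces the memory `μ'`, in time at most `t`. -/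
def Does (K : ℕ) (p : RAMProg) (μ : Mem) (t : ℕ) (μ' : Mem) : Prop :=
  ∀ s, Shows K s μ → ∃ s', RunsLE p s t s' ∧ Shows K s' μ'

namespace Does
variable {K : ℕ} {p q : RAMProg} {μ μ' μ'' : Mem} {t t' : ℕ}

theorem mono (h : Does K p μ t μ') (ht : t ≤ t') : Does K p μ t' μ' := fun s hs => by
  obtain ⟨s', h1, h2⟩ := h s hs
  exact ⟨s', h1.mono ht, h2⟩

theorem seq (h : Does K p μ t μ') (h' : Does K q μ' t' μ'') :
    Does K (.seq p q) μ (t + t') μ'' := fun s hs => by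
  obtain ⟨s', h1, h2⟩ := h s hs
  obtain ⟨s'', h3, h4⟩ := h' s' h2
  exact ⟨s'', h1.seq h3, h4⟩

end Does

/-- The variables, arrays, and the binary lengths of the big numbers are at most `V`. -/
def MemBd (V : ℕ) (μ : Mem) : Prop := EnvBd V μ.v μ.a ∧ ∀ z, (μ.b z).size ≤ V

theorem EnvBd.mono {V W : ℕ} {v r} (h : EnvBd V v r) (hW : V ≤ W) : EnvBd W v r :=
  ⟨fun x => (h.1 x).trans hW, fun a i => (h.2 a i).trans hW⟩

theorem MemBd.mono {V W : ℕ} {μ} (h : MemBd V μ) (hW : V ≤ W) : MemBd W μ :=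
  ⟨h.1.mono hW, fun z => (h.2 z).trans hW⟩

theorem MemBd.setV {V c : ℕ} {μ : Mem} (h : MemBd V μ) (x : ℕ) (hc : c ≤ V) :
    MemBd V (μ.setV x c) :=
  ⟨⟨fun y => by simp only [Mem.setV_v, Function.update_apply]; split_ifs; exacts [hc, h.1.1 y],
    h.1.2⟩, h.2⟩

theorem MemBd.setB {V c : ℕ} {μ : Mem} (h : MemBd V μ) (x : ℕ) (hc : c.size ≤ V) :
    MemBd V (μ.setB x c) :=
  ⟨h.1, fun y => by simp only [Mem.setB_b, Function.update_apply]; split_ifs; exacts [hc, h.2 y]⟩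

theorem MemBd.setA {V : ℕ} {f : ℕ → ℕ} {μ : Mem} (h : MemBd V μ) (x : ℕ) (hc : ∀ i, f i ≤ V) :
    MemBd V (μ.setA x f) :=
  ⟨⟨h.1.1, fun y i => by
    simp only [Mem.setA_a, Function.update_apply]; split_ifs; exacts [hc i, h.1.2 y i]⟩, h.2⟩

/-- The value of an expression in the memory `μ`. -/
def Ex.val (e : Ex) (μ : Mem) : ℕ := e.eval μ.v μ.a

/-- The program `p` acts as `f`, in polynomial time. -/
def Acts (K : ℕ) (p : RAMProg) (f : Mem → Mem) : Prop :=
  ∃ T, PolyBd T ∧ ∀ V μ, 2 ≤ V → MemBd V μ → Does K p μ (T V) (f μ)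

/-- The operation `f` on memories increases bounds polynomially. -/
def Tame (f : Mem → Mem) : Prop :=
  ∃ W, PolyBd W ∧ ∀ V μ, 2 ≤ V → MemBd V μ → MemBd (W V) (f μ)

/-- Computes two expressions, then does something. -/
theorem Shows.comp_run {K : ℕ} (e : Ex) (d : ℕ) : ∃ T, PolyBd T ∧ ∀ V s μ, 2 ≤ V → MemBd V μ →
    Shows K s μ → ∃ s', RunsLE (e.comp K d) s (T V) s' ∧ s'.reg (sc K d) = e.val μ ∧
      SameBut K d s s' ∧ Shows K s' μ ∧ e.val μ ≤ T V := by
  obtain ⟨T, hT, h⟩ := e.comp_computes K d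
  obtain ⟨W, hW, h'⟩ := e.eval_bd
  refine ⟨_, hT.add hW, fun V s μ hV hB hs => ?_⟩
  obtain ⟨s', h1, h2, h3⟩ := h V s μ.v μ.a hV hB.1 hs.v hs.a
  exact ⟨s', h1.mono (Nat.le_add_right _ _), h2, h3, hs.sameBut h3,
    (h' V _ _ hV hB.1).trans (Nat.le_add_left _ _)⟩

/-! ### Instructions on the abstract memory -/

section Instructions
variable (K : ℕ)

/-- `v x := e` -/
def iAsg (x : ℕ) (e : Ex) : RAMProg :=
  .seq (e.comp K 0) (.seq (.const (sc K 1) 0) (.arith .add (uv K x) (sc K 0) (sc K 1)))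

theorem iAsg_acts (x : ℕ) (e : Ex) : Acts K (iAsg K x e) fun μ => μ.setV x (e.val μ) := by
  obtain ⟨T, hT, h⟩ := Shows.comp_run (K := K) e 0
  have hI := (PolyBd.const 1).add ((PolyBd.const 3).mul hT)
  refine ⟨_, hT.add (hI.add hI), fun V μ hV hB s hs => ?_⟩
  obtain ⟨s₁, h1, h2, -, h4, h5⟩ := h V s μ hV hB hs
  refine ⟨_, h1.seq (.seq (.const (by simp)) (.arith ?_ ?_ ?_)), ?_⟩
  · simpa [h2] using Nat.size_le_of_le h5
  · simp
  · simpa [h2, RAMOp.eval] using Nat.size_le_of_le h5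
  · simpa [h2, RAMOp.eval] using (h4.setSc (c := 0) 1).setUv (c := e.val μ) x

/-- `a x [i] := e` -/
def iSto (x : ℕ) (i e : Ex) : RAMProg :=
  .seq (i.comp K 0) (.seq (e.comp K 1) (.store (K + x) (sc K 0) (sc K 1)))

theorem iSto_acts (x : ℕ) (i e : Ex) : Acts K (iSto K x i e) fun μ =>
    μ.setA x (Function.update (μ.a x) (i.val μ) (e.val μ)) := by
  obtain ⟨T, hT, h⟩ := Shows.comp_run (K := K) i 0
  obtain ⟨T', hT', h'⟩ := Shows.comp_run (K := K) e 1
  refine ⟨_, hT.add (hT'.add ((PolyBd.const 1).add ((PolyBd.const 3).mul (hT.add hT')))),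
    fun V μ hV hB s hs => ?_⟩
  obtain ⟨s₁, h1, h2, h3, h4, h5⟩ := h V s μ hV hB hs
  obtain ⟨s₂, k1, k2, k3, k4, k5⟩ := h' V s₁ μ hV hB h4
  have h6 : s₂.reg (sc K 0) = i.val μ := (k3.sc_eq (by omega)).trans h2
  refine ⟨_, h1.seq (.seq k1 (.store ?_ ?_)), ?_⟩
  · rw [h6]; exact Nat.size_le_of_le (by omega)
  · rw [k2]; exact Nat.size_le_of_le (by omega)
  · rw [h6, k2]; exact k4.setArr x

/-- `b z := e` -/
def iBset (z : ℕ) (e : Ex) : RAMProg :=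
  .seq (e.comp K 0) (.seq (.const (sc K 1) 0) (.arith .add (bg K z) (sc K 0) (sc K 1)))

theorem iBset_acts (z : ℕ) (e : Ex) : Acts K (iBset K z e) fun μ => μ.setB z (e.val μ) := by
  obtain ⟨T, hT, h⟩ := Shows.comp_run (K := K) e 0
  have hI := (PolyBd.const 1).add ((PolyBd.const 3).mul hT)
  refine ⟨_, hT.add (hI.add hI), fun V μ hV hB s hs => ?_⟩
  obtain ⟨s₁, h1, h2, -, h4, h5⟩ := h V s μ hV hB hs
  refine ⟨_, h1.seq (.seq (.const (by simp)) (.arith ?_ ?_ ?_)), ?_⟩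
  · simpa [h2] using Nat.size_le_of_le h5
  · simp
  · simpa [h2, RAMOp.eval] using Nat.size_le_of_le h5
  · simpa [h2, RAMOp.eval] using (h4.setSc (c := 0) 1).setBg (c := e.val μ) z

theorem Nat.size_mul_le (x y : ℕ) : (x * y).size ≤ x.size + y.size := by
  rw [Nat.size_le, pow_add]
  exact Nat.mul_lt_mul'' (Nat.lt_size_self x) (Nat.lt_size_self y)

theorem Nat.size_add_le (x y : ℕ) : (x + y).size ≤ x.size + y.size + 1 := by
  rw [Nat.size_le]
  have h1 := Nat.lt_size_self x
  have h2 := Nat.lt_size_self y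
  have h3 : 2 ^ x.size ≤ 2 ^ (x.size + y.size) := Nat.pow_le_pow_right (by omega) (by omega)
  have h4 : 2 ^ y.size ≤ 2 ^ (x.size + y.size) := Nat.pow_le_pow_right (by omega) (by omega)
  rw [pow_succ]
  omega

theorem RAMOp.size_eval_le (op : RAMOp) (x y : ℕ) : (op.eval x y).size ≤ x.size + y.size + 1 := by
  cases op
  · exact Nat.size_add_le x y
  · exact (Nat.size_mono (Nat.sub_le x y)).trans (by omega)
  · exact (Nat.size_mul_le x y).trans (by omega)
  · exact (Nat.size_mono (Nat.div_le_self x y)).trans (by omega)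

/-- `b z := op (b z) e` -/
def iBop (op : RAMOp) (z : ℕ) (e : Ex) : RAMProg :=
  .seq (e.comp K 0) (.arith op (bg K z) (bg K z) (sc K 0))

theorem iBop_acts (op : RAMOp) (z : ℕ) (e : Ex) :
    Acts K (iBop K op z e) fun μ => μ.setB z (op.eval (μ.b z) (e.val μ)) := by
  obtain ⟨T, hT, h⟩ := Shows.comp_run (K := K) e 0
  refine ⟨_, hT.add ((PolyBd.const 1).add ((PolyBd.const 3).mul
    ((PolyBd.id.add hT).add (.const 1)))), fun V μ hV hB s hs => ?_⟩
  obtain ⟨s₁, h1, h2, -, h4, h5⟩ := h V s μ hV hB hs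
  have h6 := hB.2 z
  have h7 := Nat.size_le_of_le h5
  have h8 := op.size_eval_le (μ.b z) (e.val μ)
  refine ⟨_, h1.seq (.arith ?_ ?_ ?_), ?_⟩
  · rw [h4.b]; omega
  · rw [h2]; omega
  · rw [h4.b, h2]; omega
  · rw [h4.b, h2]; exact h4.setBg z

/-- `b z := op (b x) (b y)` -/
theorem iBopB_acts (op : RAMOp) (z x y : ℕ) :
    Acts K (.arith op (bg K z) (bg K x) (bg K y)) fun μ =>
      μ.setB z (op.eval (μ.b x) (μ.b y)) := by
  refine ⟨_, (PolyBd.const 1).add ((PolyBd.const 3).mul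
    ((PolyBd.id.add .id).add (.const 1))), fun V μ hV hB s hs => ?_⟩
  have h6 := hB.2 x
  have h7 := hB.2 y
  have h8 := op.size_eval_le (μ.b x) (μ.b y)
  refine ⟨_, .arith ?_ ?_ ?_, ?_⟩
  · rw [hs.b]; omega
  · rw [hs.b]; omega
  · rw [hs.b, hs.b]; omega
  · rw [hs.b, hs.b]; exact hs.setBg z

/-- `a x [i] := b z % e`, then `b z := b z / e` -/
def iBdig (x : ℕ) (i : Ex) (z : ℕ) (e : Ex) : RAMProg :=
  .seq (i.comp K 0) <| .seq (e.comp K 1) <| .seq (.arith .div (sc K 2) (bg K z) (sc K 1)) <|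
  .seq (.arith .mul (sc K 3) (sc K 2) (sc K 1)) <| .seq (.arith .sub (sc K 3) (bg K z) (sc K 3)) <|
  .seq (.store (K + x) (sc K 0) (sc K 3)) <| .seq (.const (sc K 4) 0) <|
  .arith .add (bg K z) (sc K 2) (sc K 4)

theorem iBdig_acts (x : ℕ) (i : Ex) (z : ℕ) (e : Ex) : Acts K (iBdig K x i z e) fun μ =>
    (μ.setA x (Function.update (μ.a x) (i.val μ) (μ.b z % e.val μ))).setB z
      (μ.b z / e.val μ) := by
  obtain ⟨T, hT, h⟩ := Shows.comp_run (K := K) i 0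
  obtain ⟨T', hT', h'⟩ := Shows.comp_run (K := K) e 1
  have hI := (PolyBd.const 1).add ((PolyBd.const 3).mul (hT.add (hT'.add .id)))
  refine ⟨_, hT.add (hT'.add (hI.add (hI.add (hI.add (hI.add (hI.add hI)))))),
    fun V μ hV hB s hs => ?_⟩
  obtain ⟨s₁, h1, h2, h3, h4, h5⟩ := h V s μ hV hB hs
  obtain ⟨s₂, k1, k2, k3, k4, k5⟩ := h' V s₁ μ hV hB h4
  have h6 : s₂.reg (sc K 0) = i.val μ := (k3.sc_eq (by omega)).trans h2
  have hz := hB.2 z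
  have e1 : (μ.b z / e.val μ).size ≤ V := (Nat.size_mono (Nat.div_le_self _ _)).trans hz
  have e2 : (μ.b z / e.val μ * e.val μ).size ≤ V :=
    (Nat.size_mono (Nat.div_mul_le_self _ _)).trans hz
  have e3 : (μ.b z % e.val μ).size ≤ V := (Nat.size_mono (Nat.mod_le _ _)).trans hz
  have e4 := Nat.size_le_of_le h5
  have e5 := Nat.size_le_of_le k5
  have hzz := k4.b z
  refine ⟨_, h1.seq (k1.seq (.seq (.arith ?_ ?_ ?_) (.seq (.arith ?_ ?_ ?_) (.seq
    (.arith ?_ ?_ ?_) (.seq (.store ?_ ?_) (.seq (.const ?_) (.arith ?_ ?_ ?_))))))), ?_⟩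
  any_goals simp [RAMOp.eval, hzz, k2, h6, sub_mul_div_eq_mod]; try omega
  exact (Shows.setSc (Shows.setArr (((k4.setSc 2).setSc 3).setSc 3) x) 4).setBg z

/-- The next entry of the input of the subroutine, at address `b z`, is `e`. -/
def iOut (z : ℕ) (e : Ex) : RAMProg :=
  .seq (e.comp K 0) <| .seq (.store 0 (bg K z) (sc K 0)) <| .seq (.const (sc K 0) 1) <|
  .arith .add (bg K z) (bg K z) (sc K 0)

theorem iOut_acts (hK : 0 < K) (z : ℕ) (e : Ex) : Acts K (iOut K z e) fun μ =>
    (μ.setOA (Function.update (μ.oa 0) (μ.b z) (e.val μ))).setB z (μ.b z + 1) := by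
  obtain ⟨T, hT, h⟩ := Shows.comp_run (K := K) e 0
  have hI := (PolyBd.const 1).add ((PolyBd.const 3).mul (hT.add (PolyBd.id.add (.const 2))))
  refine ⟨_, hT.add (hI.add (hI.add hI)), fun V μ hV hB s hs => ?_⟩
  obtain ⟨s₁, h1, h2, h3, h4, h5⟩ := h V s μ hV hB hs
  have hz := hB.2 z
  have e1 := Nat.size_add_le (μ.b z) 1
  have e4 := Nat.size_le_of_le h5
  have hzz := h4.b z
  rw [Nat.size_one] at e1
  refine ⟨_, h1.seq (.seq (.store ?_ ?_) (.seq (.const ?_) (.arith ?_ ?_ ?_))), ?_⟩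
  any_goals simp [RAMOp.eval, hzz, h2]; try omega
  exact (Shows.setSc (Shows.setOArr h4 hK) 0).setBg z

/-- The next entry of the input of the subroutine, at address `b z`, is `b y`. -/
def iOutB (z y : ℕ) : RAMProg :=
  .seq (.store 0 (bg K z) (bg K y)) <| .seq (.const (sc K 0) 1) <|
  .arith .add (bg K z) (bg K z) (sc K 0)

theorem iOutB_acts (hK : 0 < K) (z y : ℕ) : Acts K (iOutB K z y) fun μ =>
    (μ.setOA (Function.update (μ.oa 0) (μ.b z) (μ.b y))).setB z (μ.b z + 1) := by
  have hI := (PolyBd.const 1).add ((PolyBd.const 3).mul (PolyBd.id.add (.const 2)))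
  refine ⟨_, (hI.add (hI.add hI)), fun V μ hV hB s hs => ?_⟩
  have hz := hB.2 z
  have hy := hB.2 y
  have e1 := Nat.size_add_le (μ.b z) 1
  have hzz := hs.b z
  have hyy := hs.b y
  rw [Nat.size_one] at e1
  refine ⟨_, .seq (.store ?_ ?_) (.seq (.const ?_) (.arith ?_ ?_ ?_)), ?_⟩
  any_goals simp [RAMOp.eval, hzz, hyy]; try omega
  exact (Shows.setSc (Shows.setOArr hs hK) 0).setBg z

/-- `v x := b z` -/
def iMove (x z : ℕ) : RAMProg := .seq (.const (sc K 0) 0) (.arith .add (uv K x) (bg K z) (sc K 0))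

theorem iMove_acts (x z : ℕ) : Acts K (iMove K x z) fun μ => μ.setV x (μ.b z) := by
  have hI := (PolyBd.const 1).add ((PolyBd.const 3).mul .id)
  refine ⟨_, hI.add hI, fun V μ hV hB s hs => ?_⟩
  have hz := hB.2 z
  have hzz := hs.b z
  refine ⟨_, .seq (.const ?_) (.arith ?_ ?_ ?_), ?_⟩
  any_goals simp [RAMOp.eval, hzz]; try omega
  exact (Shows.setSc hs 0).setUv x

/-- `o x := b z` -/
def iToO (x z : ℕ) : RAMProg := .seq (.const (sc K 0) 0) (.arith .add x (bg K z) (sc K 0))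

theorem iToO_acts (x z : ℕ) (hx : x < K) : Acts K (iToO K x z) fun μ => μ.setO x (μ.b z) := by
  have hI := (PolyBd.const 1).add ((PolyBd.const 3).mul .id)
  refine ⟨_, hI.add hI, fun V μ hV hB s hs => ?_⟩
  have hz := hB.2 z
  have hzz := hs.b z
  refine ⟨_, .seq (.const ?_) (.arith ?_ ?_ ?_), ?_⟩
  any_goals simp [RAMOp.eval, hzz]; try omega
  exact (Shows.setSc hs 0).setOr hx

/-- `b z := o x` -/
def iOfO (z x : ℕ) : RAMProg := .seq (.const (sc K 0) 0) (.arith .add (bg K z) x (sc K 0))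

/-- `MemBd` says nothing about the registers of the subroutine, whose contents are not under
control. The bound on the register that is read is therefore a separate hypothesis, instead of a
statement of the form `Acts`. -/
theorem iOfO_does (z x : ℕ) (hx : x < K) (μ : Mem) {V : ℕ} (hV : (μ.o x).size ≤ V) :
    Does K (iOfO K z x) μ (2 * (1 + 3 * V)) (μ.setB z (μ.o x)) := by
  intro s hs
  have hxx := hs.o x hx
  have hne := ne_sc_of_lt (y := 0) hx
  refine ⟨_, RunsLE.mono (.seq (.const (A := V) ?_) (.arith (A := V) ?_ ?_ ?_)) (by omega), ?_⟩
  any_goals simp [RAMOp.eval, hxx, hne]; try omega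
  exact (Shows.setSc hs 0).setBg z

/-- Moves entry `v 0` of the input of the machine to the array `0`. -/
def iInp : RAMProg :=
  .seq (.load (sc K 0) 0 (uv K 0)) <| .seq (.store (K + 0) (uv K 0) (sc K 0)) <|
  -- The original entry is erased, because the subroutine must later find its own arrays as in an
  -- initial state.
  .seq (.const (sc K 0) 0) <| .store 0 (uv K 0) (sc K 0)

theorem iInp_does (hK : 0 < K) (μ : Mem) {V : ℕ} (h0 : μ.v 0 ≤ V) (h1 : μ.oa 0 (μ.v 0) ≤ V) :
    Does K (iInp K) μ (4 * (1 + 3 * V))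
      ((μ.setA 0 (Function.update (μ.a 0) (μ.v 0) (μ.oa 0 (μ.v 0)))).setOA
        (Function.update (μ.oa 0) (μ.v 0) 0)) := by
  intro s hs
  have e0 := Nat.size_le_of_le h0
  have e1 := Nat.size_le_of_le h1
  have hv := hs.v 0
  have ho := hs.oa 0 hK
  refine ⟨_, RunsLE.mono (.seq (.load (A := V) ?_ ?_) (.seq (.store (A := V) ?_ ?_)
    (.seq (.const (A := V) ?_) (.store (A := V) ?_ ?_)))) (by omega), ?_⟩
  any_goals simp [hv, ho]; try omega
  exact Shows.setOArr (Shows.setSc (Shows.setArr (hs.setSc 0) 0) 0) hK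

end Instructions

/-! ### Loops -/

/-- Repeats `p` as often as `b z` says; `b z` counts down to `0`. -/
def iRep (K z : ℕ) (p : RAMProg) : RAMProg :=
  .loop (bg K z) <| .seq p <| .seq (.const (sc K 0) 1) (.arith .sub (bg K z) (bg K z) (sc K 0))

/-- `M j` is the memory before round `j`, and `M' j` the memory after the body in that round but
before the counter is decreased; the body must leave the counter alone. -/
theorem iRep_does {K z : ℕ} {p : RAMProg} (M M' : ℕ → Mem) {n t : ℕ}
    (hb : ∀ j ≤ n, (M j).b z = n - j) (hp : ∀ j < n, Does K p (M j) t (M' j))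
    (hb' : ∀ j < n, (M' j).b z = n - j)
    (hM : ∀ j < n, M (j + 1) = (M' j).setB z (n - (j + 1))) :
    Does K (iRep K z p) (M 0) ((n + 1) * (t + 8 * (n.size + 1) + n.size + 1)) (M n) := by
  intro s hs
  obtain ⟨s', h1, h2, h3⟩ := RunsLE.loop (x := bg K z) (body := .seq p <|
    .seq (.const (sc K 0) 1) (.arith .sub (bg K z) (bg K z) (sc K 0))) (n := n)
    (B := t + 8 * (n.size + 1)) (A := n.size) (fun j s => Shows K s (M j)) le_rfl (by
      intro j s hj hr hs
      obtain ⟨s₁, h1, h2⟩ := hp j hj s hr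
      have h3 : s₁.reg (bg K z) = n - j := (h2.b z).trans (hb' j hj)
      have h4 : (n - j).size ≤ n.size := Nat.size_mono (by omega)
      have h5 : (n - j - 1).size ≤ n.size := Nat.size_mono (by omega)
      refine ⟨_, RunsLE.mono (h1.seq (.seq (.const (A := n.size + 1) ?_)
        (.arith (A := n.size + 1) ?_ ?_ ?_))) (by omega), ?_, ?_⟩
      · simp
      · simp [h3]; omega
      · simp
      · simp [h3, RAMOp.eval]; omega
      · rw [hM j hj]
        have := (h2.setSc (c := 1) 0).setBg (c := n - (j + 1)) z
        simpa [RAMOp.eval, h3, Nat.sub_sub] using this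
      · simp [RAMOp.eval, h3]; omega) s hs (by rw [hs.b, hb 0 (by omega)]; simp)
  exact ⟨s', h1, h2⟩

/-- Runs `p` with `v 0 = 0, …, n - 1`. -/
def iFor (K : ℕ) (n : Ex) (p : RAMProg) : RAMProg :=
  .seq (iBset K 0 n) <| .seq (iAsg K 0 (.const 0)) <|
  .seq (iRep K 0 (.seq p (iAsg K 0 (.bin .add (.var 0) (.const 1))))) (iAsg K 0 (.const 0))

theorem iFor_does (K : ℕ) (n : Ex) : ∃ T, PolyBd T ∧
    ∀ (p : RAMProg) (M M' : ℕ → Mem) (μ : Mem) (N V t : ℕ), 2 ≤ V → MemBd V μ → n.val μ = N →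
    M 0 = (μ.setB 0 N).setV 0 0 →
    (∀ j ≤ N, (M j).b 0 = N - j) → (∀ j < N, Does K p (M j) t (M' j)) →
    (∀ j < N, (M' j).b 0 = N - j) → (∀ j < N, (M' j).v 0 = j) → (∀ j < N, MemBd V (M' j)) →
    MemBd V (M N) →
    (∀ j < N, M (j + 1) = ((M' j).setV 0 (j + 1)).setB 0 (N - (j + 1))) →
    Does K (iFor K n p) μ (T V + (N + 1) * t) ((M N).setV 0 0) := by
  obtain ⟨T₁, hT₁, h₁⟩ := iBset_acts K 0 n
  obtain ⟨T₂, hT₂, h₂⟩ := iAsg_acts K 0 (.const 0)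
  obtain ⟨T₃, hT₃, h₃⟩ := iAsg_acts K 0 (.bin .add (.var 0) (.const 1))
  obtain ⟨W, hW, hw⟩ := n.eval_bd
  have hVW : ∀ V, 2 ≤ V → 2 ≤ V + W V := fun V hV => by omega
  have hT₂' := hT₂.comp (PolyBd.id.add hW) hVW
  refine ⟨fun V => T₁ V + (T₂ (V + W V) + ((W V + 1) * (T₃ V + 8 * (W V + 1) + W V + 1) +
    T₂ V)), hT₁.add (hT₂'.add (((hW.add (.const 1)).mul
      (((hT₃.add ((PolyBd.const 8).mul (hW.add (.const 1)))).add hW).add (.const 1))).add hT₂)),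
    fun p M M' μ N V t hV hB hN hM0 hb hp hb' hv hB' hBN hM => ?_⟩
  have hNW : N ≤ W V := by rw [← hN]; exact hw V _ _ hV hB.1
  have hsz : N.size ≤ W V := Nat.size_le_of_le hNW
  have s1 := h₁ V μ hV hB
  simp only [hN] at s1
  have s2 := h₂ (V + W V) (μ.setB 0 N) (hVW V hV)
    ((hB.mono (by omega)).setB 0 (by omega))
  change Does K _ _ _ ((μ.setB 0 N).setV 0 0) at s2
  rw [← hM0] at s2
  have s3 := iRep_does (K := K) (z := 0) (p := .seq p (iAsg K 0 (.bin .add (.var 0) (.const 1))))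
    (n := N) (t := t + T₃ V) M (fun j => (M' j).setV 0 (j + 1)) hb
    (fun j hj => by
      have := h₃ V (M' j) hV (hB' j hj)
      simp only [Ex.val, Ex.eval, RAMOp.eval, hv j hj] at this
      exact (hp j hj).seq this) (fun j hj => by simpa using hb' j hj) hM
  have s4 := h₂ V (M N) hV hBN
  refine (s1.seq (s2.seq (s3.seq s4))).mono ?_
  have : (N + 1) * (t + T₃ V + 8 * (N.size + 1) + N.size + 1) ≤
      (N + 1) * t + (W V + 1) * (T₃ V + 8 * (W V + 1) + W V + 1) := by
    calc _ = (N + 1) * t + (N + 1) * (T₃ V + 8 * (N.size + 1) + N.size + 1) := by ring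
      _ ≤ _ := by gcongr
  dsimp only
  omega

/-! ### Programs with a polynomial time meaning -/

/-- A program together with the polynomial time operation on memories that it performs. -/
structure Code (K : ℕ) where
  prog : RAMProg
  den : Mem → Mem
  acts : Acts K prog den
  tame : Tame den

namespace Code
variable {K : ℕ}

def seq (p q : Code K) : Code K where
  prog := .seq p.prog q.prog
  den μ := q.den (p.den μ)
  acts := by
    obtain ⟨T, hT, h⟩ := p.acts
    obtain ⟨T', hT', h'⟩ := q.acts
    obtain ⟨W, hW, hw⟩ := p.tame
    -- The second program starts from a memory bounded by `W V`; adding `2` brings this bound into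
    -- the range where polynomial bounds apply.
    exact ⟨_, hT.add (hT'.comp (hW.add (.const 2)) fun V _ => by omega), fun V μ hV hB =>
      (h V μ hV hB).seq (h' (W V + 2) _ (by omega) ((hw V μ hV hB).mono (by omega)))⟩
  tame := by
    obtain ⟨W, hW, h⟩ := p.tame
    obtain ⟨W', hW', h'⟩ := q.tame
    exact ⟨_, hW'.comp (hW.add (.const 2)) fun V _ => by omega, fun V μ hV hB =>
      h' _ _ (by omega) ((h V μ hV hB).mono (by omega))⟩

@[simp] theorem seq_den (p q : Code K) (μ : Mem) : (p.seq q).den μ = q.den (p.den μ) := rfl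

def asg (x : ℕ) (e : Ex) : Code K where
  prog := iAsg K x e
  den μ := μ.setV x (e.val μ)
  acts := iAsg_acts K x e
  tame := by
    obtain ⟨W, hW, h⟩ := e.eval_bd
    exact ⟨_, PolyBd.id.add hW, fun V μ hV hB => (hB.mono (by omega)).setV x
      ((h V _ _ hV hB.1).trans (by omega))⟩

@[simp] theorem asg_den (x : ℕ) (e : Ex) (μ : Mem) :
    (asg x e : Code K).den μ = μ.setV x (e.val μ) := rfl

def bset (z : ℕ) (e : Ex) : Code K where
  prog := iBset K z e
  den μ := μ.setB z (e.val μ)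
  acts := iBset_acts K z e
  tame := by
    obtain ⟨W, hW, h⟩ := e.eval_bd
    exact ⟨_, PolyBd.id.add hW, fun V μ hV hB => (hB.mono (by omega)).setB z
      (Nat.size_le_of_le ((h V _ _ hV hB.1).trans (by omega)))⟩

@[simp] theorem bset_den (z : ℕ) (e : Ex) (μ : Mem) :
    (bset z e : Code K).den μ = μ.setB z (e.val μ) := rfl

def bop (op : RAMOp) (z : ℕ) (e : Ex) : Code K where
  prog := iBop K op z e
  den μ := μ.setB z (op.eval (μ.b z) (e.val μ))
  acts := iBop_acts K op z e
  tame := by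
    obtain ⟨W, hW, h⟩ := e.eval_bd
    refine ⟨_, (PolyBd.id.add hW).add (.const 1), fun V μ hV hB => (hB.mono (by omega)).setB z ?_⟩
    have h1 := Nat.size_le_of_le (h V _ _ hV hB.1)
    have h2 := hB.2 z
    have h3 := op.size_eval_le (μ.b z) (e.val μ)
    change Nat.size (e.val μ) ≤ _ at h1
    omega

@[simp] theorem bop_den (op : RAMOp) (z : ℕ) (e : Ex) (μ : Mem) :
    (bop op z e : Code K).den μ = μ.setB z (op.eval (μ.b z) (e.val μ)) := rfl

def bopB (op : RAMOp) (z x y : ℕ) : Code K where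
  prog := .arith op (bg K z) (bg K x) (bg K y)
  den μ := μ.setB z (op.eval (μ.b x) (μ.b y))
  acts := iBopB_acts K op z x y
  tame := by
    refine ⟨_, (PolyBd.id.add .id).add (.const 1), fun V μ hV hB => (hB.mono (by omega)).setB z ?_⟩
    have h1 := hB.2 x
    have h2 := hB.2 y
    have h3 := op.size_eval_le (μ.b x) (μ.b y)
    omega

@[simp] theorem bopB_den (op : RAMOp) (z x y : ℕ) (μ : Mem) :
    (bopB op z x y : Code K).den μ = μ.setB z (op.eval (μ.b x) (μ.b y)) := rfl

def outB (hK : 0 < K) (z y : ℕ) : Code K where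
  prog := iOutB K z y
  den μ := (μ.setOA (Function.update (μ.oa 0) (μ.b z) (μ.b y))).setB z (μ.b z + 1)
  acts := iOutB_acts K hK z y
  tame := by
    refine ⟨_, PolyBd.id.add (.const 2), fun V μ hV hB => MemBd.setB (μ := μ.setOA _) ?_ z ?_⟩
    · exact hB.mono (by omega)
    · have h1 := hB.2 z
      have h3 := Nat.size_add_le (μ.b z) 1
      rw [Nat.size_one] at h3
      omega

@[simp] theorem outB_den (hK : 0 < K) (z y : ℕ) (μ : Mem) : (outB hK z y : Code K).den μ =
    (μ.setOA (Function.update (μ.oa 0) (μ.b z) (μ.b y))).setB z (μ.b z + 1) := rfl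

def toO (x z : ℕ) (hx : x < K) : Code K where
  prog := iToO K x z
  den μ := μ.setO x (μ.b z)
  acts := iToO_acts K x z hx
  tame := ⟨_, .id, fun _ _ _ hB => hB⟩

@[simp] theorem toO_den (x z : ℕ) (hx : x < K) (μ : Mem) :
    (toO x z hx : Code K).den μ = μ.setO x (μ.b z) := rfl

theorem update_ite_lt (f g : ℕ → ℕ) (j : ℕ) :
    Function.update (fun i => if i < j then f i else g i) j (f j) =
      fun i => if i < j + 1 then f i else g i := by
  funext i
  by_cases h : i = j
  · subst h; simp
  · rw [Function.update_of_ne h]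
    simp only [show i < j + 1 ↔ i < j by omega]

/-- Writes the table of the values of `e`, for the values of `v 0` below `n`, into an array. -/
def tab (x : ℕ) (n e : Ex) (hx : x ∉ e.arrays) : Code K where
  prog := iFor K n (iSto K x (.var 0) e)
  den μ := ((μ.setA x fun i => if i < n.val μ then e.eval (Function.update μ.v 0 i) μ.a
    else μ.a x i).setB 0 0).setV 0 0
  acts := by
    obtain ⟨T, hT, h⟩ := iFor_does K n
    obtain ⟨T', hT', h'⟩ := iSto_acts K x (.var 0) e
    obtain ⟨W, hW, hw⟩ := n.eval_bd
    obtain ⟨W', hW', hw'⟩ := e.eval_bd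
    let A : ℕ → ℕ := fun V => V + W V + W' (V + W V)
    have hVW : ∀ V, 2 ≤ V → 2 ≤ V + W V := fun V hV => by omega
    have hA : PolyBd A := (PolyBd.id.add hW).add (hW'.comp (PolyBd.id.add hW) hVW)
    have hA2 : ∀ V, 2 ≤ V → 2 ≤ A V := fun V hV => by simp only [A]; omega
    refine ⟨_, (hT.comp hA hA2).add ((hW.add (.const 1)).mul (hT'.comp hA hA2)),
      fun V μ hV hB => ?_⟩
    set N := n.val μ with hN
    have hNW : N ≤ W V := hw V _ _ hV hB.1
    let g : ℕ → ℕ := fun i => e.eval (Function.update μ.v 0 i) μ.a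
    have hg : ∀ i ≤ N, g i ≤ W' (V + W V) := fun i hi =>
      hw' _ _ _ (hVW V hV) (hB.1.update (by omega))
    let F : ℕ → ℕ → ℕ := fun j i => if i < j then g i else μ.a x i
    have hF : ∀ j ≤ N, ∀ i, F j i ≤ A V := fun j hj i => by
      simp only [F]
      split_ifs with hi
      · exact (hg i (by omega)).trans (by simp only [A]; omega)
      · exact (hB.1.2 x i).trans (by simp only [A]; omega)
    have hbd : ∀ i j, i ≤ N → j ≤ N →
        MemBd (A V) (((μ.setA x (F j)).setV 0 i).setB 0 (N - i)) := fun i j hi hj =>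
      (((hB.mono (by simp only [A]; omega)).setA x (hF j hj)).setV 0 (by simp only [A]; omega)).setB 0
        (Nat.size_le_of_le (by simp only [A]; omega))
    have := h (iSto K x (.var 0) e) (fun j => ((μ.setA x (F j)).setV 0 j).setB 0 (N - j))
      (fun j => ((μ.setA x (F (j + 1))).setV 0 j).setB 0 (N - j)) μ N (A V) (T' (A V))
      (hA2 V hV) (hB.mono (by simp only [A]; omega)) rfl
      (by ext y <;> simp [Mem.setA, Mem.setB, Mem.setV, F, hN])
      (fun j _ => by simp) (fun j hj => by
        have := h' (A V) _ (hA2 V hV) (hbd j j hj.le hj.le)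
        convert this using 1
        have e1 : e.eval (Function.update μ.v 0 j) (Function.update μ.a x (F j)) = g j :=
          e.eval_congr_arrays _ fun y hy => Function.update_of_ne (by rintro rfl; exact hx hy) _ _
        have e2 := update_ite_lt g (μ.a x) j
        ext y z <;> simp [Mem.setA, Mem.setB, Mem.setV, Ex.val, e1, Ex.eval]
        simp only [F, e2]) (fun j hj => by simp) (fun j hj => by simp)
      (fun j hj => hbd j (j + 1) hj.le hj)
      (hbd N N le_rfl le_rfl)
      (fun j hj => by simp [Mem.setA, Mem.setB, Mem.setV])
    have h3 : (N + 1) * T' (A V) ≤ (W V + 1) * T' (A V) := Nat.mul_le_mul_right _ (by omega)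
    refine Does.mono (t := T (A V) + (N + 1) * T' (A V)) ?_ (by omega)
    convert this using 1
    simp [Mem.setA, Mem.setB, Mem.setV, F, g, hN]
  tame := by
    obtain ⟨W, hW, hw⟩ := n.eval_bd
    obtain ⟨W', hW', hw'⟩ := e.eval_bd
    have hVW : ∀ V, 2 ≤ V → 2 ≤ V + W V := fun V hV => by omega
    refine ⟨_, PolyBd.id.add (hW'.comp (PolyBd.id.add hW) hVW), fun V μ hV hB =>
      (((hB.mono (Nat.le_add_right _ _)).setA x fun i => ?_).setB 0 (by simp)).setV 0 (by simp)⟩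
    have hNW : n.val μ ≤ W V := hw V _ _ hV hB.1
    split_ifs with hi
    · exact (hw' _ _ _ (hVW V hV) (hB.1.update (by omega))).trans (by omega)
    · exact (hB.1.2 x i).trans (by omega)

theorem tab_den (x : ℕ) (n e : Ex) (hx : x ∉ e.arrays) {μ : Mem} (hv : μ.v 0 = 0)
    (hb : μ.b 0 = 0) : (tab x n e hx : Code K).den μ = μ.setA x fun i =>
      if i < n.val μ then e.eval (Function.update μ.v 0 i) μ.a else μ.a x i := by
  ext y <;> simp [tab, Mem.setA, Mem.setB, Mem.setV, Function.update_apply] <;> rintro rfl <;>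
    simp [*]

/-- The value of an expression does not depend on arrays and on the variable `0`. -/
def _root_.Ex.Stable (e : Ex) : Prop :=
  ∀ v r r' i, e.eval (Function.update v 0 i) r = e.eval v r'

/-- Writes the `n` lowest digits of `b z` to the base `e + 1` into an array, and removes them. -/
def digs (x z : ℕ) (n e : Ex) (hz : z ≠ 0) (he : e.Stable) : Code K where
  prog := iFor K n (iBdig K x (.var 0) z (.bin .add e (.const 1)))
  den μ := (((μ.setA x fun i => if i < n.val μ then μ.b z / (e.val μ + 1) ^ i % (e.val μ + 1)
    else μ.a x i).setB z (μ.b z / (e.val μ + 1) ^ n.val μ)).setB 0 0).setV 0 0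
  acts := by
    obtain ⟨T, hT, h⟩ := iFor_does K n
    obtain ⟨T', hT', h'⟩ := iBdig_acts K x (.var 0) z (.bin .add e (.const 1))
    obtain ⟨W, hW, hw⟩ := n.eval_bd
    obtain ⟨W', hW', hw'⟩ := e.eval_bd
    let A : ℕ → ℕ := fun V => V + W V + W' V
    have hA : PolyBd A := (PolyBd.id.add hW).add hW'
    have hA2 : ∀ V, 2 ≤ V → 2 ≤ A V := fun V hV => by simp only [A]; omega
    refine ⟨_, (hT.comp hA hA2).add ((hW.add (.const 1)).mul (hT'.comp hA hA2)),
      fun V μ hV hB => ?_⟩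
    set N := n.val μ with hN
    have hNW : N ≤ W V := hw V _ _ hV hB.1
    set E := e.val μ with hE
    have hEW : E ≤ W' V := hw' V _ _ hV hB.1
    let F : ℕ → ℕ → ℕ := fun j i => if i < j then μ.b z / (E + 1) ^ i % (E + 1) else μ.a x i
    have hF : ∀ j ≤ N, ∀ i, F j i ≤ A V := fun j hj i => by
      simp only [F]
      split_ifs with hi
      · have := Nat.mod_lt (μ.b z / (E + 1) ^ i) (show E + 1 > 0 by omega)
        simp only [A]; omega
      · exact (hB.1.2 x i).trans (by simp only [A]; omega)
    have hbd : ∀ i j, i ≤ N → j ≤ N → MemBd (A V)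
        ((((μ.setA x (F j)).setV 0 i).setB z (μ.b z / (E + 1) ^ j)).setB 0 (N - i)) :=
      fun i j hi hj => ((((hB.mono (by simp only [A]; omega)).setA x (hF j hj)).setV 0
        (by simp only [A]; omega)).setB z ((Nat.size_mono (Nat.div_le_self _ _)).trans
        ((hB.2 z).trans (by simp only [A]; omega)))).setB 0
        (Nat.size_le_of_le (by simp only [A]; omega))
    have := h (iBdig K x (.var 0) z (.bin .add e (.const 1)))
      (fun j => (((μ.setA x (F j)).setV 0 j).setB z (μ.b z / (E + 1) ^ j)).setB 0 (N - j))
      (fun j => (((μ.setA x (F (j + 1))).setV 0 j).setB z (μ.b z / (E + 1) ^ (j + 1))).setB 0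
        (N - j)) μ N (A V) (T' (A V))
      (hA2 V hV) (hB.mono (by simp only [A]; omega)) rfl
      (by ext y <;> simp [Mem.setA, Mem.setB, Mem.setV, F, hN])
      (fun j _ => by simp) (fun j hj => by
        have := h' (A V) _ (hA2 V hV) (hbd j j hj.le hj.le)
        convert this using 1
        have e1 : e.eval (Function.update μ.v 0 j) (Function.update μ.a x (F j)) = E := he _ _ _ _
        have e2 := update_ite_lt (fun i => μ.b z / (E + 1) ^ i % (E + 1)) (μ.a x) j
        ext y w
        · rfl
        · by_cases hy : y = 0
          · subst hy; simp [hz.symm]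
          · by_cases hyz : y = z
            · subst hyz
              simp [hz, Ex.val, Ex.eval, RAMOp.eval, e1, Nat.div_div_eq_div_mul, pow_succ]
            · simp [hy, hyz]
        · simp [Ex.val, Ex.eval, RAMOp.eval, e1, Function.update_of_ne hz]
          simp only [F, e2]
        · rfl
        · rfl) (fun j hj => by simp) (fun j hj => by simp)
      (fun j hj => hbd j (j + 1) hj.le hj)
      (hbd N N le_rfl le_rfl)
      (fun j hj => by
        ext y <;> simp [Mem.setA, Mem.setB, Mem.setV])
    have h3 : (N + 1) * T' (A V) ≤ (W V + 1) * T' (A V) := Nat.mul_le_mul_right _ (by omega)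
    refine Does.mono (t := T (A V) + (N + 1) * T' (A V)) ?_ (by omega)
    convert this using 1
    simp [Mem.setA, Mem.setB, Mem.setV, F, hN, hE]
  tame := by
    obtain ⟨W', hW', hw'⟩ := e.eval_bd
    refine ⟨_, PolyBd.id.add hW', fun V μ hV hB =>
      ((((hB.mono (Nat.le_add_right _ _)).setA x fun i => ?_).setB z ?_).setB 0 (by simp)).setV 0
        (by simp)⟩
    · have hEW : e.val μ ≤ W' V := hw' V _ _ hV hB.1
      split_ifs with hi
      · have := Nat.mod_lt (μ.b z / (e.val μ + 1) ^ i) (show e.val μ + 1 > 0 by omega)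
        omega
      · exact (hB.1.2 x i).trans (by omega)
    · exact (Nat.size_mono (Nat.div_le_self _ _)).trans ((hB.2 z).trans (by omega))

theorem digs_den (x z : ℕ) (n e : Ex) (hz : z ≠ 0) (he : e.Stable) {μ : Mem} (hv : μ.v 0 = 0)
    (hb : μ.b 0 = 0) : (digs x z n e hz he : Code K).den μ = (μ.setA x fun i =>
      if i < n.val μ then μ.b z / (e.val μ + 1) ^ i % (e.val μ + 1) else μ.a x i).setB z
        (μ.b z / (e.val μ + 1) ^ n.val μ) := by
  ext y <;> simp [digs, Mem.setA, Mem.setB, Mem.setV, Function.update_apply]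
  · rintro rfl; simp [*]
  · rintro rfl; simp [*, hz.symm]

theorem _root_.Nat.size_mul_pow_le (x y n : ℕ) : (x * y ^ n).size ≤ x.size + n * y := by
  induction n with
  | zero => simp
  | succ n ih =>
    have h1 := Nat.size_mul_le (x * y ^ n) y
    have h2 := Nat.size_le_self y
    rw [pow_succ, ← mul_assoc, Nat.succ_mul]
    omega

/-- Multiplies `b z` by the `n`-th power of `e`. -/
def mulPow (z : ℕ) (n e : Ex) (hz : z ≠ 0) (he : e.Stable) : Code K where
  prog := iFor K n (iBop K .mul z e)
  den μ := ((μ.setB z (μ.b z * e.val μ ^ n.val μ)).setB 0 0).setV 0 0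
  acts := by
    obtain ⟨T, hT, h⟩ := iFor_does K n
    obtain ⟨T', hT', h'⟩ := iBop_acts K .mul z e
    obtain ⟨W, hW, hw⟩ := n.eval_bd
    obtain ⟨W', hW', hw'⟩ := e.eval_bd
    let A : ℕ → ℕ := fun V => V + W V + W V * W' V
    have hA : PolyBd A := (PolyBd.id.add hW).add (hW.mul hW')
    have hA2 : ∀ V, 2 ≤ V → 2 ≤ A V := fun V hV => by simp only [A]; omega
    refine ⟨_, (hT.comp hA hA2).add ((hW.add (.const 1)).mul (hT'.comp hA hA2)),
      fun V μ hV hB => ?_⟩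
    set N := n.val μ with hN
    have hNW : N ≤ W V := hw V _ _ hV hB.1
    set E := e.val μ with hE
    have hEW : E ≤ W' V := hw' V _ _ hV hB.1
    have hbd : ∀ i j, i ≤ N → j ≤ N → MemBd (A V)
        (((μ.setV 0 i).setB z (μ.b z * E ^ j)).setB 0 (N - i)) :=
      fun i j hi hj => (((hB.mono (by simp only [A]; omega)).setV 0
        (by simp only [A]; omega)).setB z (by
          have h1 := Nat.size_mul_pow_le (μ.b z) E j
          have h2 := hB.2 z
          have h3 := Nat.mul_le_mul (hj.trans hNW) hEW
          simp only [A]; omega)).setB 0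
        (Nat.size_le_of_le (by simp only [A]; omega))
    have := h (iBop K .mul z e)
      (fun j => ((μ.setV 0 j).setB z (μ.b z * E ^ j)).setB 0 (N - j))
      (fun j => ((μ.setV 0 j).setB z (μ.b z * E ^ (j + 1))).setB 0 (N - j)) μ N (A V) (T' (A V))
      (hA2 V hV) (hB.mono (by simp only [A]; omega)) rfl
      (by ext y <;> simp [Mem.setB, Mem.setV, hN])
      (fun j _ => by simp) (fun j hj => by
        have := h' (A V) _ (hA2 V hV) (hbd j j hj.le hj.le)
        convert this using 1
        have e1 : e.eval (Function.update μ.v 0 j) μ.a = E := he _ _ _ _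
        ext y w
        · rfl
        · by_cases hy : y = 0
          · subst hy; simp [hz.symm]
          · by_cases hyz : y = z
            · subst hyz
              simp [hz, Ex.val, RAMOp.eval, e1, pow_succ, mul_assoc]
            · simp [hy, hyz]
        · rfl
        · rfl
        · rfl) (fun j hj => by simp) (fun j hj => by simp)
      (fun j hj => hbd j (j + 1) hj.le hj)
      (hbd N N le_rfl le_rfl)
      (fun j hj => by
        ext y <;> simp [Mem.setB, Mem.setV])
    have h3 : (N + 1) * T' (A V) ≤ (W V + 1) * T' (A V) := Nat.mul_le_mul_right _ (by omega)
    refine Does.mono (t := T (A V) + (N + 1) * T' (A V)) ?_ (by omega)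
    convert this using 1
    simp [Mem.setB, Mem.setV, hN, hE]
  tame := by
    obtain ⟨W, hW, hw⟩ := n.eval_bd
    obtain ⟨W', hW', hw'⟩ := e.eval_bd
    refine ⟨_, PolyBd.id.add (hW.mul hW'), fun V μ hV hB =>
      (((hB.mono (Nat.le_add_right _ _)).setB z ?_).setB 0 (by simp)).setV 0 (by simp)⟩
    have hNW : n.val μ ≤ W V := hw V _ _ hV hB.1
    have hEW : e.val μ ≤ W' V := hw' V _ _ hV hB.1
    have h1 := Nat.size_mul_pow_le (μ.b z) (e.val μ) (n.val μ)
    have h2 := hB.2 z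
    have h3 := Nat.mul_le_mul hNW hEW
    omega

theorem mulPow_den (z : ℕ) (n e : Ex) (hz : z ≠ 0) (he : e.Stable) {μ : Mem} (hv : μ.v 0 = 0)
    (hb : μ.b 0 = 0) : (mulPow z n e hz he : Code K).den μ =
      μ.setB z (μ.b z * e.val μ ^ n.val μ) := by
  ext y <;> simp [mulPow, Mem.setB, Mem.setV, Function.update_apply]
  · rintro rfl; simp [*]
  · rintro rfl; simp [*, hz.symm]

theorem update_ite_mem (f g : ℕ → ℕ) (p j : ℕ) :
    Function.update (fun i => if p ≤ i ∧ i < p + j then f (i - p) else g i) (p + j) (f j) =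
      fun i => if p ≤ i ∧ i < p + (j + 1) then f (i - p) else g i := by
  funext i
  by_cases h : i = p + j
  · subst h; simp
  · rw [Function.update_of_ne h]
    simp only [show i < p + (j + 1) ↔ i < p + j by omega]

/-- Writes the values of `e`, for the values of `v 0` below `n`, into the input of the subroutine,
from address `b z` on. -/
def outRow (hK : 0 < K) (z : ℕ) (n e : Ex) (hz : z ≠ 0) : Code K where
  prog := iFor K n (iOut K z e)
  den μ := (((μ.setOA fun i => if μ.b z ≤ i ∧ i < μ.b z + n.val μ then
    e.eval (Function.update μ.v 0 (i - μ.b z)) μ.a else μ.oa 0 i).setB z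
      (μ.b z + n.val μ)).setB 0 0).setV 0 0
  acts := by
    obtain ⟨T, hT, h⟩ := iFor_does K n
    obtain ⟨T', hT', h'⟩ := iOut_acts K hK z e
    obtain ⟨W, hW, hw⟩ := n.eval_bd
    let A : ℕ → ℕ := fun V => V + W V + 1
    have hA : PolyBd A := (PolyBd.id.add hW).add (.const 1)
    have hA2 : ∀ V, 2 ≤ V → 2 ≤ A V := fun V hV => by simp only [A]; omega
    refine ⟨_, (hT.comp hA hA2).add ((hW.add (.const 1)).mul (hT'.comp hA hA2)),
      fun V μ hV hB => ?_⟩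
    set N := n.val μ with hN
    have hNW : N ≤ W V := hw V _ _ hV hB.1
    let g : ℕ → ℕ := fun i => e.eval (Function.update μ.v 0 i) μ.a
    let F : ℕ → ℕ → ℕ := fun j i =>
      if μ.b z ≤ i ∧ i < μ.b z + j then g (i - μ.b z) else μ.oa 0 i
    have hbd : ∀ i j, i ≤ N → j ≤ N → MemBd (A V)
        ((((μ.setOA (F j)).setV 0 i).setB z (μ.b z + j)).setB 0 (N - i)) :=
      fun i j hi hj => ((MemBd.setV (μ := μ.setOA (F j)) (hB.mono (by simp only [A]; omega)) 0
        (by simp only [A]; omega)).setB z (by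
          have h1 := Nat.size_add_le (μ.b z) j
          have h2 := hB.2 z
          have h3 := Nat.size_le_self j
          simp only [A]; omega)).setB 0
        (Nat.size_le_of_le (by simp only [A]; omega))
    have := h (iOut K z e)
      (fun j => (((μ.setOA (F j)).setV 0 j).setB z (μ.b z + j)).setB 0 (N - j))
      (fun j => (((μ.setOA (F (j + 1))).setV 0 j).setB z (μ.b z + (j + 1))).setB 0 (N - j))
      μ N (A V) (T' (A V))
      (hA2 V hV) (hB.mono (by simp only [A]; omega)) rfl
      (by
        have hF0 : F 0 = μ.oa 0 := by
          funext i
          simp only [F]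
          rw [if_neg (by omega)]
        ext y <;> simp [Mem.setOA, Mem.setB, Mem.setV, hF0, hN])
      (fun j _ => by simp) (fun j hj => by
        have := h' (A V) _ (hA2 V hV) (hbd j j hj.le hj.le)
        convert this using 1
        have e2 := update_ite_mem g (μ.oa 0) (μ.b z) j
        ext y w
        · rfl
        · by_cases hy : y = 0
          · subst hy; simp [hz.symm]
          · by_cases hyz : y = z
            · subst hyz
              simp [hz, add_assoc]
            · simp [hy, hyz]
        · rfl
        · rfl
        · simp [Ex.val, Function.update_of_ne hz]
          change _ = Function.update μ.oa 0 (Function.update (F j) (μ.b z + j) (g j)) y w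
          simp only [F, e2]) (fun j hj => by simp) (fun j hj => by simp)
      (fun j hj => hbd j (j + 1) hj.le hj)
      (hbd N N le_rfl le_rfl)
      (fun j hj => by
        ext y <;> simp [Mem.setOA, Mem.setB, Mem.setV])
    have h3 : (N + 1) * T' (A V) ≤ (W V + 1) * T' (A V) := Nat.mul_le_mul_right _ (by omega)
    refine Does.mono (t := T (A V) + (N + 1) * T' (A V)) ?_ (by omega)
    convert this using 1
    simp [Mem.setOA, Mem.setB, Mem.setV, F, hN, g]
  tame := by
    obtain ⟨W, hW, hw⟩ := n.eval_bd
    refine ⟨_, (PolyBd.id.add hW).add (.const 1), fun V μ hV hB =>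
      ((MemBd.setB (μ := μ.setOA _) (hB.mono ?_) z ?_).setB 0 (by simp)).setV 0 (by simp)⟩
    · omega
    · have hNW : n.val μ ≤ W V := hw V _ _ hV hB.1
      have h1 := Nat.size_add_le (μ.b z) (n.val μ)
      have h2 := hB.2 z
      have h3 := Nat.size_le_self (n.val μ)
      omega

theorem outRow_den (hK : 0 < K) (z : ℕ) (n e : Ex) (hz : z ≠ 0) {μ : Mem} (hv : μ.v 0 = 0)
    (hb : μ.b 0 = 0) : (outRow hK z n e hz : Code K).den μ = (μ.setOA fun i =>
      if μ.b z ≤ i ∧ i < μ.b z + n.val μ then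
        e.eval (Function.update μ.v 0 (i - μ.b z)) μ.a else μ.oa 0 i).setB z
      (μ.b z + n.val μ) := by
  ext y <;> simp [outRow, Mem.setOA, Mem.setB, Mem.setV, Function.update_apply]
  · rintro rfl; simp [*]
  · rintro rfl; simp [*, hz.symm]

/-- Runs `p` with `v x = 0, …, n - 1`, where `b z` counts down. -/
def rep (x z : ℕ) (n : Ex) (p : Code K)
    -- The body must not increase the bound at all. A polynomial increase, which suffices for a
    -- sequence, would become exponential when it is repeated.
    (hp : ∀ V μ, 2 ≤ V → MemBd V μ → MemBd V (p.den μ))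
    (hz : ∀ μ, (p.den μ).b z = μ.b z) (hx : ∀ μ, (p.den μ).v x = μ.v x) : Code K where
  prog := .seq (iBset K z n) <| .seq (iAsg K x (.const 0)) <|
    iRep K z (.seq p.prog (iAsg K x (.bin .add (.var x) (.const 1))))
  den μ := (fun ν => ((p.den ν).setV x (ν.v x + 1)).setB z (ν.b z - 1))^[n.val μ]
    ((μ.setB z (n.val μ)).setV x 0)
  acts := by
    obtain ⟨T, hT, h⟩ := iBset_acts K z n
    obtain ⟨T', hT', h'⟩ := p.acts
    obtain ⟨T₁, hT₁, h₁⟩ := iAsg_acts K x (.const 0)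
    obtain ⟨T₂, hT₂, h₂⟩ := iAsg_acts K x (.bin .add (.var x) (.const 1))
    obtain ⟨W, hW, hw⟩ := n.eval_bd
    have hVW : ∀ V, 2 ≤ V → 2 ≤ V + W V := fun V hV => by omega
    have hVW' := PolyBd.id.add hW
    refine ⟨_, hT.add ((hT₁.comp hVW' hVW).add ((hW.add (.const 1)).mul
      (((hT'.comp hVW' hVW).add (hT₂.comp hVW' hVW)).add
      (((PolyBd.const 9).mul hW).add (.const 9))))), fun V μ hV hB => ?_⟩
    set N := n.val μ with hN
    have hNW : N ≤ W V := hw V _ _ hV hB.1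
    let M : ℕ → Mem := fun j => (fun ν => ((p.den ν).setV x (ν.v x + 1)).setB z (ν.b z - 1))^[j]
      ((μ.setB z N).setV x 0)
    have hM : ∀ j, M (j + 1) =
        ((p.den (M j)).setV x ((M j).v x + 1)).setB z ((M j).b z - 1) := fun j =>
      Function.iterate_succ_apply' _ _ _
    have hb : ∀ j, (M j).b z = N - j := fun j => by
      induction j with
      | zero => simp [M]
      | succ j ih => rw [hM]; simp [ih]; omega
    have hv : ∀ j, (M j).v x = j := fun j => by
      induction j with
      | zero => simp [M]
      | succ j ih => rw [hM]; simp [ih]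
    have hbd : ∀ j ≤ N, MemBd (V + W V) (M j) := fun j => by
      induction j with
      | zero =>
        intro _
        exact ((hB.mono (by omega)).setB z (Nat.size_le_of_le (by omega))).setV x (by omega)
      | succ j ih =>
        intro hj
        rw [hM, hb, hv]
        exact ((hp _ _ (hVW V hV) (ih (by omega))).setV x (by omega)).setB z
          (Nat.size_le_of_le (by omega))
    have := iRep_does (K := K) (z := z)
      (p := .seq p.prog (iAsg K x (.bin .add (.var x) (.const 1)))) M
      (fun j => (p.den (M j)).setV x ((M j).v x + 1)) (n := N)
      (t := T' (V + W V) + T₂ (V + W V)) (fun j _ => hb j) (fun j hj => by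
        have h1 := h' _ _ (hVW V hV) (hbd j hj.le)
        have h2 := h₂ _ _ (hVW V hV) (hp _ _ (hVW V hV) (hbd j hj.le))
        simp only [Ex.val, Ex.eval, RAMOp.eval, hx] at h2
        exact h1.seq h2)
      (fun j hj => by simp [hz, hb]) (fun j hj => by rw [hM, hb, Nat.sub_sub])
    refine ((h V μ hV hB).seq (Does.seq (h₁ _ _ (hVW V hV)
      ((hB.mono (by omega)).setB z (Nat.size_le_of_le (by omega)))) this)).mono ?_
    have h2 := Nat.size_le_self N
    exact Nat.add_le_add_left (Nat.add_le_add_left (Nat.mul_le_mul (by omega) (by omega)) _) _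
  tame := by
    obtain ⟨W, hW, hw⟩ := n.eval_bd
    refine ⟨_, PolyBd.id.add hW, fun V μ hV hB => ?_⟩
    have hNW : n.val μ ≤ W V := hw V _ _ hV hB.1
    have : ∀ j ≤ n.val μ, MemBd (V + W V)
        ((fun ν => ((p.den ν).setV x (ν.v x + 1)).setB z (ν.b z - 1))^[j]
          ((μ.setB z (n.val μ)).setV x 0)) ∧
        ((fun ν => ((p.den ν).setV x (ν.v x + 1)).setB z (ν.b z - 1))^[j]
          ((μ.setB z (n.val μ)).setV x 0)).v x = j := fun j => by
      induction j with
      | zero =>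
        intro _
        exact ⟨((hB.mono (by omega)).setB z (Nat.size_le_of_le (by omega))).setV x (by omega),
          by simp⟩
      | succ j ih =>
        intro hj
        obtain ⟨h1, h2⟩ := ih (by omega)
        rw [Function.iterate_succ_apply', h2]
        exact ⟨((hp _ _ (by omega) h1).setV x (by omega)).setB z
          ((Nat.size_mono (Nat.sub_le _ 1)).trans (h1.2 z)), by simp⟩
    exact (this _ le_rfl).1

theorem rep_den {x z : ℕ} {n : Ex} {p : Code K} {hp hz hx} {μ : Mem} (M : ℕ → Mem) {N : ℕ}
    (hn : n.val μ = N) (h0 : (μ.setB z N).setV x 0 = M 0)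
    (hM : ∀ j < N, ((p.den (M j)).setV x ((M j).v x + 1)).setB z ((M j).b z - 1) = M (j + 1)) :
    (rep x z n p hp hz hx : Code K).den μ = M N := by
  have : ∀ j ≤ N, (fun ν => ((p.den ν).setV x (ν.v x + 1)).setB z (ν.b z - 1))^[j]
      ((μ.setB z N).setV x 0) = M j := fun j => by
    induction j with
    | zero => exact fun _ => h0
    | succ j ih => intro hj; rw [Function.iterate_succ_apply', ih (by omega), hM j (by omega)]
  change (fun ν => ((p.den ν).setV x (ν.v x + 1)).setB z (ν.b z - 1))^[n.val μ]
    ((μ.setB z (n.val μ)).setV x 0) = _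
  rw [hn, this N le_rfl]

end Code

/-! ### Reading the input -/

/-- The memory that represents the initial state on the input `l`. -/
def Mem.start (l : List ℕ) : Mem where
  v _ := 0
  b _ := 0
  a _ _ := 0
  o x := if x = 0 then l.length else 0
  oa a i := if a = 0 then l.getD i 0 else 0

/-- The memory after the input `l` has been moved to the array `0`. -/
def Mem.input (l : List ℕ) : Mem where
  v _ := 0
  b _ := 0
  a a i := if a = 0 then l.getD i 0 else 0
  o _ := 0
  oa _ _ := 0

theorem shows_start {K : ℕ} (hK : 0 < K) (l : List ℕ) :
    Shows K (RAMState.start l) (Mem.start l) where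
  v x := by simp [RAMState.start, Mem.start, uv]; omega
  b x := by simp [RAMState.start, Mem.start, bg]
  a i := by funext j; simp [RAMState.start, Mem.start]; omega
  o x _ := by simp [RAMState.start, Mem.start]
  oa i _ := by funext j; simp [RAMState.start, Mem.start]

/-- Moves the input to the array `0`. -/
def readInput (K : ℕ) : RAMProg :=
  .seq (iOfO K 0 0) <| .seq (iRep K 0 (.seq (iInp K) (iAsg K 0 (.bin .add (.var 0) (.const 1))))) <|
  .seq (iAsg K 0 (.const 0)) (iToO K 0 0)

theorem readInput_does (K : ℕ) (hK : 0 < K) : ∃ T, PolyBd T ∧ ∀ (l : List ℕ) (V : ℕ), 2 ≤ V →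
    l.length ≤ V → (∀ i, l.getD i 0 ≤ V) →
    Does K (readInput K) (.start l) (T V) (.input l) := by
  obtain ⟨T₁, hT₁, h₁⟩ := iAsg_acts K 0 (.bin .add (.var 0) (.const 1))
  obtain ⟨T₂, hT₂, h₂⟩ := iAsg_acts K 0 (.const 0)
  obtain ⟨T₃, hT₃, h₃⟩ := iToO_acts K 0 0 hK
  refine ⟨fun V => 2 * (1 + 3 * V) + ((V + 1) * (4 * (1 + 3 * V) + T₁ V + 8 * (V + 1) + V + 1) +
    (T₂ V + T₃ V)), ((PolyBd.const 2).mul ((PolyBd.const 1).add ((PolyBd.const 3).mul .id))).add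
    (((PolyBd.id.add (.const 1)).mul ((((((PolyBd.const 4).mul ((PolyBd.const 1).add
      ((PolyBd.const 3).mul .id))).add hT₁).add ((PolyBd.const 8).mul (PolyBd.id.add
      (.const 1)))).add .id).add (.const 1))).add (hT₂.add hT₃)), fun l V hV hl hi => ?_⟩
  set N := l.length
  have hNs : N.size ≤ V := Nat.size_le_of_le hl
  let M : ℕ → Mem := fun j =>
    { v := Function.update (fun _ => 0) 0 j
      b := Function.update (fun _ => 0) 0 (N - j)
      a := fun a i => if a = 0 ∧ i < j then l.getD i 0 else 0
      o := fun x => if x = 0 then l.length else 0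
      oa := fun a i => if a = 0 ∧ ¬ i < j then l.getD i 0 else 0 }
  let M' : ℕ → Mem := fun j =>
    { M j with
      a := fun a i => if a = 0 ∧ i < j + 1 then l.getD i 0 else 0
      oa := fun a i => if a = 0 ∧ ¬ i < j + 1 then l.getD i 0 else 0 }
  have hbd : ∀ j ≤ N, ∀ a : ℕ → ℕ → ℕ, (∀ x i, a x i ≤ V) → ∀ f, MemBd V
      { v := Function.update (fun _ => 0) 0 j, b := Function.update (fun _ => 0) 0 (N - j),
        a := a, o := (M 0).o, oa := f } := by
    intro j hj a ha f
    refine ⟨⟨fun x => ?_, ha⟩, fun z => ?_⟩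
    · simp only [Function.update_apply]; split_ifs <;> omega
    · simp only [Function.update_apply]
      split_ifs
      · exact Nat.size_le_of_le (by omega)
      · simp
  have hA : ∀ j x i, (if x = 0 ∧ i < j then l.getD i 0 else 0) ≤ V := by
    intro j x i
    split_ifs
    · exact hi i
    · omega
  have s1 := iOfO_does K 0 0 hK (.start l) (V := V) (by simpa [Mem.start] using hNs)
  have e1 : (Mem.start l).setB 0 ((Mem.start l).o 0) = M 0 := by
    ext x y <;> simp [Mem.start, M, Mem.setB, Function.update_apply, N]
  rw [e1] at s1
  have s2 := iRep_does (K := K) (z := 0)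
    (p := .seq (iInp K) (iAsg K 0 (.bin .add (.var 0) (.const 1)))) M
    (fun j => (M' j).setV 0 (j + 1)) (n := N) (t := 4 * (1 + 3 * V) + T₁ V)
    (fun j hj => by simp [M]) (fun j hj => by
      have k1 := iInp_does K hK (M j) (V := V) (by simp [M]; omega) (by simp [M]; exact hi j)
      have k2 := h₁ V (M' j) hV (hbd j hj.le _ (hA (j + 1)) _)
      refine Does.seq (μ' := M' j) ?_ ?_
      · convert k1 using 1
        ext x y
        · rfl
        · rfl
        · by_cases hx : x = 0
          · subst hx
            by_cases hy : y = j
            · subst hy; simp [M, M']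
            · simp [M, M', hy, show y < j + 1 ↔ y < j by omega]
          · simp [M, M', hx]
        · rfl
        · by_cases hx : x = 0
          · subst hx
            by_cases hy : y = j
            · subst hy; simp [M, M']
            · simp [M, M', hy, show j < y ↔ j ≤ y by omega]
          · simp [M, M', hx]
      · simpa [Ex.val, Ex.eval, RAMOp.eval, M', M] using k2)
    (fun j hj => by simp [M', M]) (fun j hj => by
      ext x y <;> simp [M', M, Mem.setV, Mem.setB])
  have s3 : Does K _ (M N) (T₂ V) ((M N).setV 0 0) := h₂ V (M N) hV (hbd N le_rfl _ (hA N) _)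
  have s4 : Does K (iToO K 0 0) ((M N).setV 0 0) (T₃ V)
      (((M N).setV 0 0).setO 0 (((M N).setV 0 0).b 0)) :=
    h₃ V ((M N).setV 0 0) hV ((hbd N le_rfl _ (hA N) _).setV 0 (by omega))
  have e2 : ((M N).setV 0 0).setO 0 (((M N).setV 0 0).b 0) = Mem.input l := by
    have hN : ∀ y, ¬ y < N → l.getD y 0 = 0 := fun y hy => List.getD_eq_default l 0 (by omega)
    ext x y
    · simp [Mem.input, M]
    · simp [Mem.input, M]
    · by_cases hx : x = 0
      · by_cases hy : y < N
        · simp [Mem.input, M, hx, hy]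
        · have := hN y hy
          simp only [List.getD_eq_getElem?_getD] at this
          simp [Mem.input, M, hy, this]
      · simp [Mem.input, M, hx]
    · by_cases hx : x = 0 <;> simp [Mem.input, M, hx]
    · by_cases hy : y < N
      · simp [Mem.input, M]; omega
      · have := hN y hy
        simp only [List.getD_eq_getElem?_getD] at this
        simp [Mem.input, M, this]
  rw [e2] at s4
  refine Does.mono (s1.seq (s2.seq (s3.seq s4))) ?_
  have : (N + 1) * (4 * (1 + 3 * V) + T₁ V + 8 * (N.size + 1) + N.size + 1) ≤
      (V + 1) * (4 * (1 + 3 * V) + T₁ V + 8 * (V + 1) + V + 1) := by gcongr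
  dsimp only
  omega

/-! ### Sparsification of formulas -/

/-- A partial clause: at each of `k` positions there is a literal or nothing (`0`). -/
abbrev PClause (k m : ℕ) : Type := Fin k → Fin (m + 1)

namespace PClause
variable {k m : ℕ}

/-- The number of literals. -/
def psize (C : PClause k m) : ℕ := (Finset.univ.filter fun i => C i ≠ 0).card

/-- `C` contains `H`, position by position. -/
def Ext (H C : PClause k m) : Prop := ∀ i, H i ≠ 0 → C i = H i

instance (H C : PClause k m) : Decidable (Ext H C) :=
  inferInstanceAs (Decidable (∀ i, H i ≠ 0 → C i = H i))

/-- The literals of `C` at the positions at which `H` has none. -/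
def petal (H C : PClause k m) : PClause k m := fun i => if H i ≠ 0 then 0 else C i

/-- Both the literals of `H` and those of `C`. -/
def join (H C : PClause k m) : PClause k m := fun i => if H i ≠ 0 then H i else C i

theorem Ext.refl (C : PClause k m) : Ext C C := fun _ _ => rfl

theorem Ext.trans {C D E : PClause k m} (h : Ext C D) (h' : Ext D E) : Ext C E := fun i hi => by
  have := h i hi
  rw [← this] at hi ⊢
  exact h' i hi

theorem Ext.psize_le {H C : PClause k m} (h : Ext H C) : psize H ≤ psize C :=
  Finset.card_le_card fun i hi => by
    simp only [Finset.mem_filter, Finset.mem_univ, true_and] at hi ⊢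
    rwa [h i hi]

theorem Ext.eq_of_psize_le {H C : PClause k m} (h : Ext H C) (hc : psize C ≤ psize H) : H = C := by
  have hs : (Finset.univ.filter fun i => H i ≠ 0) = Finset.univ.filter fun i => C i ≠ 0 :=
    Finset.eq_of_subset_of_card_le (fun i hi => by
      simp only [Finset.mem_filter, Finset.mem_univ, true_and] at hi ⊢
      rwa [h i hi]) hc
  funext i
  by_cases hi : H i = 0
  · have : i ∉ Finset.univ.filter fun i => H i ≠ 0 := by simp [hi]
    rw [hs] at this
    simp only [Finset.mem_filter, Finset.mem_univ, true_and, not_not] at this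
    rw [hi, this]
  · exact (h i hi).symm

theorem psize_petal {H C : PClause k m} (h : Ext H C) : psize H + psize (petal H C) = psize C := by
  unfold psize petal
  rw [← Finset.card_union_of_disjoint]
  · congr 1
    ext i
    simp only [Finset.mem_union, Finset.mem_filter, Finset.mem_univ, true_and]
    by_cases hi : H i = 0
    · simp [hi]
    · simp [hi, h i hi]
  · rw [Finset.disjoint_filter]
    intro i _ hi
    simp [hi]

theorem ext_petal (H C : PClause k m) : Ext (petal H C) C := fun i hi => by
  unfold petal at hi ⊢
  split_ifs at hi ⊢ with h
  · exact absurd rfl hi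
  · rfl

theorem petal_injOn (H : PClause k m) {C D : PClause k m} (hC : Ext H C) (hD : Ext H D)
    (h : petal H C = petal H D) : C = D := by
  funext i
  by_cases hi : H i = 0
  · simpa [petal, hi] using congrFun h i
  · rw [hC i hi, hD i hi]

theorem ext_join_left (H C : PClause k m) : Ext H (join H C) := fun i hi => by simp [join, hi]

theorem petal_join {H H' C : PClause k m} (h : Ext H' (petal H C)) :
    petal H (join H H') = H' := by
  funext i
  by_cases hi : H i = 0
  · simp [petal, join, hi]
  · by_contra hne
    have h0 : H' i ≠ 0 := fun h0 => hne (by simp [petal, hi, h0])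
    have := h i h0
    simp [petal, hi] at this
    exact h0 this.symm

theorem ext_join {H H' C : PClause k m} (hC : Ext H C) (h : Ext H' (petal H C)) :
    Ext (join H H') C := fun i hi => by
  by_cases hH : H i = 0
  · simp only [join, hH, ne_eq, not_true_eq_false, if_false] at hi ⊢
    have := h i hi
    simpa [petal, hH] using this
  · simp only [join, hH, ne_eq, not_false_eq_true, if_true] at hi ⊢
    exact hC i hH

/-- The minimal elements of `S`. -/
def act (S : Finset (PClause k m)) : Finset (PClause k m) :=
  S.filter fun C => ∀ D ∈ S, Ext D C → D = C

/-- The number of minimal elements of `S` of size `c` that contain `H`. -/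
def deg (S : Finset (PClause k m)) (c : ℕ) (H : PClause k m) : ℕ :=
  ((act S).filter fun C => psize C = c ∧ Ext H C).card

/-- The number of minimal elements of `S` of size `c`. -/
def num (S : Finset (PClause k m)) (c : ℕ) : ℕ := ((act S).filter fun C => psize C = c).card

/-- Many minimal elements of size `psize H + i` contain `H`. -/
def IsFlower (θ : ℕ → ℕ) (S : Finset (PClause k m)) (i : ℕ) (H : PClause k m) : Prop :=
  1 ≤ i ∧ 1 ≤ psize H ∧ θ i ≤ deg S (psize H + i) H

/-- `cnt i` counts the clauses of size `i` that have been added in the course of the process that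
has led to `S`. -/
structure Inv (θ : ℕ → ℕ) (S : Finset (PClause k m)) (cnt : ℕ → ℕ) : Prop where
  le_num : ∀ i, cnt i ≤ num S i + ∑ j ∈ Finset.Ico 1 i, cnt j * (2 * θ (i - j))
  deg_le : ∀ i, 0 < cnt i → ∀ H, 1 ≤ psize H → psize H < i → deg S i H ≤ 2 * θ (i - psize H)

theorem Inv.zero (θ : ℕ → ℕ) (S : Finset (PClause k m)) : Inv θ S fun _ => 0 :=
  ⟨fun _ => Nat.zero_le _, fun _ h => absurd h (lt_irrefl 0)⟩

/-! ### Adding clauses of one size -/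

section Add
variable {θ : ℕ → ℕ} {S P : Finset (PClause k m)} {cnt : ℕ → ℕ} {a : ℕ}

theorem subset_act_union (hP : ∀ p ∈ P, psize p = a) (hf : ∀ p ∈ P, ∀ C ∈ S, ¬ Ext C p) :
    P ⊆ act (S ∪ P) := fun p hp => by
  simp only [act, Finset.mem_filter, Finset.mem_union]
  refine ⟨.inr hp, fun D hD hE => ?_⟩
  rcases hD with hD | hD
  · exact absurd hE (hf p hp D hD)
  · exact hE.eq_of_psize_le (by rw [hP p hp, hP D hD])

theorem act_union_subset : act (S ∪ P) ⊆ act S ∪ P := fun C hC => by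
  simp only [act, Finset.mem_filter, Finset.mem_union] at hC ⊢
  rcases hC.1 with h | h
  · exact .inl ⟨h, fun D hD => hC.2 D (.inl hD)⟩
  · exact .inr h

theorem mem_act_union {C : PClause k m} (hC : C ∈ act S) (h : ∀ p ∈ P, ¬ Ext p C) :
    C ∈ act (S ∪ P) := by
  simp only [act, Finset.mem_filter, Finset.mem_union] at hC ⊢
  exact ⟨.inl hC.1, fun D hD hE => hD.elim (fun hD => hC.2 D hD hE) fun hD => absurd hE (h D hD)⟩

theorem act_subset (S : Finset (PClause k m)) : act S ⊆ S := Finset.filter_subset _ _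

theorem num_le_of_le (hP : ∀ p ∈ P, psize p = a) (hf : ∀ p ∈ P, ∀ C ∈ S, ¬ Ext C p) {i : ℕ}
    (hi : i ≤ a) : num S i ≤ num (S ∪ P) i := by
  refine Finset.card_le_card fun C hC => ?_
  simp only [Finset.mem_filter] at hC ⊢
  refine ⟨mem_act_union hC.1 fun p hp hE => ?_, hC.2⟩
  have := hE.eq_of_psize_le (by rw [hP p hp, hC.2]; exact hi)
  subst this
  exact hf p hp p (act_subset S hC.1) (.refl p)

theorem num_add_card_le (hP : ∀ p ∈ P, psize p = a) (hf : ∀ p ∈ P, ∀ C ∈ S, ¬ Ext C p) :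
    num S a + P.card ≤ num (S ∪ P) a := by
  have hd : Disjoint ((act S).filter fun C => psize C = a) P := by
    rw [Finset.disjoint_left]
    intro C hC hP
    exact hf C hP C (act_subset S (Finset.mem_filter.1 hC).1) (.refl C)
  unfold num
  rw [← Finset.card_union_of_disjoint hd]
  refine Finset.card_le_card fun C hC => ?_
  rw [Finset.mem_union] at hC
  rcases hC with hC | hC
  · simp only [Finset.mem_filter] at hC ⊢
    refine ⟨mem_act_union hC.1 fun p hp hE => ?_, hC.2⟩
    have := hE.eq_of_psize_le (by rw [hP p hp, hC.2])
    subst this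
    exact hf p hp p (act_subset S hC.1) (.refl p)
  · exact Finset.mem_filter.2 ⟨subset_act_union hP hf hC, hP C hC⟩

/-- A minimal clause that ceases to be minimal when `P` is added contains a member of `P`, and is
counted by the degree of that member. -/
theorem num_le_add_sum (i : ℕ) : num S i ≤ num (S ∪ P) i + ∑ p ∈ P, deg S i p := by
  have : ((act S).filter fun C => psize C = i) ⊆ ((act (S ∪ P)).filter fun C => psize C = i) ∪
      P.biUnion fun p => (act S).filter fun C => psize C = i ∧ Ext p C := fun C hC => by
    simp only [Finset.mem_filter, Finset.mem_union, Finset.mem_biUnion] at hC ⊢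
    by_cases h : ∃ p ∈ P, Ext p C
    · obtain ⟨p, hp, hE⟩ := h
      exact .inr ⟨p, hp, hC.1, hC.2, hE⟩
    · push Not at h
      exact .inl ⟨mem_act_union hC.1 h, hC.2⟩
  refine (Finset.card_le_card this).trans ((Finset.card_union_le _ _).trans ?_)
  exact Nat.add_le_add_left Finset.card_biUnion_le _

/-- For sizes below `a` no minimal clause is lost. At size `a` all of `P` is new and minimal, which
balances the increase of `cnt a`. At a larger size `i` each member of `P` removes at most `2 * θ (i
- a)` minimal clauses, and the sum in the invariant grows by exactly this much. Degrees need control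
only at sizes where something has been added; the original formula may have arbitrarily large
degrees. -/
theorem Inv.add (hI : Inv θ S cnt) (ha : 1 ≤ a) (hP : ∀ p ∈ P, psize p = a)
    (hf : ∀ p ∈ P, ∀ C ∈ S, ¬ Ext C p)
    (hdeg : ∀ H, 1 ≤ psize H → psize H < a →
      deg S a H + (P.filter fun p => Ext H p).card ≤ 2 * θ (a - psize H)) :
    Inv θ (S ∪ P) fun j => cnt j + if j = a then P.card else 0 where
  le_num i := by
    have hsum : ∑ j ∈ Finset.Ico 1 i, (cnt j + if j = a then P.card else 0) * (2 * θ (i - j)) =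
        ∑ j ∈ Finset.Ico 1 i, cnt j * (2 * θ (i - j)) +
          if a < i then P.card * (2 * θ (i - a)) else 0 := by
      simp only [add_mul, Finset.sum_add_distrib, ite_mul, zero_mul, Finset.sum_ite_eq',
        Finset.mem_Ico, ha, true_and]
    have h0 := hI.le_num i
    rw [hsum]
    rcases lt_trichotomy i a with h | h | h
    · have := num_le_of_le hP hf h.le
      rw [if_neg (by omega), if_neg (by omega)]
      omega
    · subst h
      have := num_add_card_le hP hf
      rw [if_pos rfl, if_neg (by omega)]
      omega
    · rw [if_neg (by omega), if_pos h]
      -- The degree bound is available only if some clause of size `i` has been added; otherwise the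
      -- left side is `0`.
      rcases Nat.eq_zero_or_pos (cnt i) with hc | hc
      · omega
      · have h1 := num_le_add_sum (S := S) (P := P) i
        have h2 : ∑ p ∈ P, deg S i p ≤ P.card * (2 * θ (i - a)) := by
          rw [← smul_eq_mul]
          refine Finset.sum_le_card_nsmul _ _ _ fun p hp => ?_
          have := hI.deg_le i hc p (by rw [hP p hp]; exact ha) (by rw [hP p hp]; exact h)
          rwa [hP p hp] at this
        omega
  deg_le i hi H hH hHi := by
    by_cases hia : i = a
    · subst hia
      refine le_trans ?_ (hdeg H hH hHi)
      have : ((act (S ∪ P)).filter fun C => psize C = i ∧ Ext H C) ⊆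
          ((act S).filter fun C => psize C = i ∧ Ext H C) ∪ P.filter fun p => Ext H p :=
        fun C hC => by
          simp only [Finset.mem_filter, Finset.mem_union] at hC ⊢
          rcases Finset.mem_union.1 (act_union_subset hC.1) with h | h
          · exact .inl ⟨h, hC.2⟩
          · exact .inr ⟨h, hC.2.2⟩
      exact (Finset.card_le_card this).trans (Finset.card_union_le _ _)
    -- All new clauses have size `a`, so minimal clauses of another size were minimal before, and
    -- the degrees can only drop.
    · simp only [hia, if_false, add_zero] at hi
      refine le_trans (Finset.card_le_card fun C hC => ?_) (hI.deg_le i hi H hH hHi)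
      simp only [Finset.mem_filter] at hC ⊢
      rcases Finset.mem_union.1 (act_union_subset hC.1) with h | h
      · exact ⟨h, hC.2⟩
      · exact absurd (hC.2.1.symm.trans (hP C h)) hia

end Add

/-- A flower whose clauses have the least size, and among these one whose petals have the least
size. -/
def IsLeastFlower (θ : ℕ → ℕ) (S : Finset (PClause k m)) (i : ℕ) (H : PClause k m) : Prop :=
  IsFlower θ S i H ∧ ∀ i' H', IsFlower θ S i' H' →
    psize H + i < psize H' + i' ∨ psize H + i = psize H' + i' ∧ i ≤ i'

/-- The minimal clauses that form the flower with the heart `H` and petals of size `i`. -/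
def flower (S : Finset (PClause k m)) (i : ℕ) (H : PClause k m) : Finset (PClause k m) :=
  (act S).filter fun C => psize C = psize H + i ∧ Ext H C

def petals (S : Finset (PClause k m)) (i : ℕ) (H : PClause k m) : Finset (PClause k m) :=
  (flower S i H).image (petal H)

/-! ### Hearts and petals of a least flower -/

section Step
variable {θ : ℕ → ℕ} {S : Finset (PClause k m)} {cnt : ℕ → ℕ} {i : ℕ} {H : PClause k m}

/-- The form in which leastness is used: below the least flower, first by the size of the clauses
and then by the size of the petals, all degrees are under the threshold. -/
theorem IsLeastFlower.deg_lt (h : IsLeastFlower θ S i H) {i' : ℕ} {H' : PClause k m}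
    (hi : 1 ≤ i') (hH : 1 ≤ psize H')
    (hlt : psize H' + i' < psize H + i ∨ psize H' + i' = psize H + i ∧ i' < i) :
    deg S (psize H' + i') H' < θ i' := by
  by_contra hge
  have := h.2 i' H' ⟨hi, hH, by omega⟩
  omega

/-- Clauses with the same heart are determined by their petals, so no petals coincide. -/
theorem card_petals : (petals S i H).card = deg S (psize H + i) H := by
  unfold petals
  rw [Finset.card_image_of_injOn]
  · rfl
  · intro C hC D hD h
    simp only [flower, Finset.coe_filter, Set.mem_ofPred_eq] at hC hD
    exact petal_injOn H hC.2.2 hD.2.2 h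

theorem IsLeastFlower.exists_mem (h : IsLeastFlower θ S i H) (hθ : ∀ i, 1 ≤ θ i) :
    ∃ C ∈ act S, psize C = psize H + i ∧ Ext H C := by
  have : 0 < deg S (psize H + i) H := lt_of_lt_of_le (hθ i) h.1.2.2
  obtain ⟨C, hC⟩ := Finset.card_pos.1 this
  exact ⟨C, Finset.mem_filter.1 hC⟩

theorem not_ext_of_act {C D p : PClause k m} (hC : C ∈ act S) (hp : Ext p C)
    (hlt : psize p < psize C) (hD : D ∈ S) : ¬ Ext D p := fun hE => by
  have h1 := (Finset.mem_filter.1 hC).2 D hD (hE.trans hp)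
  have h2 := hE.psize_le
  rw [h1] at h2
  omega

/-- The heart is smaller than the clauses of the flower, so by leastness the old degrees at its size
are below `θ`. One new clause adds at most `1`, which is at most `θ`. -/
theorem Inv.insert_heart (hI : Inv θ S cnt) (h : IsLeastFlower θ S i H) (hθ : ∀ i, 1 ≤ θ i) :
    Inv θ (S ∪ {H}) fun j => cnt j + if j = psize H then 1 else 0 := by
  obtain ⟨C, hC, hC1, hC2⟩ := h.exists_mem hθ
  have h1 := h.1.1
  have := hI.add (P := {H}) (a := psize H) h.1.2.1 (by simp)
    (by
      intro p hp D hD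
      rw [Finset.mem_singleton] at hp
      subst hp
      exact not_ext_of_act hC hC2 (by omega) hD)
    (fun H' hH' hlt => by
      have h2 := h.deg_lt (i' := psize H - psize H') (H' := H') (by omega) hH' (by omega)
      rw [show psize H' + (psize H - psize H') = psize H by omega] at h2
      have h3 : (({H} : Finset (PClause k m)).filter fun p => Ext H' p).card ≤ 1 :=
        (Finset.card_filter_le _ _).trans (by simp)
      have h4 := hθ (psize H - psize H')
      omega)
  simpa using this

/-- Both halves of the leastness enter. Old degrees at size `i` are below the threshold because the
clauses of the flower are larger than the petals. The petals containing `H'` correspond to the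
clauses of the flower containing `H` and `H'` jointly; these would form a flower with clauses of the
same size and smaller petals, so there are fewer than `θ (i - psize H')` of them. -/
theorem Inv.add_petals (hI : Inv θ S cnt) (h : IsLeastFlower θ S i H) :
    Inv θ (S ∪ petals S i H) fun j => cnt j + if j = i then (petals S i H).card else 0 := by
  have h1 := h.1.2.1
  have hmem : ∀ p ∈ petals S i H, ∃ C ∈ act S, psize C = psize H + i ∧ Ext H C ∧
      petal H C = p := fun p hp => by
    obtain ⟨C, hC, rfl⟩ := Finset.mem_image.1 hp
    obtain ⟨hC1, hC2, hC3⟩ := Finset.mem_filter.1 hC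
    exact ⟨C, hC1, hC2, hC3, rfl⟩
  have hps : ∀ p ∈ petals S i H, psize p = i := fun p hp => by
    obtain ⟨C, hC, hC1, hC2, rfl⟩ := hmem p hp
    have := psize_petal hC2
    omega
  refine hI.add h.1.1 hps (fun p hp D hD => ?_) (fun H' hH' hlt => ?_)
  · have hpi := hps p hp
    obtain ⟨C, hC, hC1, hC2, rfl⟩ := hmem p hp
    exact not_ext_of_act hC (ext_petal H C) (by omega) hD
  · have h2 := h.deg_lt (i' := i - psize H') (H' := H') (by omega) hH' (by omega)
    rw [show psize H' + (i - psize H') = i by omega] at h2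
    -- If no petal contains `H'` there is nothing to count; a petal that does contain it guarantees
    -- that `H'` is disjoint from the heart, so that the sizes add up in `join H H'`.
    have h3 : ((petals S i H).filter fun p => Ext H' p).card ≤ θ (i - psize H') := by
      by_cases hex : ∃ p ∈ petals S i H, Ext H' p
      · obtain ⟨p, hp, hE⟩ := hex
        obtain ⟨C, hC, hC1, hC2, rfl⟩ := hmem p hp
        have hj := psize_petal (ext_join_left H H')
        rw [petal_join hE] at hj
        have h4 := h.deg_lt (i' := i - psize H') (H' := join H H') (by omega) (by omega) (by omega)
        rw [show psize (join H H') + (i - psize H') = psize H + i by omega] at h4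
        refine le_trans ?_ h4.le
        have hsub : ((petals S i H).filter fun p => Ext H' p) ⊆ ((act S).filter fun C =>
            psize C = psize H + i ∧ Ext (join H H') C).image (petal H) := fun p hp => by
          obtain ⟨hp1, hp2⟩ := Finset.mem_filter.1 hp
          obtain ⟨D, hD, hD1, hD2, rfl⟩ := hmem p hp1
          exact Finset.mem_image.2 ⟨D, Finset.mem_filter.2 ⟨hD, hD1, ext_join hD2 hp2⟩, rfl⟩
        exact (Finset.card_le_card hsub).trans Finset.card_image_le
      · rw [Finset.filter_false_of_mem (by simpa using hex)]
        simp
    omega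

end Step

/-! ### Counting -/

/-- Every nonempty clause contains a clause with a single literal. -/
theorem num_le_sum_deg (S : Finset (PClause k m)) {i : ℕ} (hi : 1 ≤ i) :
    num S i ≤ ∑ H ∈ Finset.univ.filter (fun H : PClause k m => psize H = 1), deg S i H := by
  unfold num
  refine le_trans (Finset.card_le_card fun C hC => ?_) Finset.card_biUnion_le
  obtain ⟨hC1, hC2⟩ := Finset.mem_filter.1 hC
  have : 0 < psize C := by omega
  obtain ⟨j, hj⟩ := Finset.card_pos.1 this
  simp only [Finset.mem_filter, Finset.mem_univ, true_and] at hj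
  refine Finset.mem_biUnion.2 ⟨fun l => if l = j then C j else 0, ?_, ?_⟩
  · rw [Finset.mem_filter]
    refine ⟨Finset.mem_univ _, ?_⟩
    unfold psize
    rw [Finset.card_eq_one]
    refine ⟨j, ?_⟩
    ext l
    simp only [Finset.mem_filter, Finset.mem_univ, true_and, Finset.mem_singleton]
    by_cases hl : l = j <;> simp [hl, hj]
  · refine Finset.mem_filter.2 ⟨hC1, hC2, fun l hl => ?_⟩
    by_cases hlj : l = j
    · simp [hlj]
    · simp [hlj] at hl

theorem card_psize_one_le :
    (Finset.univ.filter fun H : PClause k m => psize H = 1).card ≤ k * m := by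
  have hsub : (Finset.univ.filter fun H : PClause k m => psize H = 1) ⊆
      (Finset.univ : Finset (Fin k × Fin m)).image
        fun p l => if l = p.1 then Fin.succ p.2 else 0 := fun H hH => by
    simp only [Finset.mem_filter, Finset.mem_univ, true_and, psize, Finset.card_eq_one] at hH
    obtain ⟨j, hj⟩ := hH
    have hj' : H j ≠ 0 := by
      have : j ∈ Finset.univ.filter fun i => H i ≠ 0 := by rw [hj]; simp
      simpa using this
    refine Finset.mem_image.2 ⟨(j, (H j).pred hj'), Finset.mem_univ _, ?_⟩
    funext l
    by_cases hl : l = j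
    · subst hl; simp
    · have : l ∉ Finset.univ.filter fun i => H i ≠ 0 := by rw [hj]; simpa using hl
      simp only [Finset.mem_filter, Finset.mem_univ, true_and, not_not] at this
      simp [hl, this]
  refine (Finset.card_le_card hsub).trans (Finset.card_image_le.trans ?_)
  simp

theorem num_one_le (S : Finset (PClause k m)) : num S 1 ≤ k * m :=
  (Finset.card_le_card fun _ hC => Finset.mem_filter.2
    ⟨Finset.mem_univ _, (Finset.mem_filter.1 hC).2⟩).trans card_psize_one_le

/-- Every clause has at most `k` literals. -/
theorem psize_le (C : PClause k m) : psize C ≤ k :=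
  (Finset.card_filter_le _ _).trans (by simp)

/-- The thresholds. -/
def thr (M Y i : ℕ) : ℕ := M * Y ^ (2 * i - 1)

/-- There are at most `k * m` clauses with one literal, and the invariant bounds the degree of each
of them. -/
theorem Inv.num_le {S : Finset (PClause k m)} {M Y : ℕ} {cnt : ℕ → ℕ} (hM : 1 ≤ M)
    (hI : Inv (thr M Y) S cnt) {i : ℕ} (hi : 1 ≤ i) (hc : 0 < cnt i) :
    num S i ≤ k * m * (2 * thr M Y (i - 1)) := by
  rcases hi.eq_or_lt with h | h
  · subst h
    have := num_one_le S
    -- By truncated subtraction the threshold at `0` is `M * Y ^ 0 = M`, so clauses of size one obey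
    -- the same bound.
    have h2 : 1 ≤ 2 * thr M Y (1 - 1) := by simp [thr]; omega
    exact this.trans (Nat.le_mul_of_pos_right _ h2)
  · refine (num_le_sum_deg S hi).trans ?_
    refine (Finset.sum_le_card_nsmul _ _ (2 * thr M Y (i - 1)) fun H hH => ?_).trans ?_
    · have h1 := (Finset.mem_filter.1 hH).2
      have := hI.deg_le i hc H (by omega) (by omega)
      rwa [h1] at this
    · rw [smul_eq_mul]
      exact Nat.mul_le_mul_right _ card_psize_one_le

/-- The exponents are odd because `(2 * j - 1) + (2 * (i - j) - 1) = 2 * i - 2`: each term of the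
recursion falls short of the claim by one factor `Y`. The coefficients total `6 * k * M`, namely `4
* k * M` from the minimal clauses and `2 * k * M` from the removed ones, and the missing `Y` pays
for them. -/
theorem Inv.cnt_le {S : Finset (PClause k m)} {M Y n : ℕ} {cnt : ℕ → ℕ} (hM : 1 ≤ M)
    (hm : m = 2 * n) (hY : 6 * k * M ≤ Y) (hk : 1 ≤ k) (hI : Inv (thr M Y) S cnt) (i : ℕ)
    (hi : 1 ≤ i) (hik : i ≤ k) : cnt i ≤ n * Y ^ (2 * i - 1) := by
  have hY1 : 1 ≤ Y := le_trans (by nlinarith) hY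
  induction i using Nat.strong_induction_on with
  | _ i ih =>
    rcases Nat.eq_zero_or_pos (cnt i) with hc | hc
    · omega
    have h1 := hI.le_num i
    have h2 := hI.num_le hM hi hc
    rcases hi.eq_or_lt with h | h
    · subst h
      simp only [thr, Nat.sub_self, Finset.Ico_self, Finset.sum_empty] at h1 h2
      subst hm
      simp only [mul_zero, Nat.zero_sub, pow_zero, mul_one, add_zero] at h1 h2 ⊢
      calc cnt 1 ≤ k * (2 * n) * (2 * M) := h1.trans h2
        _ = n * (4 * k * M) := by ring
        _ ≤ n * Y := Nat.mul_le_mul_left _ (le_trans (by nlinarith) hY)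
        _ = _ := by simp
    · have h3 : ∑ j ∈ Finset.Ico 1 i, cnt j * (2 * thr M Y (i - j)) ≤
          k * (n * 2 * M * Y ^ (2 * i - 2)) := by
        have : ∀ j ∈ Finset.Ico 1 i, cnt j * (2 * thr M Y (i - j)) ≤ n * 2 * M * Y ^ (2 * i - 2) := by
          intro j hj
          rw [Finset.mem_Ico] at hj
          calc _ ≤ n * Y ^ (2 * j - 1) * (2 * (M * Y ^ (2 * (i - j) - 1))) :=
                Nat.mul_le_mul_right _ (ih j hj.2 hj.1 (by omega))
            _ = n * 2 * M * (Y ^ (2 * j - 1) * Y ^ (2 * (i - j) - 1)) := by ring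
            _ = n * 2 * M * Y ^ (2 * i - 2) := by
                rw [← pow_add, show 2 * j - 1 + (2 * (i - j) - 1) = 2 * i - 2 by omega]
        refine (Finset.sum_le_card_nsmul _ _ _ this).trans ?_
        rw [Nat.card_Ico, smul_eq_mul]
        exact Nat.mul_le_mul_right _ (by omega)
      have h4 : thr M Y (i - 1) ≤ M * Y ^ (2 * i - 2) :=
        Nat.mul_le_mul_left _ (Nat.pow_le_pow_right hY1 (by omega))
      calc cnt i ≤ k * (2 * n) * (2 * (M * Y ^ (2 * i - 2))) + k * (n * 2 * M * Y ^ (2 * i - 2)) := by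
            subst hm
            refine h1.trans (Nat.add_le_add (h2.trans ?_) h3)
            gcongr
        _ = n * (6 * k * M * Y ^ (2 * i - 2)) := by ring
        _ ≤ n * (Y * Y ^ (2 * i - 2)) := by gcongr
        _ = n * Y ^ (2 * i - 1) := by
            rw [← pow_succ', show 2 * i - 2 + 1 = 2 * i - 1 by omega]

/-- A measure of the progress of the process. -/
def progress (k Y : ℕ) (cnt : ℕ → ℕ) : ℕ := ∑ i ∈ Finset.Icc 1 k, cnt i * Y ^ (2 * k + 1 - 2 * i)

/-- The weights compensate the bounds on `cnt`, so each of the `k` summands is at most `n * Y ^ (2 *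
k)`. A petal step contributes at least `M * Y ^ (2 * k)`, hence only about `k * n / M` petal steps
are possible. -/
theorem Inv.progress_le {S : Finset (PClause k m)} {M Y n : ℕ} {cnt : ℕ → ℕ} (hM : 1 ≤ M)
    (hm : m = 2 * n) (hY : 6 * k * M ≤ Y) (hk : 1 ≤ k) (hI : Inv (thr M Y) S cnt) :
    progress k Y cnt ≤ k * (n * Y ^ (2 * k)) := by
  refine (Finset.sum_le_card_nsmul _ _ (n * Y ^ (2 * k)) fun i hi => ?_).trans (by simp)
  rw [Finset.mem_Icc] at hi
  calc _ ≤ n * Y ^ (2 * i - 1) * Y ^ (2 * k + 1 - 2 * i) :=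
        Nat.mul_le_mul_right _ (hI.cnt_le hM hm hY hk i hi.1 hi.2)
    _ = n * Y ^ (2 * k) := by
        rw [mul_assoc, ← pow_add, show 2 * i - 1 + (2 * k + 1 - 2 * i) = 2 * k by omega]

theorem progress_add {Y a q : ℕ} {cnt : ℕ → ℕ} (ha : 1 ≤ a) (hak : a ≤ k) :
    progress k Y (fun j => cnt j + if j = a then q else 0) =
      progress k Y cnt + q * Y ^ (2 * k + 1 - 2 * a) := by
  simp [progress, add_mul, Finset.sum_add_distrib, ha, hak]

/-! ### The process -/

/-- A clause is true if one of the literals in it is true. -/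
def Holds (x : Fin (m + 1) → Prop) (C : PClause k m) : Prop := ∃ i, C i ≠ 0 ∧ x (C i)

theorem Holds.petal {x : Fin (m + 1) → Prop} {C H : PClause k m} (h : Ext H C) (hC : Holds x C)
    (hH : ¬ Holds x H) : Holds x (petal H C) := by
  obtain ⟨i, hi, hx⟩ := hC
  have : H i = 0 := by
    by_contra h0
    exact hH ⟨i, h0, by rwa [← h i h0]⟩
  exact ⟨i, by simpa [PClause.petal, this] using hi, by simpa [PClause.petal, this] using hx⟩

theorem exists_act {S : Finset (PClause k m)} {C : PClause k m} (hC : C ∈ S) :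
    ∃ D ∈ act S, Ext D C := by
  induction hn : psize C using Nat.strong_induction_on generalizing C with
  | _ n ih =>
    by_cases h : ∀ D ∈ S, Ext D C → D = C
    · exact ⟨C, Finset.mem_filter.2 ⟨hC, h⟩, .refl C⟩
    · push Not at h
      obtain ⟨D, hD, hE, hne⟩ := h
      have hlt : psize D < n := by
        by_contra hge
        exact hne (hE.eq_of_psize_le (by omega))
      obtain ⟨D', h1, h2⟩ := ih _ hlt hD rfl
      exact ⟨D', h1, h2.trans hE⟩

variable (fl : Finset (PClause k m) → Option (ℕ × PClause k m))

/-- Adds the heart or the petals of a flower. -/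
def step (S : Finset (PClause k m)) (heart : Bool) : Finset (PClause k m) :=
  match fl S with
  | none => S
  | some (i, H) => S ∪ if heart then {H} else petals S i H

/-- The step with number `u` of a block that consists of `d` heart steps followed by a step of the
other kind. -/
def stepD (S : Finset (PClause k m)) (u d : ℕ) : Finset (PClause k m) :=
  if u < d then step fl S true else if u = d then step fl S false else S

/-- The first `t` steps of the process, in blocks of `G` steps described by the digits `w`. -/
def run (G : ℕ) (w : ℕ → ℕ) (S : Finset (PClause k m)) : ℕ → Finset (PClause k m)
  | 0 => S
  | t + 1 => stepD fl (run G w S t) (t % G) (w (t / G))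

theorem subset_step (S : Finset (PClause k m)) (c : Bool) : S ⊆ step fl S c := by
  unfold step
  split
  · exact subset_rfl
  · exact Finset.subset_union_left

theorem subset_run (G : ℕ) (w : ℕ → ℕ) (S : Finset (PClause k m)) (t : ℕ) : S ⊆ run fl G w S t := by
  induction t with
  | zero => exact subset_rfl
  | succ t ih =>
    refine ih.trans ?_
    simp only [run, stepD]
    split_ifs
    exacts [subset_step fl _ _, subset_step fl _ _, subset_rfl]

theorem run_congr {G : ℕ} {w w' : ℕ → ℕ} (S : Finset (PClause k m)) {t : ℕ}
    (h : ∀ j < t, w (j / G) = w' (j / G)) : run fl G w S t = run fl G w' S t := by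
  induction t with
  | zero => rfl
  | succ t ih => rw [run, run, ih fun j hj => h j (by omega), h t (by omega)]

variable {fl} {M Y n : ℕ} {x : Fin (m + 1) → Prop}

/-- The assignment `x` satisfies `S`, and the process has come far. -/
def Good (fl : Finset (PClause k m) → Option (ℕ × PClause k m)) (M Y : ℕ)
    (x : Fin (m + 1) → Prop) (S : Finset (PClause k m)) (r : ℕ) : Prop :=
  (∀ C ∈ S, Holds x C) ∧ (fl S = none ∨ ∃ cnt, Inv (thr M Y) S cnt ∧ r ≤ progress k Y cnt)

theorem Good.mono {S : Finset (PClause k m)} {r r' : ℕ} (h : Good fl M Y x S r) (hr : r' ≤ r) :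
    Good fl M Y x S r' :=
  ⟨h.1, h.2.imp_right fun ⟨cnt, h1, h2⟩ => ⟨cnt, h1, hr.trans h2⟩⟩

/-- If `x` satisfies the heart, the heart is added and the progress grows by at least `1`. If not,
`x` satisfies every petal, and adding all of them, at least `thr M Y i` in number, contributes `M *
Y ^ (2 * k)`, the same amount for all `i`. -/
theorem Good.step {S : Finset (PClause k m)} {r : ℕ} (hM : 1 ≤ M) (hY : 1 ≤ Y)
    (hfl : ∀ S i H, fl S = some (i, H) → IsLeastFlower (thr M Y) S i H)
    (h : Good fl M Y x S r) :
    Good fl M Y x (step fl S true) (r + 1) ∨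
      Good fl M Y x (step fl S false) (r + M * Y ^ (2 * k)) := by
  have hθ : ∀ i, 1 ≤ thr M Y i := fun i => Nat.mul_pos hM (Nat.pow_pos hY)
  rcases h.2 with hn | ⟨cnt, hI, hr⟩
  -- Without a flower a step changes nothing, and the count `r` no longer matters.
  · left
    have : PClause.step fl S true = S := by simp [PClause.step, hn]
    rw [this]
    exact ⟨h.1, .inl hn⟩
  rcases hf : fl S with _ | ⟨i, H⟩
  · left
    have : PClause.step fl S true = S := by simp [PClause.step, hf]
    rw [this]
    exact ⟨h.1, .inl hf⟩
  have hL := hfl S i H hf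
  have hik : psize H + i ≤ k := by
    obtain ⟨C, -, hC, -⟩ := hL.exists_mem hθ
    have := psize_le C
    omega
  have h1 := hL.1.1
  have h2 := hL.1.2.1
  by_cases hx : Holds x H
  · left
    have : PClause.step fl S true = S ∪ {H} := by simp [PClause.step, hf]
    rw [this]
    refine ⟨fun C hC => ?_, .inr ⟨_, hI.insert_heart hL hθ, ?_⟩⟩
    · rcases Finset.mem_union.1 hC with hC | hC
      · exact h.1 C hC
      · rw [Finset.mem_singleton] at hC
        exact hC ▸ hx
    · rw [progress_add h2 (by omega), one_mul]
      have := Nat.pow_pos (n := 2 * k + 1 - 2 * psize H) hY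
      omega
  · right
    have : PClause.step fl S false = S ∪ petals S i H := by simp [PClause.step, hf]
    rw [this]
    refine ⟨fun C hC => ?_, .inr ⟨_, hI.add_petals hL, ?_⟩⟩
    · rcases Finset.mem_union.1 hC with hC | hC
      · exact h.1 C hC
      · obtain ⟨D, hD, rfl⟩ := Finset.mem_image.1 hC
        obtain ⟨hD1, hD2, hD3⟩ := Finset.mem_filter.1 hD
        exact (h.1 D (act_subset S hD1)).petal hD3 hx
    · rw [progress_add h1 (by omega), card_petals]
      have h3 : thr M Y i * Y ^ (2 * k + 1 - 2 * i) = M * Y ^ (2 * k) := by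
        rw [thr, mul_assoc, ← pow_add, show 2 * i - 1 + (2 * k + 1 - 2 * i) = 2 * k by omega]
      have h4 := Nat.mul_le_mul_right (Y ^ (2 * k + 1 - 2 * i)) hL.1.2.2
      omega

/-- The result of a block. -/
theorem run_block {G : ℕ} {w : ℕ → ℕ} (S : Finset (PClause k m)) (j : ℕ) {u : ℕ} (hu : u ≤ G) :
    run fl G w S (G * j + u) =
      if u ≤ w j then (fun T => step fl T true)^[u] (run fl G w S (G * j))
      else step fl ((fun T => step fl T true)^[w j] (run fl G w S (G * j))) false := by
  induction u with
  | zero => simp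
  | succ u ih =>
    have h1 : (G * j + u) % G = u := by rw [Nat.mul_add_mod]; exact Nat.mod_eq_of_lt (by omega)
    have h2 : (G * j + u) / G = j := by
      rw [Nat.mul_add_div (by omega), Nat.div_eq_of_lt (by omega), add_zero]
    rw [← add_assoc, run, ih (by omega), h1, h2, stepD]
    rcases lt_trichotomy u (w j) with h | h | h
    · rw [if_pos h, if_pos h.le, if_pos (by omega), Function.iterate_succ_apply']
    · rw [if_neg (by omega), if_pos h, if_pos h.le, if_neg (by omega), h]
    · rw [if_neg (by omega), if_neg (by omega), if_neg (by omega), if_neg (by omega)]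

/-- A block advances the progress by at least `G`, whether it consists of `G` heart steps or ends
with a petal step. One digit between `0` and `G` describes it: the number of heart steps before the
first petal step, or `G` if there is none. Recording petal steps in this way is much cheaper than
one bit for each step. -/
theorem exists_digits (hM : 1 ≤ M) (hY : 1 ≤ Y)
    (hfl : ∀ S i H, fl S = some (i, H) → IsLeastFlower (thr M Y) S i H)
    {S : Finset (PClause k m)} (hS : ∀ C ∈ S, Holds x C) (J : ℕ) :
    ∃ w : ℕ → ℕ, (∀ j, w j ≤ M * Y ^ (2 * k)) ∧
      Good fl M Y x (run fl (M * Y ^ (2 * k)) w S (M * Y ^ (2 * k) * J)) (M * Y ^ (2 * k) * J) := by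
  set G := M * Y ^ (2 * k) with hG
  have hGpos : 0 < G := Nat.mul_pos hM (Nat.pow_pos hY)
  induction J with
  | zero => exact ⟨fun _ => 0, fun _ => Nat.zero_le _, hS, .inr ⟨_, .zero _ _, by simp⟩⟩
  | succ J ih =>
    obtain ⟨w, hw, hgood⟩ := ih
    set T := run fl G w S (G * J) with hT
    have key : ∀ t ≤ G, Good fl M Y x ((fun T => step fl T true)^[t] T) (G * J + t) ∨
        ∃ d < t, Good fl M Y x (step fl ((fun T => step fl T true)^[d] T) false) (G * J + G) := by
      intro t
      induction t with
      | zero => exact fun _ => .inl hgood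
      | succ t iht =>
        intro ht
        rcases iht (by omega) with h | ⟨d, hd, h⟩
        · rcases h.step hM hY hfl with h | h
          · left
            rw [Function.iterate_succ_apply']
            exact h
          · exact .inr ⟨t, by omega, h.mono (by omega)⟩
        · exact .inr ⟨d, by omega, h⟩
    -- Changing the digit number `J` does not disturb the first `J` blocks.
    have hdig : ∀ d ≤ G, run fl G (Function.update w J d) S (G * (J + 1)) =
        if G ≤ d then (fun T => step fl T true)^[G] T
        else step fl ((fun T => step fl T true)^[d] T) false := fun d hd => by
      rw [mul_add, mul_one, run_block S J le_rfl, Function.update_self,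
        run_congr (w' := w) fl S fun j hj => Function.update_of_ne (by
          have : j / G < J := by rw [Nat.div_lt_iff_lt_mul hGpos, mul_comm]; exact hj
          omega) _ _]
    rcases key G le_rfl with h | ⟨d, hd, h⟩
    · refine ⟨Function.update w J G, fun j => ?_, ?_⟩
      · rw [Function.update_apply]; split_ifs; exacts [le_rfl, hw j]
      · rw [hdig G le_rfl, if_pos le_rfl]
        exact h
    · refine ⟨Function.update w J d, fun j => ?_, ?_⟩
      · rw [Function.update_apply]; split_ifs; exacts [hd.le, hw j]
      · rw [hdig d hd.le, if_neg (by omega)]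
        exact h

/-- Without flowers every single literal has small degree at each size from `2` on. In addition
there are at most `k * m` clauses of size one, and the empty clause. -/
theorem card_act_le {S : Finset (PClause k m)} (hM : 1 ≤ M) (hY : 1 ≤ Y)
    (h : ∀ i H, ¬ IsFlower (thr M Y) S i H) :
    (act S).card ≤ 1 + k * (k * m * (M * Y ^ (2 * k))) := by
  have h0 : num S 0 ≤ 1 := by
    refine Finset.card_le_one.2 fun C hC D hD => ?_
    have hz : ∀ C : PClause k m, psize C = 0 → C = 0 := fun C hC => by
      funext i
      by_contra hne
      have : i ∈ Finset.univ.filter fun i => C i ≠ 0 := by simpa using hne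
      rw [Finset.card_eq_zero.1 hC] at this
      simp at this
    rw [hz C (Finset.mem_filter.1 hC).2, hz D (Finset.mem_filter.1 hD).2]
  have hG : 1 ≤ M * Y ^ (2 * k) := Nat.mul_pos hM (Nat.pow_pos hY)
  have h1 : ∀ c ∈ Finset.Icc 1 k, num S c ≤ k * m * (M * Y ^ (2 * k)) := fun c hc => by
    rw [Finset.mem_Icc] at hc
    rcases hc.1.eq_or_lt with h1 | h1
    · subst h1
      exact (num_one_le S).trans (Nat.le_mul_of_pos_right _ hG)
    · refine (num_le_sum_deg S hc.1).trans ((Finset.sum_le_card_nsmul _ _ (M * Y ^ (2 * k))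
        fun H hH => ?_).trans (Nat.mul_le_mul_right _ card_psize_one_le))
      have hH1 := (Finset.mem_filter.1 hH).2
      have := h (c - 1) H
      simp only [IsFlower, not_and, not_le] at this
      have := this (by omega) (by omega)
      rw [show psize H + (c - 1) = c by omega] at this
      exact this.le.trans (Nat.mul_le_mul_left _ (Nat.pow_le_pow_right hY (by omega)))
  have h2 : (act S).card ≤ ∑ c ∈ Finset.range (k + 1), num S c := by
    rw [Finset.card_eq_sum_card_fiberwise (f := psize) (t := Finset.range (k + 1))
      fun C _ => by simpa using Nat.lt_succ_of_le (psize_le C)]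
    rfl
  refine h2.trans ?_
  rw [Finset.sum_range_succ', add_comm]
  refine Nat.add_le_add h0 ?_
  refine (Finset.sum_le_card_nsmul _ _ _ fun c hc => h1 (c + 1) (by
    rw [Finset.mem_range] at hc
    rw [Finset.mem_Icc]; omega)).trans (by simp)

/-- Every satisfiable formula has a sparse satisfiable strengthening that is found by the process
with suitable digits. -/
theorem exists_sparse (hM : 1 ≤ M) (hk : 1 ≤ k) (hm : m = 2 * n) (hY : 6 * k * M ≤ Y)
    (hfl : ∀ S i H, fl S = some (i, H) → IsLeastFlower (thr M Y) S i H)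
    (hfl' : ∀ S, fl S = none → ∀ i H, ¬ IsFlower (thr M Y) S i H)
    {S : Finset (PClause k m)} (hS : ∀ C ∈ S, Holds x C) {J : ℕ} (hJ : k * n < M * J) :
    ∃ w : ℕ → ℕ, (∀ j, w j ≤ M * Y ^ (2 * k)) ∧
      (∀ C ∈ run fl (M * Y ^ (2 * k)) w S (M * Y ^ (2 * k) * J), Holds x C) ∧
      (act (run fl (M * Y ^ (2 * k)) w S (M * Y ^ (2 * k) * J))).card ≤
        1 + k * (k * m * (M * Y ^ (2 * k))) := by
  have hY1 : 1 ≤ Y := le_trans (by nlinarith) hY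
  obtain ⟨w, hw, h⟩ := exists_digits hM hY1 hfl hS J
  refine ⟨w, hw, h.1, card_act_le hM hY1 (hfl' _ ?_)⟩
  rcases h.2 with h | ⟨cnt, hI, hr⟩
  · exact h
  -- Were a flower left after `J` blocks, the progress would be at least `M * J * Y ^ (2 * k)`, more
  -- than the maximum `k * n * Y ^ (2 * k)`.
  · have h1 := hr.trans (hI.progress_le hM hm hY hk)
    have h2 := Nat.mul_lt_mul_of_pos_right hJ (Nat.pow_pos (n := 2 * k) hY1)
    nlinarith

end PClause

/-! ### Digits -/

theorem sum_range_pow_eq {m R : ℕ} (G : ℕ → ℕ) (F : (Fin R → Fin m) → ℕ)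
    (h : ∀ j (hj : j < m ^ R), G j = F (finFunctionFinEquiv.symm ⟨j, hj⟩)) :
    ∑ j ∈ Finset.range (m ^ R), G j = ∑ g, F g := by
  rw [Finset.sum_range, ← Equiv.sum_comp finFunctionFinEquiv.symm]
  exact Finset.sum_congr rfl fun j _ => h j j.2

theorem finFunctionFinEquiv_symm_val {m R : ℕ} (j : Fin (m ^ R)) (s : Fin R) :
    (finFunctionFinEquiv.symm j s : ℕ) = j / m ^ (s : ℕ) % m := rfl

/-- The rule behind the tensor power: a sum over all strings of digits of a product over the digits
is a power of a single sum. -/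
theorem sum_range_pow_prod (m R : ℕ) (f : ℕ → ℕ) :
    ∑ j ∈ Finset.range (m ^ R), ∏ s ∈ Finset.range R, f (j / m ^ s % m) =
      (∑ i ∈ Finset.range m, f i) ^ R := by
  rw [sum_range_pow_eq _ (fun g => ∏ s, f (g s)) fun j hj => ?_, Finset.sum_range, Fintype.sum_pow]
  rw [Finset.prod_range]
  rfl

theorem exists_digits_eq {m R : ℕ} (f : ℕ → ℕ) (hf : ∀ j < R, f j < m) :
    ∃ x < m ^ R, ∀ j < R, x / m ^ j % m = f j := by
  refine ⟨finFunctionFinEquiv fun j : Fin R => ⟨f j, hf j j.2⟩, Fin.is_lt _, fun j hj => ?_⟩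
  have := finFunctionFinEquiv_symm_val
    (finFunctionFinEquiv fun j : Fin R => (⟨f j, hf j j.2⟩ : Fin m)) ⟨j, hj⟩
  rw [Equiv.symm_apply_apply] at this
  exact this.symm

/-! ### The protocol for set disjointness -/

namespace Protocol

/-- Alice's polynomial number `t`, at `r`. -/
def psiA (q l : ℕ) (x : ℕ → ℕ) (r t : ℕ) : ℕ :=
  ∑ u ∈ Finset.range l, x (t * l + u) * (r ^ u % q)

/-- Bob's polynomial number `t`, at `r`. -/
def psiB (q l : ℕ) (y : ℕ → ℕ) (r t : ℕ) : ℕ :=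
  (∑ u ∈ Finset.range l, y (t * l + u) * (r ^ (l - 1 - u) % q)) % q

/-- The fingerprint of the digits `w`. -/
def hash (q J : ℕ) (w : ℕ → ℕ) (r : ℕ) : ℕ := (∑ j ∈ Finset.range J, w j * (r ^ j % q)) % q

/-- Merlin's polynomial, at `r`. -/
def phi (q l : ℕ) (p : ℕ → ℕ) (r : ℕ) : ℕ :=
  (∑ u ∈ Finset.range (2 * l), p u * (if u = l - 1 then 0 else 1) * (r ^ u % q)) % q

/-- Alice accepts, given the random element, Bob's messages, and his fingerprint. -/
def accA (q l T J : ℕ) (p x w : ℕ → ℕ) (j : ℕ) : Prop :=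
  phi q l p (j % q) =
    (∑ t ∈ Finset.range T, j / q ^ (t + 1) % q * psiA q l x (j % q) t) % q ∧
  j / q ^ (T + 1) % q = hash q J w (j % q)

/-- The messages are those that Bob sends. -/
def accB (q l T J : ℕ) (y w : ℕ → ℕ) (j : ℕ) : Prop :=
  (∀ t < T, j / q ^ (t + 1) % q = psiB q l y (j % q) t) ∧
  j / q ^ (T + 1) % q = hash q J w (j % q)

instance {q l T J : ℕ} {p x w : ℕ → ℕ} {j : ℕ} : Decidable (accA q l T J p x w j) :=
  inferInstanceAs (Decidable (_ ∧ _))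

instance {q l T J : ℕ} {y w : ℕ → ℕ} {j : ℕ} : Decidable (accB q l T J y w j) :=
  inferInstanceAs (Decidable (_ ∧ _))

variable {q l T J : ℕ} {p x y w w' : ℕ → ℕ}

/-- The messages that Bob sends on the random element `r`. -/
def msg (q l T J : ℕ) [NeZero q] (y w : ℕ → ℕ) (r : Fin q) : Fin (T + 2) → Fin q := fun i =>
  if (i : ℕ) = 0 then r else if (i : ℕ) ≤ T then Fin.ofNat q (psiB q l y r (i - 1))
    else Fin.ofNat q (hash q J w r)

theorem psiB_lt [NeZero q] (r t : ℕ) : psiB q l y r t < q := Nat.mod_lt _ (NeZero.pos q)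
theorem hash_lt [NeZero q] (r : ℕ) : hash q J w r < q := Nat.mod_lt _ (NeZero.pos q)

theorem accB_iff [NeZero q] (j : Fin (q ^ (T + 2))) : accB q l T J y w j ↔
    finFunctionFinEquiv.symm j = msg q l T J y w (finFunctionFinEquiv.symm j 0) := by
  have hr : (finFunctionFinEquiv.symm j 0 : ℕ) = j % q := by
    rw [finFunctionFinEquiv_symm_val]; simp
  constructor
  · intro ⟨h1, h2⟩
    funext i
    apply Fin.ext
    unfold msg
    split_ifs with hi hi'
    · rw [show i = 0 from Fin.ext hi]
    · rw [finFunctionFinEquiv_symm_val, hr]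
      have := h1 (i - 1) (by omega)
      rw [show (i : ℕ) - 1 + 1 = i by omega] at this
      rw [this]
      exact (Nat.mod_eq_of_lt (psiB_lt _ _)).symm
    · rw [finFunctionFinEquiv_symm_val, hr, show (i : ℕ) = T + 1 by omega, h2]
      exact (Nat.mod_eq_of_lt (hash_lt _)).symm
  · intro h
    refine ⟨fun t ht => ?_, ?_⟩
    · have h1 := congrArg Fin.val (congrFun h ⟨t + 1, by omega⟩)
      rw [finFunctionFinEquiv_symm_val] at h1
      rw [h1]
      simp only [msg, Nat.add_eq_zero_iff, one_ne_zero, and_false, if_false,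
        if_pos (show t + 1 ≤ T by omega), hr]
      exact Nat.mod_eq_of_lt (psiB_lt _ _)
    · have h1 := congrArg Fin.val (congrFun h ⟨T + 1, by omega⟩)
      rw [finFunctionFinEquiv_symm_val] at h1
      rw [h1]
      simp only [msg, Nat.add_eq_zero_iff, one_ne_zero, and_false, if_false,
        if_neg (show ¬ T + 1 ≤ T by omega), hr]
      exact Nat.mod_eq_of_lt (hash_lt _)

/-- Summing over all messages amounts to summing over the random elements. -/
theorem sum_accB [NeZero q] (F : ℕ → ℕ) :
    ∑ j ∈ Finset.range (q ^ (T + 2)), (if accB q l T J y w j then F j else 0) =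
      ∑ r : Fin q, F (finFunctionFinEquiv (msg q l T J y w r)) := by
  rw [sum_range_pow_eq _ (fun g => if g = msg q l T J y w (g 0) then F (finFunctionFinEquiv g)
    else 0) fun j hj => by
      have := accB_iff (l := l) (J := J) (y := y) (w := w) ⟨j, hj⟩
      simp only at this
      simp only [this, Equiv.apply_symm_apply]]
  have : ∀ g : Fin (T + 2) → Fin q, (if g = msg q l T J y w (g 0) then
      F (finFunctionFinEquiv g) else 0) =
      ∑ r : Fin q, if g = msg q l T J y w r then F (finFunctionFinEquiv g) else 0 := fun g => by
    rw [Finset.sum_eq_single (g 0)]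
    · intro r _ hr
      rw [if_neg]
      intro h
      exact hr (by rw [h]; simp [msg])
    · simp
  simp only [this]
  rw [Finset.sum_comm]
  simp

theorem sum_accB_one [NeZero q] :
    ∑ j ∈ Finset.range (q ^ (T + 2)), (if accB q l T J y w j then 1 else 0) = q := by
  rw [sum_accB fun _ => 1]
  simp

/-- On a transcript actually sent by Bob, Alice's two checks concern only the random element and the
inputs of both, not the encoding of the messages. -/
theorem accA_msg [NeZero q] (r : Fin q) :
    accA q l T J p x w (finFunctionFinEquiv (msg q l T J y w' r)) ↔
      phi q l p r = (∑ t ∈ Finset.range T, psiB q l y r t * psiA q l x r t) % q ∧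
      hash q J w' r = hash q J w r := by
  set j := finFunctionFinEquiv (msg q l T J y w' r) with hj
  have h : accB q l T J y w' j := by
    rw [accB_iff, hj, Equiv.symm_apply_apply]
    simp [msg]
  have hr : (j : ℕ) % q = r := by
    have h0 := finFunctionFinEquiv_symm_val j 0
    rw [hj, Equiv.symm_apply_apply] at h0
    simp only [Fin.val_zero, pow_zero, Nat.div_one] at h0
    rw [← h0]
    simp [msg]
  unfold accA
  rw [h.2, hr, Finset.sum_congr rfl fun t ht => by rw [h.1 t (Finset.mem_range.1 ht), hr]]

theorem sum_accA_accB [NeZero q] :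
    ∑ j ∈ Finset.range (q ^ (T + 2)),
      (if accA q l T J p x w j then 1 else 0) * (if accB q l T J y w' j then 1 else 0) =
    (Finset.univ.filter fun r : Fin q =>
      phi q l p r = (∑ t ∈ Finset.range T, psiB q l y r t * psiA q l x r t) % q ∧
      hash q J w' r = hash q J w r).card := by
  simp only [mul_ite, mul_one, mul_zero]
  rw [sum_accB fun j => if accA q l T J p x w j then 1 else 0]
  simp only [accA_msg, Finset.card_filter]

/-! ### Completeness and soundness by counting roots -/

open Polynomial

variable [Fact q.Prime]

theorem card_root_le (D : (ZMod q)[X]) (hD : D ≠ 0) :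
    (Finset.univ.filter fun r : Fin q => D.eval ((r : ℕ) : ZMod q) = 0).card ≤ D.natDegree := by
  classical
  have hinj : Function.Injective fun r : Fin q => ((r : ℕ) : ZMod q) := fun r s h => by
    have := (ZMod.natCast_eq_natCast_iff' _ _ _).1 h
    rw [Nat.mod_eq_of_lt r.2, Nat.mod_eq_of_lt s.2] at this
    exact Fin.ext this
  rw [← Finset.card_image_of_injective _ hinj]
  refine le_trans (Finset.card_le_card (t := D.roots.toFinset) fun z hz => ?_)
    (D.roots.toFinset_card_le.trans D.card_roots')
  obtain ⟨r, hr, rfl⟩ := Finset.mem_image.1 hz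
  simpa [hD] using hr

/-- The polynomial with the given coefficients. -/
noncomputable def poly (q n : ℕ) (c : ℕ → ℕ) : (ZMod q)[X] :=
  ∑ u ∈ Finset.range n, C (c u : ZMod q) * X ^ u

theorem coeff_poly (n : ℕ) (c : ℕ → ℕ) (i : ℕ) :
    (poly q n c).coeff i = if i < n then (c i : ZMod q) else 0 := by
  simp [poly, Polynomial.finsetSum_coeff, Polynomial.coeff_X_pow]

theorem eval_poly (n : ℕ) (c : ℕ → ℕ) (r : ℕ) : (poly q n c).eval (r : ZMod q) =
    ((∑ u ∈ Finset.range n, c u * (r ^ u % q) : ℕ) : ZMod q) := by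
  simp [poly, Polynomial.eval_finsetSum]

theorem natDegree_lt_of_coeff {D : (ZMod q)[X]} {n : ℕ} (hn : 0 < n)
    (h : ∀ i, n ≤ i → D.coeff i = 0) : D.natDegree < n := by
  have := (Polynomial.natDegree_le_iff_coeff_eq_zero (p := D) (n := n - 1)).2
    fun i hi => h i (by omega)
  omega

/-- The fingerprint evaluates the polynomial whose coefficients are the digits. Digits below `q`
that differ stay different in the field, so the difference is a nonzero polynomial of degree below
`J`. -/
theorem card_hash_le (hw : ∀ j < J, w j < q) (hw' : ∀ j < J, w' j < q)
    (hne : ∃ j < J, w j ≠ w' j) :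
    (Finset.univ.filter fun r : Fin q => hash q J w' r = hash q J w r).card ≤ J := by
  obtain ⟨j, hj, hne⟩ := hne
  have hD : poly q J w' - poly q J w ≠ 0 := fun h => by
    have := congrArg (fun D => D.coeff j) h
    simp only [Polynomial.coeff_sub, coeff_poly, if_pos hj, Polynomial.coeff_zero, sub_eq_zero] at this
    rw [ZMod.natCast_eq_natCast_iff', Nat.mod_eq_of_lt (hw j hj), Nat.mod_eq_of_lt (hw' j hj)] at this
    exact hne this.symm
  refine le_trans (Finset.card_le_card fun r hr => ?_) ((card_root_le _ hD).trans
    (natDegree_lt_of_coeff (n := J) (by omega) fun i hi => ?_).le)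
  · have hr := (Finset.mem_filter.1 hr).2
    refine Finset.mem_filter.2 ⟨Finset.mem_univ _, ?_⟩
    rw [Polynomial.eval_sub, eval_poly, eval_poly, sub_eq_zero, ZMod.natCast_eq_natCast_iff']
    exact hr
  · rw [Polynomial.coeff_sub, coeff_poly, coeff_poly, if_neg (by omega), if_neg (by omega), sub_zero]

/-- The sum of the products of Alice's and Bob's polynomials. -/
noncomputable def prodPoly (q l T : ℕ) (x y : ℕ → ℕ) : (ZMod q)[X] :=
  ∑ t ∈ Finset.range T, (poly q l fun u => y (t * l + (l - 1 - u))) *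
    poly q l fun u => x (t * l + u)

theorem eval_prodPoly (r : ℕ) : (prodPoly q l T x y).eval (r : ZMod q) =
    ((∑ t ∈ Finset.range T, psiB q l y r t * psiA q l x r t : ℕ) : ZMod q) := by
  rw [prodPoly, Polynomial.eval_finsetSum]
  simp only [Polynomial.eval_mul, eval_poly, Nat.cast_sum, Nat.cast_mul]
  refine Finset.sum_congr rfl fun t _ => ?_
  congr 1
  · rw [psiB, ZMod.natCast_mod, Nat.cast_sum, ← Finset.sum_range_reflect]
    refine Finset.sum_congr rfl fun u hu => ?_
    rw [Finset.mem_range] at hu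
    rw [show l - 1 - (l - 1 - u) = u by omega]
    push_cast
    rfl
  · rw [psiA]
    push_cast
    rfl

/-- Bob's coefficients are reversed within each block, so the pairs of equal positions, and only
these, meet in degree `l - 1`. -/
theorem coeff_prodPoly (hl : 0 < l) : (prodPoly q l T x y).coeff (l - 1) =
    ((∑ s ∈ Finset.range (T * l), x s * y s : ℕ) : ZMod q) := by
  have h1 : ∑ s ∈ Finset.range (T * l), x s * y s =
      ∑ t ∈ Finset.range T, ∑ u ∈ Finset.range l, x (t * l + u) * y (t * l + u) := by
    induction T with
    | zero => simp
    | succ T ih => rw [add_mul, one_mul, Finset.sum_range_add, ih, Finset.sum_range_succ]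
  rw [h1, prodPoly, Polynomial.finsetSum_coeff, Nat.cast_sum]
  refine Finset.sum_congr rfl fun t _ => ?_
  rw [Polynomial.coeff_mul, Finset.Nat.sum_antidiagonal_eq_sum_range_succ_mk,
    show (l - 1).succ = l by omega, ← Finset.sum_range_reflect, Nat.cast_sum]
  refine Finset.sum_congr rfl fun u hu => ?_
  rw [Finset.mem_range] at hu
  rw [coeff_poly, coeff_poly, if_pos (by omega), if_pos (by omega),
    show l - 1 - (l - 1 - u) = u by omega, mul_comm]
  push_cast
  rfl

theorem natDegree_poly_lt (hl : 0 < l) (c : ℕ → ℕ) : (poly q l c).natDegree < l :=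
  natDegree_lt_of_coeff hl fun i hi => by rw [coeff_poly, if_neg (by omega)]

theorem coeff_prodPoly_eq_zero (hl : 0 < l) {i : ℕ} (hi : 2 * l ≤ i) :
    (prodPoly q l T x y).coeff i = 0 := by
  rw [prodPoly, Polynomial.finsetSum_coeff]
  refine Finset.sum_eq_zero fun t _ => Polynomial.coeff_eq_zero_of_natDegree_lt ?_
  refine lt_of_le_of_lt Polynomial.natDegree_mul_le ?_
  have h1 := natDegree_poly_lt (q := q) hl fun u => y (t * l + (l - 1 - u))
  have h2 := natDegree_poly_lt (q := q) hl fun u => x (t * l + u)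
  omega

theorem phi_eq_iff (r : Fin q) :
    phi q l p r = (∑ t ∈ Finset.range T, psiB q l y r t * psiA q l x r t) % q ↔
      (poly q (2 * l) (fun u => p u * if u = l - 1 then 0 else 1) - prodPoly q l T x y).eval
        ((r : ℕ) : ZMod q) = 0 := by
  rw [Polynomial.eval_sub, eval_poly, eval_prodPoly, sub_eq_zero, ZMod.natCast_eq_natCast_iff', phi]

/-- Merlin's polynomial has coefficient `0` in degree `l - 1` by construction. The true one has the
size of the intersection there, which is positive and below `q`. The two polynomials differ, and
their difference has degree below `2 * l`. -/
theorem card_phi_le (hl : 0 < l) (h0 : 0 < ∑ s ∈ Finset.range (T * l), x s * y s)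
    (hq : ∑ s ∈ Finset.range (T * l), x s * y s < q) :
    (Finset.univ.filter fun r : Fin q => phi q l p r =
      (∑ t ∈ Finset.range T, psiB q l y r t * psiA q l x r t) % q).card ≤ 2 * l := by
  simp only [phi_eq_iff]
  refine (card_root_le _ fun h => ?_).trans (natDegree_lt_of_coeff (by omega) fun i hi => ?_).le
  · have := congrArg (fun D => D.coeff (l - 1)) h
    simp only [Polynomial.coeff_sub, coeff_poly, coeff_prodPoly hl, Polynomial.coeff_zero,
      if_pos (show l - 1 < 2 * l by omega), if_true, mul_zero, Nat.cast_zero, zero_sub,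
      neg_eq_zero] at this
    rw [ZMod.natCast_eq_zero_iff] at this
    exact absurd (Nat.le_of_dvd h0 this) (by omega)
  · rw [Polynomial.coeff_sub, coeff_poly, coeff_prodPoly_eq_zero hl hi, if_neg (by omega), sub_zero]

/-- Merlin sends the coefficients of the true polynomial. Suppressing the one of degree `l - 1`
loses nothing, because it vanishes for disjoint sets. -/
theorem exists_phi (hl : 0 < l) (h0 : ∑ s ∈ Finset.range (T * l), x s * y s = 0) :
    ∃ p : ℕ → ℕ, (∀ u, p u < q) ∧ ∀ r : Fin q, phi q l p r =
      (∑ t ∈ Finset.range T, psiB q l y r t * psiA q l x r t) % q := by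
  refine ⟨fun u => ((prodPoly q l T x y).coeff u).val, fun u => ZMod.val_lt _, fun r => ?_⟩
  have : poly q (2 * l) (fun u => ((prodPoly q l T x y).coeff u).val *
      if u = l - 1 then 0 else 1) = prodPoly q l T x y := by
    ext i
    rw [coeff_poly]
    split_ifs with hi hi'
    · subst hi'
      rw [coeff_prodPoly hl, h0]
      simp
    · simp
    · exact (coeff_prodPoly_eq_zero hl (by omega)).symm
  rw [phi_eq_iff, this, sub_self, Polynomial.eval_zero]

end Protocol

/-! ### Notation for expressions -/

namespace Ex

instance : Add Ex := ⟨.bin .add⟩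
instance : Sub Ex := ⟨.bin .sub⟩
instance : Mul Ex := ⟨.bin .mul⟩
instance : Div Ex := ⟨.bin .div⟩
instance (c : ℕ) : OfNat Ex c := ⟨.const c⟩

/-- `1` if `e < f`, and `0` otherwise -/
def lt (e f : Ex) : Ex := 1 - (e + 1 - f)

/-- `1` if `e = f`, and `0` otherwise -/
def eq (e f : Ex) : Ex := 1 - ((e - f) + (f - e))

/-- `1` if `e = 0`, and `0` otherwise -/
def not (e : Ex) : Ex := 1 - e

def mod (e f : Ex) : Ex := e - e / f * f

/-- The least value of `x` below `n` for which `e` is not `0`. -/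
def least (x y : ℕ) (n e : Ex) : Ex := .sum y n (not (.sum x (.var y + 1) e))

section Eval
variable (v : ℕ → ℕ) (r : ℕ → ℕ → ℕ) (e f : Ex)

@[simp] theorem eval_var (x : ℕ) : (Ex.var x).eval v r = v x := rfl
@[simp] theorem eval_const (x : ℕ) : (Ex.const x).eval v r = x := rfl
@[simp] theorem eval_read (a : ℕ) : (Ex.read a e).eval v r = r a (e.eval v r) := rfl
@[simp] theorem eval_sum (x : ℕ) : (Ex.sum x e f).eval v r =
  ∑ i ∈ Finset.range (e.eval v r), f.eval (Function.update v x i) r := rfl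
@[simp] theorem eval_add : (e + f).eval v r = e.eval v r + f.eval v r := rfl
@[simp] theorem eval_sub : (e - f).eval v r = e.eval v r - f.eval v r := rfl
@[simp] theorem eval_mul : (e * f).eval v r = e.eval v r * f.eval v r := rfl
@[simp] theorem eval_div : (e / f).eval v r = e.eval v r / f.eval v r := rfl
@[simp] theorem eval_zero : (0 : Ex).eval v r = 0 := rfl
@[simp] theorem eval_one : (1 : Ex).eval v r = 1 := rfl
@[simp] theorem eval_ofNat (c : ℕ) [c.AtLeastTwo] :
  (ofNat(c) : Ex).eval v r = (OfNat.ofNat c : ℕ) := rfl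

@[simp] theorem eval_lt : (lt e f).eval v r = if e.eval v r < f.eval v r then 1 else 0 := by
  simp only [lt, eval_add, eval_sub, eval_one]
  split_ifs <;> omega

@[simp] theorem eval_eq : (eq e f).eval v r = if e.eval v r = f.eval v r then 1 else 0 := by
  simp only [eq, eval_add, eval_sub, eval_one]
  split_ifs <;> omega

@[simp] theorem eval_not : (not e).eval v r = if e.eval v r = 0 then 1 else 0 := by
  simp only [not, eval_sub, eval_one]
  split_ifs <;> omega

@[simp] theorem eval_mod : (mod e f).eval v r = e.eval v r % f.eval v r :=
  sub_mul_div_eq_mod _ _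

theorem ite_mul_ite (p q : Prop) [Decidable p] [Decidable q] :
    (if p then 1 else 0) * (if q then 1 else 0) = if p ∧ q then 1 else 0 := by
  by_cases hp : p <;> by_cases hq : q <;> simp [hp, hq]

theorem eval_pow {b e m : Ex} (hm : b.eval v r ^ e.eval v r ≤ m.eval v r) (h : 1 ≤ m.eval v r) :
    (Ex.pow b e m).eval v r = b.eval v r ^ e.eval v r := by
  rw [eval, powMod_eq h, Nat.mod_eq_of_lt (by omega)]

end Eval

section Arrays
variable (e f : Ex)

@[simp] theorem arrays_add : (e + f).arrays = e.arrays ++ f.arrays := rfl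
@[simp] theorem arrays_sub : (e - f).arrays = e.arrays ++ f.arrays := rfl
@[simp] theorem arrays_mul : (e * f).arrays = e.arrays ++ f.arrays := rfl
@[simp] theorem arrays_div : (e / f).arrays = e.arrays ++ f.arrays := rfl
@[simp] theorem arrays_zero : (0 : Ex).arrays = [] := rfl
@[simp] theorem arrays_one : (1 : Ex).arrays = [] := rfl
@[simp] theorem arrays_ofNat (c : ℕ) [c.AtLeastTwo] : (ofNat(c) : Ex).arrays = [] := rfl
@[simp] theorem arrays_lt : (lt e f).arrays = e.arrays ++ f.arrays := by simp [lt]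
@[simp] theorem mem_arrays_eq (a : ℕ) :
    a ∈ (eq e f).arrays ↔ a ∈ e.arrays ∨ a ∈ f.arrays := by simp [eq]; tauto
@[simp] theorem arrays_not : (not e).arrays = e.arrays := by simp [not]
@[simp] theorem mem_arrays_mod (a : ℕ) :
    a ∈ (mod e f).arrays ↔ a ∈ e.arrays ∨ a ∈ f.arrays := by simp [mod]

end Arrays

end Ex

/-- The least number below `B` at which `P` does not vanish, or `B`. -/
def leastN (P : ℕ → ℕ) (B : ℕ) : ℕ :=
  ∑ j ∈ Finset.range B, if ∑ i ∈ Finset.range (j + 1), P i = 0 then 1 else 0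

theorem leastN_eq {P : ℕ → ℕ} {B z : ℕ} (hz : z ≤ B) (h : ∀ i < z, P i = 0)
    (h' : z < B → P z ≠ 0) : leastN P B = z := by
  unfold leastN
  have : ∀ j < B, (∑ i ∈ Finset.range (j + 1), P i = 0 ↔ j < z) := fun j hj => by
    rw [Finset.sum_eq_zero_iff]
    constructor
    · intro h0
      by_contra hjz
      exact h' (by omega) (h0 z (by simp; omega))
    · intro hjz i hi
      rw [Finset.mem_range] at hi
      exact h i (by omega)
  rw [Finset.sum_congr rfl fun j hj => by rw [if_congr (this j (Finset.mem_range.1 hj)) rfl rfl],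
    ← Finset.card_filter]
  have : (Finset.range B).filter (fun j => j < z) = Finset.range z := by ext; simp; omega
  rw [this, Finset.card_range]

theorem leastN_spec (P : ℕ → ℕ) (B : ℕ) : leastN P B ≤ B ∧ (∀ i < leastN P B, P i = 0) ∧
    (leastN P B < B → P (leastN P B) ≠ 0) := by
  by_cases h : ∃ z < B, P z ≠ 0
  · classical
    have h1 := Nat.find_spec h
    have h2 : ∀ i < Nat.find h, P i = 0 := fun i hi => by
      have := Nat.find_min h hi
      simp only [not_and, not_not] at this
      exact this (hi.trans h1.1)
    rw [leastN_eq h1.1.le h2 fun _ => h1.2]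
    exact ⟨h1.1.le, h2, fun _ => h1.2⟩
  · push Not at h
    rw [leastN_eq le_rfl h fun h => absurd h (lt_irrefl B)]
    exact ⟨le_rfl, h, fun h => absurd h (lt_irrefl B)⟩

@[simp] theorem Ex.eval_least (x y : ℕ) (n e : Ex) (v r) : (least x y n e).eval v r =
    ∑ j ∈ Finset.range (n.eval v r),
      if ∑ i ∈ Finset.range (j + 1), e.eval (Function.update (Function.update v y j) x i) r = 0
        then 1 else 0 := by
  simp [least]

/-! ### Partial clauses as numbers -/

namespace PClause
variable {k m : ℕ}

/-- The number of a partial clause. -/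
def enc (C : PClause k m) : ℕ := finFunctionFinEquiv C

/-- The partial clause with the given number. -/
def dec (k m c : ℕ) : PClause k m := fun i => Fin.ofNat (m + 1) (c / (m + 1) ^ (i : ℕ))

theorem enc_lt (C : PClause k m) : enc C < (m + 1) ^ k := Fin.is_lt _

theorem dig_enc (C : PClause k m) (i : Fin k) : enc C / (m + 1) ^ (i : ℕ) % (m + 1) = C i := by
  have := finFunctionFinEquiv_symm_val (finFunctionFinEquiv C) i
  rw [Equiv.symm_apply_apply] at this
  exact this.symm

theorem dec_enc (C : PClause k m) : dec k m (enc C) = C := by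
  funext i
  exact Fin.ext (dig_enc C i)

theorem enc_dec {c : ℕ} (hc : c < (m + 1) ^ k) : enc (dec k m c) = c := by
  have : dec k m c = finFunctionFinEquiv.symm ⟨c, hc⟩ := by
    funext i
    exact Fin.ext rfl
  rw [this, enc, Equiv.apply_symm_apply]

theorem enc_injective : Function.Injective (enc : PClause k m → ℕ) := fun C D h => by
  rw [← dec_enc C, h, dec_enc]

theorem exists_enc {c : ℕ} (hc : c < (m + 1) ^ k) : ∃ C : PClause k m, enc C = c :=
  ⟨_, enc_dec hc⟩

theorem enc_eq_sum (C : PClause k m) : enc C = ∑ i, (C i : ℕ) * (m + 1) ^ (i : ℕ) := by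
  rw [enc, finFunctionFinEquiv_apply]

theorem sum_range_enc (F : ℕ → ℕ) :
    ∑ c ∈ Finset.range ((m + 1) ^ k), F c = ∑ C : PClause k m, F (enc C) :=
  sum_range_pow_eq F (fun C => F (enc C)) fun j hj => by rw [enc, Equiv.apply_symm_apply]

/-- The digits of the heart are removed without a borrow, so the machine finds petals by a
subtraction. -/
theorem enc_petal {H C : PClause k m} (h : Ext H C) : enc (petal H C) = enc C - enc H := by
  have : enc (petal H C) + enc H = enc C := by
    rw [enc_eq_sum, enc_eq_sum, enc_eq_sum, ← Finset.sum_add_distrib]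
    refine Finset.sum_congr rfl fun i _ => ?_
    by_cases hi : H i = 0
    · simp [petal, hi]
    · simp [petal, hi, h i hi]
  omega

/-- The indicator function of a set of partial clauses. -/
def ind (S : Finset (PClause k m)) (c : ℕ) : ℕ :=
  if c < (m + 1) ^ k then if dec k m c ∈ S then 1 else 0 else 0

@[simp] theorem ind_enc (S : Finset (PClause k m)) (C : PClause k m) :
    ind S (enc C) = if C ∈ S then 1 else 0 := by
  rw [ind, if_pos (enc_lt C), dec_enc]

theorem ind_of_le (S : Finset (PClause k m)) {c : ℕ} (hc : (m + 1) ^ k ≤ c) : ind S c = 0 := by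
  rw [ind, if_neg (by omega)]

end PClause

/-! ### Expressions for partial clauses -/

namespace PClause
variable {k m : ℕ}

/-- Variable `11` is the base and variable `12` the number of partial clauses. -/
def Std (k m : ℕ) (v : ℕ → ℕ) : Prop := v 11 = m + 1 ∧ v 12 = (m + 1) ^ k

theorem Std.update {v : ℕ → ℕ} (h : Std k m v) {x c : ℕ} (hx : x ≠ 11) (hx' : x ≠ 12) :
    Std k m (Function.update v x c) := by
  unfold Std at h ⊢
  rwa [Function.update_of_ne hx.symm, Function.update_of_ne hx'.symm]

/-- The digit at position `p` of `c`. -/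
def digE (c p : Ex) : Ex := .mod (c / .pow (.var 11) p (.var 12)) (.var 11)

theorem eval_digE {v r} (h : Std k m v) {c p : Ex} (hp : p.eval v r ≤ k) : (digE c p).eval v r =
    c.eval v r / (m + 1) ^ p.eval v r % (m + 1) := by
  have h1 : 1 ≤ (m + 1) ^ k := Nat.pow_pos (by omega)
  rw [digE, Ex.eval_mod, Ex.eval_div, Ex.eval_pow]
  · simp [h.1]
  · simpa [h.1, h.2] using Nat.pow_le_pow_right (by omega) hp
  · simpa [h.2] using h1

/-- The size of the partial clause `c`. -/
def psizeE (k : ℕ) (c : Ex) : Ex := .sum 9 (.const k) (.lt 0 (digE c (.var 9)))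

theorem eval_psizeE {v r} (h : Std k m v) {c : Ex} {C : PClause k m}
    (hc : ∀ i, c.eval (Function.update v 9 i) r = enc C) :
    (psizeE k c).eval v r = psize C := by
  rw [psizeE, Ex.eval_sum, psize, Finset.card_filter, Ex.eval_const, Finset.sum_range]
  refine Finset.sum_congr rfl fun i _ => ?_
  rw [Ex.eval_lt, eval_digE (h.update (by omega) (by omega)) (by simp), hc]
  simp only [Ex.eval_var, Function.update_self, dig_enc, Ex.eval_zero]
  simp [Nat.pos_iff_ne_zero]

/-- Whether the partial clause `d` contains `c`. -/
def extE (k : ℕ) (c d : Ex) : Ex := .not <| .sum 9 (.const k) <|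
  .lt 0 (digE c (.var 9)) * .not (.eq (digE d (.var 9)) (digE c (.var 9)))

theorem eval_extE {v r} (h : Std k m v) {c d : Ex} {C D : PClause k m}
    (hc : ∀ i, c.eval (Function.update v 9 i) r = enc C)
    (hd : ∀ i, d.eval (Function.update v 9 i) r = enc D) :
    (extE k c d).eval v r = if Ext C D then 1 else 0 := by
  rw [extE, Ex.eval_not, Ex.eval_sum, Ex.eval_const, Finset.sum_range]
  refine if_congr ?_ rfl rfl
  rw [Finset.sum_eq_zero_iff]
  unfold Ext
  have : ∀ i : Fin k, ((Ex.lt 0 (digE c (.var 9)) *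
      .not (.eq (digE d (.var 9)) (digE c (.var 9)))).eval (Function.update v 9 i) r = 0 ↔
      (C i ≠ 0 → D i = C i)) := fun i => by
    have h' := h.update (c := i) (x := 9) (by omega) (by omega)
    rw [Ex.eval_mul, Ex.eval_lt, Ex.eval_not, Ex.eval_eq,
      eval_digE h' (by simp), eval_digE h' (by simp), hc, hd]
    simp only [Ex.eval_var, Function.update_self, dig_enc, Ex.eval_zero]
    by_cases h0 : C i = 0
    · simp [h0]
    · have : 0 < (C i : ℕ) := Nat.pos_of_ne_zero fun h => h0 (Fin.ext h)
      by_cases hD : D i = C i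
      · simp [hD]
      · simp [h0, hD, this, Fin.val_inj]
  simp only [Finset.mem_univ, this, forall_true_left]

/-- Whether the partial clause in the variable `0` is a minimal element of the set in the array
`8`. -/
def actE (k : ℕ) : Ex := .read 8 (.var 0) * .not (.sum 1 (.var 12) <|
  .read 8 (.var 1) * extE k (.var 1) (.var 0) * .not (.eq (.var 1) (.var 0)))

theorem eval_actE {v r} (h : Std k m v) {S : Finset (PClause k m)} {C : PClause k m}
    (hr : r 8 = ind S) (hv : v 0 = enc C) : (actE k).eval v r = if C ∈ act S then 1 else 0 := by
  rw [actE, Ex.eval_mul, Ex.eval_not, Ex.eval_sum]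
  simp only [Ex.eval_var, h.2, sum_range_enc, Ex.eval_read, hv, hr, ind_enc]
  have : ∀ D : PClause k m, (Ex.read 8 (.var 1) * extE k (.var 1) (.var 0) *
      .not (.eq (.var 1) (.var 0))).eval (Function.update v 1 (enc D)) r = 0 ↔
      (D ∈ S → Ext D C → D = C) := fun D => by
    rw [Ex.eval_mul, Ex.eval_mul, eval_extE (C := D) (D := C) (h.update (by omega) (by omega))
      (fun i => by simp) (fun i => by simp [hv])]
    simp [hr, hv, enc_injective.eq_iff]
    grind
  simp only [Finset.sum_eq_zero_iff, this, Finset.mem_univ, forall_true_left]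
  simp only [act, Finset.mem_filter]
  rw [mul_ite, mul_one, mul_zero, ← ite_and]
  exact if_congr (by tauto) rfl rfl

/-- The number of partial clauses of size `c` in the array `9` that contain `h`. -/
def degE (k : ℕ) (c h : Ex) : Ex := .sum 3 (.var 12) <|
  .read 9 (.var 3) * .eq (psizeE k (.var 3)) c * extE k h (.var 3)

theorem eval_degE {v r} (h : Std k m v) {S : Finset (PClause k m)} {H : PClause k m} {c e : Ex}
    {c' : ℕ} (hr : r 9 = ind (act S)) (hc : ∀ i, c.eval (Function.update v 3 i) r = c')
    (he : ∀ i j, e.eval (Function.update (Function.update v 3 i) 9 j) r = enc H) :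
    (degE k c e).eval v r = deg S c' H := by
  rw [degE, Ex.eval_sum]
  simp only [Ex.eval_var, h.2, sum_range_enc]
  rw [deg, ← Finset.filter_filter, Finset.card_filter, Finset.sum_filter, ← Finset.sum_filter_add_sum_filter_not
    Finset.univ (fun C => C ∈ act S), Finset.filter_mem_eq_inter, Finset.univ_inter]
  rw [Finset.sum_eq_zero (s := Finset.univ.filter fun C => C ∉ act S), add_zero]
  · refine Finset.sum_congr rfl fun D hD => ?_
    have h' := h.update (c := enc D) (x := 3) (by omega) (by omega)
    rw [Ex.eval_mul, Ex.eval_mul, Ex.eval_eq, eval_extE (C := H) (D := D) h' (he _)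
      (fun i => by simp), eval_psizeE (C := D) h' (fun i => by simp), hc]
    simp only [Ex.eval_read, Ex.eval_var, Function.update_self, hr, ind_enc, hD, if_true, one_mul,
      Ex.ite_mul_ite, ite_and]
  · intro D hD
    rw [Ex.eval_mul, Ex.eval_mul]
    simp [hr, (Finset.mem_filter.1 hD).2]

/-! ### Finding flowers -/

/-- Whether `z` is the number of a flower. -/
def IsFl (M Y : ℕ) (S : Finset (PClause k m)) (z : ℕ) : Prop :=
  IsFlower (thr M Y) S (z / (m + 1) ^ k % k) (dec k m (z % (m + 1) ^ k)) ∧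
    psize (dec k m (z % (m + 1) ^ k)) + z / (m + 1) ^ k % k = z / (k * (m + 1) ^ k)

noncomputable instance (M Y : ℕ) (S : Finset (PClause k m)) (z : ℕ) : Decidable (IsFl M Y S z) :=
  Classical.propDecidable _

/-- The number of the least flower. -/
noncomputable def flowerCode (M Y : ℕ) (S : Finset (PClause k m)) : ℕ :=
  leastN (fun z => if IsFl M Y S z then 1 else 0) ((k + 1) * (k * (m + 1) ^ k))

/-- The least flower. -/
noncomputable def leastFlower (M Y : ℕ) (S : Finset (PClause k m)) : Option (ℕ × PClause k m) :=
  if flowerCode M Y S < (k + 1) * (k * (m + 1) ^ k) then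
    some (flowerCode M Y S / (m + 1) ^ k % k, dec k m (flowerCode M Y S % (m + 1) ^ k)) else none

/-- The number is `(c * k + i) * U + enc H` with `c = psize H + i` and `U = (m + 1) ^ k`. The least
number thus has the least `c` and then the least `i`, the order required of a least flower. There is
room for `i` as a digit to the base `k` because the heart is not empty. -/
theorem IsFlower.exists_code {M Y : ℕ} (hM : 1 ≤ M) (hY : 1 ≤ Y) {S : Finset (PClause k m)} {i : ℕ}
    {H : PClause k m} (h : IsFlower (thr M Y) S i H) :
    ∃ z < (k + 1) * (k * (m + 1) ^ k), IsFl M Y S z ∧ z / (m + 1) ^ k % k = i ∧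
      z / (k * (m + 1) ^ k) = psize H + i ∧ dec k m (z % (m + 1) ^ k) = H := by
  have h1 : 0 < deg S (psize H + i) H := lt_of_lt_of_le (Nat.mul_pos hM (Nat.pow_pos hY)) h.2.2
  obtain ⟨C, hC⟩ := Finset.card_pos.1 h1
  have hs := psize_le C
  rw [(Finset.mem_filter.1 hC).2.1] at hs
  have hi : i < k := by have := h.2.1; omega
  set U := (m + 1) ^ k with hU
  have hUpos : 0 < U := Nat.pow_pos (by omega)
  have he : enc H < U := enc_lt H
  have e1 : ((((psize H + i) * k + i) * U + enc H)) % U = enc H := by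
    rw [Nat.add_comm, Nat.add_mul_mod_self_right, Nat.mod_eq_of_lt he]
  have e2 : ((((psize H + i) * k + i) * U + enc H)) / U = (psize H + i) * k + i := by
    rw [Nat.add_comm, Nat.add_mul_div_right _ _ hUpos, Nat.div_eq_of_lt he, zero_add]
  have e3 : ((psize H + i) * k + i) % k = i := by
    rw [Nat.add_comm, Nat.add_mul_mod_self_right, Nat.mod_eq_of_lt hi]
  have e4 : ((psize H + i) * k + i) / k = psize H + i := by
    rw [Nat.add_comm, Nat.add_mul_div_right _ _ (by omega), Nat.div_eq_of_lt hi, zero_add]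
  have e5 : ((((psize H + i) * k + i) * U + enc H)) / (k * U) = psize H + i := by
    rw [mul_comm k U, ← Nat.div_div_eq_div_mul, e2, e4]
  refine ⟨((psize H + i) * k + i) * U + enc H, ?_, ⟨?_, ?_⟩, ?_, e5, ?_⟩
  · rw [← Nat.div_lt_iff_lt_mul (Nat.mul_pos (by omega) hUpos), e5]
    omega
  · rw [e2, e1, e3, dec_enc]; exact h
  · rw [e1, dec_enc, e5, e2, e3]
  · rw [e2, e3]
  · rw [e1, dec_enc]

/-- The order of numbers refines the lexicographic order of the pair of sizes, so comparing
quotients by `(m + 1) ^ k` and then by `k` suffices. -/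
theorem leastFlower_some {M Y : ℕ} (hM : 1 ≤ M) (hY : 1 ≤ Y) (S : Finset (PClause k m)) (i : ℕ)
    (H : PClause k m) (h : leastFlower M Y S = some (i, H)) : IsLeastFlower (thr M Y) S i H := by
  unfold leastFlower at h
  split_ifs at h with hlt
  simp only [Option.some.injEq, Prod.mk.injEq] at h
  obtain ⟨-, h1, h2⟩ := leastN_spec (fun z => if IsFl M Y S z then 1 else 0)
    ((k + 1) * (k * (m + 1) ^ k))
  change ∀ z < flowerCode M Y S, _ at h1
  have h2 := h2 hlt
  change (if IsFl M Y S (flowerCode M Y S) then 1 else 0) ≠ 0 at h2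
  set z := flowerCode M Y S with hz
  have hfl : IsFl M Y S z := by
    by_contra hne
    exact h2 (if_neg hne)
  have hc : psize H + i = z / (m + 1) ^ k / k := by
    rw [Nat.div_div_eq_div_mul, mul_comm _ k, ← hfl.2, h.1, h.2]
  rw [IsFl, h.1, h.2] at hfl
  refine ⟨hfl.1, fun i' H' h' => ?_⟩
  obtain ⟨z', -, g1, g2, g3, g4⟩ := h'.exists_code hM hY
  have hzz : z ≤ z' := by
    by_contra hlt
    have := h1 z' (by omega)
    rw [if_pos g1] at this
    omega
  rw [mul_comm k, ← Nat.div_div_eq_div_mul] at g3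
  have hz1 : z / (m + 1) ^ k ≤ z' / (m + 1) ^ k := Nat.div_le_div_right hzz
  have hz2 : z / (m + 1) ^ k / k ≤ z' / (m + 1) ^ k / k := Nat.div_le_div_right hz1
  rw [← hc, g3] at hz2
  rcases hz2.lt_or_eq with hlt' | heq
  · exact .inl hlt'
  · refine .inr ⟨heq, ?_⟩
    have d1 := Nat.div_add_mod (z / (m + 1) ^ k) k
    have d2 := Nat.div_add_mod (z' / (m + 1) ^ k) k
    rw [← hc, h.1, heq] at d1
    rw [g3, g2] at d2
    omega

theorem leastFlower_none {M Y : ℕ} (hM : 1 ≤ M) (hY : 1 ≤ Y) (S : Finset (PClause k m))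
    (h : leastFlower M Y S = none) (i : ℕ) (H : PClause k m) : ¬ IsFlower (thr M Y) S i H := by
  intro hfl
  obtain ⟨z, hz, g1, -⟩ := hfl.exists_code hM hY
  unfold leastFlower at h
  split_ifs at h with hlt
  obtain ⟨-, h1, -⟩ := leastN_spec (fun z => if IsFl M Y S z then 1 else 0)
    ((k + 1) * (k * (m + 1) ^ k))
  change ∀ z < flowerCode M Y S, _ at h1
  have := h1 z (by omega)
  rw [if_pos g1] at this
  omega

/-- Whether the variable `x` is the number of a flower. -/
def flE (k M Y : ℕ) : Ex :=
  let U : Ex := .var 12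
  let i : Ex := .mod (.var 1 / U) (.const k)
  let h : Ex := .mod (.var 1) U
  let c : Ex := .var 1 / (.const k * U)
  .lt 0 i * .lt 0 (psizeE k h) * .eq (psizeE k h + i) c *
    -- Since `i < k`, the exponent is at most `2 * k`, so `Y ^ (2 * k)` is a modulus for which the
    -- reduction has no effect.
    .not (.lt (degE k c h) (.const M * .pow (.const Y) (2 * i - 1) (.const (Y ^ (2 * k)))))

theorem eval_flE {v r} (h : Std k m v) {M Y : ℕ} (hk : 1 ≤ k) (hY : 1 ≤ Y)
    {S : Finset (PClause k m)} (hr : r 9 = ind (act S)) :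
    (flE k M Y).eval v r = if IsFl M Y S (v 1) then 1 else 0 := by
  have hU : 0 < (m + 1) ^ k := Nat.pow_pos (by omega)
  have hH := enc_dec (Nat.mod_lt (v 1) hU)
  have hi := Nat.mod_lt (v 1 / (m + 1) ^ k) hk
  have h12 := h.2
  have hY' : 1 ≤ Y ^ (2 * k) := Nat.pow_pos hY
  dsimp only [flE]
  rw [Ex.eval_mul, Ex.eval_mul, Ex.eval_mul, Ex.eval_not, Ex.eval_lt, Ex.eval_lt, Ex.eval_lt,
    Ex.eval_eq, Ex.eval_add, eval_psizeE (C := dec k m (v 1 % (m + 1) ^ k)) h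
      (fun i => by simp [h12, hH]), eval_degE (S := S) (c' := v 1 / (k * (m + 1) ^ k))
      (H := dec k m (v 1 % (m + 1) ^ k)) h hr (fun i => by simp [h12])
      (fun i j => by simp [h12, hH]), Ex.eval_mul (e := .const M), Ex.eval_pow]
  · simp only [Ex.eval_mod, Ex.eval_div, Ex.eval_var, Ex.eval_const, Ex.eval_sub, Ex.eval_mul,
      Ex.eval_one, Ex.eval_ofNat, Ex.eval_zero, h12, IsFl, IsFlower, thr]
    by_cases hs : psize (dec k m (v 1 % (m + 1) ^ k)) + v 1 / (m + 1) ^ k % k =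
      v 1 / (k * (m + 1) ^ k)
    · have aux : ∀ a b c d : ℕ, (if 0 < a then 1 else 0) * (if 0 < b then 1 else 0) * 1 *
          (if (if c < d then 1 else 0) = 0 then 1 else 0) =
          if 1 ≤ a ∧ 1 ≤ b ∧ d ≤ c then 1 else 0 := fun a b c d => by
        by_cases ha : 0 < a <;> by_cases hb : 0 < b <;> by_cases hc : c < d <;>
          simp [ha, hb, hc, Nat.one_le_iff_ne_zero] <;> omega
      simp only [hs, if_true, and_true]
      exact aux _ _ _ _
    · simp [hs]
  · simpa [h12] using Nat.pow_le_pow_right hY (by omega)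
  · simpa using hY'

end PClause

namespace Code
variable {K : ℕ}

theorem tab_eq {x : ℕ} {n e : Ex} (hx : x ∉ e.arrays) {μ : Mem} (hv : μ.v 0 = 0) (hb : μ.b 0 = 0)
    (F : ℕ → ℕ) (h : ∀ i < n.val μ, e.eval (Function.update μ.v 0 i) μ.a = F i)
    (h' : ∀ i, n.val μ ≤ i → μ.a x i = F i) :
    (tab x n e hx : Code K).den μ = μ.setA x F := by
  rw [tab_den x n e hx hv hb]
  congr 1
  funext i
  split_ifs with hi
  · exact h i hi
  · exact h' i (by omega)

theorem tab_arr_le {x : ℕ} {n e : Ex} (hx : x ∉ e.arrays) {μ : Mem} {V : ℕ}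
    (h : ∀ y i, μ.a y i ≤ V) (he : ∀ i, e.eval (Function.update μ.v 0 i) μ.a ≤ V) (y i : ℕ) :
    ((tab x n e hx : Code K).den μ).a y i ≤ V := by
  simp only [tab, Mem.setV_a, Mem.setB_a, Mem.setA_a, Function.update_apply]
  split_ifs
  · dsimp only
    split_ifs
    exacts [he i, h x i]
  · exact h y i

theorem pos_ite (p : Prop) [Decidable p] : (0 < if p then 1 else 0) ↔ p := by
  by_cases h : p <;> simp [h]

end Code

namespace PClause
variable {k m : ℕ}

/-! ### A step of the sparsification -/

/-- The elements of the petals of the flower with the number in variable `23`. -/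
def petalE (k : ℕ) : Ex :=
  let U : Ex := .var 12
  let h : Ex := .mod (.var 23) U
  .sum 4 U <| .read 9 (.var 4) * .eq (psizeE k (.var 4)) (.var 23 / (.const k * U)) *
    extE k h (.var 4) * .eq (.var 4 - h) (.var 0)

theorem eval_petalE {v r} (h : Std k m v) {M Y : ℕ} {S : Finset (PClause k m)}
    {C : PClause k m} (hr : r 9 = ind (act S)) (h23 : IsFl M Y S (v 23)) (hv : v 0 = enc C) :
    0 < (petalE k).eval v r ↔
      C ∈ petals S (v 23 / (m + 1) ^ k % k) (dec k m (v 23 % (m + 1) ^ k)) := by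
  have hH := enc_dec (k := k) (Nat.mod_lt (v 23) (show 0 < (m + 1) ^ k from Nat.pow_pos (by omega)))
  have h12 := h.2
  dsimp only [petalE]
  rw [Ex.eval_sum]
  simp only [Ex.eval_var, h12, sum_range_enc]
  rw [Finset.sum_pos_iff]
  unfold petals flower
  rw [h23.2]
  simp only [Finset.mem_image, Finset.mem_filter, Finset.mem_univ, true_and]
  refine exists_congr fun D => ?_
  have h' := h.update (c := enc D) (x := 4) (by omega) (by omega)
  rw [Ex.eval_mul, Ex.eval_mul, Ex.eval_mul, Ex.eval_eq, Ex.eval_eq,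
    eval_extE (C := dec k m (v 23 % (m + 1) ^ k)) (D := D) h' (fun i => by simp [hH, h12])
      (fun i => by simp), eval_psizeE (C := D) h' (fun i => by simp)]
  have key : Ext (dec k m (v 23 % (m + 1) ^ k)) D →
      (enc D - v 23 % (m + 1) ^ k = enc C ↔ petal (dec k m (v 23 % (m + 1) ^ k)) D = C) := fun hE => by
    rw [← enc_injective.eq_iff, enc_petal hE, hH]
  have e1 : (Function.update v 4 (enc D)) 23 = v 23 := by simp
  have e2 : (Function.update v 4 (enc D)) 12 = v 12 := by simp
  have e3 : (Function.update v 4 (enc D)) 0 = v 0 := by simp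
  simp only [Ex.eval_read, Ex.eval_var, Function.update_self, hr, ind_enc, Ex.eval_div, Ex.eval_mul,
    Ex.eval_const, Ex.eval_sub, Ex.eval_mod, e1, e2, e3, h12, hv, Ex.ite_mul_ite, Code.pos_ite]
  tauto

/-- The next set of partial clauses, at the partial clause in variable `0`. -/
def stepE (k M Y : ℕ) : Ex :=
  let G : Ex := .const (M * Y ^ (2 * k))
  let U : Ex := .var 12
  let u : Ex := .mod (.var 22) G
  let d : Ex := .read 7 (.var 22 / G)
  .lt 0 <| .read 8 (.var 0) + .lt (.var 23) (.const (k + 1) * (.const k * U)) *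
    (.lt u d * .eq (.var 0) (.mod (.var 23) U) + .eq u d * petalE k)

theorem eval_stepE {v r} (h : Std k m v) {M Y : ℕ} {S : Finset (PClause k m)}
    {C : PClause k m} (hr : r 9 = ind (act S)) (hr8 : r 8 = ind S) (h23 : v 23 = flowerCode M Y S)
    (hv : v 0 = enc C) : (stepE k M Y).eval v r =
      if C ∈ stepD (leastFlower M Y) S (v 22 % (M * Y ^ (2 * k))) (r 7 (v 22 / (M * Y ^ (2 * k))))
      then 1 else 0 := by
  have h12 := h.2
  dsimp only [stepE]
  rw [Ex.eval_lt]
  refine if_congr ?_ rfl rfl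
  simp only [Ex.eval_add, Ex.eval_mul, Ex.eval_lt, Ex.eval_eq, Ex.eval_read, Ex.eval_var,
    Ex.eval_const, Ex.eval_mod, Ex.eval_div, Ex.eval_zero, hr8, hv, ind_enc, h12]
  set u := v 22 % (M * Y ^ (2 * k))
  set d := r 7 (v 22 / (M * Y ^ (2 * k)))
  by_cases hz : flowerCode M Y S < (k + 1) * (k * (m + 1) ^ k)
  · have hfl : leastFlower M Y S = some (v 23 / (m + 1) ^ k % k, dec k m (v 23 % (m + 1) ^ k)) := by
      rw [leastFlower, if_pos hz, h23]
    have his : IsFl M Y S (v 23) := by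
      have := (leastN_spec (fun z => if IsFl M Y S z then 1 else 0)
        ((k + 1) * (k * (m + 1) ^ k))).2.2 hz
      by_contra hne
      rw [h23] at hne
      exact this (if_neg hne)
    have hH := enc_dec (k := k) (Nat.mod_lt (v 23)
      (show 0 < (m + 1) ^ k from Nat.pow_pos (by omega)))
    have hC : enc C = v 23 % (m + 1) ^ k ↔ C = dec k m (v 23 % (m + 1) ^ k) := by
      conv_lhs => rw [← hH]
      exact enc_injective.eq_iff
    have hp := eval_petalE h hr his hv
    rw [← h23] at hz
    rw [if_pos hz, one_mul]
    unfold stepD step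
    simp only [hfl]
    by_cases h1 : u < d
    · simp [h1, h1.ne, hC]
      grind
    · by_cases h2 : u = d
      · simp [h2, hp]
        grind
      · simp [h1, h2, Code.pos_ite]
  · have hfl : leastFlower M Y S = none := by rw [leastFlower, if_neg hz]
    rw [h23, if_neg hz]
    unfold stepD step
    simp only [hfl]
    simp [Code.pos_ite]

variable {K : ℕ}

theorem notMem_actE {a : ℕ} (ha : a ≠ 8) : a ∉ (actE k).arrays := by
  simp [actE, extE, digE, Ex.arrays, ha]

theorem notMem_stepE {M Y a : ℕ} (ha : a ≠ 7) (ha' : a ≠ 8) (ha'' : a ≠ 9) :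
    a ∉ (stepE k M Y).arrays := by
  simp [stepE, petalE, extE, psizeE, digE, Ex.arrays, ha, ha', ha'']

/-- A step of the sparsification of the set in the array `8`. -/
def stepCode (k M Y : ℕ) : Code K :=
  (Code.tab 9 (.var 12) (actE k) (notMem_actE (by omega))).seq <|
  (Code.asg 23 (.least 1 2 (.const (k + 1) * (.const k * .var 12)) (flE k M Y))).seq <|
  (Code.tab 10 (.var 12) (stepE k M Y) (notMem_stepE (by omega) (by omega) (by omega))).seq <|
  (Code.tab 8 (.var 12) (.read 10 (.var 0)) (by simp [Ex.arrays])).seq <|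
  -- The auxiliary arrays and the variable `23` are cleared, so that the next step finds the same
  -- situation.
  (Code.tab 9 (.var 12) 0 (by simp)).seq <| (Code.tab 10 (.var 12) 0 (by simp)).seq <|
  Code.asg 23 0

theorem stepCode_den {M Y : ℕ} {μ : Mem} (h : Std k m μ.v) (hk : 1 ≤ k) (hY : 1 ≤ Y)
    {S : Finset (PClause k m)} (h8 : μ.a 8 = ind S) (h9 : μ.a 9 = 0) (h10 : μ.a 10 = 0)
    (h0 : μ.v 0 = 0) (hb : μ.b 0 = 0) (h23 : μ.v 23 = 0) :
    (stepCode k M Y : Code K).den μ = μ.setA 8 (ind (stepD (leastFlower M Y) S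
      (μ.v 22 % (M * Y ^ (2 * k))) (μ.a 7 (μ.v 22 / (M * Y ^ (2 * k)))))) := by
  set S' := stepD (leastFlower M Y) S
      (μ.v 22 % (M * Y ^ (2 * k))) (μ.a 7 (μ.v 22 / (M * Y ^ (2 * k))))
  have h12 := h.2
  simp only [stepCode, Code.seq_den, Code.asg_den]
  have t1 := Code.tab_eq (K := K) (x := 9) (n := .var 12) (notMem_actE (k := k) (by omega)) h0 hb
    (ind (act S)) (fun i hi => by
      obtain ⟨C, rfl⟩ := exists_enc (by simpa [Ex.val, h12] using hi)
      rw [eval_actE (h.update (by omega) (by omega)) h8 (C := C) (by simp), ind_enc]) (fun i hi => by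
      rw [h9, ind_of_le _ (by simpa [Ex.val, h12] using hi)]; rfl)
  rw [t1]
  have e1 : (Ex.least 1 2 (.const (k + 1) * (.const k * .var 12)) (flE k M Y)).val
      (μ.setA 9 (ind (act S))) = flowerCode M Y S := by
    rw [Ex.val, Ex.eval_least]
    have : ∀ i j, (flE k M Y).eval (Function.update (Function.update μ.v 2 j) 1 i)
        (μ.setA 9 (ind (act S))).a = if IsFl M Y S i then 1 else 0 := fun i j => by
      rw [eval_flE ((h.update (by omega) (by omega)).update (by omega) (by omega)) hk hY (S := S)
        (by simp)]
      simp
    simp only [Mem.setA_v, this]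
    simp [flowerCode, leastN, h12]
  rw [e1]
  set μ₂ := (μ.setA 9 (ind (act S))).setV 23 (flowerCode M Y S) with hμ₂
  have s2 : Std k m μ₂.v := h.update (by omega) (by omega)
  have g0 : μ₂.v 0 = 0 := by simp [hμ₂, h0]
  have gb : μ₂.b 0 = 0 := by simp [hμ₂, hb]
  have t2 := Code.tab_eq (K := K) (x := 10) (n := .var 12)
    (notMem_stepE (k := k) (M := M) (Y := Y) (by omega) (by omega) (by omega)) g0 gb
    (ind S') (fun i hi => by
      obtain ⟨C, rfl⟩ := exists_enc (m := m) (k := k) (by simpa [Ex.val, s2.2] using hi)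
      rw [eval_stepE (s2.update (by omega) (by omega)) (S := S) (C := C) (by simp [hμ₂])
        (by simp [hμ₂, h8]) (by simp [hμ₂]) (by simp), ind_enc]
      simp [hμ₂, S']) (fun i hi => by
      rw [ind_of_le _ (by simpa [Ex.val, s2.2] using hi)]; simp [hμ₂, h10])
  have t3 := Code.tab_eq (K := K) (x := 8) (n := .var 12) (e := .read 10 (.var 0))
    (μ := μ₂.setA 10 (ind S')) (by simp [Ex.arrays]) g0 gb (ind S') (fun i hi => by simp)
    (fun i hi => by
      have hi := show (m + 1) ^ k ≤ i by simpa [Ex.val, s2.2] using hi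
      simp [hμ₂, h8, ind_of_le _ hi])
  have t4 := Code.tab_eq (K := K) (x := 9) (n := .var 12) (e := 0)
    (μ := (μ₂.setA 10 (ind S')).setA 8 (ind S')) (by simp) g0 gb 0 (fun i hi => by simp)
    (fun i hi => by
      have hi := show (m + 1) ^ k ≤ i by simpa [Ex.val, s2.2] using hi
      simp [hμ₂, ind_of_le _ hi])
  have t5 := Code.tab_eq (K := K) (x := 10) (n := .var 12) (e := 0)
    (μ := ((μ₂.setA 10 (ind S')).setA 8 (ind S')).setA 9 0) (by simp) g0 gb 0 (fun i hi => by simp)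
    (fun i hi => by
      have hi := show (m + 1) ^ k ≤ i by simpa [Ex.val, s2.2] using hi
      simp [ind_of_le _ hi])
  rw [t2, t3, t4, t5]
  ext x y
  · by_cases hx : x = 23
    · subst hx; simp [hμ₂, h23, Ex.val]
    · simp [hμ₂, hx]
  · simp [hμ₂]
  · by_cases hx : x = 9
    · subst hx; simp [hμ₂, h9]
    · by_cases hx' : x = 10
      · subst hx'; simp [hμ₂, h10]
      · by_cases hx'' : x = 8
        · subst hx''; simp [hμ₂]
        · simp [hμ₂, hx, hx', hx'']
  · simp [hμ₂]
  · simp [hμ₂]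

/-- The condition for repeating a step: the tables contain only indicators or values bounded by
existing entries, and the large flower number in the variable `23` is erased at the end. -/
theorem stepCode_bd (k M Y V : ℕ) (μ : Mem) (hV : 2 ≤ V) (h : MemBd V μ) :
    MemBd V ((stepCode k M Y : Code K).den μ) := by
  refine ⟨⟨fun x => ?_, ?_⟩, fun z => ?_⟩
  · simp only [stepCode, Code.seq_den, Code.asg_den, Code.tab, Mem.setV_v, Mem.setB_v, Mem.setA_v,
      Function.update_apply]
    by_cases hx : x = 23
    · rw [if_pos hx]; exact Nat.zero_le _
    · by_cases hx0 : x = 0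
      · simp only [if_neg hx, if_pos hx0]; exact Nat.zero_le _
      · simp only [if_neg hx, if_neg hx0]; exact h.1.1 x
  · simp only [stepCode, Code.seq_den, Code.asg_den, Mem.setV_a]
    have h1 := Code.tab_arr_le (K := K) (x := 9) (n := .var 12)
      (notMem_actE (k := k) (by omega)) h.1.2 fun i => by
        have := h.1.2 8 i
        rw [actE, Ex.eval_mul, Ex.eval_not]
        simp only [Ex.eval_read, Ex.eval_var, Function.update_self]
        split_ifs <;> omega
    set ν := (Code.tab (K := K) 9 (.var 12) (actE k) (notMem_actE (by omega))).den μ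
    set c := (Ex.least 1 2 (.const (k + 1) * (.const k * .var 12)) (flE k M Y)).val ν
    have h2 := Code.tab_arr_le (K := K) (x := 10) (n := .var 12) (μ := ν.setV 23 c)
      (notMem_stepE (k := k) (M := M) (Y := Y) (by omega) (by omega) (by omega)) h1 fun i => by
        dsimp only [stepE]
        rw [Ex.eval_lt]
        split_ifs <;> omega
    exact Code.tab_arr_le _ (Code.tab_arr_le _ (Code.tab_arr_le _ h2 fun i => h2 10 _)
      fun i => by simp) fun i => by simp
  · simp only [stepCode, Code.seq_den, Code.asg_den, Code.tab, Mem.setV_b, Mem.setB_b, Mem.setA_b,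
      Function.update_apply]
    have := h.2 z
    split_ifs <;> simp <;> omega

end PClause

/-! ### The vectors -/

namespace PClause
variable {k m : ℕ}

/-- The variables below `h`, with the values `al`, do not satisfy `C`. -/
def FalsA (h : ℕ) (al : ℕ → ℕ) (C : PClause k m) : Prop :=
  ∀ p, C p ≠ 0 → ((C p : ℕ) - 1) / 2 < h → al (((C p : ℕ) - 1) / 2) ≠ ((C p : ℕ) - 1) % 2

/-- The variables from `h` on, with the values `al`, do not satisfy `C`. -/
def FalsB (h : ℕ) (al : ℕ → ℕ) (C : PClause k m) : Prop :=
  ∀ p, C p ≠ 0 → h ≤ ((C p : ℕ) - 1) / 2 → al (((C p : ℕ) - 1) / 2 - h) ≠ ((C p : ℕ) - 1) % 2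

instance (h : ℕ) (al : ℕ → ℕ) : DecidablePred (FalsA h al : PClause k m → Prop) := fun _ =>
  inferInstanceAs (Decidable (∀ _, _))

instance (h : ℕ) (al : ℕ → ℕ) : DecidablePred (FalsB h al : PClause k m → Prop) := fun _ =>
  inferInstanceAs (Decidable (∀ _, _))

/-- The number of minimal elements that precede `C`. -/
def rank (S : Finset (PClause k m)) (C : PClause k m) : ℕ :=
  ((act S).filter fun D => enc D < enc C).card

/-- Whether the minimal element of rank `s`, which is less than `B`, has the property `f`. -/
def slot (B : ℕ) (S : Finset (PClause k m)) (f : PClause k m → Prop) [DecidablePred f] (s : ℕ) : ℕ :=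
  if s < B then ((act S).filter fun C => rank S C = s ∧ f C).card else 0

variable {S : Finset (PClause k m)}

theorem rank_lt_rank {C D : PClause k m} (hC : C ∈ act S) (h : enc C < enc D) :
    rank S C < rank S D := by
  refine Finset.card_lt_card (Finset.ssubset_iff_of_subset (fun E hE => ?_) |>.2 ⟨C, ?_, ?_⟩)
  · simp only [Finset.mem_filter] at hE ⊢
    exact ⟨hE.1, hE.2.trans h⟩
  · simp [hC, h]
  · simp

theorem rank_inj {C D : PClause k m} (hC : C ∈ act S) (hD : D ∈ act S) (h : rank S C = rank S D) :
    C = D := by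
  rcases lt_trichotomy (enc C) (enc D) with h' | h' | h'
  · exact absurd h (rank_lt_rank hC h').ne
  · exact enc_injective h'
  · exact absurd h (rank_lt_rank hD h').ne'

theorem rank_lt {C : PClause k m} (hC : C ∈ act S) : rank S C < (act S).card := by
  refine Finset.card_lt_card (Finset.ssubset_iff_of_subset (Finset.filter_subset _ _) |>.2 ⟨C, hC, ?_⟩)
  simp

theorem slot_le_one (B : ℕ) (f : PClause k m → Prop) [DecidablePred f] (s : ℕ) :
    slot B S f s ≤ 1 := by
  unfold slot
  split_ifs
  · refine Finset.card_le_one.2 fun C hC D hD => ?_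
    rw [Finset.mem_filter] at hC hD
    exact rank_inj hC.1 hD.1 (hC.2.1.trans hD.2.1.symm)
  · omega

theorem sum_slot_le (B : ℕ) (f g : PClause k m → Prop) [DecidablePred f] [DecidablePred g] :
    ∑ s ∈ Finset.range B, slot B S f s * slot B S g s ≤ B := by
  refine (Finset.sum_le_card_nsmul _ _ 1 fun s _ =>
    Nat.mul_le_mul (slot_le_one B f s) (slot_le_one B g s)).trans (by simp)

/-- If at most `B` clauses are minimal, each has a slot of its own, and a common position of the two
strings is a common minimal clause. -/
theorem sum_slot_pos_iff {B : ℕ} (hB : (act S).card ≤ B) (f g : PClause k m → Prop)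
    [DecidablePred f] [DecidablePred g] :
    0 < ∑ s ∈ Finset.range B, slot B S f s * slot B S g s ↔ ∃ C ∈ act S, f C ∧ g C := by
  rw [Finset.sum_pos_iff]
  constructor
  · rintro ⟨s, hs, h⟩
    have h1 := Nat.pos_of_mul_pos_right h
    have h2 := Nat.pos_of_mul_pos_left h
    rw [slot, if_pos (Finset.mem_range.1 hs), Finset.card_pos] at h1 h2
    obtain ⟨C, hC⟩ := h1
    obtain ⟨D, hD⟩ := h2
    rw [Finset.mem_filter] at hC hD
    have := rank_inj hC.1 hD.1 (hC.2.1.trans hD.2.1.symm)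
    subst this
    exact ⟨C, hC.1, hC.2.2, hD.2.2⟩
  · rintro ⟨C, hC, hf, hg⟩
    have hlt := (rank_lt hC).trans_le hB
    refine ⟨rank S C, Finset.mem_range.2 hlt, Nat.mul_pos ?_ ?_⟩
    · rw [slot, if_pos hlt, Finset.card_pos]
      exact ⟨C, by simp [hC, hf]⟩
    · rw [slot, if_pos hlt, Finset.card_pos]
      exact ⟨C, by simp [hC, hg]⟩

end PClause

/-! ### Parameters and entries of the instance -/

/-- The parameters of the reduction: the number of variables in the first half, the length of the
polynomials, their number, the size of the field, the number of digits of the advice for the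
sparsification, and the number of repetitions. -/
structure Par where
  h : ℕ
  l : ℕ
  T : ℕ
  q : ℕ
  J : ℕ
  R : ℕ

namespace Par
variable (P : Par) {k m : ℕ} (M Y : ℕ) (S₀ : Finset (PClause k m))

open PClause

/-- The number of values of the advice for a block of the sparsification, minus one. -/
def adv (k M Y : ℕ) : ℕ := M * Y ^ (2 * k)

/-- The number of vectors. -/
def N (k M Y : ℕ) : ℕ := 2 ^ P.h * P.q ^ (2 * P.l) * (adv k M Y + 1) ^ P.J

/-- The number of transcripts. -/
def m₁ : ℕ := P.q ^ (P.T + 2)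

/-- The dimension. -/
def dim : ℕ := P.m₁ ^ P.R

/-- The part of the assignment in the vector number `i`. -/
def al (i j : ℕ) : ℕ := if j < P.h then i / 2 ^ j % 2 else 0

/-- The polynomial in the vector number `i`. -/
def ph (i j : ℕ) : ℕ := if j < 2 * P.l then i / 2 ^ P.h / P.q ^ j % P.q else 0

/-- The advice in the vector number `i`, when its digits are less than `g + 1`. -/
def wd (g i j : ℕ) : ℕ :=
  if j < P.J then i / 2 ^ P.h / P.q ^ (2 * P.l) / (g + 1) ^ j % (g + 1) else 0

/-- The sparse formula that the vector number `i` describes. -/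
noncomputable def sp (i : ℕ) : Finset (PClause k m) :=
  run (leastFlower M Y) (adv k M Y) (P.wd (adv k M Y) i) S₀ (adv k M Y * P.J)

noncomputable def slotA (i : ℕ) : ℕ → ℕ := slot (P.T * P.l) (P.sp M Y S₀ i) (FalsA P.h (P.al i))
noncomputable def slotB (i : ℕ) : ℕ → ℕ := slot (P.T * P.l) (P.sp M Y S₀ i) (FalsB P.h (P.al i))

/-- Whether Alice, with the input number `i`, accepts the transcript `j`. -/
noncomputable def accA (i j : ℕ) : ℕ :=
  if (act (P.sp M Y S₀ i)).card ≤ P.T * P.l ∧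
    Protocol.accA P.q P.l P.T P.J (P.ph i) (P.slotA M Y S₀ i) (P.wd (adv k M Y) i) j then 1 else 0

/-- Whether Bob, with the input number `i`, agrees with the transcript `j`. -/
noncomputable def accB (i j : ℕ) : ℕ :=
  if Protocol.accB P.q P.l P.T P.J (P.slotB M Y S₀ i) (P.wd (adv k M Y) i) j then 1 else 0

/-- Whether `c` is `1` for all the digits of `j`. -/
def bit (c : ℕ → ℕ) (j : ℕ) : ℕ :=
  if ∑ s ∈ Finset.range P.R, (1 - c (j / P.m₁ ^ s % P.m₁)) = 0 then 1 else 0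

/-- Entry `j` of the vector number `i` of Alice. -/
noncomputable def rowA (i j : ℕ) : ℕ := P.bit (P.accA M Y S₀ i) j

/-- Entry `j` of the vector number `i` of Bob. -/
noncomputable def rowB (i j : ℕ) : ℕ := P.bit (P.accB M Y S₀ i) j

/-- The assignments of the vectors number `i` and `j` together satisfy all clauses. -/
def Sat (i j : ℕ) : Prop := ∀ C ∈ S₀, ¬ (FalsA P.h (P.al i) C ∧ FalsB P.h (P.al j) C)

variable {P M Y S₀}

theorem bit_eq_prod (c : ℕ → ℕ) (hc : ∀ j, c j ≤ 1) (j : ℕ) :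
    P.bit c j = ∏ s ∈ Finset.range P.R, c (j / P.m₁ ^ s % P.m₁) := by
  unfold bit
  simp only [Finset.sum_eq_zero_iff]
  split_ifs with h
  · refine (Finset.prod_eq_one fun s hs => ?_).symm
    have := h s hs
    have := hc (j / P.m₁ ^ s % P.m₁)
    omega
  · push Not at h
    obtain ⟨s, hs, h⟩ := h
    refine (Finset.prod_eq_zero hs ?_).symm
    omega

theorem accA_le (i j : ℕ) : P.accA M Y S₀ i j ≤ 1 := by unfold accA; split_ifs <;> omega
theorem accB_le (i j : ℕ) : P.accB M Y S₀ i j ≤ 1 := by unfold accB; split_ifs <;> omega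

/-- Inner products are multiplicative under tensor powers. -/
theorem sum_rowA_rowB (i i' : ℕ) :
    ∑ j ∈ Finset.range P.dim, P.rowA M Y S₀ i j * P.rowB M Y S₀ i' j =
      (∑ j ∈ Finset.range P.m₁, P.accA M Y S₀ i j * P.accB M Y S₀ i' j) ^ P.R := by
  rw [← sum_range_pow_prod]
  refine Finset.sum_congr rfl fun j _ => ?_
  rw [rowA, rowB, bit_eq_prod _ (accA_le i), bit_eq_prod _ (accB_le i'), Finset.prod_mul_distrib]

/-- For each random element exactly one transcript agrees with Bob's input. This makes all of Bob's
sets equally large, as the subset problem demands. -/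
theorem sum_rowB [NeZero P.q] (i : ℕ) :
    ∑ j ∈ Finset.range P.dim, P.rowB M Y S₀ i j = P.q ^ P.R := by
  have h1 : ∑ j ∈ Finset.range P.m₁, P.accB M Y S₀ i j = P.q := Protocol.sum_accB_one
  rw [← h1, ← sum_range_pow_prod]
  exact Finset.sum_congr rfl fun j _ => bit_eq_prod _ (accB_le i) j

/-- The inner product of two unamplified vectors is the number of random elements on which Alice
accepts, or `0` if her sparse formula has too many clauses for the slots. -/
theorem sum_accA_accB [NeZero P.q] (i i' : ℕ) :
    ∑ j ∈ Finset.range P.m₁, P.accA M Y S₀ i j * P.accB M Y S₀ i' j =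
      if (act (P.sp M Y S₀ i)).card ≤ P.T * P.l then
        (Finset.univ.filter fun r : Fin P.q => Protocol.phi P.q P.l (P.ph i) r =
          (∑ t ∈ Finset.range P.T, Protocol.psiB P.q P.l (P.slotB M Y S₀ i') r t *
            Protocol.psiA P.q P.l (P.slotA M Y S₀ i) r t) % P.q ∧
          Protocol.hash P.q P.J (P.wd (adv k M Y) i') r =
            Protocol.hash P.q P.J (P.wd (adv k M Y) i) r).card else 0 := by
  split_ifs with h
  · rw [← Protocol.sum_accA_accB]
    refine Finset.sum_congr rfl fun j _ => ?_
    rw [accA, accB]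
    congr 1
    exact if_congr (by tauto) rfl rfl
  · refine Finset.sum_eq_zero fun j _ => ?_
    rw [accA, if_neg (by tauto), zero_mul]

theorem sp_congr {i i' : ℕ} (h : ∀ j < P.J, P.wd (adv k M Y) i j = P.wd (adv k M Y) i' j) :
    P.sp M Y S₀ i = P.sp M Y S₀ i' :=
  run_congr _ _ fun j hj => h _ (Nat.div_lt_of_lt_mul hj)

theorem FalsA.mono {h : ℕ} {al : ℕ → ℕ} {C D : PClause k m} (hE : Ext D C) (hC : FalsA h al C) :
    FalsA h al D := fun p hp => by
  have := hC p (by rw [hE p hp]; exact hp)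
  rwa [hE p hp] at this

theorem FalsB.mono {h : ℕ} {al : ℕ → ℕ} {C D : PClause k m} (hE : Ext D C) (hC : FalsB h al C) :
    FalsB h al D := fun p hp => by
  have := hC p (by rw [hE p hp]; exact hp)
  rwa [hE p hp] at this

/-- The conditions on the parameters that are needed for the soundness. -/
structure Sound (P : Par) (g : ℕ) : Prop where
  prime : P.q.Prime
  l_pos : 0 < P.l
  field : 8 * P.T * P.l + 8 ≤ P.q
  poly : 8 * P.l ≤ P.q
  hash : 4 * P.J ≤ P.q
  dig : g < P.q

/-- Different advice is caught by the fingerprint, with at most `J ≤ q / 4` exceptions. With equal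
advice both work on the same sparse formula, and the check of Merlin's polynomial has at most `2 * l
≤ q / 4` exceptions. The advice need not be a good one. -/
theorem sum_le_of_not_sat (hP : P.Sound (adv k M Y)) {i i' : ℕ} (h : ¬ P.Sat S₀ i i') :
    4 * ∑ j ∈ Finset.range P.m₁, P.accA M Y S₀ i j * P.accB M Y S₀ i' j ≤ P.q := by
  have := Fact.mk hP.prime
  have : NeZero P.q := ⟨hP.prime.ne_zero⟩
  rw [sum_accA_accB]
  split_ifs with hact
  swap
  · omega
  have hwd : ∀ i j, P.wd (adv k M Y) i j < P.q := fun i j => by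
    unfold wd
    have := hP.dig
    split_ifs
    · have := Nat.mod_lt (i / 2 ^ P.h / P.q ^ (2 * P.l) / (adv k M Y + 1) ^ j)
        (show adv k M Y + 1 > 0 by omega)
      omega
    · exact hP.prime.pos
  by_cases hw : ∃ j < P.J, P.wd (adv k M Y) i j ≠ P.wd (adv k M Y) i' j
  · refine (Nat.mul_le_mul_left 4 ((Finset.card_le_card fun r hr => ?_).trans
      (Protocol.card_hash_le (w := P.wd (adv k M Y) i) (w' := P.wd (adv k M Y) i')
        (fun j _ => hwd i j) (fun j _ => hwd i' j) hw))).trans hP.hash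
    rw [Finset.mem_filter] at hr ⊢
    exact ⟨hr.1, hr.2.2⟩
  · push Not at hw
    have hsp := sp_congr (S₀ := S₀) hw
    simp only [Sat, not_forall, not_not] at h
    obtain ⟨C, hC, hfa, hfb⟩ := h
    -- The process never removes a clause, so `C` is still present and contains a minimal clause
    -- `D`. Having fewer literals, `D` is falsified by both halves as well.
    obtain ⟨D, hD, hE⟩ := exists_act (subset_run (leastFlower M Y) (adv k M Y)
      (P.wd (adv k M Y) i) S₀ (adv k M Y * P.J) hC)
    have hpos : 0 < ∑ s ∈ Finset.range (P.T * P.l), P.slotA M Y S₀ i s * P.slotB M Y S₀ i' s := by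
      rw [slotA, slotB, ← hsp, sum_slot_pos_iff hact]
      exact ⟨D, hD, FalsA.mono hE hfa, FalsB.mono hE hfb⟩
    have hlt : ∑ s ∈ Finset.range (P.T * P.l), P.slotA M Y S₀ i s * P.slotB M Y S₀ i' s < P.q := by
      rw [slotA, slotB, ← hsp]
      have := sum_slot_le (S := P.sp M Y S₀ i) (P.T * P.l) (FalsA P.h (P.al i))
        (FalsB P.h (P.al i'))
      have := hP.field
      rw [mul_assoc] at this
      omega
    have h2 := hP.poly
    refine (Nat.mul_le_mul_left 4 ((Finset.card_le_card fun r hr => ?_).trans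
      (Protocol.card_phi_le (p := P.ph i) hP.l_pos hpos hlt))).trans (by omega)
    rw [Finset.mem_filter] at hr ⊢
    exact ⟨hr.1, hr.2.1⟩

/-- Soundness of the reduction. -/
theorem sum_row_le_of_not_sat (hP : P.Sound (adv k M Y)) {i i' : ℕ} (h : ¬ P.Sat S₀ i i') :
    4 ^ P.R * ∑ j ∈ Finset.range P.dim, P.rowA M Y S₀ i j * P.rowB M Y S₀ i' j ≤ P.q ^ P.R := by
  rw [sum_rowA_rowB, ← mul_pow]
  exact Nat.pow_le_pow_left (sum_le_of_not_sat hP h) _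

/-- The number of a vector is a triple in mixed radix: half assignment, Merlin's polynomial, advice.
All combinations occur. -/
theorem exists_index (P : Par) (hq : 0 < P.q) (g : ℕ) (x p w : ℕ → ℕ) (hx : ∀ j < P.h, x j < 2)
    (hp : ∀ j < 2 * P.l, p j < P.q) (hw : ∀ j < P.J, w j < g + 1) :
    ∃ i < 2 ^ P.h * P.q ^ (2 * P.l) * (g + 1) ^ P.J, (∀ j < P.h, P.al i j = x j) ∧
      (∀ j < 2 * P.l, P.ph i j = p j) ∧ ∀ j < P.J, P.wd g i j = w j := by
  obtain ⟨a, ha, ha'⟩ := exists_digits_eq x hx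
  obtain ⟨b, hb, hb'⟩ := exists_digits_eq p hp
  obtain ⟨c, hc, hc'⟩ := exists_digits_eq w hw
  have e1 : (a + 2 ^ P.h * (b + P.q ^ (2 * P.l) * c)) / 2 ^ P.h = b + P.q ^ (2 * P.l) * c := by
    rw [Nat.add_mul_div_left _ _ (by positivity), Nat.div_eq_of_lt ha, zero_add]
  have e2 : (b + P.q ^ (2 * P.l) * c) / P.q ^ (2 * P.l) = c := by
    rw [Nat.add_mul_div_left _ _ (by positivity), Nat.div_eq_of_lt hb, zero_add]
  refine ⟨a + 2 ^ P.h * (b + P.q ^ (2 * P.l) * c), ?_, fun j hj => ?_, fun j hj => ?_,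
    fun j hj => ?_⟩
  · have h1 : b + P.q ^ (2 * P.l) * c < P.q ^ (2 * P.l) * (g + 1) ^ P.J := by
      have := Nat.mul_le_mul_left (P.q ^ (2 * P.l)) (Nat.succ_le_of_lt hc)
      rw [Nat.succ_eq_add_one, mul_add, mul_one] at this
      omega
    have := Nat.mul_le_mul_left (2 ^ P.h) (Nat.succ_le_of_lt h1)
    rw [Nat.succ_eq_add_one, mul_add, mul_one, ← mul_assoc (2 ^ P.h) (P.q ^ (2 * P.l))] at this
    omega
  · rw [al, if_pos hj, ← ha' j hj]
    obtain ⟨d, hd⟩ : ∃ d, P.h = j + 1 + d := ⟨P.h - (j + 1), by omega⟩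
    rw [hd, pow_add, pow_succ, show a + 2 ^ j * 2 * 2 ^ d * (b + P.q ^ (2 * P.l) * c) =
      a + 2 ^ j * (2 * (2 ^ d * (b + P.q ^ (2 * P.l) * c))) by ring,
      Nat.add_mul_div_left _ _ (by positivity), Nat.add_mul_mod_self_left]
  · rw [ph, if_pos hj, e1, ← hb' j hj]
    obtain ⟨d, hd⟩ : ∃ d, 2 * P.l = j + 1 + d := ⟨2 * P.l - (j + 1), by omega⟩
    rw [hd, pow_add, pow_succ, show b + P.q ^ j * P.q * P.q ^ d * c =
      b + P.q ^ j * (P.q * (P.q ^ d * c)) by ring,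
      Nat.add_mul_div_left _ _ (by positivity), Nat.add_mul_mod_self_left]
  · rw [wd, if_pos hj, e1, e2, hc' j hj]

theorem phi_congr {q l : ℕ} {p p' : ℕ → ℕ} (h : ∀ j < 2 * l, p j = p' j) (r : ℕ) :
    Protocol.phi q l p r = Protocol.phi q l p' r := by
  unfold Protocol.phi
  rw [Finset.sum_congr rfl fun u hu => by rw [h u (Finset.mem_range.1 hu)]]

/-- Completeness of the reduction. -/
theorem exists_sum_row_eq (hP : P.Sound (adv k M Y)) {n : ℕ} (hM : 1 ≤ M) (hk : 1 ≤ k)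
    (hm : m = 2 * n) (hY : 6 * k * M ≤ Y) (hJ : k * n < M * P.J) (hn : n ≤ 2 * P.h)
    (hact : 1 + k * (k * m * adv k M Y) ≤ P.T * P.l) {x : ℕ → ℕ} (hx : ∀ j, x j < 2)
    (hS : ∀ C ∈ S₀, ∃ p, C p ≠ 0 ∧ x (((C p : ℕ) - 1) / 2) = ((C p : ℕ) - 1) % 2) :
    ∃ i < P.N k M Y, ∃ i' < P.N k M Y,
      ∑ j ∈ Finset.range P.dim, P.rowA M Y S₀ i j * P.rowB M Y S₀ i' j = P.q ^ P.R := by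
  have hY1 : 1 ≤ Y := le_trans (by nlinarith) hY
  have := Fact.mk hP.prime
  have : NeZero P.q := ⟨hP.prime.ne_zero⟩
  obtain ⟨w, hw, hsat, hcard⟩ := exists_sparse (fl := leastFlower M Y) hM hk hm hY
    (leastFlower_some hM hY1) (leastFlower_none hM hY1)
    (x := fun u => x (((u : ℕ) - 1) / 2) = ((u : ℕ) - 1) % 2) hS hJ
  set S := run (leastFlower M Y) (adv k M Y) w S₀ (adv k M Y * P.J) with hSdef
  change ∀ C ∈ S, _ at hsat
  change (act S).card ≤ _ at hcard
  have hcard' := hcard.trans hact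
  obtain ⟨i', hi', ha', -, hw'⟩ := P.exists_index hP.prime.pos (adv k M Y) (fun j => x (P.h + j))
    (fun _ => 0) w (fun j _ => hx _) (fun _ _ => hP.prime.pos) fun j _ => Nat.lt_succ_of_le (hw j)
  have hspw : ∀ i, (∀ j < P.J, P.wd (adv k M Y) i j = w j) → P.sp M Y S₀ i = S := fun i hi =>
    run_congr _ _ fun j hj => hi _ (Nat.div_lt_of_lt_mul hj)
  -- Alice's slots do not depend on Merlin's polynomial. This auxiliary number, with the zero
  -- polynomial, serves to state disjointness before the polynomial is known.
  obtain ⟨i₀, -, ha₀, -, hw₀⟩ := P.exists_index hP.prime.pos (adv k M Y) x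
    (fun _ => 0) w (fun j _ => hx _) (fun _ _ => hP.prime.pos) fun j _ => Nat.lt_succ_of_le (hw j)
  have hzero : ∀ i, (∀ j < P.h, P.al i j = x j) → (∀ j < P.J, P.wd (adv k M Y) i j = w j) →
      ∑ s ∈ Finset.range (P.T * P.l), P.slotA M Y S₀ i s * P.slotB M Y S₀ i' s = 0 := by
    intro i ha hwi
    by_contra hne
    rw [slotA, slotB, hspw i hwi, hspw i' hw'] at hne
    obtain ⟨C, hC, hfa, hfb⟩ := (sum_slot_pos_iff hcard' _ _).1 (Nat.pos_of_ne_zero hne)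
    obtain ⟨p, hp, hxp⟩ := hsat C (act_subset S hC)
    have hlt := (C p).2
    rcases lt_or_ge (((C p : ℕ) - 1) / 2) P.h with h1 | h1
    · exact hfa p hp h1 ((ha _ h1).trans hxp)
    · refine hfb p hp h1 ((ha' _ ?_).trans ?_)
      · have : (C p : ℕ) ≠ 0 := fun h => hp (Fin.ext h)
        omega
      · rwa [show P.h + (((C p : ℕ) - 1) / 2 - P.h) = ((C p : ℕ) - 1) / 2 by omega]
  -- Now the honest polynomial is available; the final number combines it with the same half
  -- assignment and advice.
  obtain ⟨p, hp, hphi⟩ := Protocol.exists_phi (q := P.q) hP.l_pos (hzero i₀ ha₀ hw₀)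
  obtain ⟨i, hi, ha, hpi, hwi⟩ := P.exists_index hP.prime.pos (adv k M Y) x
    p w (fun j _ => hx _) (fun j _ => hp j) fun j _ => Nat.lt_succ_of_le (hw j)
  refine ⟨i, hi, i', hi', ?_⟩
  rw [sum_rowA_rowB, sum_accA_accB, hspw i hwi, if_pos hcard', Finset.filter_true_of_mem]
  · simp
  intro r _
  have hA : P.slotA M Y S₀ i = P.slotA M Y S₀ i₀ := by
    have hal : P.al i = P.al i₀ := by
      funext j
      by_cases hj : j < P.h
      · rw [ha j hj, ha₀ j hj]
      · rw [al, al, if_neg hj, if_neg hj]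
    rw [slotA, slotA, hspw i hwi, hspw i₀ hw₀]
    congr!
  refine ⟨?_, ?_⟩
  · rw [phi_congr hpi, hA, hphi r]
  · unfold Protocol.hash
    rw [Finset.sum_congr rfl fun j hj => by
      rw [hw' j (Finset.mem_range.1 hj), ← hwi j (Finset.mem_range.1 hj)]]

end Par

/-! ### Formulas as sets of partial clauses -/

namespace PClause
variable {k n : ℕ}

theorem lit_lt (a : Fin n × Bool) : 2 * (a.1 : ℕ) + a.2.toNat + 1 < 2 * n + 1 := by
  have := a.1.2
  have := Bool.toNat_le a.2
  omega

/-- A clause as a partial clause without empty positions. -/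
def ofClause (c : KClause k n) : PClause k (2 * n) := fun i =>
  ⟨2 * ((c i).1 : ℕ) + (c i).2.toNat + 1, lit_lt (c i)⟩

/-- A formula as a set of partial clauses. -/
def ofFormula (φ : List (KClause k n)) : Finset (PClause k (2 * n)) := (φ.map ofClause).toFinset

theorem mem_ofFormula {φ : List (KClause k n)} {C : PClause k (2 * n)} :
    C ∈ ofFormula φ ↔ ∃ c : Fin φ.length, ofClause φ[c] = C := by
  simp only [ofFormula, List.mem_toFinset, List.mem_map]
  constructor
  · rintro ⟨c, hc, rfl⟩
    obtain ⟨i, hi, rfl⟩ := List.getElem_of_mem hc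
    exact ⟨⟨i, hi⟩, rfl⟩
  · rintro ⟨c, rfl⟩
    exact ⟨_, List.getElem_mem _, rfl⟩

/-- The literals of the formula `φ` are in the array. -/
def HasInput (φ : List (KClause k n)) (r : ℕ → ℕ) : Prop :=
  ∀ (c : Fin φ.length) (p : Fin k), r (2 + c * k + p) = 2 * ((φ[c] p).1 : ℕ) + (φ[c] p).2.toNat

end PClause

namespace Par
variable {k m n : ℕ} {P : Par} {M Y : ℕ} {S₀ : Finset (PClause k m)}

open PClause

/-! ### Expressions for the vectors -/

/-- Whether the partial clause in variable `0` belongs to the formula. -/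
def formulaE (k : ℕ) : Ex := .lt 0 <| .sum 1 (.var 25) <| .eq (.var 0) <| .sum 2 (.const k) <|
  (.read 0 (2 + .var 1 * .const k + .var 2) + 1) * .pow (.var 11) (.var 2) (.var 12)

theorem eval_formulaE {v r} {φ : List (KClause k n)} (h : Std k (2 * n) v) (hr : HasInput φ (r 0))
    (h25 : v 25 = φ.length) {C : PClause k (2 * n)} (hv : v 0 = enc C) :
    (formulaE k).eval v r = if C ∈ ofFormula φ then 1 else 0 := by
  have hU : 1 ≤ (2 * n + 1) ^ k := Nat.pow_pos (by omega)
  rw [formulaE, Ex.eval_lt]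
  refine if_congr ?_ rfl rfl
  rw [Ex.eval_zero, Ex.eval_sum, Finset.sum_pos_iff, mem_ofFormula]
  have key : ∀ c : Fin φ.length, 0 < (Ex.eq (.var 0) <| .sum 2 (.const k) <|
      (.read 0 (2 + .var 1 * .const k + .var 2) + 1) * .pow (.var 11) (.var 2) (.var 12)).eval
      (Function.update v 1 c) r ↔ ofClause φ[c] = C := fun c => by
    rw [Ex.eval_eq, Code.pos_ite, Ex.eval_sum, Ex.eval_const, Finset.sum_range, eq_comm,
      ← enc_injective.eq_iff, enc_eq_sum (ofClause φ[c])]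
    simp only [Ex.eval_var]
    rw [show (Function.update v 1 ↑c) 0 = enc C by simp [hv]]
    have : ∀ p : Fin k, ((.read 0 (2 + .var 1 * .const k + .var 2) + 1) *
        Ex.pow (.var 11) (.var 2) (.var 12)).eval
        (Function.update (Function.update v 1 ↑c) 2 ↑p) r =
        (ofClause φ[c] p : ℕ) * (2 * n + 1) ^ (p : ℕ) := fun p => by
      rw [Ex.eval_mul, Ex.eval_pow]
      · simp [h.1, hr c p, ofClause]
      · simpa [h.1, h.2] using Nat.pow_le_pow_right (by omega) p.2.le
      · simpa [h.2] using hU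
    simp only [this]
  simp only [← key]
  simp only [Ex.eval_var, h25, Finset.mem_range]
  exact ⟨fun ⟨c, hc, h⟩ => ⟨⟨c, hc⟩, h⟩, fun ⟨c, h⟩ => ⟨c, c.2, h⟩⟩

/-- Whether the first half of the variables falsifies the partial clause in variable `1`. -/
def falsAE (k : ℕ) : Ex :=
  let d : Ex := digE (.var 1) (.var 7)
  .not <| .sum 7 (.const k) <| .lt 0 d * .lt ((d - 1) / 2) (.var 18) *
    .eq (.read 5 ((d - 1) / 2)) (.mod (d - 1) 2)

/-- Whether the second half of the variables falsifies the partial clause in variable `1`. -/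
def falsBE (k : ℕ) : Ex :=
  let d : Ex := digE (.var 1) (.var 7)
  .not <| .sum 7 (.const k) <| .lt 0 d * .not (.lt ((d - 1) / 2) (.var 18)) *
    .eq (.read 5 ((d - 1) / 2 - .var 18)) (.mod (d - 1) 2)

theorem eval_falsAE {v r} (h : Std k m v) {C : PClause k m} (hv : v 1 = enc C) :
    (falsAE k).eval v r = if FalsA (v 18) (r 5) C then 1 else 0 := by
  dsimp only [falsAE]
  rw [Ex.eval_not, Ex.eval_sum, Ex.eval_const, Finset.sum_range]
  refine if_congr ?_ rfl rfl
  rw [Finset.sum_eq_zero_iff]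
  unfold FalsA
  simp only [Finset.mem_univ, forall_true_left]
  refine forall_congr' fun p => ?_
  have hd : (digE (.var 1) (.var 7)).eval (Function.update v 7 (p : ℕ)) r = C p := by
    rw [eval_digE (h.update (by omega) (by omega)) (by simp)]
    simp [hv, dig_enc]
  simp only [Ex.eval_mul, Ex.eval_lt, Ex.eval_eq, Ex.eval_div, Ex.eval_sub, Ex.eval_mod, hd,
    Ex.eval_zero, Ex.eval_one, Ex.eval_ofNat, Ex.eval_read, Ex.eval_var]
  rw [show (Function.update v 7 (p : ℕ)) 18 = v 18 by simp]
  have : C p ≠ 0 ↔ 0 < (C p : ℕ) := by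
    rw [Nat.pos_iff_ne_zero, not_iff_not]
    exact ⟨fun h => by rw [h]; rfl, fun h => Fin.ext h⟩
  rw [this]
  split_ifs <;> simp [*]

theorem eval_falsBE {v r} (h : Std k m v) {C : PClause k m} (hv : v 1 = enc C) :
    (falsBE k).eval v r = if FalsB (v 18) (r 5) C then 1 else 0 := by
  dsimp only [falsBE]
  rw [Ex.eval_not, Ex.eval_sum, Ex.eval_const, Finset.sum_range]
  refine if_congr ?_ rfl rfl
  rw [Finset.sum_eq_zero_iff]
  unfold FalsB
  simp only [Finset.mem_univ, forall_true_left]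
  refine forall_congr' fun p => ?_
  have hd : (digE (.var 1) (.var 7)).eval (Function.update v 7 (p : ℕ)) r = C p := by
    rw [eval_digE (h.update (by omega) (by omega)) (by simp)]
    simp [hv, dig_enc]
  simp only [Ex.eval_mul, Ex.eval_lt, Ex.eval_eq, Ex.eval_div, Ex.eval_sub, Ex.eval_mod, hd,
    Ex.eval_zero, Ex.eval_one, Ex.eval_ofNat, Ex.eval_read, Ex.eval_var, Ex.eval_not]
  rw [show (Function.update v 7 (p : ℕ)) 18 = v 18 by simp]
  have : C p ≠ 0 ↔ 0 < (C p : ℕ) := by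
    rw [Nat.pos_iff_ne_zero, not_iff_not]
    exact ⟨fun h => by rw [h]; rfl, fun h => Fin.ext h⟩
  rw [this, ← not_lt (b := v 18)]
  split_ifs <;> simp_all

theorem sum_ind_mul (A : Finset (PClause k m)) (F : ℕ → ℕ) :
    ∑ c ∈ Finset.range ((m + 1) ^ k), ind A c * F c = ∑ C ∈ A, F (enc C) := by
  rw [sum_range_enc]
  simp [Finset.sum_ite_mem]

/-- Whether the partial clause with the rank in variable `0` has the property `f`. -/
def slotE (f : Ex) : Ex := .sum 1 (.var 12) <| .read 9 (.var 1) *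
  (.eq (.sum 2 (.var 1) (.read 9 (.var 2))) (.var 0) * f)

theorem eval_slotE {v r} (h : Std k m v) {S : Finset (PClause k m)} (hr : r 9 = ind (act S))
    {e : Ex} {f : PClause k m → Prop} [DecidablePred f]
    (he : ∀ C, e.eval (Function.update v 1 (enc C)) r = if f C then 1 else 0) {B : ℕ}
    (hB : v 0 < B) : (slotE e).eval v r = slot B S f (v 0) := by
  have hrank : ∀ C : PClause k m, ∑ d ∈ Finset.range (enc C), ind (act S) d = rank S C := fun C => by
    have h1 : ∑ d ∈ Finset.range (enc C), ind (act S) d =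
        ∑ d ∈ Finset.range ((m + 1) ^ k), ind (act S) d * if d < enc C then 1 else 0 := by
      simp only [mul_ite, mul_one, mul_zero]
      rw [← Finset.sum_filter]
      refine Finset.sum_congr ?_ fun _ _ => rfl
      ext d
      have := enc_lt C
      simp
      omega
    rw [h1, sum_ind_mul, rank, Finset.card_filter]
  rw [slotE, Ex.eval_sum, slot, if_pos hB, Ex.eval_var, h.2, Finset.card_filter]
  simp only [Ex.eval_mul, Ex.eval_read, Ex.eval_var, Function.update_self, hr]
  rw [sum_ind_mul]
  refine Finset.sum_congr rfl fun C _ => ?_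
  rw [he, Ex.eval_eq, Ex.eval_sum]
  simp only [Ex.eval_read, Ex.eval_var, Function.update_self, hr, hrank]
  rw [show (Function.update v 1 (enc C)) 0 = v 0 by simp, Ex.ite_mul_ite]

/-- The parameters are in the variables. -/
structure HasPar (P : Par) (k n : ℕ) (v : ℕ → ℕ) : Prop where
  std : Std k (2 * n) v
  l : v 13 = P.l
  T : v 14 = P.T
  q : v 15 = P.q
  q' : v 16 = P.q - 1
  R : v 17 = P.R
  h : v 18 = P.h
  J : v 19 = P.J
  m₁ : v 20 = P.m₁
  dim : v 21 = P.dim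

theorem HasPar.update {v : ℕ → ℕ} (h : P.HasPar k n v) {x c : ℕ} (hx : x < 11 ∨ 21 < x) :
    P.HasPar k n (Function.update v x c) := by
  obtain ⟨h1, h2, h3, h4, h5, h6, h7, h8, h9, h10⟩ := h
  constructor
  · exact h1.update (by omega) (by omega)
  all_goals rw [Function.update_of_ne (by omega)]; assumption

/-- The power of `e` to the exponent `f`, modulo `q`. -/
def powE (e f : Ex) : Ex := .pow e f (.var 16)

theorem eval_powE {v r} (h : P.HasPar k n v) (hq : 2 ≤ P.q) (e f : Ex) :
    (powE e f).eval v r = e.eval v r ^ f.eval v r % P.q := by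
  rw [powE, Ex.eval, powMod_eq]
  · rw [Ex.eval_var, h.q', show P.q - 1 + 1 = P.q by omega]
  · rw [Ex.eval_var, h.q']; omega

/-- The digit number `e` of the transcript in variable `0`. -/
def transE (e : Ex) : Ex := .mod (.var 0 / .pow (.var 15) e (.var 20)) (.var 15)

theorem eval_transE {v r} (h : P.HasPar k n v) (hq : 2 ≤ P.q) {e : Ex} (he : e.eval v r ≤ P.T + 1) :
    (transE e).eval v r = v 0 / P.q ^ e.eval v r % P.q := by
  rw [transE, Ex.eval_mod, Ex.eval_div, Ex.eval_pow]
  · simp [h.q]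
  · simpa [h.q, h.m₁, m₁] using Nat.pow_le_pow_right (show 0 < P.q by omega) (by omega)
  · simpa [h.m₁, m₁] using Nat.one_le_pow _ _ (show 0 < P.q by omega)

/-- The random element of the field. -/
def rndE : Ex := .mod (.var 0) (.var 15)

theorem eval_rndE {v r} (h : P.HasPar k n v) : rndE.eval v r = v 0 % P.q := by
  simp [rndE, h.q]

def hashE : Ex := .mod (.sum 2 (.var 19) (.read 7 (.var 2) * powE rndE (.var 2))) (.var 15)

theorem eval_hashE {v r} (h : P.HasPar k n v) (hq : 2 ≤ P.q) :
    hashE.eval v r = Protocol.hash P.q P.J (r 7) (v 0 % P.q) := by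
  rw [hashE, Ex.eval_mod, Ex.eval_sum, Protocol.hash, Ex.eval_var, Ex.eval_var, h.J, h.q]
  congr 1
  refine Finset.sum_congr rfl fun j _ => ?_
  have h' := h.update (x := 2) (c := j) (by omega)
  rw [Ex.eval_mul, eval_powE h' hq, eval_rndE h']
  simp

def phiE : Ex := .mod (.sum 2 (2 * .var 13) (.read 6 (.var 2) * .not (.eq (.var 2) (.var 13 - 1)) *
  powE rndE (.var 2))) (.var 15)

theorem eval_phiE {v r} (h : P.HasPar k n v) (hq : 2 ≤ P.q) :
    phiE.eval v r = Protocol.phi P.q P.l (r 6) (v 0 % P.q) := by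
  rw [phiE, Ex.eval_mod, Ex.eval_sum, Protocol.phi, Ex.eval_mul, Ex.eval_var, Ex.eval_var, h.l, h.q,
    Ex.eval_ofNat]
  congr 1
  refine Finset.sum_congr rfl fun j _ => ?_
  have h' := h.update (x := 2) (c := j) (by omega)
  rw [Ex.eval_mul, Ex.eval_mul, eval_powE h' hq, eval_rndE h', Ex.eval_not, Ex.eval_eq]
  simp [h.l]

def psiAE : Ex := .sum 2 (.var 13) (.read 12 (.var 1 * .var 13 + .var 2) * powE rndE (.var 2))

theorem eval_psiAE {v r} (h : P.HasPar k n v) (hq : 2 ≤ P.q) :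
    psiAE.eval v r = Protocol.psiA P.q P.l (r 12) (v 0 % P.q) (v 1) := by
  rw [psiAE, Ex.eval_sum, Protocol.psiA, Ex.eval_var, h.l]
  refine Finset.sum_congr rfl fun j _ => ?_
  have h' := h.update (x := 2) (c := j) (by omega)
  rw [Ex.eval_mul, eval_powE h' hq, eval_rndE h']
  simp [h.l]

def psiBE : Ex := .mod (.sum 2 (.var 13) (.read 13 (.var 1 * .var 13 + .var 2) *
  powE rndE (.var 13 - 1 - .var 2))) (.var 15)

theorem eval_psiBE {v r} (h : P.HasPar k n v) (hq : 2 ≤ P.q) :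
    psiBE.eval v r = Protocol.psiB P.q P.l (r 13) (v 0 % P.q) (v 1) := by
  rw [psiBE, Ex.eval_mod, Ex.eval_sum, Protocol.psiB, Ex.eval_var, Ex.eval_var, h.l, h.q]
  congr 1
  refine Finset.sum_congr rfl fun j _ => ?_
  have h' := h.update (x := 2) (c := j) (by omega)
  rw [Ex.eval_mul, eval_powE h' hq, eval_rndE h']
  simp [h.l]

def accAE : Ex := .not (.lt (.var 14 * .var 13) (.sum 1 (.var 12) (.read 9 (.var 1)))) *
  (.eq phiE (.mod (.sum 1 (.var 14) (transE (.var 1 + 1) * psiAE)) (.var 15)) *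
  .eq (transE (.var 14 + 1)) hashE)

theorem eval_accAE {v r} (h : P.HasPar k n v) (hq : 2 ≤ P.q) {i : ℕ}
    {S₀ : Finset (PClause k (2 * n))} (h6 : r 6 = P.ph i) (h7 : r 7 = P.wd (adv k M Y) i)
    (h9 : r 9 = ind (act (P.sp M Y S₀ i))) (h12 : r 12 = P.slotA M Y S₀ i) :
    accAE.eval v r = P.accA M Y S₀ i (v 0) := by
  have h1 : (Ex.sum 1 (.var 12) (.read 9 (.var 1))).eval v r = (act (P.sp M Y S₀ i)).card := by
    have := sum_ind_mul (act (P.sp M Y S₀ i)) fun _ => 1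
    simpa [h.std.2, h9] using this
  have h2 : (Ex.sum 1 (.var 14) (transE (.var 1 + 1) * psiAE)).eval v r =
      ∑ t ∈ Finset.range P.T, v 0 / P.q ^ (t + 1) % P.q *
        Protocol.psiA P.q P.l (P.slotA M Y S₀ i) (v 0 % P.q) t := by
    rw [Ex.eval_sum, Ex.eval_var, h.T]
    refine Finset.sum_congr rfl fun t ht => ?_
    rw [Finset.mem_range] at ht
    have h' := h.update (x := 1) (c := t) (by omega)
    rw [Ex.eval_mul, eval_transE h' hq (by simp; omega), eval_psiAE h' hq, h12]
    simp
  rw [accAE, Ex.eval_mul, Ex.eval_mul, Ex.eval_not, Ex.eval_lt, Ex.eval_eq, Ex.eval_eq, Ex.eval_mod,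
    eval_phiE h hq, eval_hashE h hq, eval_transE h hq (by simp [h.T]), h1, h2, h6, h7, accA,
    Ex.ite_mul_ite]
  simp only [Ex.eval_mul, Ex.eval_var, Ex.eval_add, Ex.eval_one, h.T, h.l, h.q]
  by_cases hc : (act (P.sp M Y S₀ i)).card ≤ P.T * P.l
  · rw [if_neg (not_lt.2 hc)]
    simp only [if_true, one_mul, hc, true_and]
    exact if_congr Iff.rfl rfl rfl
  · rw [if_pos (not_le.1 hc)]
    simp [hc]

def accBE : Ex := .not (.sum 1 (.var 14) (.not (.eq (transE (.var 1 + 1)) psiBE))) *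
  .eq (transE (.var 14 + 1)) hashE

theorem eval_accBE {v r} (h : P.HasPar k n v) (hq : 2 ≤ P.q) {i : ℕ}
    {S₀ : Finset (PClause k (2 * n))} (h7 : r 7 = P.wd (adv k M Y) i)
    (h13 : r 13 = P.slotB M Y S₀ i) :
    accBE.eval v r = P.accB M Y S₀ i (v 0) := by
  rw [accBE, Ex.eval_mul, Ex.eval_not, Ex.eval_eq, eval_hashE h hq,
    eval_transE h hq (by simp [h.T]), h7, accB, Ex.ite_mul_ite, Ex.eval_sum, Ex.eval_var, h.T]
  simp only [Ex.eval_var, Ex.eval_add, Ex.eval_one, h.T]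
  refine if_congr (and_congr ?_ Iff.rfl) rfl rfl
  rw [Finset.sum_eq_zero_iff]
  refine forall_congr' fun t => ?_
  rw [Finset.mem_range]
  refine imp_congr_right fun ht => ?_
  have h' := h.update (x := 1) (c := t) (by omega)
  rw [Ex.eval_not, Ex.eval_eq, eval_transE h' hq (by simp; omega), eval_psiBE h' hq, h13]
  simp

/-- The entry with the number in variable `0` of the vector that is given by the array `x`. -/
def bitE (x : ℕ) : Ex := .not <| .sum 1 (.var 17) <|
  1 - .read x (.mod (.var 0 / .pow (.var 20) (.var 1) (.var 21)) (.var 20))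

theorem eval_bitE {v r} (h : P.HasPar k n v) (hq : 2 ≤ P.q) {x : ℕ} {c : ℕ → ℕ}
    (hc : ∀ j < P.m₁, r x j = c j) : (bitE x).eval v r = P.bit c (v 0) := by
  have hm : 0 < P.m₁ := Nat.pow_pos (by omega)
  rw [bitE, Ex.eval_not, Ex.eval_sum, bit, Ex.eval_var, h.R]
  refine if_congr ?_ rfl rfl
  rw [Finset.sum_congr rfl fun s hs => ?_]
  rw [Finset.mem_range] at hs
  have h' := h.update (x := 1) (c := s) (by omega)
  rw [Ex.eval_sub, Ex.eval_read, Ex.eval_mod, Ex.eval_div, Ex.eval_pow]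
  · simp [h.m₁, hc _ (Nat.mod_lt _ hm)]
  · simpa [h.m₁, h.dim, dim] using Nat.pow_le_pow_right hm hs.le
  · simpa [h.dim, dim] using Nat.one_le_pow _ _ hm

end Par

theorem Ex.stable_const (c : ℕ) : (Ex.const c).Stable := fun _ _ _ _ => rfl

theorem Ex.stable_var {x : ℕ} (hx : x ≠ 0) : (Ex.var x).Stable := fun _ _ _ _ =>
  Function.update_of_ne hx _ _

theorem Code.digs_eq {K x z : ℕ} {n e : Ex} (hz : z ≠ 0) (he : e.Stable) {μ : Mem}
    (hv : μ.v 0 = 0) (hb : μ.b 0 = 0) (F : ℕ → ℕ) (B : ℕ)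
    (h : ∀ i, (if i < n.val μ then μ.b z / (e.val μ + 1) ^ i % (e.val μ + 1) else μ.a x i) = F i)
    (hB : μ.b z / (e.val μ + 1) ^ n.val μ = B) :
    (digs x z n e hz he : Code K).den μ = (μ.setA x F).setB z B := by
  rw [digs_den x z n e hz he hv hb, hB, funext h]

namespace Par
variable {K k n : ℕ} {P : Par} {M Y : ℕ} {φ : List (KClause k n)}

open PClause

/-! ### The program that writes a vector -/

/-- The memory is ready for the computation of the vectors. -/
structure Ready (P : Par) (φ : List (KClause k n)) (μ : Mem) : Prop where
  par : P.HasPar k n μ.v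
  input : HasInput φ (μ.a 0)
  len : μ.v 25 = φ.length
  v0 : μ.v 0 = 0
  v22 : μ.v 22 = 0
  v23 : μ.v 23 = 0
  b0 : μ.b 0 = 0
  b1 : μ.b 1 = 0
  b6 : μ.b 6 = 0
  b7 : μ.b 7 = 0
  clean : ∀ x, 5 ≤ x → μ.a x = 0

/-- Only four big numbers matter: the loop counters `b 0` and `b 1`, the work register `b 6`, and
the permanent zero `b 7`. The counter, the address and the number of the current vector are free to
change. -/
theorem Ready.congr {μ ν : Mem} (h : P.Ready φ μ) (hv : ν.v = μ.v) (ha : ν.a = μ.a)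
    (hb : ∀ z, z = 0 ∨ z = 1 ∨ z = 6 ∨ z = 7 → ν.b z = μ.b z) : P.Ready φ ν := by
  obtain ⟨h1, h2, h3, h4, h5, h6, h7, h8, h9, h10, h11⟩ := h
  constructor <;> simp_all

/-- Decodes the number in `b 5`. -/
def decodeCode (k M Y : ℕ) : Code K :=
  -- `b 7` is always `0`, so this copies the number of the vector before its digits are consumed.
  (Code.bopB .add 6 5 7).seq <|
  (Code.digs 5 6 (.var 18) 1 (by omega) (Ex.stable_const 1)).seq <|
  (Code.digs 6 6 (2 * .var 13) (.var 16) (by omega) (Ex.stable_var (by omega))).seq <|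
  (Code.digs 7 6 (.var 19) (.const (adv k M Y)) (by omega) (Ex.stable_const _)).seq <|
  Code.bset 6 0

theorem decodeCode_den {μ : Mem} (h : P.Ready φ μ) (hq : 2 ≤ P.q) :
    (decodeCode k M Y : Code K).den μ = ((μ.setA 5 (P.al (μ.b 5))).setA 6 (P.ph (μ.b 5))).setA 7
      (P.wd (adv k M Y) (μ.b 5)) := by
  have hc := h.clean
  simp only [decodeCode, Code.seq_den, Code.bopB_den, Code.bset_den, RAMOp.eval, h.b7, add_zero]
  have h13 := h.par.l
  have h16 := h.par.q'
  have h18 := h.par.h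
  have h19 := h.par.J
  have hq' : P.q - 1 + 1 = P.q := by omega
  have t1 := Code.digs_eq (K := K) (x := 5) (z := 6) (n := .var 18) (e := 1) (by omega)
    (Ex.stable_const 1) (μ := μ.setB 6 (μ.b 5)) h.v0 (by simp [h.b0]) (P.al (μ.b 5))
    (μ.b 5 / 2 ^ P.h) (fun j => by simp [al, Ex.val, h18, hc]) (by simp [Ex.val, h18])
  rw [t1]
  have t2 := Code.digs_eq (K := K) (x := 6) (z := 6) (n := 2 * .var 13) (e := .var 16) (by omega)
    (Ex.stable_var (by omega))
    (μ := ((μ.setB 6 (μ.b 5)).setA 5 (P.al (μ.b 5))).setB 6 (μ.b 5 / 2 ^ P.h))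
    (by simp [h.v0]) (by simp [h.b0]) (P.ph (μ.b 5)) (μ.b 5 / 2 ^ P.h / P.q ^ (2 * P.l))
    (fun j => by simp [ph, Ex.val, h13, h16, hq', hc]) (by simp [Ex.val, h13, h16, hq'])
  rw [t2]
  have t3 := Code.digs_eq (K := K) (x := 7) (z := 6) (n := .var 19) (e := .const (adv k M Y))
    (by omega) (Ex.stable_const _)
    (μ := ((((μ.setB 6 (μ.b 5)).setA 5 (P.al (μ.b 5))).setB 6 (μ.b 5 / 2 ^ P.h)).setA 6
      (P.ph (μ.b 5))).setB 6 (μ.b 5 / 2 ^ P.h / P.q ^ (2 * P.l)))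
    (by simp [h.v0]) (by simp [h.b0]) (P.wd (adv k M Y) (μ.b 5)) _
    (fun j => by simp [wd, Ex.val, h19, hc]) rfl
  rw [t3]
  ext x y
  · simp
  · by_cases hx : x = 6
    · subst hx; simp [h.b6, Ex.val]
    · simp [hx]
  · simp
  · simp
  · simp

/-- The sparse formula that is described by the advice. -/
def sparseCode (k M Y : ℕ) : Code K :=
  (Code.tab 8 (.var 12) (formulaE k) (by simp [formulaE, Ex.arrays])).seq <|
  (Code.rep 22 1 (.const (adv k M Y) * .var 19) (stepCode k M Y)
    (fun V μ hV h => stepCode_bd k M Y V μ hV h)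
    (fun μ => by simp [stepCode, Code.tab]) (fun μ => by simp [stepCode, Code.tab])).seq <|
  Code.asg 22 0

theorem sparseCode_den {μ : Mem} (h : P.HasPar k n μ.v) (hin : HasInput φ (μ.a 0))
    (hlen : μ.v 25 = φ.length) (hv0 : μ.v 0 = 0) (hv22 : μ.v 22 = 0) (hv23 : μ.v 23 = 0)
    (hb0 : μ.b 0 = 0) (hb1 : μ.b 1 = 0) (h8 : μ.a 8 = 0) (h9 : μ.a 9 = 0) (h10 : μ.a 10 = 0)
    (hk : 1 ≤ k) (hY : 1 ≤ Y) {i : ℕ} (h7 : μ.a 7 = P.wd (adv k M Y) i) :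
    (sparseCode k M Y : Code K).den μ = μ.setA 8 (ind (P.sp M Y (ofFormula φ) i)) := by
  have h12 := h.std.2
  simp only [sparseCode, Code.seq_den, Code.asg_den]
  have t1 := Code.tab_eq (K := K) (x := 8) (n := .var 12) (e := formulaE k)
    (by simp [formulaE, Ex.arrays]) hv0 hb0
    (ind (ofFormula φ)) (fun i hi => by
      obtain ⟨C, rfl⟩ := exists_enc (m := 2 * n) (k := k) (by simpa [Ex.val, h12] using hi)
      rw [eval_formulaE (h.std.update (by omega) (by omega)) hin (by simp [hlen]) (C := C) (by simp),
        ind_enc]) (fun i hi => by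
      rw [h8, ind_of_le _ (by simpa [Ex.val, h12] using hi)]; rfl)
  rw [t1]
  let S : ℕ → Finset (PClause k (2 * n)) :=
    run (leastFlower M Y) (adv k M Y) (P.wd (adv k M Y) i) (ofFormula φ)
  have t2 := Code.rep_den (K := K) (x := 22) (z := 1) (n := .const (adv k M Y) * .var 19)
    (p := stepCode k M Y) (hp := fun V μ hV h => stepCode_bd k M Y V μ hV h)
    (hz := fun μ => by simp [stepCode, Code.tab]) (hx := fun μ => by simp [stepCode, Code.tab])
    (μ := μ.setA 8 (ind (ofFormula φ))) (fun j => ((μ.setA 8 (ind (S j))).setV 22 j).setB 1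
      (adv k M Y * P.J - j)) (N := adv k M Y * P.J) (by simp [Ex.val, h.J])
    (by ext x y <;> simp [S, run]) (fun j hj => by
      have := stepCode_den (K := K) (k := k) (m := 2 * n) (M := M) (Y := Y) (S := S j)
        (μ := ((μ.setA 8 (ind (S j))).setV 22 j).setB 1 (adv k M Y * P.J - j))
        (h.std.update (by omega) (by omega)) hk hY (by simp) (by simp [h9]) (by simp [h10])
        (by simp [hv0]) (by simp [hb0]) (by simp [hv23])
      rw [this]
      have e1 : stepD (leastFlower M Y) (S j) (j % adv k M Y)
          (P.wd (adv k M Y) i (j / adv k M Y)) = S (j + 1) := rfl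
      ext x y
      · by_cases hx : x = 22
        · subst hx; simp
        · simp [hx]
      · by_cases hx : x = 1
        · subst hx; simp; omega
        · simp [hx]
      · by_cases hx : x = 8
        · subst hx
          simp [h7, ← e1, adv]
        · simp [hx]
      · simp
      · simp)
  rw [t2]
  ext x y
  · by_cases hx : x = 22
    · subst hx; simp [hv22, Ex.val]
    · simp [hx]
  · by_cases hx : x = 1
    · subst hx; simp [hb1]
    · simp [hx]
  · rfl
  · rfl
  · rfl

end Par

/-! ### Decisions on all transcripts and the writing of a row -/

namespace Par
variable {K k n : ℕ} {P : Par} {M Y : ℕ} {φ : List (KClause k n)}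

open PClause

/-- The decisions of Alice and Bob on all transcripts. -/
def acceptCode (k : ℕ) : Code K :=
  (Code.tab 9 (.var 12) (actE k) (notMem_actE (by omega))).seq <|
  (Code.tab 12 (.var 14 * .var 13) (slotE (falsAE k))
    (by simp [slotE, falsAE, digE, Ex.arrays])).seq <|
  (Code.tab 13 (.var 14 * .var 13) (slotE (falsBE k))
    (by simp [slotE, falsBE, digE, Ex.arrays])).seq <|
  (Code.tab 18 (.var 20) accAE
    (by simp [accAE, phiE, psiAE, transE, hashE, powE, rndE, Ex.arrays])).seq <|
  Code.tab 19 (.var 20) accBE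
    (by simp [accBE, psiBE, transE, hashE, powE, rndE, Ex.arrays])

theorem acceptCode_den {μ : Mem} (h : P.HasPar k n μ.v) (hq : 2 ≤ P.q) (hv0 : μ.v 0 = 0)
    (hb0 : μ.b 0 = 0) {i : ℕ} (h5 : μ.a 5 = P.al i) (h6 : μ.a 6 = P.ph i)
    (h7 : μ.a 7 = P.wd (adv k M Y) i) (h8 : μ.a 8 = ind (P.sp M Y (ofFormula φ) i))
    (h9 : μ.a 9 = 0) (h12 : μ.a 12 = 0) (h13 : μ.a 13 = 0) (h18 : μ.a 18 = 0) (h19 : μ.a 19 = 0) :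
    (acceptCode k : Code K).den μ =
      ((((μ.setA 9 (ind (act (P.sp M Y (ofFormula φ) i)))).setA 12
        (P.slotA M Y (ofFormula φ) i)).setA 13 (P.slotB M Y (ofFormula φ) i)).setA 18
        fun j => if j < P.m₁ then P.accA M Y (ofFormula φ) i j else 0).setA 19
        fun j => if j < P.m₁ then P.accB M Y (ofFormula φ) i j else 0 := by
  have g12 := h.std.2
  have hB : (Ex.var 14 * .var 13).eval μ.v μ.a = P.T * P.l := by simp [h.T, h.l]
  have t1 := Code.tab_eq (K := K) (x := 9) (n := .var 12) (notMem_actE (k := k) (by omega)) hv0 hb0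
    (ind (act (P.sp M Y (ofFormula φ) i))) (fun i hi => by
      obtain ⟨C, rfl⟩ := exists_enc (m := 2 * n) (by simpa [Ex.val, g12] using hi)
      rw [eval_actE (h.std.update (by omega) (by omega)) h8 (C := C) (by simp), ind_enc])
    (fun i hi => by
      rw [h9, ind_of_le _ (by simpa [Ex.val, g12] using hi)]; rfl)
  have t2 := Code.tab_eq (K := K) (x := 12) (n := .var 14 * .var 13) (e := slotE (falsAE k))
    (μ := μ.setA 9 (ind (act (P.sp M Y (ofFormula φ) i))))
    (by simp [slotE, falsAE, digE, Ex.arrays]) hv0 hb0 (P.slotA M Y (ofFormula φ) i)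
    (fun s hs => by
      simp only [Mem.setA_v]
      rw [eval_slotE (h.std.update (by omega) (by omega)) (S := P.sp M Y (ofFormula φ) i) (by simp)
        (B := P.T * P.l) (f := FalsA P.h (P.al i)) (fun C => by
          rw [eval_falsAE ((h.std.update (by omega) (by omega)).update (by omega) (by omega))
            (C := C) (by simp)]
          simp [h5, h.h]) (by simpa [Ex.val, h.T, h.l] using hs)]
      simp [slotA]) (fun s hs => by
      rw [slotA, slot, if_neg (by simpa [Ex.val, h.T, h.l] using hs)]
      simp [h12])
  have t3 := Code.tab_eq (K := K) (x := 13) (n := .var 14 * .var 13) (e := slotE (falsBE k))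
    (μ := (μ.setA 9 (ind (act (P.sp M Y (ofFormula φ) i)))).setA 12 (P.slotA M Y (ofFormula φ) i))
    (by simp [slotE, falsBE, digE, Ex.arrays]) hv0 hb0 (P.slotB M Y (ofFormula φ) i)
    (fun s hs => by
      simp only [Mem.setA_v]
      rw [eval_slotE (h.std.update (by omega) (by omega)) (S := P.sp M Y (ofFormula φ) i) (by simp)
        (B := P.T * P.l) (f := FalsB P.h (P.al i)) (fun C => by
          rw [eval_falsBE ((h.std.update (by omega) (by omega)).update (by omega) (by omega))
            (C := C) (by simp)]
          simp [h5, h.h]) (by simpa [Ex.val, h.T, h.l] using hs)]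
      simp [slotB]) (fun s hs => by
      rw [slotB, slot, if_neg (by simpa [Ex.val, h.T, h.l] using hs)]
      simp [h13])
  have t4 := Code.tab_eq (K := K) (x := 18) (n := .var 20) (e := accAE)
    (μ := ((μ.setA 9 (ind (act (P.sp M Y (ofFormula φ) i)))).setA 12
      (P.slotA M Y (ofFormula φ) i)).setA 13 (P.slotB M Y (ofFormula φ) i))
    (by simp [accAE, phiE, psiAE, transE, hashE, powE, rndE, Ex.arrays]) hv0 hb0
    (fun j => if j < P.m₁ then P.accA M Y (ofFormula φ) i j else 0)
    (fun j hj => by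
      rw [if_pos (by simpa [Ex.val, h.m₁] using hj)]
      simp only [Mem.setA_v]
      rw [eval_accAE (M := M) (Y := Y) (i := i)
        (S₀ := ofFormula φ) (h.update (by omega)) hq (by simp [h6]) (by simp [h7]) (by simp)
        (by simp)]
      simp) (fun j hj => by
      rw [if_neg (by simpa [Ex.val, h.m₁] using hj)]
      simp [h18])
  have t5 := Code.tab_eq (K := K) (x := 19) (n := .var 20) (e := accBE)
    (μ := (((μ.setA 9 (ind (act (P.sp M Y (ofFormula φ) i)))).setA 12
      (P.slotA M Y (ofFormula φ) i)).setA 13 (P.slotB M Y (ofFormula φ) i)).setA 18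
      fun j => if j < P.m₁ then P.accA M Y (ofFormula φ) i j else 0)
    (by simp [accBE, psiBE, transE, hashE, powE, rndE, Ex.arrays]) hv0 hb0
    (fun j => if j < P.m₁ then P.accB M Y (ofFormula φ) i j else 0)
    (fun j hj => by
      rw [if_pos (by simpa [Ex.val, h.m₁] using hj)]
      simp only [Mem.setA_v]
      rw [eval_accBE (M := M) (Y := Y) (i := i)
        (S₀ := ofFormula φ) (h.update (by omega)) hq (by simp [h7]) (by simp)]
      simp) (fun j hj => by
      rw [if_neg (by simpa [Ex.val, h.m₁] using hj)]
      simp [h19])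
  simp only [acceptCode, Code.seq_den]
  rw [t1, t2, t3, t4, t5]

/-- Removes everything from the arrays that are used for the computation of a vector. -/
def clearCode : Code K :=
  (Code.tab 5 (.var 18) 0 (by simp)).seq <|
  (Code.tab 6 (2 * .var 13) 0 (by simp)).seq <|
  (Code.tab 7 (.var 19) 0 (by simp)).seq <|
  (Code.tab 8 (.var 12) 0 (by simp)).seq <|
  (Code.tab 9 (.var 12) 0 (by simp)).seq <|
  (Code.tab 12 (.var 14 * .var 13) 0 (by simp)).seq <|
  (Code.tab 13 (.var 14 * .var 13) 0 (by simp)).seq <|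
  (Code.tab 18 (.var 20) 0 (by simp)).seq <|
  Code.tab 19 (.var 20) 0 (by simp)

theorem clearCode_den {μ : Mem} (h : P.HasPar k n μ.v) (hv0 : μ.v 0 = 0) (hb0 : μ.b 0 = 0)
    (h5 : ∀ j, P.h ≤ j → μ.a 5 j = 0) (h6 : ∀ j, 2 * P.l ≤ j → μ.a 6 j = 0)
    (h7 : ∀ j, P.J ≤ j → μ.a 7 j = 0) (h8 : ∀ j, (2 * n + 1) ^ k ≤ j → μ.a 8 j = 0)
    (h9 : ∀ j, (2 * n + 1) ^ k ≤ j → μ.a 9 j = 0) (h12 : ∀ j, P.T * P.l ≤ j → μ.a 12 j = 0)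
    (h13 : ∀ j, P.T * P.l ≤ j → μ.a 13 j = 0) (h18 : ∀ j, P.m₁ ≤ j → μ.a 18 j = 0)
    (h19 : ∀ j, P.m₁ ≤ j → μ.a 19 j = 0) :
    (clearCode : Code K).den μ = ((((((((μ.setA 5 0).setA 6 0).setA 7 0).setA 8 0).setA 9 0).setA
      12 0).setA 13 0).setA 18 0).setA 19 0 := by
  have key : ∀ (x : ℕ) (e : Ex) (B : ℕ) (ν : Mem), ν.v = μ.v → ν.b = μ.b → ν.a x = μ.a x →
      e.val ν = B → (∀ j, B ≤ j → μ.a x j = 0) →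
      (Code.tab (K := K) x e 0 (by simp)).den ν = ν.setA x 0 := fun x e B ν hv hb ha he h' =>
    Code.tab_eq (by simp) (by rw [hv, hv0]) (by rw [hb, hb0]) 0 (fun _ _ => rfl) fun i hi => by
      rw [ha, h' i (he ▸ hi)]; rfl
  simp only [clearCode, Code.seq_den]
  rw [key 5 _ P.h μ rfl rfl (by simp) (by simp [Ex.val, h.h]) h5,
    key 6 _ (2 * P.l) (μ.setA 5 0) rfl rfl (by simp) (by simp [Ex.val, h.l]) h6,
    key 7 _ P.J ((μ.setA 5 0).setA 6 0) rfl rfl (by simp) (by simp [Ex.val, h.J]) h7,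
    key 8 _ _ (((μ.setA 5 0).setA 6 0).setA 7 0) rfl rfl (by simp) (by simp [Ex.val, h.std.2]) h8,
    key 9 _ _ ((((μ.setA 5 0).setA 6 0).setA 7 0).setA 8 0) rfl rfl (by simp) (by simp [Ex.val, h.std.2]) h9,
    key 12 _ (P.T * P.l) (((((μ.setA 5 0).setA 6 0).setA 7 0).setA 8 0).setA 9 0) rfl rfl (by simp) (by simp [Ex.val, h.l, h.T]) h12,
    key 13 _ (P.T * P.l)
      ((((((μ.setA 5 0).setA 6 0).setA 7 0).setA 8 0).setA 9 0).setA 12 0) rfl rfl (by simp) (by simp [Ex.val, h.l, h.T]) h13,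
    key 18 _ P.m₁
      (((((((μ.setA 5 0).setA 6 0).setA 7 0).setA 8 0).setA 9 0).setA 12 0).setA 13 0) rfl rfl (by simp) (by simp [Ex.val, h.m₁]) h18,
    key 19 _ P.m₁ ((((((((μ.setA 5 0).setA 6 0).setA 7 0).setA 8 0).setA 9 0).setA
      12 0).setA 13 0).setA 18 0) rfl rfl (by simp) (by simp [Ex.val, h.m₁]) h19]

/-- Writes the vector with the number in `b 5` that is given by the array `x`, and proceeds to the
next vector. -/
def rowCode (hK : 0 < K) (k M Y x : ℕ) : Code K :=
  (decodeCode k M Y).seq <| (sparseCode k M Y).seq <| (acceptCode k).seq <|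
  (Code.outRow hK 2 (.var 21) (bitE x) (by omega)).seq <| clearCode.seq <|
  Code.bop .add 5 1

/-- Everything used to compute the vector is erased again. The memory changes only in the output,
its address and the number of the vector, so it is ready for the next one. -/
theorem rowCode_den (hK : 0 < K) {μ : Mem} (h : P.Ready φ μ) (hq : 2 ≤ P.q) (hk : 1 ≤ k)
    (hY : 1 ≤ Y) {x : ℕ} {c : ℕ → ℕ}
    (hx : x = 18 ∧ c = P.rowA M Y (ofFormula φ) (μ.b 5) ∨
      x = 19 ∧ c = P.rowB M Y (ofFormula φ) (μ.b 5)) :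
    (rowCode hK k M Y x : Code K).den μ = ((μ.setOA fun j =>
      if μ.b 2 ≤ j ∧ j < μ.b 2 + P.dim then c (j - μ.b 2) else μ.oa 0 j).setB 2
        (μ.b 2 + P.dim)).setB 5 (μ.b 5 + 1) := by
  obtain ⟨i, hi⟩ : ∃ i, μ.b 5 = i := ⟨_, rfl⟩
  rw [hi] at hx ⊢
  have hc := h.clean
  have hp := h.par
  have t1 := decodeCode_den (K := K) (k := k) (M := M) (Y := Y) h hq
  rw [hi] at t1
  obtain ⟨μ₁, hμ₁⟩ : ∃ ν, ν = ((μ.setA 5 (P.al i)).setA 6 (P.ph i)).setA 7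
    (P.wd (adv k M Y) i) := ⟨_, rfl⟩
  rw [← hμ₁] at t1
  have a1 : μ₁.v = μ.v ∧ μ₁.b = μ.b ∧ μ₁.o = μ.o ∧ μ₁.oa = μ.oa ∧ μ₁.a 5 = P.al i ∧
      μ₁.a 6 = P.ph i ∧ μ₁.a 7 = P.wd (adv k M Y) i ∧
      ∀ x, x ≠ 5 → x ≠ 6 → x ≠ 7 → μ₁.a x = μ.a x := by
    subst hμ₁
    simp +contextual
  clear hμ₁
  obtain ⟨v1, b1, o1, oa1, a15, a16, a17, a1⟩ := a1
  have t2 := sparseCode_den (K := K) (φ := φ) (μ := μ₁) (i := i) (P := P) (M := M) (Y := Y)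
    (by rw [v1]; exact hp) (by rw [a1 0 (by omega) (by omega) (by omega)]; exact h.input)
    (by rw [v1, h.len]) (by rw [v1, h.v0]) (by rw [v1, h.v22]) (by rw [v1, h.v23])
    (by rw [b1, h.b0]) (by rw [b1, h.b1]) (by rw [a1, hc] <;> omega) (by rw [a1, hc] <;> omega)
    (by rw [a1, hc] <;> omega) hk hY a17
  obtain ⟨μ₂, hμ₂⟩ : ∃ ν, ν = μ₁.setA 8 (ind (P.sp M Y (ofFormula φ) i)) := ⟨_, rfl⟩
  rw [← hμ₂] at t2
  have a2 : μ₂.v = μ₁.v ∧ μ₂.b = μ₁.b ∧ μ₂.o = μ₁.o ∧ μ₂.oa = μ₁.oa ∧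
      μ₂.a 8 = ind (P.sp M Y (ofFormula φ) i) ∧ ∀ x, x ≠ 8 → μ₂.a x = μ₁.a x := by
    subst hμ₂
    simp +contextual
  clear hμ₂
  obtain ⟨v2, b2, o2, oa2, a28, a2⟩ := a2
  rw [v1] at v2
  rw [b1] at b2
  rw [o1] at o2
  rw [oa1] at oa2
  have a2' : ∀ x, x ≠ 5 → x ≠ 6 → x ≠ 7 → x ≠ 8 → μ₂.a x = μ.a x := fun x h5 h6 h7 h8 => by
    rw [a2 x h8, a1 x h5 h6 h7]
  have t3 := acceptCode_den (K := K) (φ := φ) (μ := μ₂) (i := i) (P := P) (M := M) (Y := Y)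
    (by rw [v2]; exact hp) hq (by rw [v2, h.v0]) (by rw [b2, h.b0]) (by rw [a2 5 (by omega), a15])
    (by rw [a2 6 (by omega), a16]) (by rw [a2 7 (by omega), a17]) a28
    (by rw [a2', hc] <;> omega) (by rw [a2', hc] <;> omega) (by rw [a2', hc] <;> omega)
    (by rw [a2', hc] <;> omega) (by rw [a2', hc] <;> omega)
  obtain ⟨μ₃, hμ₃⟩ : ∃ ν, ν = ((((μ₂.setA 9 (ind (act (P.sp M Y (ofFormula φ) i)))).setA 12
        (P.slotA M Y (ofFormula φ) i)).setA 13 (P.slotB M Y (ofFormula φ) i)).setA 18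
        fun j => if j < P.m₁ then P.accA M Y (ofFormula φ) i j else 0).setA 19
        fun j => if j < P.m₁ then P.accB M Y (ofFormula φ) i j else 0 := ⟨_, rfl⟩
  rw [← hμ₃] at t3
  have a3 : μ₃.v = μ₂.v ∧ μ₃.b = μ₂.b ∧ μ₃.o = μ₂.o ∧ μ₃.oa = μ₂.oa ∧
      μ₃.a 9 = ind (act (P.sp M Y (ofFormula φ) i)) ∧
      μ₃.a 12 = P.slotA M Y (ofFormula φ) i ∧ μ₃.a 13 = P.slotB M Y (ofFormula φ) i ∧
      (μ₃.a 18 = fun j => if j < P.m₁ then P.accA M Y (ofFormula φ) i j else 0) ∧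
      (μ₃.a 19 = fun j => if j < P.m₁ then P.accB M Y (ofFormula φ) i j else 0) ∧
      ∀ x, x ≠ 9 → x ≠ 12 → x ≠ 13 → x ≠ 18 → x ≠ 19 → μ₃.a x = μ₂.a x := by
    subst hμ₃
    simp +contextual
  clear hμ₃
  obtain ⟨v3, b3, o3, oa3, a39, a312, a313, a318, a319, a3⟩ := a3
  rw [v2] at v3
  rw [b2] at b3
  rw [o2] at o3
  rw [oa2] at oa3
  have e3 : (Ex.var 21).val μ₃ = P.dim := by simp [Ex.val, v3, hp.dim]
  have t4 := Code.outRow_den (K := K) hK 2 (.var 21) (bitE x) (by omega) (μ := μ₃)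
    (by rw [v3, h.v0]) (by rw [b3, h.b0])
  have t5 : (fun j => if μ₃.b 2 ≤ j ∧ j < μ₃.b 2 + (Ex.var 21).val μ₃ then
      (bitE x).eval (Function.update μ₃.v 0 (j - μ₃.b 2)) μ₃.a else μ₃.oa 0 j) =
      fun j => if μ.b 2 ≤ j ∧ j < μ.b 2 + P.dim then c (j - μ.b 2) else μ.oa 0 j := by
    rw [e3, b3, oa3, v3]
    funext j
    split_ifs
    · have hp' : P.HasPar k n (Function.update μ.v 0 (j - μ.b 2)) := HasPar.update hp (by omega)
      rcases hx with ⟨rfl, rfl⟩ | ⟨rfl, rfl⟩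
      · rw [eval_bitE hp' hq (c := P.accA M Y (ofFormula φ) i) fun j hj => by simp [a318, hj]]
        simp [rowA]
      · rw [eval_bitE hp' hq (c := P.accB M Y (ofFormula φ) i) fun j hj => by simp [a319, hj]]
        simp [rowB]
    · rfl
  rw [t5, e3, b3] at t4
  have t6 := clearCode_den (K := K) (k := k) (n := n) (P := P) (μ := (μ₃.setOA fun j =>
      if μ.b 2 ≤ j ∧ j < μ.b 2 + P.dim then c (j - μ.b 2) else μ.oa 0 j).setB 2
        (μ.b 2 + P.dim)) (by simp only [Mem.setB_v, Mem.setOA_v, v3]; exact hp)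
    (by simp [v3, h.v0]) (by simp [b3, h.b0])
    (fun j hj => by simp [a3, a2, a15, al, hj]) (fun j hj => by simp [a3, a2, a16, ph, hj])
    (fun j hj => by simp [a3, a2, a17, wd, hj]) (fun j hj => by simp [a3, a28, ind_of_le _ hj])
    (fun j hj => by simp [a39, ind_of_le _ hj]) (fun j hj => by simp [a312, slotA, slot, hj])
    (fun j hj => by simp [a313, slotB, slot, hj]) (fun j hj => by simp [a318, hj])
    (fun j hj => by simp [a319, hj])
  simp only [rowCode, Code.seq_den, Code.bop_den]
  rw [t1, t2, t3, t4, t6]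
  have hc' : ∀ x, 5 ≤ x → ∀ y, μ.a x y = 0 := fun x hx y => by rw [hc x hx]; rfl
  ext x y
  · simp [v3]
  · by_cases hx : x = 5
    · subst hx; simp [b3, RAMOp.eval, Ex.val, hi]
    · simp [hx, b3]
  · simp only [Mem.setB_a, Mem.setA_a, Mem.setOA_a, Function.update_apply]
    split_ifs <;> first
      | (subst_vars; rw [hc' _ (by omega)]; rfl)
      | rw [a3, a2'] <;> assumption
  · simp [o3]
  · simp [oa3]

end Par

/-! ### The parameters -/

/-- The least prime number above `X`. -/
def leastPrime (X : ℕ) : ℕ := X + 1 + leastN (fun z => if (X + 1 + z).Prime then 1 else 0) X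

/-- By Bertrand's postulate the search below `2 * X` succeeds. -/
theorem leastPrime_spec {X : ℕ} (hX : X ≠ 0) :
    (leastPrime X).Prime ∧ X < leastPrime X ∧ leastPrime X ≤ 2 * X := by
  obtain ⟨p, hp, h1, h2⟩ := Nat.exists_prime_lt_and_le_two_mul X hX
  obtain ⟨h3, h4, h5⟩ := leastN_spec (fun z => if (X + 1 + z).Prime then 1 else 0) X
  have h6 : leastN (fun z => if (X + 1 + z).Prime then 1 else 0) X < X := by
    by_contra h
    have := h4 (p - (X + 1)) (by omega)
    rw [show X + 1 + (p - (X + 1)) = p by omega, if_pos hp] at this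
    omega
  have h7 := h5 h6
  simp only [ne_eq, ite_eq_right_iff, one_ne_zero, imp_false, not_not] at h7
  exact ⟨h7, by unfold leastPrime; omega, by unfold leastPrime; omega⟩

/-- The least prime number above the variable `26`. -/
def leastPrimeE : Ex :=
  let p : Ex := .var 26 + 1 + .var 1
  .var 26 + 1 + .least 1 2 (.var 26) (.not (.sum 3 p (.lt 1 (.var 3) * .eq 0 (.mod p (.var 3)))))

theorem eval_leastPrimeE {v r} : (leastPrimeE).eval v r = leastPrime (v 26) := by
  dsimp only [leastPrimeE]
  rw [Ex.eval_add, Ex.eval_least, leastPrime, leastN]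
  have h1 : (Ex.var 26 + 1).eval v r = v 26 + 1 := by simp
  rw [h1]
  congr 1
  refine Finset.sum_congr (by simp) fun j _ => if_congr ?_ rfl rfl
  rw [Finset.sum_congr rfl fun i _ => ?_]
  rw [Ex.eval_not]
  refine if_congr ?_ rfl rfl
  have hj : 0 < v 26 := by have := Finset.mem_range.1 ‹j ∈ _›; omega
  rw [Ex.eval_sum, Finset.sum_eq_zero_iff, Nat.prime_def_lt']
  simp only [Ex.eval_add, Ex.eval_var, Ex.eval_one, Ex.eval_mul, Ex.eval_lt, Ex.eval_eq,
    Ex.eval_zero, Ex.eval_mod, Finset.mem_range]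
  simp only [Function.update_self, Function.update_of_ne, ne_eq,
    Nat.reduceEqDiff, not_false_eq_true, OfNat.one_ne_ofNat, OfNat.ofNat_ne_one, Ex.ite_mul_ite,
    ite_eq_right_iff, one_ne_zero, imp_false, not_and]
  refine ⟨fun h => ⟨by omega, fun d h2 hd hdvd => h d hd (by omega) ?_⟩, fun h d hd h1 h2 =>
    h.2 d (by omega) hd (Nat.dvd_of_mod_eq_zero ?_)⟩
  · exact (Nat.mod_eq_zero_of_dvd hdvd).symm
  · exact h2.symm

/-- The binary length of the variable `10`. -/
def sizeE : Ex := .least 1 2 (.var 10 + 1) (.lt (.var 10) (.pow 2 (.var 1) (2 * .var 10 + 1)))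

/-- The search stops at the first power of `2` above the number. That power is still below the
modulus `2 * v 10 + 2`, so the reduction does no harm up to there. -/
theorem eval_sizeE {v r} : sizeE.eval v r = (v 10).size := by
  have := leastN_eq (P := fun i => if v 10 < 2 ^ i % (2 * v 10 + 1 + 1) then 1 else 0)
    (B := v 10 + 1) (z := (v 10).size) ((Nat.size_le_self _).trans (by omega)) (fun i hi => by
      have := Nat.lt_size.1 hi
      rw [if_neg]
      rw [Nat.mod_eq_of_lt (by omega)]
      omega) (fun _ => by
      have h1 := Nat.lt_size_self (v 10)
      have h2 : 2 ^ (v 10).size < 2 * v 10 + 1 + 1 := by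
        rcases Nat.eq_zero_or_pos (v 10).size with h | h
        · rw [h]; omega
        · have h3 : 2 ^ ((v 10).size - 1) ≤ v 10 := Nat.lt_size.1 (by omega)
          have h4 : 2 ^ (v 10).size = 2 * 2 ^ ((v 10).size - 1) := by
            rw [← pow_succ', Nat.sub_add_cancel h]
          omega
      rw [Nat.mod_eq_of_lt h2, if_pos h1]
      omega)
  rw [← this, sizeE, Ex.eval_least, leastN]
  refine Finset.sum_congr (by simp) fun j _ => if_congr ?_ rfl rfl
  rw [Finset.sum_congr rfl fun i _ => ?_]
  simp only [Ex.eval_lt, Ex.eval_var]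
  rw [Ex.eval, powMod_eq (by simp)]
  simp

/-- The `k`-th power of an expression, for fixed `k`. -/
def Ex.npow (e : Ex) : ℕ → Ex
  | 0 => 1
  | k + 1 => e.npow k * e

@[simp] theorem Ex.eval_npow (e : Ex) (k : ℕ) (v r) : (e.npow k).eval v r = e.eval v r ^ k := by
  induction k with
  | zero => rfl
  | succ k ih => rw [npow, Ex.eval_mul, ih, pow_succ]

theorem Code.asg_eq {K x c : ℕ} {e : Ex} {μ : Mem} (h : e.val μ = c) :
    (asg x e : Code K).den μ = μ.setV x c := by rw [asg_den, h]

namespace Par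

/-- The parameters for `n` variables. -/
def ofSize (k M n : ℕ) : Par where
  -- With `s = n.size`, `l` of order `n / s ^ 2` keeps the number of Merlin's polynomials at `2 ^
  -- O(n / s)`, while `T * l` is at least `s * n`, more than the `O(n)` clauses of a sparse formula.
  -- The bound for `q` makes the size of an intersection smaller than `q` and the errors at most `1
  -- / 4`. As `T` has order `s ^ 3` and `q` has `O(s)` bits, `R` of order `n / s ^ 6` gives a
  -- dimension of `2 ^ O(n / s ^ 2)`.
  h := (n + 1) / 2
  l := n / (n.size * n.size) + 1
  T := n.size * n.size * n.size
  q := leastPrime (8 * (n.size * n.size * n.size) * (n / (n.size * n.size) + 1) + 8)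
  J := k * n / M + 1
  R := n / (n.size * n.size * n.size * (n.size * n.size * n.size)) + 1

variable {K k n M Y n₀ : ℕ}

def smallCode (n₀ k M : ℕ) : Code K :=
  (Code.asg 10 (.read 0 0 + .const n₀)).seq <| (Code.asg 25 (.read 0 1)).seq <|
  (Code.asg 11 (2 * .var 10 + 1)).seq <| (Code.asg 12 ((Ex.var 11).npow k)).seq <|
  (Code.asg 24 sizeE).seq <| (Code.asg 13 (.var 10 / (.var 24 * .var 24) + 1)).seq <|
  (Code.asg 14 (.var 24 * .var 24 * .var 24)).seq <|
  (Code.asg 26 (8 * .var 14 * .var 13 + 8)).seq <| (Code.asg 15 leastPrimeE).seq <|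
  (Code.asg 16 (.var 15 - 1)).seq <| (Code.asg 17 (.var 10 / (.var 14 * .var 14) + 1)).seq <|
  (Code.asg 18 ((.var 10 + 1) / 2)).seq <| Code.asg 19 (.const k * .var 10 / .const M + 1)

theorem smallCode_den {μ : Mem} (hn : μ.a 0 0 + n₀ = n) : (smallCode n₀ k M : Code K).den μ =
    ((((((((((((μ.setV 10 n).setV 25 (μ.a 0 1)).setV 11 (2 * n + 1)).setV 12 ((2 * n + 1) ^ k)).setV
      24 n.size).setV 13 (ofSize k M n).l).setV 14 (ofSize k M n).T).setV 26
      (8 * (ofSize k M n).T * (ofSize k M n).l + 8)).setV 15 (ofSize k M n).q).setV 16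
      ((ofSize k M n).q - 1)).setV 17 (ofSize k M n).R).setV 18 (ofSize k M n).h).setV 19
      (ofSize k M n).J := by
  simp only [smallCode, Code.seq_den]
  rw [Code.asg_eq (x := 10) (c := n), Code.asg_eq (x := 25) (c := μ.a 0 1),
    Code.asg_eq (x := 11) (c := 2 * n + 1), Code.asg_eq (x := 12) (c := (2 * n + 1) ^ k),
    Code.asg_eq (x := 24) (c := n.size), Code.asg_eq (x := 13) (c := (ofSize k M n).l),
    Code.asg_eq (x := 14) (c := (ofSize k M n).T),
    Code.asg_eq (x := 26) (c := 8 * (ofSize k M n).T * (ofSize k M n).l + 8),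
    Code.asg_eq (x := 15) (c := (ofSize k M n).q), Code.asg_eq (x := 16) (c := (ofSize k M n).q - 1),
    Code.asg_eq (x := 17) (c := (ofSize k M n).R), Code.asg_eq (x := 18) (c := (ofSize k M n).h),
    Code.asg_eq (x := 19) (c := (ofSize k M n).J)]
  all_goals simp [Ex.val, eval_sizeE, eval_leastPrimeE, hn]
  all_goals rfl

/-- The number of vectors, the number of transcripts and the dimension. -/
def bigCode (k M Y : ℕ) : Code K :=
  (Code.bset 8 1).seq <|
  (Code.mulPow 8 (.var 18) 2 (by omega) (Ex.stable_const 2)).seq <|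
  (Code.mulPow 8 (2 * .var 13) (.var 15) (by omega) (Ex.stable_var (by omega))).seq <|
  (Code.mulPow 8 (.var 19) (.const (adv k M Y + 1)) (by omega) (Ex.stable_const _)).seq <|
  (Code.bset 9 1).seq <|
  (Code.mulPow 9 (.var 14 + 2) (.var 15) (by omega) (Ex.stable_var (by omega))).seq <|
  (Code.bset 3 1).seq <|
  Code.mulPow 3 ((.var 14 + 2) * .var 17) (.var 15) (by omega) (Ex.stable_var (by omega))

theorem bigCode_den {P : Par} {μ : Mem} (h0 : μ.v 0 = 0) (b0 : μ.b 0 = 0) (hh : μ.v 18 = P.h)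
    (hl : μ.v 13 = P.l) (hq : μ.v 15 = P.q) (hJ : μ.v 19 = P.J) (hT : μ.v 14 = P.T)
    (hR : μ.v 17 = P.R) : (bigCode k M Y : Code K).den μ =
    ((μ.setB 8 (P.N k M Y)).setB 9 P.m₁).setB 3 P.dim := by
  have key : ∀ (z : ℕ) (n e : Ex) (hz : z ≠ 0) (he : e.Stable) (ν : Mem), ν.v = μ.v → ν.a = μ.a →
      ν.b 0 = 0 → (Code.mulPow z n e hz he : Code K).den ν =
        ν.setB z (ν.b z * e.val μ ^ n.val μ) := fun z n e hz he ν hv ha hb => by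
    rw [Code.mulPow_den z n e hz he (hv ▸ h0) hb]
    simp [Ex.val, hv, ha]
  simp only [bigCode, Code.seq_den, Code.bset_den]
  rw [key 8 _ _ _ _ (μ.setB 8 ((1 : Ex).val μ)) rfl rfl (by simpa using b0)]
  rw [key 8 _ _ _ _ ((μ.setB 8 ((1 : Ex).val μ)).setB 8 _) rfl rfl (by simpa using b0)]
  rw [key 8 _ _ _ _ (((μ.setB 8 ((1 : Ex).val μ)).setB 8 _).setB 8 _) rfl rfl (by simpa using b0)]
  rw [key 9 _ _ _ _ (((((μ.setB 8 ((1 : Ex).val μ)).setB 8 _).setB 8 _).setB 8 _).setB 9 _)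
    rfl rfl (by simpa using b0)]
  rw [key 3 _ _ _ _ (((((((μ.setB 8 ((1 : Ex).val μ)).setB 8 _).setB 8 _).setB 8 _).setB 9 _).setB
    9 _).setB 3 _) rfl rfl (by simpa using b0)]
  ext x y
  · rfl
  · simp only [Mem.setB_b, Function.update_apply]
    by_cases h3 : x = 3
    · subst h3; simp [Ex.val, hT, hq, hR, dim, m₁, pow_mul]
    by_cases h9 : x = 9
    · subst h9; simp [Ex.val, hT, hq, m₁]
    by_cases h8 : x = 8
    · subst h8; simp [Ex.val, hh, hq, hl, hJ, N]
    simp [h3, h9, h8]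
  · rfl
  · rfl
  · rfl

end Par

namespace Par
variable {K k n M Y n₀ : ℕ}
open PClause

/-! ### The program that writes both collections -/

/-- Puts `j` rows of length `d` into `G`, from the position `p` on. -/
def fillRows (p d j : ℕ) (c : ℕ → ℕ → ℕ) (G : ℕ → ℕ) (i : ℕ) : ℕ :=
  if p ≤ i ∧ i < p + j * d then c ((i - p) / d) ((i - p) % d) else G i

theorem fillRows_zero (p d : ℕ) (c : ℕ → ℕ → ℕ) (G : ℕ → ℕ) : fillRows p d 0 c G = G := by
  funext i
  rw [fillRows, if_neg (by omega)]

theorem fillRows_succ (p d j : ℕ) (c : ℕ → ℕ → ℕ) (G : ℕ → ℕ) :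
    (fun i => if p + j * d ≤ i ∧ i < p + j * d + d then c j (i - (p + j * d)) else
      fillRows p d j c G i) = fillRows p d (j + 1) c G := by
  funext i
  have e : (j + 1) * d = j * d + d := by ring
  unfold fillRows
  split_ifs with h1 h2 h3 h4 h5
  · have h4 : i - p = (i - (p + j * d)) + d * j := by rw [mul_comm d]; omega
    have h5 : i - (p + j * d) < d := by omega
    have h6 : d ≠ 0 := by omega
    rw [h4, Nat.add_mul_div_left _ _ (by omega), Nat.add_mul_mod_self_left, Nat.div_eq_of_lt h5,
      Nat.mod_eq_of_lt h5, zero_add]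
  · omega
  · rfl
  · omega
  · omega
  · rfl

/-- One vector costs a polynomial in `V`, so all of them cost that polynomial times `N + 1`.
Addresses are as large as `N * dim`, but only their binary lengths enter the bound. -/
theorem rows_does (hK : 0 < K) (k M Y x : ℕ) : ∃ T, PolyBd T ∧ ∀ (n : ℕ)
    (φ : List (KClause k n)) (P : Par) (V N : ℕ) (μ : Mem) (c : ℕ → ℕ → ℕ), P.Ready φ μ → 2 ≤ P.q →
    1 ≤ k → 1 ≤ Y → (x = 18 ∧ c = P.rowA M Y (ofFormula φ) ∨ x = 19 ∧ c = P.rowB M Y (ofFormula φ)) →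
    2 ≤ V → MemBd V μ → μ.b 5 = 0 → μ.b 4 = N → (μ.b 2 + N * P.dim).size ≤ V → Does K
      (iRep K 4 (rowCode hK k M Y x).prog) μ ((N + 1) * T V)
      ((((μ.setOA (fillRows (μ.b 2) P.dim N c (μ.oa 0))).setB 2 (μ.b 2 + N * P.dim)).setB 5 N).setB 4
        0) := by
  obtain ⟨T, hT, h⟩ := (rowCode hK k M Y x).acts
  refine ⟨fun V => T V + 8 * (V + 1) + V + 1, ((hT.add ((PolyBd.const 8).mul (PolyBd.id.add
    (.const 1)))).add .id).add (.const 1), fun n φ P V N μ c hR hq hk hY hx hV hB h5 h4 hsz => ?_⟩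
  let F : ℕ → Mem := fun j => ((μ.setOA (fillRows (μ.b 2) P.dim j c (μ.oa 0))).setB 2
    (μ.b 2 + j * P.dim)).setB 5 j
  let F' : ℕ → Mem := fun j => (F j).setB 4 (N - j)
  have hN : N.size ≤ V := h4 ▸ hB.2 4
  have hF : ∀ j, P.Ready φ (F' j) := fun j => hR.congr rfl rfl (by
    rintro z (rfl | rfl | rfl | rfl) <;> simp [F', F])
  have hF' : ∀ j ≤ N, MemBd V (F' j) := fun j hj => MemBd.setB (MemBd.setB (MemBd.setB
    (μ := μ.setOA _) hB 2 ((Nat.size_mono (by gcongr)).trans hsz)) 5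
    ((Nat.size_mono hj).trans hN)) 4 ((Nat.size_mono (Nat.sub_le _ _)).trans hN)
  have := iRep_does (K := K) (z := 4) (p := (rowCode hK k M Y x).prog) F'
    (fun j => (rowCode hK k M Y x).den (F' j)) (n := N) (t := T V) (fun j _ => by simp [F'])
    (fun j hj => h V _ hV (hF' j hj.le)) (fun j hj => by
      rw [rowCode_den (c := c j) hK (hF j) hq hk hY (by simp [F', F]; tauto)]
      simp [F']) (fun j hj => by
      rw [rowCode_den (c := c j) hK (hF j) hq hk hY (by simp [F', F]; tauto)]
      have e := fillRows_succ (μ.b 2) P.dim j c (μ.oa 0)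
      ext y z
      · rfl
      · simp only [F', F, Mem.setB_b, Mem.setOA_b, Function.update_apply]
        split_ifs <;> first | omega | rfl | ring
      · rfl
      · rfl
      · simp [F', F, ← e])
  have e0 : F' 0 = μ := by
    have := fillRows_zero (μ.b 2) P.dim c (μ.oa 0)
    ext y z
    · rfl
    · by_cases y2 : y = 2
      · subst y2; simp [F', F]
      by_cases y4 : y = 4
      · subst y4; simp [F', h4]
      by_cases y5 : y = 5
      · subst y5; simp [F', F, h5]
      simp [F', F, y2, y4, y5]
    · rfl
    · rfl
    · simp [F', F, this]
  have eN : F' N = (F N).setB 4 0 := by simp [F']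
  rw [e0, eN] at this
  exact this.mono (by dsimp only; gcongr)

/-- The entries of the instance that consists of `N` vectors of length `d` in each collection. -/
def instanceFn (N d : ℕ) (A B : ℕ → ℕ → ℕ) : ℕ → ℕ :=
  fillRows (2 + N * d) d N B <| fillRows 2 d N A <|
    Function.update (Function.update (fun _ => 0) 0 N) 1 d

/-- Writes the number of vectors and the dimension. -/
def headCode (hK : 0 < K) : Code K :=
  (Code.outB hK 2 8).seq <| (Code.outB hK 2 3).seq <| Code.bopB .add 4 8 7

/-- Returns to the first vector. -/
def backCode : Code K := (Code.bset 5 0).seq <| Code.bopB .add 4 8 7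

/-- Writes the instance that belongs to the formula in the input. -/
def buildProg (hK : 0 < K) (n₀ k M Y : ℕ) : RAMProg :=
  .seq (readInput K) <| .seq ((smallCode n₀ k M).seq (bigCode k M Y) : Code K).prog <|
  .seq (iMove K 20 9) <| .seq (iMove K 21 3) <| .seq (headCode hK).prog <|
  .seq (iRep K 4 (rowCode hK k M Y 18).prog) <| .seq (backCode : Code K).prog <|
  -- After the last row the write address is the length of the instance, which the subroutine
  -- expects in its register `0`.
  .seq (iRep K 4 (rowCode hK k M Y 19).prog) <| iToO K 0 2

/-- At the end the registers and arrays of the subroutine are those of an initial state on the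
instance. The remaining memory is ready and bounded, which is needed for testing the pair that a
Max-IP program returns. `N` occurs in the time only as a factor. -/
theorem build_does (hK : 0 < K) (n₀ k M Y : ℕ) : ∃ T, PolyBd T ∧ ∀ (n : ℕ)
    (φ : List (KClause k n)) (l : List ℕ) (V N d : ℕ), 1 ≤ k → 1 ≤ Y → 2 ≤ V →
    2 ≤ (ofSize k M n).q → l.getD 0 0 + n₀ = n → l.getD 1 0 = φ.length →
    HasInput φ (fun i => l.getD i 0) → l.length ≤ V → (∀ i, l.getD i 0 ≤ V) →
    (ofSize k M n).dim = d → (ofSize k M n).m₁ ≤ V → d ≤ V → (ofSize k M n).N k M Y = N →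
    ∃ μ : Mem, Does K (buildProg hK n₀ k M Y) (.start l) ((N + 1) * T V) μ ∧ MemBd (T V) μ ∧
      (ofSize k M n).Ready φ μ ∧ N.size ≤ T V ∧ (μ.o = fun x => if x = 0 then 2 + 2 * (N * d) else 0) ∧
      μ.oa = fun x i => if x = 0 then instanceFn N d ((ofSize k M n).rowA M Y (ofFormula φ))
        ((ofSize k M n).rowB M Y (ofFormula φ)) i else 0 := by
  obtain ⟨T₁, hT₁, h₁⟩ := readInput_does K hK
  obtain ⟨T₂, hT₂, h₂⟩ := ((smallCode n₀ k M).seq (bigCode k M Y) : Code K).acts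
  obtain ⟨W, hW, hw⟩ := ((smallCode n₀ k M).seq (bigCode k M Y) : Code K).tame
  obtain ⟨T₃, hT₃, h₃⟩ := iMove_acts K 20 9
  obtain ⟨T₄, hT₄, h₄⟩ := iMove_acts K 21 3
  obtain ⟨T₅, hT₅, h₅⟩ := (headCode hK).acts
  obtain ⟨T₆, hT₆, h₆⟩ := rows_does hK k M Y 18
  obtain ⟨T₇, hT₇, h₇⟩ := (backCode : Code K).acts
  obtain ⟨T₈, hT₈, h₈⟩ := rows_does hK k M Y 19
  obtain ⟨T₉, hT₉, h₉⟩ := iToO_acts K 0 2 hK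
  let A : ℕ → ℕ := fun V => 2 * W V + 2 * V + 10
  have hA : PolyBd A := (((PolyBd.const 2).mul hW).add ((PolyBd.const 2).mul .id)).add (.const 10)
  have hA2 : ∀ V, 2 ≤ V → 2 ≤ A V := fun V _ => by simp only [A]; omega
  refine ⟨fun V => T₁ V + T₂ V + T₃ (A V) + T₄ (A V) + T₅ (A V) + T₆ (A V) + T₇ (A V) + T₈ (A V) +
    T₉ (A V) + A V, ((((((((hT₁.add hT₂).add (hT₃.comp hA hA2)).add (hT₄.comp hA hA2)).add
    (hT₅.comp hA hA2)).add (hT₆.comp hA hA2)).add (hT₇.comp hA hA2)).add (hT₈.comp hA hA2)).add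
    (hT₉.comp hA hA2)).add hA, fun n φ l V N d hk hY hV hq hn hlen hin hl hli hd hm₁ hdV hN => ?_⟩
  have hAW : W V ≤ A V := by simp only [A]; omega
  have hAV : V ≤ A V := by simp only [A]; omega
  have hA2 := hA2 V hV
  have s1 := h₁ l V hV hl hli
  have B0 : MemBd V (Mem.input l) := ⟨⟨fun _ => Nat.zero_le _, fun a i => by
    simp only [Mem.input]
    split_ifs
    · exact hli i
    · omega⟩, fun _ => by simp [Mem.input]⟩
  have s2 := h₂ V _ hV B0
  have B1' := hw V _ hV B0
  have B1 := B1'.mono hAW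
  have e1 := Code.seq_den (smallCode n₀ k M : Code K) (bigCode k M Y) (Mem.input l)
  rw [smallCode_den (n := n) (by simpa [Mem.input] using hn),
    bigCode_den (P := ofSize k M n) (by simp [Mem.input]) (by simp [Mem.input]) (by simp)
      (by simp) (by simp) (by simp) (by simp) (by simp)] at e1
  rw [hd, hN] at e1
  generalize ((smallCode n₀ k M).seq (bigCode k M Y) : Code K).den (Mem.input l) = μ₁ at *
  have b1 : μ₁.b = Function.update (Function.update (Function.update (fun _ => 0) 8 N) 9
    (ofSize k M n).m₁) 3 d := by rw [e1]; rfl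
  have a1 : μ₁.a = (Mem.input l).a := by rw [e1]; rfl
  have o1 : μ₁.o = fun _ => 0 := by rw [e1]; rfl
  have oa1 : μ₁.oa = fun _ _ => 0 := by rw [e1]; rfl
  have s3 := h₃ _ _ hA2 B1
  have B2 := B1.setV 20 (c := μ₁.b 9) (by simp [b1]; omega)
  have s4 := h₄ _ _ hA2 B2
  have B3 := B2.setV 21 (c := μ₁.b 3) (by simp [b1]; omega)
  have hNs : N.size ≤ W V := by simpa [b1] using B1'.2 8
  simp only [Mem.setV_b] at s4
  obtain ⟨μ₃, e3⟩ : ∃ ν, ν = (μ₁.setV 20 (μ₁.b 9)).setV 21 (μ₁.b 3) := ⟨_, rfl⟩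
  rw [← e3] at s4 B3
  have v3 : (ofSize k M n).HasPar k n μ₃.v := by
    subst e3
    rw [b1, e1]
    refine ⟨⟨?_, ?_⟩, ?_, ?_, ?_, ?_, ?_, ?_, ?_, ?_, ?_⟩ <;> simp [hd]
  have v3' : μ₃.v 25 = φ.length ∧ μ₃.v 0 = 0 ∧ μ₃.v 22 = 0 ∧ μ₃.v 23 = 0 := by
    subst e3
    rw [e1]
    simp [Mem.input, ← hlen]
  have b3 : μ₃.b = μ₁.b := by rw [e3]; rfl
  have a3 : μ₃.a = (Mem.input l).a := by rw [e3, ← a1]; rfl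
  have o3 : μ₃.o = fun _ => 0 := by rw [e3, ← o1]; rfl
  have oa3 : μ₃.oa = fun _ _ => 0 := by rw [e3, ← oa1]; rfl
  clear e3 e1
  have s5 := h₅ _ _ hA2 B3
  have e4 : (headCode hK).den μ₃ = ((μ₃.setOA (Function.update (Function.update (fun _ => 0) 0 N) 1
      d)).setB 2 2).setB 4 N := by
    ext x y <;> simp [headCode, b3, b1, oa3, RAMOp.eval]
  rw [e4] at s5
  have B4 : MemBd (A V) (((μ₃.setOA (Function.update (Function.update (fun _ => 0) 0 N) 1
      d)).setB 2 2).setB 4 N) := MemBd.setB (MemBd.setB (μ := μ₃.setOA _) B3 2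
        ((Nat.size_le_self 2).trans (by omega))) 4 (by omega)
  have R4 : (ofSize k M n).Ready φ (((μ₃.setOA (Function.update (Function.update (fun _ => 0) 0 N) 1
      d)).setB 2 2).setB 4 N) := by
    refine ⟨v3, ?_, v3'.1, v3'.2.1, v3'.2.2.1, v3'.2.2.2, ?_, ?_, ?_, ?_, fun x hx => ?_⟩
    · simpa [a3, Mem.input] using hin
    · simp [b3, b1]
    · simp [b3, b1]
    · simp [b3, b1]
    · simp [b3, b1]
    · funext j
      simp [a3, Mem.input]
      omega
  generalize hμ₄ : ((μ₃.setOA (Function.update (Function.update (fun _ => 0) 0 N) 1 d)).setB 2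
    2).setB 4 N = μ₄ at *
  have b4 : μ₄.b 2 = 2 ∧ μ₄.b 4 = N ∧ μ₄.b 5 = 0 ∧ μ₄.b 8 = N ∧ μ₄.b 7 = 0 := by
    subst hμ₄; simp [b3, b1]
  have o4 : μ₄.o = fun _ => 0 := by subst hμ₄; simp [o3]
  have oa4 : μ₄.oa = fun x => if x = 0 then Function.update (Function.update (fun _ => 0) 0 N) 1 d
      else fun _ => 0 := by
    subst hμ₄; funext x; by_cases hx : x = 0 <;> simp [oa3, hx]
  clear hμ₄ e4
  have hNd : (N * d).size ≤ W V + V :=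
    (Nat.size_mul_le N d).trans (add_le_add hNs (Nat.size_le_of_le hdV))
  have hz2 : Nat.size 2 ≤ 2 := Nat.size_le_self 2
  have hNd2 : (2 + N * d).size ≤ W V + V + 3 := by
    have := Nat.size_add_le 2 (N * d)
    omega
  have hNd3 : (2 + N * d + N * d).size ≤ A V := by
    have := Nat.size_add_le (2 + N * d) (N * d)
    simp only [A]; omega
  have s6 := h₆ n φ _ (A V) N μ₄ _ R4 hq hk hY (.inl ⟨rfl, rfl⟩) hA2 B4 b4.2.2.1 b4.2.1
    (by rw [b4.1, hd]; simp only [A]; omega)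
  rw [b4.1, oa4, hd] at s6
  simp only [if_true] at s6
  obtain ⟨G, hG⟩ : ∃ G, G = fillRows 2 d N ((ofSize k M n).rowA M Y (ofFormula φ))
    (Function.update (Function.update (fun _ => 0) 0 N) 1 d) := ⟨_, rfl⟩
  rw [← hG] at s6
  have B5 : MemBd (A V) ((((μ₄.setOA G).setB 2 (2 + N * d)).setB 5 N).setB 4 0) :=
    MemBd.setB (MemBd.setB (MemBd.setB (μ := μ₄.setOA _) B4 2 (by simp only [A]; omega)) 5
      (by omega)) 4 (by simp)
  have s7 := h₇ _ _ hA2 B5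
  have e6 : (backCode : Code K).den ((((μ₄.setOA G).setB 2 (2 + N * d)).setB 5 N).setB 4 0) =
      (((μ₄.setOA G).setB 2 (2 + N * d)).setB 5 0).setB 4 N := by
    ext x y
    · rfl
    · by_cases h4 : x = 4
      · subst h4; simp [backCode, b4, RAMOp.eval]
      · by_cases h5 : x = 5 <;> simp [backCode, Ex.val, h4, h5]
    · rfl
    · rfl
    · rfl
  rw [e6] at s7
  have B6 : MemBd (A V) ((((μ₄.setOA G).setB 2 (2 + N * d)).setB 5 0).setB 4 N) :=
    MemBd.setB (MemBd.setB (MemBd.setB (μ := μ₄.setOA _) B4 2 (by simp only [A]; omega)) 5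
      (by simp)) 4 (by omega)
  have R6 : (ofSize k M n).Ready φ ((((μ₄.setOA G).setB 2 (2 + N * d)).setB 5 0).setB 4 N) :=
    R4.congr rfl rfl (by rintro z (rfl | rfl | rfl | rfl) <;> simp)
  have s8 := h₈ n φ _ (A V) N _ _ R6 hq hk hY (.inr ⟨rfl, rfl⟩) hA2 B6 (by simp) (by simp)
    (by simpa [hd] using hNd3)
  have B7 : MemBd (A V) ((((((((μ₄.setOA G).setB 2 (2 + N * d)).setB 5 0).setB 4 N).setOA
      (fillRows (2 + N * d) d N ((ofSize k M n).rowB M Y (ofFormula φ)) G)).setB 2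
      (2 + N * d + N * d)).setB 5 N).setB 4 0) :=
    MemBd.setB (MemBd.setB (MemBd.setB (μ := (((μ₄.setOA G).setB 2 (2 + N * d)).setB 5 0).setB 4
      N |>.setOA _) B6 2 hNd3) 5 (by omega)) 4 (by simp)
  have s8' : Does K (iRep K 4 (rowCode hK k M Y 19).prog)
      ((((μ₄.setOA G).setB 2 (2 + N * d)).setB 5 0).setB 4 N) ((N + 1) * T₈ (A V))
      ((((((((μ₄.setOA G).setB 2 (2 + N * d)).setB 5 0).setB 4 N).setOA
      (fillRows (2 + N * d) d N ((ofSize k M n).rowB M Y (ofFormula φ)) G)).setB 2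
      (2 + N * d + N * d)).setB 5 N).setB 4 0) := by simpa [hd] using s8
  have s9 := h₉ _ _ hA2 B7
  refine ⟨_, (s1.seq <| s2.seq <| s3.seq <| s4.seq <| s5.seq <| s6.seq <| s7.seq <|
    s8'.seq s9).mono ?_, ?_, ?_, ?_, ?_, ?_⟩
  · have key : ∀ t, t ≤ (N + 1) * t := fun t => Nat.le_mul_of_pos_left _ (by omega)
    have := key (T₁ V + T₂ V + T₃ (A V) + T₄ (A V) + T₅ (A V) + T₇ (A V) + T₉ (A V))
    have e : (N + 1) * (T₁ V + T₂ V + T₃ (A V) + T₄ (A V) + T₅ (A V) + T₆ (A V) + T₇ (A V) +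
      T₈ (A V) + T₉ (A V) + A V) = (N + 1) * (T₁ V + T₂ V + T₃ (A V) + T₄ (A V) + T₅ (A V) +
      T₇ (A V) + T₉ (A V)) + (N + 1) * T₆ (A V) + (N + 1) * T₈ (A V) + (N + 1) * A V := by ring
    dsimp only
    rw [e]
    omega
  · exact MemBd.mono (show MemBd (A V) (Mem.setO _ 0 _) from B7) (by dsimp only; omega)
  · exact R6.congr rfl rfl (by rintro z (rfl | rfl | rfl | rfl) <;> simp)
  · dsimp only; omega
  · funext x
    by_cases hx : x = 0
    · simp [hx]; ring
    · simp [hx, o4]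
  · funext x i
    by_cases hx : x = 0
    · simp [hx, instanceFn, hG]
    · simp [hx, oa4]

end Par

/-! ### The oracle -/

/-- A memory whose subroutine part is an initial state lets the subroutine run as if alone; the
caller's variables, big numbers and arrays, all from `K` on, survive. -/
theorem Does.oracle {K t : ℕ} {p : RAMProg} {l : List ℕ} {s : RAMState} (hp : p.Below K)
    (h : RAMRun p (.start l) t s) {μ : Mem} (ho : μ.o = (RAMState.start l).reg)
    (hoa : μ.oa = (RAMState.start l).arr) : Does K p μ t { μ with o := s.reg, oa := s.arr } := by
  intro u hu
  obtain ⟨u', h1, h2, h3⟩ := h.transfer hp u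
    ⟨fun x hx => by rw [hu.o x hx, ho], fun x hx i => by rw [hu.oa x hx, hoa]⟩
  refine ⟨u', ⟨t, le_rfl, h1⟩, ⟨fun x => ?_, fun x => ?_, fun i => ?_, fun x hx => (h2.1 x hx).symm,
    fun i hi => funext fun j => (h2.2 i hi j).symm⟩⟩
  · rw [← h3.1 _ (by unfold uv; omega), hu.v]
  · rw [← h3.1 _ (by unfold bg; omega), hu.b]
  · rw [← hu.a]
    exact funext fun j => (h3.2 _ (by omega) j).symm

/-! ### Encodings -/

/-- The collection of vectors with the given entries. -/
def boolVec (N d : ℕ) (c : ℕ → ℕ → ℕ) : Fin N → Fin d → Bool := fun i u => decide (c i u = 1)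

/-- The collection of sets with the given entries. -/
def setVec (N d : ℕ) (c : ℕ → ℕ → ℕ) : Fin N → Finset (Fin d) := fun i =>
  Finset.univ.filter fun u => c i u = 1

theorem charVectors_setVec (N d : ℕ) (c : ℕ → ℕ → ℕ) : charVectors (setVec N d c) = boolVec N d c := by
  funext i u
  simp [charVectors, setVec, boolVec]

theorem toNat_boolVec {N d : ℕ} {c : ℕ → ℕ → ℕ} (hc : ∀ i j, c i j ≤ 1) (i : Fin N) (u : Fin d) :
    (boolVec N d c i u).toNat = c i u := by
  have := hc i u
  unfold boolVec
  interval_cases c i u <;> rfl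

theorem encodeVectors_boolVec {N d : ℕ} {c : ℕ → ℕ → ℕ} (hc : ∀ i j, c i j ≤ 1) :
    encodeVectors (boolVec N d c) = List.ofFn fun t : Fin (N * d) => c (t / d) (t % d) := by
  rw [List.ofFn_mul, encodeVectors]
  simp only [toNat_boolVec hc]
  congr 1
  refine congrArg List.ofFn (funext fun i => congrArg List.ofFn (funext fun j => ?_))
  have hd : 0 < d := j.pos
  have h1 : ((i : ℕ) * d + j) / d = i := by
    rw [mul_comm, Nat.mul_add_div hd, Nat.div_eq_of_lt j.2, add_zero]
  have h2 : ((i : ℕ) * d + j) % d = j := by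
    rw [mul_comm, Nat.mul_add_mod, Nat.mod_eq_of_lt j.2]
  rw [h1, h2]

theorem length_encodeVectorPair {N d : ℕ} {a b : ℕ → ℕ → ℕ} (ha : ∀ i j, a i j ≤ 1)
    (hb : ∀ i j, b i j ≤ 1) :
    (encodeVectorPair (boolVec N d a) (boolVec N d b)).length = 2 + 2 * (N * d) := by
  simp [encodeVectorPair, encodeVectors_boolVec ha, encodeVectors_boolVec hb]
  ring

theorem getD_encodeVectorPair {N d : ℕ} {a b : ℕ → ℕ → ℕ} (ha : ∀ i j, a i j ≤ 1)
    (hb : ∀ i j, b i j ≤ 1) (i : ℕ) :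
    (encodeVectorPair (boolVec N d a) (boolVec N d b)).getD i 0 = Par.instanceFn N d a b i := by
  rw [encodeVectorPair, encodeVectors_boolVec ha, encodeVectors_boolVec hb, Par.instanceFn,
    Par.fillRows, Par.fillRows]
  match i with
  | 0 => simp
  | 1 => rw [if_neg (by omega), if_neg (by omega)]; simp
  | i + 2 =>
    rw [List.getD_cons_succ, List.getD_cons_succ]
    by_cases h1 : i < N * d
    · rw [List.getD_append _ _ _ _ (by simpa using h1), if_neg (by omega), if_pos (by omega)]
      simp [h1]
    · rw [List.getD_append_right _ _ _ _ (by simpa using h1)]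
      by_cases h2 : i < N * d + N * d
      · rw [if_pos (by omega)]
        have : i - N * d < N * d := by omega
        simp [this, show i + 2 - (2 + N * d) = i - N * d by omega]
      · rw [if_neg (by omega), if_neg (by omega)]
        have : ¬ i - N * d < N * d := by omega
        simp [this]

theorem bitInner_boolVec {N d : ℕ} {a b : ℕ → ℕ → ℕ} (ha : ∀ i j, a i j ≤ 1)
    (hb : ∀ i j, b i j ≤ 1) (i j : Fin N) : bitInner (boolVec N d a i) (boolVec N d b j) =
      ∑ u ∈ Finset.range d, a i u * b j u := by
  simp [bitInner, toNat_boolVec ha, toNat_boolVec hb, Finset.sum_range]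

theorem card_setVec {N d : ℕ} {b : ℕ → ℕ → ℕ} (hb : ∀ i j, b i j ≤ 1) (j : Fin N) :
    (setVec N d b j).card = ∑ u ∈ Finset.range d, b j u := by
  rw [setVec, Finset.card_filter, Finset.sum_range]
  refine Finset.sum_congr rfl fun u _ => ?_
  have := hb j u
  interval_cases b j u <;> simp

theorem card_inter_setVec {N d : ℕ} {a b : ℕ → ℕ → ℕ} (ha : ∀ i j, a i j ≤ 1)
    (hb : ∀ i j, b i j ≤ 1) (i j : Fin N) : (setVec N d a i ∩ setVec N d b j).card =
      ∑ u ∈ Finset.range d, a i u * b j u := by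
  rw [setVec, setVec, ← Finset.filter_and, Finset.card_filter, Finset.sum_range]
  refine Finset.sum_congr rfl fun u _ => ?_
  have := hb j u
  have := ha i u
  interval_cases a i u <;> interval_cases b j u <;> simp

/-! ### More variables -/

/-- The formula with `n₀` more variables, which do not occur in it. -/
def padVars {k n : ℕ} (n₀ : ℕ) (φ : List (KClause k n)) : List (KClause k (n + n₀)) :=
  φ.map fun c p => ((c p).1.castAdd n₀, (c p).2)

theorem kSatisfiable_padVars {k n n₀ : ℕ} {φ : List (KClause k n)} :
    KSatisfiable (padVars n₀ φ) ↔ KSatisfiable φ := by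
  simp only [KSatisfiable, padVars, List.mem_map, forall_exists_index, and_imp,
    forall_apply_eq_imp_iff₂]
  constructor
  · rintro ⟨x, hx⟩
    exact ⟨fun i => x (i.castAdd n₀), hx⟩
  · rintro ⟨x, hx⟩
    refine ⟨fun i => if h : i.1 < n then x ⟨i, h⟩ else false, fun c hc => ?_⟩
    obtain ⟨p, hp⟩ := hx c hc
    exact ⟨p, by simpa using hp⟩

theorem flatMap_clauses {k n : ℕ} (φ : List (KClause k n)) (f : Fin n × Bool → ℕ) :
    φ.flatMap (fun c => List.ofFn fun i => f (c i)) =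
      List.ofFn fun t : Fin (φ.length * k) =>
        f (φ.get ⟨t / k, Nat.div_lt_of_lt_mul (by rw [mul_comm k]; exact t.2)⟩
          ⟨t % k, Nat.mod_lt _ (Nat.pos_of_ne_zero fun h => by have := t.2; simp [h] at this)⟩) := by
  conv_lhs => rw [← List.ofFn_get φ]
  rw [List.ofFn_mul, List.flatMap, List.map_ofFn]
  congr 1
  refine congrArg List.ofFn (funext fun i => congrArg List.ofFn (funext fun j => ?_))
  have hd : 0 < k := j.pos
  have h1 : ((i : ℕ) * k + j) / k = i := by
    rw [mul_comm, Nat.mul_add_div hd, Nat.div_eq_of_lt j.2, add_zero]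
  have h2 : ((i : ℕ) * k + j) % k = j := by
    rw [mul_comm, Nat.mul_add_mod, Nat.mod_eq_of_lt j.2]
  simp [h1, h2]

theorem length_encodeKCNF {k n : ℕ} (φ : List (KClause k n)) :
    (encodeKCNF φ).length = 2 + φ.length * k := by
  rw [encodeKCNF, flatMap_clauses φ fun a => 2 * (a.1 : ℕ) + a.2.toNat]
  simp
  ring

theorem getD_encodeKCNF_le {k n : ℕ} (φ : List (KClause k n)) (i : ℕ) :
    (encodeKCNF φ).getD i 0 ≤ 2 * n + φ.length := by
  rw [encodeKCNF, flatMap_clauses φ fun a => 2 * (a.1 : ℕ) + a.2.toNat]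
  match i with
  | 0 => simp; omega
  | 1 => simp
  | i + 2 =>
    rw [List.getD_cons_succ, List.getD_cons_succ]
    by_cases h : i < φ.length * k
    · simp only [List.getD_eq_getElem?_getD, List.getElem?_ofFn, h, dif_pos, Option.getD_some]
      have h1 := PClause.lit_lt (φ.get ⟨i / k, Nat.div_lt_of_lt_mul (by rw [mul_comm k]; exact h)⟩
          ⟨i % k, Nat.mod_lt _ (Nat.pos_of_ne_zero fun h' => by simp [h'] at h)⟩)
      omega
    · simp [h]

/-- New variables come after the old ones, so the codes of the literals do not change. The given
input serves for the padded formula too, apart from the number of variables. -/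
theorem hasInput_padVars {k n n₀ : ℕ} (φ : List (KClause k n)) :
    PClause.HasInput (padVars n₀ φ) fun i => (encodeKCNF φ).getD i 0 := by
  intro c p
  have hk : 0 < k := p.pos
  have hc : (c : ℕ) < φ.length := by have := c.2; simpa [padVars] using this
  have h : (c : ℕ) * k + p < φ.length * k := by
    have := p.2
    nlinarith
  have h1 : ((c : ℕ) * k + p) / k = c := by
    rw [mul_comm, Nat.mul_add_div hk, Nat.div_eq_of_lt p.2, add_zero]
  have h2 : ((c : ℕ) * k + p) % k = p := by
    rw [mul_comm, Nat.mul_add_mod, Nat.mod_eq_of_lt p.2]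
  have e : (padVars n₀ φ)[c] = fun p => ((φ[(c : ℕ)] p).1.castAdd n₀, (φ[(c : ℕ)] p).2) :=
    List.getElem_map _
  dsimp only
  rw [encodeKCNF, flatMap_clauses φ fun a => 2 * (a.1 : ℕ) + a.2.toNat, e,
    show 2 + (c : ℕ) * k + p = (c * k + p) + 2 by ring, List.getD_cons_succ, List.getD_cons_succ]
  simp only [List.getD_eq_getElem?_getD, List.getElem?_ofFn, h, dif_pos, Option.getD_some, h2,
    List.get_eq_getElem, Fin.val_castAdd, getElem_congr_idx h1, Fin.eta]

namespace Par
variable {K k n M Y n₀ : ℕ} {P : Par}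
open PClause

/-! ### The program that checks a pair of vectors -/

/-- The assignment that belongs to a pair of vectors. -/
def assign (P : Par) (i j u : ℕ) : ℕ := if u < P.h then P.al i u else P.al j (u - P.h)

/-- Whether the assignment in the arrays `5` and `7` satisfies the formula. -/
def checkE (k : ℕ) : Ex :=
  let a : Ex := .read 0 (2 + .var 1 * .const k + .var 2)
  .not <| .sum 1 (.var 25) <| .not <| .sum 2 (.const k) <|
    .eq (.lt (a / 2) (.var 18) * .read 5 (a / 2) +
      .not (.lt (a / 2) (.var 18)) * .read 7 (a / 2 - .var 18)) (.mod a 2)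

theorem eval_checkE {v r} {φ : List (KClause k n)} {i j : ℕ} (hin : HasInput φ (r 0))
    (h25 : v 25 = φ.length) (h18 : v 18 = P.h) (h5 : r 5 = P.al i) (h7 : r 7 = P.al j) :
    (checkE k).eval v r = if ∀ c : Fin φ.length, ∃ p : Fin k,
      P.assign i j (φ[c] p).1 = (φ[c] p).2.toNat then 1 else 0 := by
  dsimp only [checkE]
  rw [Ex.eval_not, Ex.eval_sum, Ex.eval_var, h25, Finset.sum_range]
  refine if_congr ?_ rfl rfl
  rw [Finset.sum_eq_zero_iff]
  simp only [Finset.mem_univ, forall_true_left]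
  refine forall_congr' fun c => ?_
  rw [Ex.eval_not, ite_eq_right_iff, Ex.eval_sum, Ex.eval_const, Finset.sum_range]
  simp only [one_ne_zero, imp_false, ← Nat.pos_iff_ne_zero]
  rw [Finset.sum_pos_iff]
  simp only [Finset.mem_univ, true_and]
  refine exists_congr fun p => ?_
  have hb := Bool.toNat_le (φ[c] p).2
  have e1 : (2 * ((φ[c] p).1 : ℕ) + (φ[c] p).2.toNat) / 2 = (φ[c] p).1 := by omega
  have e2 : (2 * ((φ[c] p).1 : ℕ) + (φ[c] p).2.toNat) % 2 = (φ[c] p).2.toNat := by omega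
  have ea : (Ex.read 0 (2 + .var 1 * .const k + .var 2)).eval
      (Function.update (Function.update v 1 (c : ℕ)) 2 (p : ℕ)) r =
      2 * ((φ[c] p).1 : ℕ) + (φ[c] p).2.toNat := by
    simpa using hin c p
  rw [Ex.eval_eq, Code.pos_ite]
  simp only [Ex.eval_add, Ex.eval_mul, Ex.eval_lt, Ex.eval_not, Ex.eval_div, Ex.eval_mod, ea]
  simp only [Ex.eval_read, Ex.eval_div, Ex.eval_sub, ea, Ex.eval_ofNat, e1, e2, Ex.eval_var]
  rw [show (Function.update (Function.update v 1 (c : ℕ)) 2 (p : ℕ)) 18 = P.h by simp [h18], h5, h7,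
    assign]
  split_ifs <;> simp_all

theorem kSatisfiable_of_assign {φ : List (KClause k n)} {i j : ℕ} (h : ∀ c : Fin φ.length,
    ∃ p : Fin k, P.assign i j (φ[c] p).1 = (φ[c] p).2.toNat) : KSatisfiable φ := by
  refine ⟨fun u => decide (P.assign i j u = 1), fun c hc => ?_⟩
  obtain ⟨i, hi, rfl⟩ := List.getElem_of_mem hc
  obtain ⟨p, hp⟩ := h ⟨i, hi⟩
  refine ⟨p, ?_⟩
  simp only [Fin.getElem_fin] at hp
  dsimp only
  rw [hp]
  cases (φ[i] p).2 <;> rfl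

/-- A clause without a true literal under the combined assignment would be falsified by both halves.
-/
theorem assign_of_sat {φ : List (KClause k n)} {i j : ℕ} (h : P.Sat (ofFormula φ) i j)
    (c : Fin φ.length) : ∃ p : Fin k, P.assign i j (φ[c] p).1 = (φ[c] p).2.toNat := by
  by_contra hc
  push Not at hc
  have e : ∀ p, ((ofClause φ[c] p : ℕ) - 1) / 2 = (φ[c] p).1 ∧
      ((ofClause φ[c] p : ℕ) - 1) % 2 = (φ[c] p).2.toNat := fun p => by
    have hb := Bool.toNat_le (φ[c] p).2
    constructor <;> simp only [ofClause] <;> omega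
  refine h (ofClause φ[c]) (mem_ofFormula.2 ⟨c, rfl⟩) ⟨fun p _ hp => ?_, fun p _ hp => ?_⟩
  · have := hc p
    rw [(e p).1] at hp ⊢
    rwa [(e p).2, ← show P.assign i j _ = _ from if_pos hp]
  · have := hc p
    rw [(e p).1] at hp ⊢
    rwa [(e p).2, ← show P.assign i j _ = _ from if_neg (by omega)]

/-- Decodes and checks the pair with the numbers `o 0` and `o 1`. -/
def checkCode (hK : 1 < K) (k : ℕ) : Code K :=
  (Code.digs 5 3 (.var 18) 1 (by omega) (Ex.stable_const 1)).seq <|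
  (Code.digs 7 9 (.var 18) 1 (by omega) (Ex.stable_const 1)).seq <|
  (Code.bset 3 (checkE k)).seq <| Code.toO 0 3 (by omega)

theorem checkCode_den (hK : 1 < K) {μ : Mem} {φ : List (KClause k n)} (h : P.Ready φ μ) :
    ((checkCode hK k).den μ).o 0 = if ∀ c : Fin φ.length, ∃ p : Fin k,
      P.assign (μ.b 3) (μ.b 9) (φ[c] p).1 = (φ[c] p).2.toNat then 1 else 0 := by
  have h18 := h.par.h
  have hc := h.clean
  simp only [checkCode, Code.seq_den, Code.toO_den, Code.bset_den]
  rw [Code.digs_eq (K := K) (x := 5) (z := 3) (n := .var 18) (e := 1) (by omega)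
    (Ex.stable_const 1) (μ := μ) h.v0 h.b0 (P.al (μ.b 3)) _
    (fun j => by simp [al, Ex.val, h18, hc]) rfl,
    Code.digs_eq (K := K) (x := 7) (z := 9) (n := .var 18) (e := 1) (by omega)
    (Ex.stable_const 1) (μ := (μ.setA 5 (P.al (μ.b 3))).setB 3 _) h.v0 (by simpa using h.b0)
    (P.al (μ.b 9)) _ (fun j => by simp [al, Ex.val, h18, hc]) rfl]
  simp only [Mem.setO_o, Function.update_self, Mem.setB_b, Ex.val]
  exact eval_checkE h.input h.len h18 (by simp) (by simp)

def checkProg (hK : 1 < K) (k : ℕ) : RAMProg :=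
  .seq (iOfO K 3 0) <| .seq (iOfO K 9 1) (checkCode hK k).prog

/-- The test is run on whatever pair is returned. Acceptance alone certifies satisfiability, so
nothing has to be known about the pair for an unsatisfiable formula. -/
theorem check_does (hK : 1 < K) (k : ℕ) : ∃ T, PolyBd T ∧ ∀ (n : ℕ) (φ : List (KClause k n)) (P : Par)
    (V : ℕ) (μ : Mem), P.Ready φ μ → 2 ≤ V → MemBd V μ → (μ.o 0).size ≤ V → (μ.o 1).size ≤ V →
    ∃ μ', Does K (checkProg hK k) μ (T V) μ' ∧ (μ'.o 0 = 0 ∨ μ'.o 0 = 1) ∧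
      (μ'.o 0 = 1 → KSatisfiable φ) ∧ (P.Sat (ofFormula φ) (μ.o 0) (μ.o 1) → μ'.o 0 = 1) := by
  obtain ⟨T, hT, h⟩ := (checkCode hK k).acts
  have hI := (PolyBd.const 2).mul ((PolyBd.const 1).add ((PolyBd.const 3).mul .id))
  refine ⟨_, hI.add (hI.add hT), fun n φ P V μ hR hV hB h0 h1 => ?_⟩
  have s1 := iOfO_does K 3 0 (by omega) μ h0
  have s2 := iOfO_does K 9 1 hK (μ.setB 3 (μ.o 0)) (V := V) h1
  have s3 := h V _ hV (((hB.setB 3 h0).setB 9 h1))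
  have hR' : P.Ready φ ((μ.setB 3 (μ.o 0)).setB 9 (μ.o 1)) := hR.congr rfl rfl (by
    rintro z (rfl | rfl | rfl | rfl) <;> simp)
  have e := checkCode_den hK hR'
  have e3 : ((μ.setB 3 (μ.o 0)).setB 9 (μ.o 1)).b 3 = μ.o 0 := by simp
  have e9 : ((μ.setB 3 (μ.o 0)).setB 9 (μ.o 1)).b 9 = μ.o 1 := by simp
  rw [e3, e9] at e
  refine ⟨_, s1.seq (s2.seq s3), ?_⟩
  rw [e]
  refine ⟨?_, fun h => ?_, fun h => if_pos (assign_of_sat h)⟩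
  · split_ifs <;> simp
  · split_ifs at h with h'
    exact kSatisfiable_of_assign h'

end Par

namespace Par
variable {K k n M Y n₀ : ℕ} {P : Par}
open PClause

/-! ### The reductions -/

/-- The properties of the parameters for `n` variables that the reductions need. -/
structure Good (k M n : ℕ) (f g : ℕ → ℝ) : Prop where
  sound : (ofSize k M n).Sound (adv k M (6 * k * M))
  act : 1 + k * (k * (2 * n) * adv k M (6 * k * M)) ≤ (ofSize k M n).T * (ofSize k M n).l
  two_le : 2 ≤ (ofSize k M n).N k M (6 * k * M)
  dim : ((ofSize k M n).dim : ℝ) ≤ ((ofSize k M n).N k M (6 * k * M) : ℝ) ^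
    f ((ofSize k M n).N k M (6 * k * M))
  gap : gapFactor g ((ofSize k M n).N k M (6 * k * M)) ≤ 2 ^ (ofSize k M n).R

theorem bit_le (c : ℕ → ℕ) (j : ℕ) : P.bit c j ≤ 1 := by
  unfold bit
  split_ifs <;> omega

theorem rowA_le {m : ℕ} {S₀ : Finset (PClause k m)} {Y : ℕ} (i j : ℕ) : P.rowA M Y S₀ i j ≤ 1 :=
  bit_le _ _

theorem rowB_le {m : ℕ} {S₀ : Finset (PClause k m)} {Y : ℕ} (i j : ℕ) : P.rowB M Y S₀ i j ≤ 1 :=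
  bit_le _ _

/-- The true gap is `4 ^ R` and the tolerated factor only `2 ^ R`; the slack excludes equality. The
case `x = 0` is excluded by `0 < Q`. -/
theorem gap_contradiction {R Q x : ℕ} {γ : ℝ} (hR : R ≠ 0) (hQ : 0 < Q) (h1 : 4 ^ R * x ≤ Q)
    (h2 : (Q : ℝ) ≤ γ * x) (h3 : γ ≤ 2 ^ R) : False := by
  have h4 : (Q : ℝ) ≤ ((2 ^ R * x : ℕ) : ℝ) := by
    push_cast
    exact h2.trans (mul_le_mul_of_nonneg_right h3 (by positivity))
  have h5 := Nat.cast_le.1 h4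
  have h6 : 0 < x := Nat.pos_of_ne_zero fun h0 => by simp [h0] at h5; omega
  have h7 := Nat.le_of_mul_le_mul_right (h1.trans h5) h6
  have h8 : 2 ^ R < 4 ^ R := Nat.pow_lt_pow_left (by omega) hR
  omega

theorem mul_gap_le {R Q x : ℕ} {γ : ℝ} (h1 : 4 ^ R * x ≤ Q) (h3 : γ ≤ 2 ^ R) : (x : ℝ) * γ ≤ Q := by
  have h2 := h3.trans (pow_le_pow_left₀ zero_le_two (show (2 : ℝ) ≤ 4 by norm_num) _)
  refine le_trans ?_ (Nat.cast_le.2 h1)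
  rw [Nat.cast_mul, mul_comm]
  push_cast
  exact mul_le_mul_of_nonneg_right h2 (by positivity)

theorem gapFactor_pos (g : ℕ → ℝ) (N : ℕ) : 0 < gapFactor g N := Real.rpow_pos_of_pos two_pos _

section
variable {f g : ℕ → ℝ} {φ : List (KClause k n)}

theorem Good.exists_eq (h : Good k M n f g) (hk : 1 ≤ k) (hM : 1 ≤ M) (hφ : KSatisfiable φ) :
    ∃ i j : Fin ((ofSize k M n).N k M (6 * k * M)), ∑ u ∈ Finset.range (ofSize k M n).dim,
      (ofSize k M n).rowA M (6 * k * M) (ofFormula φ) i u *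
        (ofSize k M n).rowB M (6 * k * M) (ofFormula φ) j u =
      (ofSize k M n).q ^ (ofSize k M n).R := by
  obtain ⟨y, hy⟩ := hφ
  obtain ⟨i, hi, j, hj, he⟩ := exists_sum_row_eq (m := 2 * n) (S₀ := ofFormula φ) (n := n) h.sound hM
    hk rfl le_rfl (by
      simp only [ofSize]
      -- `J = k * n / M + 1` is the least number of blocks for which the progress would exceed its
      -- maximum.
      exact Nat.lt_mul_div_succ _ (by omega)) (by simp only [ofSize]; omega) h.act
    (x := fun u => if h : u < n then (y ⟨u, h⟩).toNat else 0) (fun u => by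
      split_ifs
      · exact Nat.lt_succ_of_le (Bool.toNat_le _)
      · omega) (fun C hC => by
      obtain ⟨c, rfl⟩ := mem_ofFormula.1 hC
      obtain ⟨p, hp⟩ := hy _ (List.getElem_mem c.2)
      have hb := Bool.toNat_le (φ[c] p).2
      have e1 : ((ofClause φ[c] p : ℕ) - 1) / 2 = (φ[c] p).1 := by
        simp only [ofClause]; omega
      have e2 : ((ofClause φ[c] p : ℕ) - 1) % 2 = (φ[c] p).2.toNat := by
        simp only [ofClause]; omega
      refine ⟨p, fun h0 => by simpa [ofClause] using congrArg Fin.val h0, ?_⟩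
      simp only [e1, e2]
      rw [dif_pos (φ[c] p).1.2]
      exact congrArg _ hp)
  exact ⟨⟨i, hi⟩, ⟨j, hj⟩, he⟩

theorem not_sat_of_not_kSatisfiable (hφ : ¬ KSatisfiable φ) (i j : ℕ) :
    ¬ P.Sat (ofFormula φ) i j := fun h => hφ (kSatisfiable_of_assign (assign_of_sat h))

/-- The intersection has `q ^ R` elements, as many as Bob's set, and so is all of it. -/
theorem Good.subsetYes (h : Good k M n f g) (hk : 1 ≤ k) (hM : 1 ≤ M) (hφ : KSatisfiable φ) :
    SubsetYes (setVec ((ofSize k M n).N k M (6 * k * M)) (ofSize k M n).dim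
      ((ofSize k M n).rowA M (6 * k * M) (ofFormula φ)))
      (setVec _ _ ((ofSize k M n).rowB M (6 * k * M) (ofFormula φ))) := by
  obtain ⟨i, j, he⟩ := h.exists_eq hk hM hφ
  have : NeZero (ofSize k M n).q := ⟨h.sound.prime.ne_zero⟩
  refine ⟨i, j, ?_⟩
  rw [← Finset.inter_eq_right]
  refine Finset.eq_of_subset_of_card_le Finset.inter_subset_right (le_of_eq ?_)
  rw [card_inter_setVec rowA_le rowB_le, he,
    card_setVec rowB_le, sum_rowB]

theorem Good.subsetNo (h : Good k M n f g) (hφ : ¬ KSatisfiable φ) :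
    SubsetNo ((ofSize k M n).q ^ (ofSize k M n).R)
      (gapFactor g ((ofSize k M n).N k M (6 * k * M)))
      (setVec ((ofSize k M n).N k M (6 * k * M)) (ofSize k M n).dim
      ((ofSize k M n).rowA M (6 * k * M) (ofFormula φ)))
      (setVec _ _ ((ofSize k M n).rowB M (6 * k * M) (ofFormula φ))) := by
  intro i j
  rw [card_inter_setVec rowA_le rowB_le,
    le_div_iff₀ (gapFactor_pos _ _)]
  exact mul_gap_le (sum_row_le_of_not_sat h.sound
    (not_sat_of_not_kSatisfiable (P := ofSize k M n) hφ i j)) h.gap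

/-- The maximum is at least `q ^ R`, while a pair that does not satisfy the formula reaches at most
`q ^ R / 4 ^ R`, too little for the approximation factor. -/
theorem Good.sat (h : Good k M n f g) (hk : 1 ≤ k) (hM : 1 ≤ M) (hφ : KSatisfiable φ) (i j : ℕ)
    (hij : ∀ i' j' : Fin ((ofSize k M n).N k M (6 * k * M)),
      ((∑ u ∈ Finset.range (ofSize k M n).dim, (ofSize k M n).rowA M (6 * k * M) (ofFormula φ) i' u *
        (ofSize k M n).rowB M (6 * k * M) (ofFormula φ) j' u : ℕ) : ℝ) ≤
      gapFactor g ((ofSize k M n).N k M (6 * k * M)) * ((∑ u ∈ Finset.range (ofSize k M n).dim,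
        (ofSize k M n).rowA M (6 * k * M) (ofFormula φ) i u *
        (ofSize k M n).rowB M (6 * k * M) (ofFormula φ) j u : ℕ) : ℝ)) :
    (ofSize k M n).Sat (ofFormula φ) i j := by
  by_contra hs
  obtain ⟨i', j', he⟩ := h.exists_eq hk hM hφ
  have h1 := sum_row_le_of_not_sat h.sound hs
  have h2 := hij i' j'
  rw [he] at h2
  exact gap_contradiction (R := (ofSize k M n).R) (Nat.succ_ne_zero _)
    (Nat.pow_pos h.sound.prime.pos) h1 h2 h.gap

end

/-- The bound on the numbers that are used. -/
def bound (k M n₀ n len : ℕ) : ℕ := 2 + 2 * n + len * (k + 1) + (ofSize k M (n + n₀)).dim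

theorem m₁_le_dim : (ofSize k M n).m₁ ≤ (ofSize k M n).dim :=
  Nat.le_self_pow (by simp [ofSize]) _

/-- The instance that belongs to a formula. -/
noncomputable def inst (k M n : ℕ) (φ : List (KClause k n)) : List ℕ :=
  encodeVectorPair
    (boolVec ((ofSize k M n).N k M (6 * k * M)) (ofSize k M n).dim
      ((ofSize k M n).rowA M (6 * k * M) (ofFormula φ)))
    (boolVec _ _ ((ofSize k M n).rowB M (6 * k * M) (ofFormula φ)))

theorem reduce_does (hK : 0 < K) (n₀ k M : ℕ) (hk : 1 ≤ k) (hM : 1 ≤ M) {f g : ℕ → ℝ}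
    (hgood : ∀ n, n₀ ≤ n → Good k M n f g) : ∃ T, PolyBd T ∧
    ∀ (n : ℕ) (φ : List (KClause k n)), ∃ μ : Mem,
      Does K (buildProg hK n₀ k M (6 * k * M)) (.start (encodeKCNF φ))
        (((ofSize k M (n + n₀)).N k M (6 * k * M) + 1) * T (bound k M n₀ n φ.length)) μ ∧
      MemBd (T (bound k M n₀ n φ.length)) μ ∧ (ofSize k M (n + n₀)).Ready (padVars n₀ φ) μ ∧
      ((ofSize k M (n + n₀)).N k M (6 * k * M)).size ≤ T (bound k M n₀ n φ.length) ∧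
      μ.o = (RAMState.start (inst k M (n + n₀) (padVars n₀ φ))).reg ∧
      μ.oa = (RAMState.start (inst k M (n + n₀) (padVars n₀ φ))).arr := by
  obtain ⟨T, hT, h⟩ := build_does hK n₀ k M (6 * k * M)
  refine ⟨T, hT, fun n φ => ?_⟩
  have hg := hgood (n + n₀) (by omega)
  have hm := m₁_le_dim (k := k) (M := M) (n := n + n₀)
  have hlen := length_encodeKCNF φ
  have e : φ.length * (k + 1) = φ.length * k + φ.length := by ring
  obtain ⟨μ, h1, h2, h3, h4, h5, h6⟩ := h (n + n₀) (padVars n₀ φ) (encodeKCNF φ)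
    (bound k M n₀ n φ.length) _ _ hk
    (Nat.mul_pos (Nat.mul_pos (by omega) hk) hM) (by unfold bound; omega) hg.sound.prime.two_le
    (by simp [encodeKCNF]) (by simp [encodeKCNF, padVars]) (hasInput_padVars φ)
    (by unfold bound; omega) (fun i => (getD_encodeKCNF_le φ i).trans (by unfold bound; omega)) rfl
    (by unfold bound; omega) (by unfold bound; omega) rfl
  refine ⟨μ, h1, h2, h3, h4, ?_, ?_⟩
  · rw [h5, inst]
    funext x
    simp only [RAMState.start]
    rw [length_encodeVectorPair rowA_le rowB_le]
  · rw [h6, inst]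
    funext x i
    simp only [RAMState.start]
    rw [getD_encodeVectorPair rowA_le rowB_le]

/-- The promise is always fulfilled: a satisfiable formula gives the complete case and any other
formula the sound case, so the answer of `p` is the answer for the formula. -/
theorem solve_of_distinguishes {p : RAMProg} {f g : ℕ → ℝ} {C : ℝ} {T : ℕ → ℝ}
    (hp : DistinguishesSubset p f g C T) (n₀ : ℕ) (hk : 1 ≤ k) (hM : 1 ≤ M)
    (hgood : ∀ n, n₀ ≤ n → Good k M n f g) : ∃ (p' : RAMProg) (U : ℕ → ℕ), PolyBd U ∧
    ∀ (n : ℕ) (φ : List (KClause k n)), ∃ (t : ℕ) (s : RAMState),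
      RAMRun p' (.start (encodeKCNF φ)) t s ∧
      (t : ℝ) ≤ (((ofSize k M (n + n₀)).N k M (6 * k * M) + 1) * U (bound k M n₀ n φ.length) : ℕ) +
        C * T ((ofSize k M (n + n₀)).N k M (6 * k * M)) ∧
      (KSatisfiable φ → s.reg 0 = 1) ∧ (¬ KSatisfiable φ → s.reg 0 = 0) := by
  obtain ⟨K', hK'⟩ := p.exists_below
  have hK : 0 < K' + 2 := by omega
  obtain ⟨U, hU, h⟩ := reduce_does hK n₀ k M hk hM hgood
  refine ⟨.seq (buildProg hK n₀ k M (6 * k * M)) p, U, hU, fun n φ => ?_⟩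
  obtain ⟨μ, h1, -, -, -, h5, h6⟩ := h n φ
  have hg := hgood (n + n₀) (by omega)
  have : NeZero (ofSize k M (n + n₀)).q := ⟨hg.sound.prime.ne_zero⟩
  by_cases hφ : KSatisfiable φ
  · have hy := hg.subsetYes hk hM (kSatisfiable_padVars (n₀ := n₀).2 hφ)
    obtain ⟨t, s, r1, r2, r3, r4⟩ := hp _ _ ((ofSize k M (n + n₀)).q ^ (ofSize k M (n + n₀)).R)
      hg.two_le hg.dim (Nat.pow_pos hg.sound.prime.pos) _ _ (fun j => by
        rw [card_setVec rowB_le, sum_rowB]) (.inl hy)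
    rw [charVectors_setVec, charVectors_setVec] at r1
    obtain ⟨s', ⟨t', ht', hr⟩, hs'⟩ := (h1.seq (Does.oracle (hK'.mono (Nat.le_add_right K' 2)) r1 h5 h6)) _
      (shows_start hK _)
    refine ⟨t', s', hr, ?_, fun _ => ?_, fun h => absurd hφ h⟩
    · refine (Nat.cast_le.2 ht').trans ?_
      rw [Nat.cast_add]
      gcongr
    · rw [hs'.o 0 hK]
      exact r3 hy
  · have hy := hg.subsetNo (φ := padVars n₀ φ) (mt kSatisfiable_padVars.1 hφ)
    obtain ⟨t, s, r1, r2, r3, r4⟩ := hp _ _ ((ofSize k M (n + n₀)).q ^ (ofSize k M (n + n₀)).R)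
      hg.two_le hg.dim (Nat.pow_pos hg.sound.prime.pos) _ _ (fun j => by
        rw [card_setVec rowB_le, sum_rowB]) (.inr hy)
    rw [charVectors_setVec, charVectors_setVec] at r1
    obtain ⟨s', ⟨t', ht', hr⟩, hs'⟩ := (h1.seq (Does.oracle (hK'.mono (Nat.le_add_right K' 2)) r1 h5 h6)) _
      (shows_start hK _)
    refine ⟨t', s', hr, ?_, fun h => absurd h hφ, fun _ => ?_⟩
    · refine (Nat.cast_le.2 ht').trans ?_
      rw [Nat.cast_add]
      gcongr
    · rw [hs'.o 0 hK]
      exact r4 hy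

/-- For a satisfiable formula the returned pair encodes a satisfying assignment, which the test
accepts. For an unsatisfiable one the test rejects every pair. -/
theorem solve_of_approximates {p : RAMProg} {f g : ℕ → ℝ} {C : ℝ} {T : ℕ → ℝ}
    (hp : ApproximatesMaxIP p f g C T) (n₀ : ℕ) (hk : 1 ≤ k) (hM : 1 ≤ M)
    (hgood : ∀ n, n₀ ≤ n → Good k M n f g) : ∃ (p' : RAMProg) (U : ℕ → ℕ), PolyBd U ∧
    ∀ (n : ℕ) (φ : List (KClause k n)), ∃ (t : ℕ) (s : RAMState),
      RAMRun p' (.start (encodeKCNF φ)) t s ∧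
      (t : ℝ) ≤ (((ofSize k M (n + n₀)).N k M (6 * k * M) + 1) * U (bound k M n₀ n φ.length) : ℕ) +
        C * T ((ofSize k M (n + n₀)).N k M (6 * k * M)) ∧
      (KSatisfiable φ → s.reg 0 = 1) ∧ (¬ KSatisfiable φ → s.reg 0 = 0) := by
  obtain ⟨K', hK'⟩ := p.exists_below
  -- The summand `2` ensures that registers `0` and `1`, which hold the returned indices, belong to
  -- the part of the subroutine even if `p` mentions fewer registers.
  have hK : 0 < K' + 2 := by omega
  obtain ⟨U, hU, h⟩ := reduce_does hK n₀ k M hk hM hgood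
  obtain ⟨T', hT', h'⟩ := check_does (show 1 < K' + 2 by omega) k
  refine ⟨.seq (buildProg hK n₀ k M (6 * k * M)) (.seq p (checkProg (show 1 < K' + 2 by omega) k)),
    fun V => U V + T' (U V + 2), hU.add (hT'.comp (hU.add (.const 2)) fun _ _ => by omega),
    fun n φ => ?_⟩
  obtain ⟨μ, h1, h2, h3, h4, h5, h6⟩ := h n φ
  have hg := hgood (n + n₀) (by omega)
  obtain ⟨t, s, i, j, r1, r2, r3, r4, r5⟩ := hp _ _ hg.two_le hg.dim
    (boolVec ((ofSize k M (n + n₀)).N k M (6 * k * M)) (ofSize k M (n + n₀)).dim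
      ((ofSize k M (n + n₀)).rowA M (6 * k * M) (ofFormula (padVars n₀ φ))))
    (boolVec _ _ ((ofSize k M (n + n₀)).rowB M (6 * k * M) (ofFormula (padVars n₀ φ))))
  obtain ⟨μ', c1, c2, c3, c4⟩ := h' _ (padVars n₀ φ) (ofSize k M (n + n₀))
    (U (bound k M n₀ n φ.length) + 2) { μ with o := s.reg, oa := s.arr } (h3.congr rfl rfl
      fun _ _ => rfl) (by omega) (MemBd.mono (μ := μ) h2 (by omega))
      (by
        dsimp only
        rw [r3]
        exact (Nat.size_mono i.2.le).trans (by omega))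
      (by
        dsimp only
        rw [r4]
        exact (Nat.size_mono j.2.le).trans (by omega))
  obtain ⟨s', ⟨t', ht', hr⟩, hs'⟩ := (h1.seq ((Does.oracle (hK'.mono (Nat.le_add_right K' 2)) r1 h5 h6).seq c1)) _
      (shows_start hK _)
  refine ⟨t', s', hr, ?_, fun hφ => ?_, fun hφ => ?_⟩
  · refine (Nat.cast_le.2 ht').trans ?_
    have key : ∀ a b c N : ℕ, (N + 1) * a + (b + c) ≤ (N + 1) * (a + c) + b := fun a b c N => by
      nlinarith [Nat.zero_le (N * c)]
    refine (Nat.cast_le.2 (key _ _ _ _)).trans ?_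
    rw [Nat.cast_add]
    gcongr
  · rw [hs'.o 0 hK]
    refine c4 ?_
    dsimp only
    rw [r3, r4]
    refine hg.sat hk hM (kSatisfiable_padVars.2 hφ) i j fun i' j' => ?_
    have := r5 i' j'
    rwa [bitInner_boolVec rowA_le rowB_le,
      bitInner_boolVec rowA_le rowB_le] at this
  · rw [hs'.o 0 hK]
    exact c2.resolve_right fun h => hφ (kSatisfiable_padVars.1 (c3 h))

end Par

namespace Par
variable {k M Y n : ℕ}

/-! ### Growth of the parameters -/

theorem tendsto_size : Tendsto Nat.size atTop atTop :=
  tendsto_atTop_atTop.2 fun b => ⟨2 ^ b, fun _ ha => (Nat.lt_size.2 ha).le⟩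

theorem two_pow_size_le (hn : n ≠ 0) : 2 ^ n.size ≤ 2 * n := by
  have h : 0 < n.size := Nat.size_pos.2 (Nat.pos_of_ne_zero hn)
  have h1 : 2 ^ (n.size - 1) ≤ n := Nat.lt_size.1 (by omega)
  have h2 : 2 ^ n.size = 2 * 2 ^ (n.size - 1) := by rw [← pow_succ', Nat.sub_add_cancel h]
  omega

theorem eventually_le_size (c : ℝ) : ∀ᶠ n : ℕ in atTop, c ≤ (n.size : ℝ) :=
  (tendsto_natCast_atTop_atTop.comp tendsto_size).eventually_ge_atTop c

theorem eventually_size_pow_le (c : ℝ) (e : ℕ) : ∀ᶠ n : ℕ in atTop, c * (n.size : ℝ) ^ e ≤ n := by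
  have h1 := ((tendsto_pow_const_div_const_pow_of_one_lt e one_lt_two).const_mul (2 * c)).comp
    tendsto_size
  rw [mul_zero] at h1
  filter_upwards [h1.eventually_le_const one_pos, eventually_ne_atTop 0] with n h2 h3
  have h4 : (2 : ℝ) ^ n.size ≤ 2 * n := by exact_mod_cast two_pow_size_le h3
  simp only [Function.comp] at h2
  rw [← mul_div_assoc, div_le_one (by positivity)] at h2
  linarith

/-- With `y = √(n.size - 2)` the binary length is at most `2 * y ^ 2`, so the claim is that `64 * y
^ 12` is eventually below `2 ^ y`. The term `n.size - 2` is a lower bound for `log log N`. -/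
theorem eventually_size_pow_le_two_rpow : ∀ᶠ n : ℕ in atTop,
    (n.size : ℝ) ^ 6 ≤ (2 : ℝ) ^ √((n.size : ℝ) - 2) := by
  have h0 : ∀ᶠ y : ℝ in atTop, 64 * y ^ 12 ≤ (2 : ℝ) ^ y := by
    have := (isLittleO_pow_exp_pos_mul_atTop (k := 12) (Real.log_pos one_lt_two)).bound
      (show (0 : ℝ) < 1 / 64 by norm_num)
    filter_upwards [this, eventually_ge_atTop 0] with y h hy
    rw [Real.norm_of_nonneg (by positivity), Real.norm_of_nonneg (Real.exp_pos _).le] at h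
    rw [Real.rpow_def_of_pos two_pos]
    linarith
  have h1 : Tendsto (fun n : ℕ => √((n.size : ℝ) - 2)) atTop atTop :=
    Real.tendsto_sqrt_atTop.comp ((tendsto_natCast_atTop_atTop.comp tendsto_size).atTop_add
      (tendsto_const_nhds (x := (-2 : ℝ))))
  filter_upwards [h1.eventually h0, eventually_le_size 4] with n h2 h3
  refine le_trans ?_ h2
  have h4 : √((n.size : ℝ) - 2) ^ 2 = n.size - 2 := Real.sq_sqrt (by linarith)
  calc (n.size : ℝ) ^ 6 ≤ (2 * √((n.size : ℝ) - 2) ^ 2) ^ 6 :=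
        pow_le_pow_left₀ (by positivity) (by rw [h4]; linarith) _
    _ = 64 * √((n.size : ℝ) - 2) ^ 12 := by ring

theorem ofSize_q_spec (k M n : ℕ) : (ofSize k M n).q.Prime ∧
    8 * (ofSize k M n).T * (ofSize k M n).l + 8 < (ofSize k M n).q ∧
    (ofSize k M n).q ≤ 2 * (8 * (ofSize k M n).T * (ofSize k M n).l + 8) :=
  leastPrime_spec (by omega)

/-- With `a = 2 ^ n.size` one has `T ≤ a ^ 3` and `l ≤ a`, so `q` is at most `32 * a ^ 4`, and `2 ≤
a` absorbs the constant `32` into `a ^ 5`. -/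
theorem q_le (hn : n ≠ 0) : (ofSize k M n).q ≤ 2 ^ (9 * n.size) := by
  refine (ofSize_q_spec k M n).2.2.trans ?_
  have h1 : n.size < 2 ^ n.size := Nat.lt_two_pow_self
  have h2 : n < 2 ^ n.size := Nat.lt_size_self n
  have h3 : n / (n.size * n.size) ≤ n := Nat.div_le_self _ _
  have h0 : 0 < n.size := Nat.size_pos.2 (Nat.pos_of_ne_zero hn)
  have h5 : 2 ≤ 2 ^ n.size := Nat.le_self_pow h0.ne' 2
  set a := 2 ^ n.size with ha
  have hT : (ofSize k M n).T ≤ a * a * a := by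
    simp only [ofSize]; gcongr
  have hl : (ofSize k M n).l ≤ a := by simp only [ofSize]; omega
  calc 2 * (8 * (ofSize k M n).T * (ofSize k M n).l + 8) ≤ 2 * (8 * (a * a * a) * a + 8) := by gcongr
    _ = 16 * a ^ 4 + 16 := by ring
    _ ≤ 32 * a ^ 4 := by have := Nat.one_le_pow 4 a (by omega); omega
    _ = 2 ^ 5 * a ^ 4 := by norm_num
    _ ≤ a ^ 5 * a ^ 4 := by gcongr
    _ = 2 ^ (9 * n.size) := by rw [← pow_add, ha, ← pow_mul, mul_comm]

theorem dim_le (hn : n ≠ 0) : ((ofSize k M n).dim : ℝ) ≤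
    (2 : ℝ) ^ (27 * ((n : ℝ) / (n.size : ℝ) ^ 2 + (n.size : ℝ) ^ 4)) := by
  have h0 : 0 < n.size := Nat.size_pos.2 (Nat.pos_of_ne_zero hn)
  have h1 : (ofSize k M n).dim ≤ 2 ^ (9 * n.size * ((ofSize k M n).T + 2) * (ofSize k M n).R) := by
    rw [pow_mul, pow_mul]
    exact Nat.pow_le_pow_left (Nat.pow_le_pow_left (q_le hn) _) _
  refine (Nat.cast_le.2 h1).trans ?_
  rw [Nat.cast_pow, Nat.cast_two, ← Real.rpow_natCast]
  refine Real.rpow_le_rpow_of_exponent_le one_le_two ?_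
  have hT : ((ofSize k M n).T : ℝ) = (n.size : ℝ) ^ 3 := by simp [ofSize]; ring
  have hR : ((ofSize k M n).R : ℝ) ≤ n / (n.size : ℝ) ^ 6 + 1 := by
    simp only [ofSize]
    rw [Nat.cast_add, Nat.cast_one]
    refine add_le_add_left (Nat.cast_div_le.trans (le_of_eq ?_)) _
    push_cast
    ring
  have hs : (1 : ℝ) ≤ n.size := by exact_mod_cast h0
  have hs3 : (1 : ℝ) ≤ (n.size : ℝ) ^ 3 := one_le_pow₀ hs
  push_cast
  rw [hT]
  -- The exponent is the length of `q` times `T + 2` times `R`; here `T + 2 ≤ 3 * n.size ^ 3`,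
  -- whence the constant `27`.
  calc 9 * (n.size : ℝ) * ((n.size : ℝ) ^ 3 + 2) * ((ofSize k M n).R : ℝ) ≤
      9 * (n.size : ℝ) * (3 * (n.size : ℝ) ^ 3) * (n / (n.size : ℝ) ^ 6 + 1) := by
        gcongr; linarith
    _ = _ := by field_simp; ring

theorem eventually_dim_le (k M : ℕ) : ∀ᶠ n : ℕ in atTop,
    ((ofSize k M n).dim : ℝ) ≤ (2 : ℝ) ^ ((n : ℝ) / n.size) := by
  filter_upwards [eventually_ne_atTop 0, eventually_le_size 54, eventually_size_pow_le 54 5] with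
    n h0 h1 h2
  refine (dim_le h0).trans (Real.rpow_le_rpow_of_exponent_le one_le_two ?_)
  have h3 : (n : ℝ) / (n.size : ℝ) ^ 2 ≤ n / n.size / 54 := by
    rw [div_div, sq]
    gcongr
  have h4 : (n.size : ℝ) ^ 4 ≤ n / n.size / 54 := by
    rw [div_div, le_div_iff₀ (by positivity)]
    linarith [show (n.size : ℝ) ^ 4 * (n.size * 54) = 54 * (n.size : ℝ) ^ 5 by ring]
  linarith

theorem le_N : (2 : ℝ) ^ ((n : ℝ) / 2) ≤ (ofSize k M n).N k M Y := by
  have h1 : 2 ^ (ofSize k M n).h ≤ (ofSize k M n).N k M Y := by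
    unfold N
    rw [mul_assoc]
    exact Nat.le_mul_of_pos_right _ (Nat.mul_pos (Nat.pow_pos (ofSize_q_spec k M n).1.pos)
      (Nat.pow_pos (Nat.succ_pos _)))
  refine le_trans ?_ (Nat.cast_le.2 h1)
  rw [Nat.cast_pow, Nat.cast_two, ← Real.rpow_natCast]
  refine Real.rpow_le_rpow_of_exponent_le one_le_two ?_
  have : n ≤ 2 * (ofSize k M n).h := by simp only [ofSize]; omega
  have : (n : ℝ) ≤ 2 * (ofSize k M n).h := by exact_mod_cast this
  linarith

/-- The three terms of the exponent come from the half assignments, Merlin's polynomials and the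
advice. -/
theorem N_le (hn : n ≠ 0) : ((ofSize k M n).N k M Y : ℝ) ≤ (2 : ℝ) ^ (((n : ℝ) + 1) / 2 +
    18 * (n / n.size + n.size) + (k * n / M + 1) * Real.logb 2 (adv k M Y + 1)) := by
  have h0 : 0 < n.size := Nat.size_pos.2 (Nat.pos_of_ne_zero hn)
  unfold N
  push_cast
  rw [Real.rpow_add two_pos, Real.rpow_add two_pos]
  have ha : (0 : ℝ) < (adv k M Y : ℝ) + 1 := by positivity
  gcongr
  · rw [← Real.rpow_natCast]
    refine Real.rpow_le_rpow_of_exponent_le one_le_two ?_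
    have : 2 * (ofSize k M n).h ≤ n + 1 := by simp only [ofSize]; omega
    have : (2 : ℝ) * (ofSize k M n).h ≤ n + 1 := by exact_mod_cast this
    linarith
  · have h1 : (ofSize k M n).q ^ (2 * (ofSize k M n).l) ≤
        2 ^ (9 * n.size * (2 * (ofSize k M n).l)) := by
      rw [pow_mul 2 (9 * n.size)]
      exact Nat.pow_le_pow_left (q_le hn) _
    have h2 : ((ofSize k M n).q : ℝ) ^ (2 * (ofSize k M n).l) ≤
        (2 : ℝ) ^ (9 * n.size * (2 * (ofSize k M n).l)) := by exact_mod_cast h1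
    refine h2.trans ?_
    rw [← Real.rpow_natCast]
    refine Real.rpow_le_rpow_of_exponent_le one_le_two ?_
    have hl : ((ofSize k M n).l : ℝ) ≤ n / (n.size * n.size) + 1 := by
      simp only [ofSize]
      rw [Nat.cast_add, Nat.cast_one]
      refine add_le_add_left (Nat.cast_div_le.trans (le_of_eq ?_)) _
      push_cast
      ring
    have hs : (1 : ℝ) ≤ n.size := by exact_mod_cast h0
    push_cast
    calc 9 * (n.size : ℝ) * (2 * ((ofSize k M n).l : ℝ)) ≤
        9 * (n.size : ℝ) * (2 * (n / (n.size * n.size) + 1)) := by gcongr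
      _ = _ := by field_simp; norm_num
  · have e : ((adv k M Y : ℝ) + 1) = (2 : ℝ) ^ Real.logb 2 (adv k M Y + 1) :=
      (Real.rpow_logb two_pos (by norm_num) ha).symm
    have hlog : 0 ≤ Real.logb 2 ((adv k M Y : ℝ) + 1) :=
      Real.logb_nonneg one_lt_two (by linarith [Nat.cast_nonneg (α := ℝ) (adv k M Y)])
    conv_lhs => rw [e]
    rw [← Real.rpow_natCast, ← Real.rpow_mul zero_le_two, mul_comm]
    refine Real.rpow_le_rpow_of_exponent_le one_le_two (mul_le_mul_of_nonneg_right ?_ hlog)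
    simp only [ofSize]
    rw [Nat.cast_add, Nat.cast_one]
    refine add_le_add_left (Nat.cast_div_le.trans (le_of_eq ?_)) _
    push_cast
    ring

/-- Besides `n / 2` there are three contributions, each eventually at most `δ * n`: the constants,
Merlin's polynomials, of order `n / n.size`, and the advice, by the choice of `M`. -/
theorem eventually_N_le {δ : ℝ} (hδ : 0 < δ) (h : k / M * Real.logb 2 (adv k M Y + 1) ≤ δ) :
    ∀ᶠ n : ℕ in atTop, ((ofSize k M n).N k M Y : ℝ) ≤ (2 : ℝ) ^ ((1 / 2 + 3 * δ) * n) := by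
  filter_upwards [eventually_ne_atTop 0, eventually_le_size (36 / δ),
    eventually_size_pow_le (36 / δ) 1, tendsto_natCast_atTop_atTop.eventually_ge_atTop
      ((1 / 2 + Real.logb 2 (adv k M Y + 1)) / δ)] with n h0 h1 h2 h3
  refine (N_le h0).trans (Real.rpow_le_rpow_of_exponent_le one_le_two ?_)
  rw [div_le_iff₀ hδ] at h1 h3
  rw [pow_one, div_mul_eq_mul_div, div_le_iff₀ hδ] at h2
  have hs : (0 : ℝ) < n.size := by
    by_contra h
    nlinarith
  have h4 : (n : ℝ) / n.size ≤ n * δ / 36 := by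
    rw [div_le_iff₀ hs]
    nlinarith [Nat.cast_nonneg (α := ℝ) n]
  have h5 : (k : ℝ) * n / M * Real.logb 2 (adv k M Y + 1) ≤ δ * n := by
    have := mul_le_mul_of_nonneg_right h (Nat.cast_nonneg (α := ℝ) n)
    calc _ = k / M * Real.logb 2 (adv k M Y + 1) * n := by ring
      _ ≤ _ := this
  linarith

/-- There is `M` for which the advice is short. -/
theorem exists_adv_le (k : ℕ) {δ : ℝ} (hδ : 0 < δ) : ∃ M : ℕ, 1 ≤ M ∧
    k / M * Real.logb 2 (adv k M (6 * k * M) + 1) ≤ δ := by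
  rcases Nat.eq_zero_or_pos k with rfl | hk
  · exact ⟨1, le_rfl, by simpa using hδ.le⟩
  have h1 : Tendsto (fun M : ℕ => (k * (2 * k + 1) * Real.logb 2 (7 * k)) / (M : ℝ) +
      k * (2 * k + 1) / Real.log 2 * (Real.log M / M)) atTop (𝓝 (0 + k * (2 * k + 1) / Real.log 2 * 0)) :=
    (tendsto_const_div_atTop_nhds_zero_nat _).add
      ((Real.isLittleO_log_id_atTop.tendsto_div_nhds_zero.comp tendsto_natCast_atTop_atTop).const_mul _)
  rw [mul_zero, add_zero] at h1
  obtain ⟨M, hM, hM1⟩ := ((h1.eventually_le_const hδ).and (eventually_ge_atTop 1)).exists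
  refine ⟨M, hM1, le_trans ?_ hM⟩
  have hM0 : (0 : ℝ) < M := by exact_mod_cast hM1
  have hk0 : (0 : ℝ) < k := by exact_mod_cast hk
  have h2 : adv k M (6 * k * M) + 1 ≤ (7 * k * M) ^ (2 * k + 1) := by
    have hkM : 1 ≤ k * M := Nat.mul_pos hk hM1
    have h3 : M ≤ 6 * k * M := Nat.le_mul_of_pos_left _ (by omega)
    calc adv k M (6 * k * M) + 1 ≤ 6 * k * M * (6 * k * M) ^ (2 * k) + 1 := by
          unfold adv; gcongr
      _ = (6 * k * M) ^ (2 * k + 1) + 1 := by rw [pow_succ']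
      _ ≤ _ := Nat.succ_le_of_lt (Nat.pow_lt_pow_left (by nlinarith) (by omega))
  have h3 : Real.logb 2 (adv k M (6 * k * M) + 1) ≤
      (2 * k + 1) * (Real.logb 2 (7 * k) + Real.log M / Real.log 2) := by
    have h4 : ((adv k M (6 * k * M) : ℝ) + 1) ≤ (7 * k * M) ^ (2 * k + 1) := by exact_mod_cast h2
    refine (Real.logb_le_logb_of_le one_lt_two (by positivity) h4).trans (le_of_eq ?_)
    rw [Real.logb_pow, Real.logb_mul (by positivity) (by positivity)]
    push_cast
    rfl
  calc _ ≤ k / M * ((2 * k + 1) * (Real.logb 2 (7 * k) + Real.log M / Real.log 2)) := by gcongr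
    _ = _ := by
      have := Real.log_pos one_lt_two
      field_simp

end Par

/-! ### The exponents and the final choice of parameters -/

/-- The functions `f` and `g`. -/
noncomputable def gapExponent (N : ℕ) : ℝ := 1 / √(Real.logb 2 (Real.logb 2 N))

theorem tendsto_gapExponent : Tendsto gapExponent atTop (𝓝 0) := by
  have h := (Real.tendsto_sqrt_atTop.comp <| (Real.tendsto_logb_atTop one_lt_two).comp <|
    (Real.tendsto_logb_atTop one_lt_two).comp tendsto_natCast_atTop_atTop).inv_tendsto_atTop
  refine h.congr fun N => ?_
  simp [gapExponent]

namespace Par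
variable {k M n : ℕ}

/-- `T * l` is at least `n.size * n`, while the sparse formula and the advice need only constant
multiples of `n`. Once `n.size` exceeds these constants, the field, larger than `8 * T * l`, meets
all conditions. -/
theorem eventually_sound (k M : ℕ) : ∀ᶠ n : ℕ in atTop,
    (ofSize k M n).Sound (adv k M (6 * k * M)) ∧
      1 + k * (k * (2 * n) * adv k M (6 * k * M)) ≤ (ofSize k M n).T * (ofSize k M n).l := by
  filter_upwards [tendsto_size.eventually_ge_atTop
    (1 + 2 * k * k * adv k M (6 * k * M) + k + adv k M (6 * k * M)), eventually_ge_atTop 1] with n h hn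
  set a := adv k M (6 * k * M)
  obtain ⟨hp, hq, -⟩ := ofSize_q_spec k M n
  have h1 : n.size * n ≤ (ofSize k M n).T * (ofSize k M n).l := by
    have h2 := Nat.lt_mul_div_succ n (show 0 < n.size * n.size from Nat.mul_pos (by omega) (by omega))
    calc n.size * n ≤ n.size * (n.size * n.size * (n / (n.size * n.size) + 1)) :=
          Nat.mul_le_mul_left _ h2.le
      _ = _ := by simp only [ofSize]; ring
  have h3 := Nat.mul_le_mul_right n h
  have h4 : (1 + 2 * k * k * a + k + a) * n = n + k * (k * (2 * n) * a) + k * n + a * n := by ring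
  have h5 : a ≤ a * n := Nat.le_mul_of_pos_right _ hn
  have h6 : (ofSize k M n).J ≤ k * n + 1 := by
    simp only [ofSize]
    exact Nat.add_le_add_right (Nat.div_le_self _ _) 1
  have h7 : 1 ≤ (ofSize k M n).T := by
    simp only [ofSize]
    exact Nat.mul_pos (Nat.mul_pos (by omega) (by omega)) (by omega)
  have h8 := Nat.mul_le_mul_right (ofSize k M n).l h7
  rw [mul_assoc] at hq
  exact ⟨⟨hp, Nat.succ_pos _, by rw [mul_assoc]; omega, by omega, by omega, by omega⟩, by omega⟩

/-- Let `L = log N`, so `n / 2 ≤ L ≤ n`, and `log L` lies between `n.size - 2` and `n.size`. The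
exponent `1 / √(log L)` tends to `0` slowly enough for both requirements. For the dimension, `n /
n.size ≤ L / √(log L)`. For the gap, `L` divided by `2 ^ √(log L)` is at most `R`, because `2 ^
√(log L)` exceeds `n.size ^ 6`. -/
theorem eventually_good (k M : ℕ) (h : ∀ᶠ n : ℕ in atTop,
    ((ofSize k M n).N k M (6 * k * M) : ℝ) ≤ (2 : ℝ) ^ (n : ℝ)) :
    ∀ᶠ n in atTop, Good k M n gapExponent gapExponent := by
  filter_upwards [eventually_sound k M, eventually_dim_le k M, h, eventually_size_pow_le_two_rpow,
    eventually_le_size 4, eventually_ge_atTop 3] with n h1 h2 h3 h4 h5 h6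
  have h7 := le_N (k := k) (M := M) (Y := 6 * k * M) (n := n)
  set N := (ofSize k M n).N k M (6 * k * M)
  have hn : (3 : ℝ) ≤ n := by exact_mod_cast h6
  have hN0 : (0 : ℝ) < N := (Real.rpow_pos_of_pos two_pos _).trans_le h7
  have hL1 : (n : ℝ) / 2 ≤ Real.logb 2 N := (Real.le_logb_iff_rpow_le one_lt_two hN0).2 h7
  have hL2 : Real.logb 2 N ≤ n := (Real.logb_le_iff_le_rpow one_lt_two hN0).2 h3
  have hN2 : (2 : ℝ) ^ Real.logb 2 N = N := Real.rpow_logb two_pos (by norm_num) hN0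
  set L := Real.logb 2 N
  have hL0 : 1 < L := by linarith
  have hLL0 : 0 < Real.logb 2 L := Real.logb_pos one_lt_two hL0
  have hn2 : (n : ℝ) ≤ 2 ^ (n.size : ℝ) := by
    rw [Real.rpow_natCast]
    exact_mod_cast (Nat.lt_size_self n).le
  have hn3 : (2 : ℝ) ^ (n.size : ℝ) ≤ 2 * n := by
    rw [Real.rpow_natCast]
    exact_mod_cast two_pow_size_le (by omega)
  have hLL1 : Real.logb 2 L ≤ n.size :=
    (Real.logb_le_iff_le_rpow one_lt_two (by linarith)).2 (hL2.trans hn2)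
  have hLL2 : (n.size : ℝ) - 2 ≤ Real.logb 2 L := by
    rw [Real.le_logb_iff_rpow_le one_lt_two (by linarith), Real.rpow_sub two_pos]
    refine le_trans ?_ hL1
    rw [show (2 : ℝ) ^ (2 : ℝ) = 4 by norm_num]
    linarith
  have hLL3 : (2 : ℝ) ^ Real.logb 2 L = L := Real.rpow_logb two_pos (by norm_num) (by linarith)
  have hf : gapExponent N = 1 / √(Real.logb 2 L) := rfl
  have hs : (0 : ℝ) < n.size := by linarith
  refine ⟨h1.1, h1.2, ?_, ?_, ?_⟩
  · have : (2 : ℝ) ^ (1 : ℝ) ≤ N :=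
      (Real.rpow_le_rpow_of_exponent_le one_le_two (by linarith)).trans h7
    rw [Real.rpow_one] at this
    exact_mod_cast this
  · refine h2.trans ?_
    change (2 : ℝ) ^ ((n : ℝ) / n.size) ≤ (N : ℝ) ^ gapExponent N
    rw [hf, ← hN2, ← Real.rpow_mul zero_le_two]
    refine Real.rpow_le_rpow_of_exponent_le one_le_two ?_
    have h8 : 2 ≤ √(n.size : ℝ) := Real.le_sqrt_of_sq_le (by linarith)
    have h9 : √(Real.logb 2 L) ≤ √(n.size : ℝ) := Real.sqrt_le_sqrt hLL1
    have h10 : 0 < √(Real.logb 2 L) := Real.sqrt_pos.2 hLL0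
    have h11 : √(n.size : ℝ) * √(n.size : ℝ) = n.size := Real.mul_self_sqrt hs.le
    rw [mul_one_div, div_le_div_iff₀ hs h10]
    calc (n : ℝ) * √(Real.logb 2 L) ≤ n * √(n.size : ℝ) := by gcongr
      _ = n / 2 * (2 * √(n.size : ℝ)) := by ring
      _ ≤ n / 2 * (√(n.size : ℝ) * √(n.size : ℝ)) := by gcongr
      _ = n / 2 * n.size := by rw [h11]
      _ ≤ L * n.size := by gcongr
  · change (2 : ℝ) ^ (L ^ (1 - gapExponent N)) ≤ _
    rw [← Real.rpow_natCast]
    refine Real.rpow_le_rpow_of_exponent_le one_le_two ?_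
    rw [Real.rpow_sub (by linarith), Real.rpow_one]
    -- Writing `L = 2 ^ log L`, the exponent becomes `log L / √(log L) = √(log L)`.
    have h8 : L ^ gapExponent N = (2 : ℝ) ^ √(Real.logb 2 L) := by
      conv_lhs => rw [← hLL3]
      rw [← Real.rpow_mul zero_le_two, hf, mul_one_div, Real.div_sqrt]
    have h9 : (n.size : ℝ) ^ 6 ≤ (2 : ℝ) ^ √(Real.logb 2 L) := h4.trans
      (Real.rpow_le_rpow_of_exponent_le one_le_two (Real.sqrt_le_sqrt hLL2))
    rw [h8]
    have h10 : (n : ℝ) ≤ (n.size : ℝ) ^ 6 * (ofSize k M n).R := by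
      have h0 : 0 < n.size := by exact_mod_cast hs
      have := (Nat.lt_mul_div_succ n (show 0 < n.size * n.size * n.size * (n.size * n.size * n.size) by
        positivity)).le
      have : (n : ℝ) ≤ ((n.size * n.size * n.size * (n.size * n.size * n.size) *
        (ofSize k M n).R : ℕ) : ℝ) := by exact_mod_cast this
      push_cast at this
      linarith [show (n.size : ℝ) * n.size * n.size * (n.size * n.size * n.size) = (n.size : ℝ) ^ 6 by ring]
    rw [div_le_iff₀ (by positivity)]
    calc L ≤ n := hL2
      _ ≤ _ := h10
      _ ≤ (2 : ℝ) ^ √(Real.logb 2 L) * (ofSize k M n).R := by gcongr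
      _ = _ := mul_comm _ _

/-- A formula without repeated clauses has at most `(n * 2) ^ k` of them. This is polynomial in `n`
and the dimension is subexponential, so every fixed power of the bound is subexponential. -/
theorem eventually_bound_pow_le (k M n₀ c : ℕ) {δ : ℝ} (hδ : 0 < δ) : ∀ᶠ n : ℕ in atTop,
    (bound k M n₀ n ((n * 2) ^ k) : ℝ) ^ c ≤ (2 : ℝ) ^ (δ * ((n + n₀ : ℕ) : ℝ)) := by
  have h0 := (eventually_dim_le k M).and <| (eventually_le_size (2 * c / δ)).and <|
    (eventually_size_pow_le (4 * c * (k + 1) / δ) 1).and <|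
    (tendsto_natCast_atTop_atTop.eventually_ge_atTop (4 * c * (3 * k + 6) / δ)).and <|
    eventually_le_size 1
  filter_upwards [(tendsto_add_atTop_nat n₀).eventually h0] with n h
  obtain ⟨h1, h2, h3, h4, h5⟩ := h
  set m := n + n₀
  have hm : m < 2 ^ m.size := Nat.lt_size_self m
  have hs : (0 : ℝ) < m.size := by linarith
  have hb1 : 2 + 2 * n + (n * 2) ^ k * (k + 1) ≤ 2 ^ ((k + 1) * m.size + (3 * k + 5)) := by
    have e1 : 1 ≤ 2 ^ m.size := Nat.one_le_two_pow
    have e2 : (n * 2) ^ k ≤ (2 ^ (m.size + 1)) ^ k := Nat.pow_le_pow_left (by rw [pow_succ]; omega) _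
    have e3 : k + 1 ≤ 2 ^ k := Nat.lt_two_pow_self
    have e4 : 2 ^ m.size ≤ 2 ^ ((k + 1) * m.size + 2 * k) := Nat.pow_le_pow_right (by omega) (by nlinarith)
    have e5 : (2 ^ (m.size + 1)) ^ k * 2 ^ k ≤ 2 ^ ((k + 1) * m.size + 2 * k) := by
      rw [← pow_mul, ← pow_add]
      exact Nat.pow_le_pow_right (by omega) (by nlinarith)
    have e6 : 2 ^ ((k + 1) * m.size + (3 * k + 5)) =
        2 ^ ((k + 1) * m.size + 2 * k) * 2 ^ (k + 5) := by rw [← pow_add]; congr 1; ring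
    have e7 : 32 ≤ 2 ^ (k + 5) := by
      calc 32 = 2 ^ 5 := by norm_num
        _ ≤ _ := Nat.pow_le_pow_right (by omega) (by omega)
    have e8 := Nat.mul_le_mul_left (2 ^ ((k + 1) * m.size + 2 * k)) e7
    have e9 := Nat.mul_le_mul e2 e3
    omega
  have hb2 : (bound k M n₀ n ((n * 2) ^ k) : ℝ) ≤
      (2 : ℝ) ^ ((k + 1) * (m.size : ℝ) + (3 * k + 6) + m / m.size) := by
    have e1 : ((2 + 2 * n + (n * 2) ^ k * (k + 1) : ℕ) : ℝ) ≤
        (2 : ℝ) ^ ((k + 1) * (m.size : ℝ) + (3 * k + 5)) := by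
      refine (Nat.cast_le.2 hb1).trans (le_of_eq ?_)
      rw [Nat.cast_pow, ← Real.rpow_natCast]
      push_cast
      rfl
    have e2 : (0 : ℝ) ≤ m / m.size := by positivity
    have e3 : (0 : ℝ) ≤ (k + 1) * (m.size : ℝ) + (3 * k + 5) := by positivity
    have e4 := Real.one_le_rpow one_le_two e2
    have e5 := Real.one_le_rpow one_le_two e3
    unfold bound
    rw [Nat.cast_add, show (k + 1) * (m.size : ℝ) + (3 * k + 6) + m / m.size =
      ((k + 1) * (m.size : ℝ) + (3 * k + 5)) + m / m.size + 1 by ring, Real.rpow_add two_pos,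
      Real.rpow_add two_pos, Real.rpow_one]
    nlinarith
  refine (pow_le_pow_left₀ (Nat.cast_nonneg _) hb2 c).trans ?_
  rw [← Real.rpow_natCast, ← Real.rpow_mul zero_le_two]
  refine Real.rpow_le_rpow_of_exponent_le one_le_two ?_
  rw [div_le_iff₀ hδ] at h2 h4
  rw [pow_one, div_mul_eq_mul_div, div_le_iff₀ hδ] at h3
  have h6 : (m : ℝ) / m.size * (2 * c) ≤ δ * m := by
    rw [div_mul_eq_mul_div, div_le_iff₀ hs]
    nlinarith [Nat.cast_nonneg (α := ℝ) m]
  nlinarith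

/-! ### The resulting running time for `k`-SAT -/

theorem exists_le_mul_of_eventually_le {u v : ℕ → ℝ} {c : ℝ} (hv : ∀ n, 1 ≤ v n)
    (h : ∀ᶠ n in atTop, u n ≤ c * v n) : ∃ C, ∀ n, u n ≤ C * v n := by
  obtain ⟨N, hN⟩ := eventually_atTop.1 h
  refine ⟨|c| + ∑ i ∈ Finset.range N, |u i|, fun n => ?_⟩
  have h1 : 0 ≤ ∑ i ∈ Finset.range N, |u i| := Finset.sum_nonneg fun _ _ => abs_nonneg _
  have hv0 : 0 ≤ v n := zero_le_one.trans (hv n)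
  by_cases hn : N ≤ n
  · exact (hN n hn).trans (mul_le_mul_of_nonneg_right ((le_abs_self c).trans (by linarith)) hv0)
  · have h2 := Finset.single_le_sum (f := fun i => |u i|) (fun _ _ => abs_nonneg _)
      (Finset.mem_range.2 (not_le.1 hn))
    calc u n ≤ |u n| := le_abs_self _
      _ ≤ (|c| + ∑ i ∈ Finset.range N, |u i|) * 1 := by
        rw [mul_one]; exact h2.trans (by linarith [abs_nonneg c])
      _ ≤ _ := mul_le_mul_of_nonneg_left (hv n) (by positivity)

/-- With `δ = ε / 48` and `m = n + n₀`, `N` is at most `2 ^ ((1 / 2 + ε / 16) * m)`. Writing the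
instance takes about `2 ^ ((1 / 2 + ε / 8) * m)`, and the subroutine at most a constant times `2 ^
((1 - 3 * ε / 8) * m)`. The padding by `n₀` variables costs a constant factor. -/
theorem kSatSolvableInTime_of_solve {ε C : ℝ} {n₀ : ℕ} (hε : 0 < ε) (hε1 : ε ≤ 1)
    (hN : ∀ᶠ n : ℕ in atTop,
      ((ofSize k M n).N k M (6 * k * M) : ℝ) ≤ (2 : ℝ) ^ ((1 / 2 + 3 * (ε / 48)) * n))
    (hC : 0 ≤ C)
    (h : ∃ (p' : RAMProg) (U : ℕ → ℕ), PolyBd U ∧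
    ∀ (n : ℕ) (φ : List (KClause k n)), ∃ (t : ℕ) (s : RAMState),
      RAMRun p' (.start (encodeKCNF φ)) t s ∧
      (t : ℝ) ≤ (((ofSize k M (n + n₀)).N k M (6 * k * M) + 1) * U (bound k M n₀ n φ.length) : ℕ) +
        C * ((ofSize k M (n + n₀)).N k M (6 * k * M) : ℝ) ^ (2 - ε) ∧
      (KSatisfiable φ → s.reg 0 = 1) ∧ (¬ KSatisfiable φ → s.reg 0 = 0)) :
    KSatSolvableInTime k fun n => (2 : ℝ) ^ ((1 - ε / 8) * (n : ℝ)) := by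
  obtain ⟨p, U, ⟨c, hU⟩, h⟩ := h
  obtain ⟨D, hD⟩ := exists_le_mul_of_eventually_le
    (u := fun n => (((ofSize k M (n + n₀)).N k M (6 * k * M) : ℝ) + 1) *
      (bound k M n₀ n ((n * 2) ^ k) : ℝ) ^ c +
        C * ((ofSize k M (n + n₀)).N k M (6 * k * M) : ℝ) ^ (2 - ε))
    (v := fun n : ℕ => (2 : ℝ) ^ ((1 - ε / 8) * (n : ℝ))) (c := (2 + C) * 2 ^ (n₀ : ℝ))
    (fun n => Real.one_le_rpow one_le_two (by
      have := Nat.cast_nonneg (α := ℝ) n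
      nlinarith)) (by
      filter_upwards [(tendsto_add_atTop_nat n₀).eventually hN,
        eventually_bound_pow_le k M n₀ c (show 0 < ε / 16 by linarith)] with n h1 h2
      have h3 := le_N (k := k) (M := M) (Y := 6 * k * M) (n := n + n₀)
      have h4 : (1 : ℝ) ≤ (ofSize k M (n + n₀)).N k M (6 * k * M) :=
        (Real.one_le_rpow one_le_two (by positivity)).trans h3
      have hm : ((n + n₀ : ℕ) : ℝ) = n + n₀ := by push_cast; rfl
      have hm0 : (0 : ℝ) ≤ ((n + n₀ : ℕ) : ℝ) := Nat.cast_nonneg _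
      have hn0 : (0 : ℝ) ≤ n := Nat.cast_nonneg _
      have hn00 : (0 : ℝ) ≤ n₀ := Nat.cast_nonneg _
      set m : ℝ := ((n + n₀ : ℕ) : ℝ)
      set N : ℝ := ((ofSize k M (n + n₀)).N k M (6 * k * M) : ℝ)
      have h5 : (N + 1) * (bound k M n₀ n ((n * 2) ^ k) : ℝ) ^ c ≤ 2 * 2 ^ ((1 - 3 * ε / 8) * m) := by
        calc _ ≤ (2 * 2 ^ ((1 / 2 + 3 * (ε / 48)) * m)) * (2 : ℝ) ^ (ε / 16 * m) := by
              gcongr; linarith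
          _ = 2 * 2 ^ ((1 / 2 + ε / 8) * m) := by
              rw [mul_assoc, ← Real.rpow_add two_pos]
              congr 2
              ring
          _ ≤ _ := by
              gcongr
              · exact one_le_two
              · linarith
      have h6 : N ^ (2 - ε) ≤ 2 ^ ((1 - 3 * ε / 8) * m) := by
        calc _ ≤ ((2 : ℝ) ^ ((1 / 2 + 3 * (ε / 48)) * m)) ^ (2 - ε) :=
              Real.rpow_le_rpow (by linarith) h1 (by linarith)
          _ ≤ _ := by
              rw [← Real.rpow_mul zero_le_two]
              refine Real.rpow_le_rpow_of_exponent_le one_le_two ?_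
              -- `(1 / 2 + ε / 16) * (2 - ε) = 1 - 3 * ε / 8 - ε ^ 2 / 16`.
              have := mul_nonneg hm0 (sq_nonneg ε)
              nlinarith
      have h7 : (2 : ℝ) ^ ((1 - 3 * ε / 8) * m) ≤ 2 ^ (n₀ : ℝ) * 2 ^ ((1 - ε / 8) * (n : ℝ)) := by
        rw [← Real.rpow_add two_pos]
        refine Real.rpow_le_rpow_of_exponent_le one_le_two ?_
        rw [hm]
        nlinarith
      calc _ ≤ 2 * 2 ^ ((1 - 3 * ε / 8) * m) + C * 2 ^ ((1 - 3 * ε / 8) * m) := by gcongr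
        _ = (2 + C) * 2 ^ ((1 - 3 * ε / 8) * m) := by ring
        _ ≤ (2 + C) * (2 ^ (n₀ : ℝ) * 2 ^ ((1 - ε / 8) * (n : ℝ))) := by gcongr
        _ = _ := by ring)
  refine ⟨p, D, fun n φ hφ => ?_⟩
  obtain ⟨t, s, h1, h2, h3⟩ := h n φ
  refine ⟨t, s, h1, h2.trans (le_trans ?_ (hD n)), h3⟩
  -- A clause is one of `(n * 2) ^ k` functions and none is repeated.
  have h4 : φ.length ≤ (n * 2) ^ k := by
    simpa using hφ.length_le_card
  have h5 : bound k M n₀ n φ.length ≤ bound k M n₀ n ((n * 2) ^ k) := by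
    unfold bound; gcongr
  have h6 : U (bound k M n₀ n φ.length) ≤ bound k M n₀ n ((n * 2) ^ k) ^ c :=
    (hU _ (by unfold bound; omega)).trans (Nat.pow_le_pow_left h5 _)
  have : (U (bound k M n₀ n φ.length) : ℝ) ≤ (bound k M n₀ n ((n * 2) ^ k) : ℝ) ^ c := by
    exact_mod_cast h6
  push_cast
  gcongr

end Par

/-! ### The theorem -/

theorem mainTheorem2 (hSETH : SETH) :
    ∃ f g : ℕ → ℝ, Tendsto f atTop (𝓝 0) ∧ Tendsto g atTop (𝓝 0) ∧
      ∀ ε : ℝ, 0 < ε →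
        (¬ ∃ (p : RAMProg) (C : ℝ),
          DistinguishesSubset p f g C fun N => (N : ℝ) ^ (2 - ε)) ∧
        (¬ ∃ (p : RAMProg) (C : ℝ),
          ApproximatesMaxIP p f g C fun N => (N : ℝ) ^ (2 - ε)) := by
  refine ⟨gapExponent, gapExponent, tendsto_gapExponent, tendsto_gapExponent, fun ε₀ hε₀ => ?_⟩
  -- A smaller `ε` only allows more time, and `ε ≤ 1` keeps the exponents `2 - ε` and `1 - ε / 8`
  -- positive.
  obtain ⟨ε, hε, hε1, hεε₀⟩ : ∃ ε : ℝ, 0 < ε ∧ ε ≤ 1 ∧ ε ≤ ε₀ :=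
    ⟨min ε₀ 1, lt_min hε₀ one_pos, min_le_right _ _, min_le_left _ _⟩
  obtain ⟨k, hk3, hk⟩ := hSETH (ε / 8) (by linarith)
  have hk1 : 1 ≤ k := by omega
  -- `k` comes from the hypothesis for `ε / 8`, then `M` from `k` and `ε`, and finally `n₀` from all
  -- of them; `f` and `g` depend on none of these.
  obtain ⟨M, hM, hMδ⟩ := Par.exists_adv_le k (show 0 < ε / 48 by linarith)
  have hN := Par.eventually_N_le (k := k) (M := M) (Y := 6 * k * M) (show 0 < ε / 48 by linarith) hMδ
  obtain ⟨n₀, hn₀⟩ := eventually_atTop.1 (Par.eventually_good k M (hN.mono fun n h => h.trans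
    (Real.rpow_le_rpow_of_exponent_le one_le_two (by
      have := Nat.cast_nonneg (α := ℝ) n
      nlinarith))))
  have key : ∀ (C : ℝ) (N : ℕ), 2 ≤ N → C * (N : ℝ) ^ (2 - ε₀) ≤ |C| * (N : ℝ) ^ (2 - ε) :=
    fun C N hN => mul_le_mul (le_abs_self C) (Real.rpow_le_rpow_of_exponent_le
      (by exact_mod_cast (show 1 ≤ N by omega)) (by linarith)) (by positivity) (abs_nonneg C)
  constructor
  · rintro ⟨p, C, hp⟩
    refine hk (Par.kSatSolvableInTime_of_solve hε hε1 hN (abs_nonneg C)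
      (Par.solve_of_distinguishes (p := p) (T := fun N => (N : ℝ) ^ (2 - ε)) ?_ n₀ hk1 hM hn₀))
    intro N m k' h2 hm h1 A B hB hAB
    obtain ⟨t, s, r1, r2, r3⟩ := hp N m k' h2 hm h1 A B hB hAB
    exact ⟨t, s, r1, r2.trans (key C N h2), r3⟩
  · rintro ⟨p, C, hp⟩
    refine hk (Par.kSatSolvableInTime_of_solve hε hε1 hN (abs_nonneg C)
      (Par.solve_of_approximates (p := p) (T := fun N => (N : ℝ) ^ (2 - ε)) ?_ n₀ hk1 hM hn₀))
    intro N m h2 hm A B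
    obtain ⟨t, s, i, j, r1, r2, r3⟩ := hp N m h2 hm A B
    exact ⟨t, s, i, j, r1, r2.trans (key C N h2), r3⟩
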